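/- **Corollary 6.7 (Strong Schauder estimate).** Let $n\ge 1$ and $\beta>0$. On $\mathbb C^*\times\mathbb C^{n-1}$, with coordinates $(z_1,z')$, $z'=(z_2,\dots,z_n)$, $z_j=x_j+iy_j$, set $r=|z_1|^\beta$, $\theta=\arg z_1$, and consider the flat cone metric $$\bar g_\beta=dr^2+\beta^2r^2d\theta^2+\sum_{j=2}^n|dz_j|^2=\beta^2|z_1|^{2\beta-2}|dz_1|^2+\sum_{j=2}^n|dz_j|^2 .$$ Let $d$ be its geodesic distance, extended to $\mathbb C^n$ (the infimum of the lengths of $C^1$ curves), let $D=\{z_1=0\}$, let $B(\rho)=\{r^2+\|z'\|^2<\rho^2\}$ be the ball of radius $\rho>0$ centred at the origin, and put $B_\beta=B(\tfrac12)$, $B'_\beta=B(\tfrac14)$. For $f:B_\beta\to\mathbb R$ put $$\|f\|_{C^\alpha(B_\beta)}=\sup_{x,y\in B_\beta}\frac{|f(x)-f(y)|}{d(x,y)^\alpha},$$ and for $S\subset B_\beta$ and a function $v$ of class $C^2$ off $D$ put $$\|v\|_{C^{2,\alpha}(S)}=\sup_{S\setminus D}\big(|v|+|\nabla v|+|\nabla^2v|\big)+\sup_{\substack{x,y\in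 S\\ |r(x)-r(y)|<r(x)/2}}\frac{|\nabla^2v(x)-\nabla^2v(y)|}{d(x,y)^\alpha},$$ where $\nabla v$ and $\nabla^2v$ are the gradient and the full Hessian (all second derivatives, the purely normal ones included) for the Levi-Civita connection of $\bar g_\beta$, lengths are taken with respect to $\bar g_\beta$, and Hessians at different points are compared through their components in the orthonormal frame $\partial_r,\ \frac1{\beta r}\partial_\theta,\ \partial_{x_j},\ \partial_{y_j}$ $(2\le j\le n)$. For every $n\ge1$ and every $\alpha\in(0,1)$ there is a constant $C=C(n,\alpha)$ such that the following holds for all $\beta\in(0,\tfrac14]$. Let $u\in L^\infty(B_\beta)$ be real-valued, let $f:B_\beta\to\mathbb R$ satisfy $\|f\|_{C^\alpha(B_\beta)}<\infty$, and suppose that $\Delta_{\bar g_\beta}u=f$ on $B_\beta\setminus D$ in the sense of distributions. Then $u$ agrees almost everywhere with a function, still denoted $u$, which is continuous on $B_\beta$, of class $C^2$ on $B_\beta\setminus D$, satisfies $\Delta_{\bar g_\beta}u=f$ pointwise on $B_\beta\setminus D$, and has $\|u\|_{C^{2,\alpha}(B(\rho))}<\infty$ for every $0<\rho<\tfrac12$;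 moreover $$\|u\|_{C^{2,\alpha}(B'_\beta)}\le C\left(\|f\|_{C^\alpha(B_\beta)}+\|u\|_{L^\infty(B_\beta)}\right).$$ -/

import Mathlib

open MeasureTheory
open scoped ENNReal NNReal

noncomputable section

namespace ConeSchauder

/-- The space `ℂⁿ = ℂ × ℂⁿ⁻¹` with `n = m + 1`; a point is `(z₁, z')`. -/
abbrev Cn (m : ℕ) : Type := ℂ × (Fin m → ℂ)

/-- The divisor `D = {z₁ = 0}`. -/
def divisor (m : ℕ) : Set (Cn m) := {p | p.1 = 0}

/-- The function `r = |z₁| ^ β`, the distance to the divisor. -/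
def rad {m : ℕ} (β : ℝ) (p : Cn m) : ℝ := ‖p.1‖ ^ β

/-- The length of a tangent vector `v` at `p` for the flat cone metric
`dr² + β² r² dθ² + |dz'|² = β² |z₁| ^ (2β - 2) |dz₁|² + |dz'|²`.
On the divisor the first coefficient is read as `0` (the metric is singular there). -/
def tangentNorm {m : ℕ} (β : ℝ) (p v : Cn m) : ℝ :=
  Real.sqrt (β ^ 2 * ‖p.1‖ ^ (2 * β - 2) * ‖v.1‖ ^ 2 + ∑ j, ‖v.2 j‖ ^ 2)

/-- The length of a curve `γ` on `[0, 1]` for the cone metric. A `C¹` curve meets the divisor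
with nonzero normal velocity at only countably many times, so that the value of `tangentNorm`
for vectors transverse to the divisor at points of the divisor plays no role. -/
def curveLength {m : ℕ} (β : ℝ) (γ : ℝ → Cn m) : ℝ≥0∞ :=
  ∫⁻ t in Set.Icc (0 : ℝ) 1, ENNReal.ofReal (tangentNorm β (γ t) (deriv γ t))

/-- The geodesic distance of the cone metric: the infimum of the lengths of `C¹` curves. -/
def coneDist {m : ℕ} (β : ℝ) (x y : Cn m) : ℝ≥0∞ :=
  ⨅ (γ : ℝ → Cn m) (_ : ContDiff ℝ 1 γ ∧ γ 0 = x ∧ γ 1 = y), curveLength β γ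

/-- The ball `B₀(ρ)` of the cone metric centred at the origin: `r² + |z'|² < ρ²`
(used for `ρ > 0`). -/
def coneBall (m : ℕ) (β ρ : ℝ) : Set (Cn m) :=
  {p | rad β p ^ 2 + ∑ j, ‖p.2 j‖ ^ 2 < ρ ^ 2}

/-- The Riemannian volume measure of the cone metric, `β² |z₁| ^ (2β - 2)` times
Lebesgue measure. -/
def coneVolume (m : ℕ) (β : ℝ) : Measure (Cn m) :=
  volume.withDensity fun p => ENNReal.ofReal (β ^ 2 * ‖p.1‖ ^ (2 * β - 2))

/-- Indices of the orthonormal frame: `inl 0`, `inl 1` are the normal directions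
`∂_r` and `(β r)⁻¹ ∂_θ`; `inr (j, 0)`, `inr (j, 1)` are `∂_{x_j}` and `∂_{y_j}`. -/
abbrev Idx (m : ℕ) : Type := Fin 2 ⊕ (Fin m × Fin 2)

/-- The orthonormal frame of the cone metric off the divisor. As vectors of `ℂ × ℂⁿ⁻¹`,
`∂_r` is `(z₁ / (β |z₁| ^ β), 0)` and `(β r)⁻¹ ∂_θ` is `(i z₁ / (β |z₁| ^ β), 0)`. -/
def frame {m : ℕ} (β : ℝ) (i : Idx m) (p : Cn m) : Cn m :=
  match i with
  | .inl k => (((β * rad β p)⁻¹ : ℝ) • ((if k = 0 then 1 else Complex.I) * p.1), 0)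
  | .inr (j, k) => (0, Pi.single j (if k = 0 then 1 else Complex.I))

/-- The derivative `D_i u` of a function along the `i`-th field of the frame. -/
def D {m : ℕ} (β : ℝ) (i : Idx m) (u : Cn m → ℝ) (p : Cn m) : ℝ :=
  fderiv ℝ u p (frame β i p)

/-- The derivative of `u` along the covariant derivative `∇_{e_i} e_j` of the frame `(e_i)`.
With `e₁ = ∂_r` and `e₂ = (β r)⁻¹ ∂_θ` one has `∇_{e₂} e₁ = r⁻¹ e₂`, `∇_{e₂} e₂ = - r⁻¹ e₁`,
and all the others vanish. -/
def connection {m : ℕ} (β : ℝ) (u : Cn m → ℝ) (p : Cn m) (i j : Idx m) : ℝ :=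
  if i = .inl 1 ∧ j = .inl 0 then (rad β p)⁻¹ * D β (.inl 1) u p
  else if i = .inl 1 ∧ j = .inl 1 then -((rad β p)⁻¹ * D β (.inl 0) u p)
  else 0

/-- The components `(∇² u)(e_i, e_j) = e_i (e_j u) - (∇_{e_i} e_j) u` in the frame of the
Hessian of `u` for the Levi-Civita connection of the cone metric. -/
def hess {m : ℕ} (β : ℝ) (u : Cn m → ℝ) (p : Cn m) (i j : Idx m) : ℝ :=
  D β i (D β j u) p - connection β u p i j

/-- The Laplacian of the cone metric, the trace of the Hessian:
`∂_r² + r⁻¹ ∂_r + (β r)⁻² ∂_θ² + ∑ⱼ (∂_{x_j}² + ∂_{y_j}²)`. -/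
def laplacian {m : ℕ} (β : ℝ) (u : Cn m → ℝ) (p : Cn m) : ℝ :=
  ∑ i, hess β u p i i

/-- `|∇ u|`, the length of the gradient. -/
def gradNorm {m : ℕ} (β : ℝ) (u : Cn m → ℝ) (p : Cn m) : ℝ :=
  Real.sqrt (∑ i, D β i u p ^ 2)

/-- The norm of a `2`-tensor, given by its components in an orthonormal frame. -/
def tensorNorm {m : ℕ} (T : Idx m → Idx m → ℝ) : ℝ :=
  Real.sqrt (∑ i, ∑ j, T i j ^ 2)

/-- The Hölder quantity `‖f‖_α = sup_{x, y ∈ S} |f x - f y| / d(x, y) ^ α`. -/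
def holderNorm {m : ℕ} (β α : ℝ) (S : Set (Cn m)) (f : Cn m → ℝ) : ℝ≥0∞ :=
  ⨆ (x ∈ S) (y ∈ S), ENNReal.ofReal |f x - f y| / coneDist β x y ^ α

/-- The Hölder semi-norm of the Hessian on `S`: the supremum of
`|∇² u (x) - ∇² u (y)| / d(x, y) ^ α` over the points `x, y` of `S` with
`|r(x) - r(y)| < r(x) / 2` (such points lie off the divisor), the tensors at `x` and `y`
being compared through their components in the frame. -/
def hessHolder {m : ℕ} (β α : ℝ) (S : Set (Cn m)) (u : Cn m → ℝ) : ℝ≥0∞ :=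
  ⨆ (x ∈ S) (y ∈ S) (_ : |rad β x - rad β y| < rad β x / 2),
    ENNReal.ofReal (tensorNorm fun i j => hess β u x i j - hess β u y i j) /
      coneDist β x y ^ α

/-- The full `C^{2,α}` norm on `S`:
`sup_{S \ D} (|u| + |∇ u| + |∇² u|) + [∇² u]_α`. -/
def c2HolderNorm {m : ℕ} (β α : ℝ) (S : Set (Cn m)) (u : Cn m → ℝ) : ℝ≥0∞ :=
  (⨆ x ∈ S \ divisor m,
    ENNReal.ofReal (|u x| + gradNorm β u x + tensorNorm (hess β u x))) +
  hessHolder β α S u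

/-- `Δ u = f` on `S \ D` in the sense of distributions, tested against smooth functions with
compact support in `S \ D`. -/
def IsWeakSolution {m : ℕ} (β : ℝ) (S : Set (Cn m)) (u f : Cn m → ℝ) : Prop :=
  ∀ φ : Cn m → ℝ, ContDiff ℝ ((⊤ : ℕ∞) : WithTop ℕ∞) φ → HasCompactSupport φ →
    tsupport φ ⊆ S \ divisor m →
    ∫ p in S, u p * laplacian β φ p ∂(coneVolume m β) = ∫ p in S, f p * φ p ∂(coneVolume m β)

end ConeSchauder

end

/-! Away from D the cone is flat. For |a| = 1 the map `lift`, ζ ↦ e^{iθ} (a ζ)^{1/β} in the first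
coordinate, is a local isometry from Euclidean space, so regularity off D is the Euclidean interior
Schauder estimate. The difficulty is a bound that is uniform up to D and in β. It comes from
splitting a solution into its average over the angle, which is a Euclidean solution across the axis,
and a remainder that decays like r^(2+α).

Euclidean estimate (`exists_schauder`). There is a mollifier η for which η - 2^N η(2·) is the
Laplacian of a test function Φ (`exists_mollifier`). If Δu = f weakly, the mollifications of u at
scales t/2 and t therefore differ by -t² times a mollification of f with kernel Φ (`mol_half_sub`).
Derivatives of Φ have mean zero, so the Hölder condition on f gains a factor t^α in every derivative
of such a difference. Summing over dyadic scales gives convergence in C² and the estimate. The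
Hölder condition is required only on a set of full measure, because it will be applied to averages
that are controlled off the axis only.

Average. For a bounded solution v, let `avg β v` be its mean over the angle, viewed as a function of
(|ζ|, z') on the Euclidean ball. By Fubini it solves Δ avg v = avg f off the axis. A logarithmic
cutoff shows that the axis is removable for bounded weak solutions (`WeakOn.of_diff_divisor`), so
the average extends to a function w with C^{2,α} bounds up to the axis (`exists_avg_bound`).

Oscillation. The values of v on a circle of radius r around D differ by O(r^(2+α))
(`angular_osc_aux`, `exists_angular_osc`). Fix an angle θ₀ and consider v(θ₀ + τ) - v(θ₀ + π - τ)
for |τ| ≤ π/2. This vanishes at τ = ±π/2, and it is compared by the maximum principle with a barrier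
cos(7βτ/2) · (K r^(2+α) + a Σ x⁴ + 2 a r² Σ x² + c r³ + ε/r), where x runs over the tangential
coordinates centred at the point in question. Here β ≤ 1/4 enters: it keeps the cosine above
cos(7π/16) > 0, while 7/2 exceeds 3 and hence every exponent of r that occurs, so the barrier is
strictly superharmonic. Fourth powers of x are used because their Laplacian vanishes to second order
at the centre; quadratic ones would force a term r² into the barrier and lose the decay. At the
centre the barrier reduces to K r^(2+α) + c r³ + ε/r, and ε → 0.

Scaling. In a chart around a point at distance r from D, the remainder W = v ∘ lift - w is
O(r^(2+α)), and the Schauder estimate on a ball of radius comparable to r bounds its first and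
second derivatives by r^(1+α) and r^α, and the α-Hölder quotient of its second derivatives by a
constant (`exists_diff_bound`).

Comparison. The Hessian of v in the frame is the Hessian of W plus that of w in the polar frame
(`IsClassical.hess_lift`). Differences of the first are controlled by Hölder continuity for close
points and by the decay r^α for distant ones. For the second, rotation invariance moves both points
to the positive real axis, where the polar frame is the standard basis, and the C^{2,α} bound for w
applies (`exists_frame_bound`). Finally the resulting distance in polar coordinates is bounded by
the geodesic distance through explicit test maps (`exists_coneDist_lower`). -/

open MeasureTheory
open scoped ENNReal NNReal

noncomputable section

namespace ConeSchauder

open Set Filter Topology Metric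
open scoped ContDiff

variable {m : ℕ}

/-! ### Real coordinates on `ℂ × ℂᵐ` -/

/-- The standard real basis of `ℂ × ℂᵐ`. -/
def dir (i : Idx m) : Cn m :=
  match i with
  | .inl k => (if k = 0 then 1 else Complex.I, 0)
  | .inr (j, k) => (0, Pi.single j (if k = 0 then 1 else Complex.I))

/-- The real coordinates on `ℂ × ℂᵐ`, dual to `dir`. -/
def co (i : Idx m) : Cn m →L[ℝ] ℝ :=
  match i with
  | .inl k => (if k = 0 then Complex.reCLM else Complex.imCLM) ∘L ContinuousLinearMap.fst ℝ ℂ _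
  | .inr (j, k) => (if k = 0 then Complex.reCLM else Complex.imCLM) ∘L
      (ContinuousLinearMap.proj (R := ℝ) (φ := fun _ : Fin m => ℂ) j) ∘L
      ContinuousLinearMap.snd ℝ ℂ _

lemma co_inl_zero (x : Cn m) : co (.inl 0) x = x.1.re := by simp [co]
lemma co_inl_one (x : Cn m) : co (.inl 1) x = x.1.im := by simp [co]
lemma co_inr_zero (j : Fin m) (x : Cn m) : co (.inr (j, 0)) x = (x.2 j).re := by simp [co]
lemma co_inr_one (j : Fin m) (x : Cn m) : co (.inr (j, 1)) x = (x.2 j).im := by simp [co]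

lemma sum_idx {M : Type*} [AddCommMonoid M] (F : Idx m → M) :
    ∑ i, F i = (F (.inl 0) + F (.inl 1)) + ∑ j, (F (.inr (j, 0)) + F (.inr (j, 1))) := by
  simp [Fintype.sum_sum_type, Fintype.sum_prod_type, Fin.sum_univ_two]

lemma forall_idx {P : Idx m → Prop} (h0 : P (.inl 0)) (h1 : P (.inl 1))
    (h2 : ∀ j, P (.inr (j, 0))) (h3 : ∀ j, P (.inr (j, 1))) (i : Idx m) : P i := by
  rcases i with k | ⟨j, k⟩
  · fin_cases k
    · exact h0
    · exact h1
  · fin_cases k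
    · exact h2 j
    · exact h3 j

lemma sum_co_smul_dir (x : Cn m) : ∑ i, co i x • dir i = x := by
  rw [sum_idx]
  ext
  · simp only [co_inl_zero, co_inl_one, co_inr_zero, co_inr_one, dir]
    simp [Prod.fst_sum]
  · rename_i j
    simp only [co_inl_zero, co_inl_one, co_inr_zero, co_inr_one, dir, Prod.snd_add, Prod.snd_sum,
      Finset.sum_apply, Pi.add_apply, Prod.smul_mk, Pi.smul_apply, Finset.sum_add_distrib,
      Pi.single_apply]
    simp

lemma co_dir (i j : Idx m) : co i (dir j) = if i = j then 1 else 0 := by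
  revert i j
  intro i j
  induction i using forall_idx <;> induction j using forall_idx <;>
    simp [co, dir, Pi.single_apply, eq_comm, apply_ite Complex.re, apply_ite Complex.im]

lemma abs_co_le (i : Idx m) (x : Cn m) : |co i x| ≤ ‖x‖ := by
  have h1 : ‖x.1‖ ≤ ‖x‖ := norm_fst_le x
  have h2 : ∀ j, ‖x.2 j‖ ≤ ‖x‖ := fun j => (norm_le_pi_norm x.2 j).trans (norm_snd_le x)
  induction i using forall_idx with
  | h0 => rw [co_inl_zero]; exact (Complex.abs_re_le_norm _).trans h1
  | h1 => rw [co_inl_one]; exact (Complex.abs_im_le_norm _).trans h1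
  | h2 j => rw [co_inr_zero]; exact (Complex.abs_re_le_norm _).trans (h2 j)
  | h3 j => rw [co_inr_one]; exact (Complex.abs_im_le_norm _).trans (h2 j)

lemma norm_dir_le (i : Idx m) : ‖dir i‖ ≤ 1 := by
  induction i using forall_idx <;> simp [dir, Prod.norm_def] <;>
    · refine (pi_norm_le_iff_of_nonneg zero_le_one).2 fun k => ?_
      rw [Pi.single_apply]
      split_ifs <;> simp

/-- The square of the Euclidean norm. -/
def sqNorm (x : Cn m) : ℝ := ∑ i, co i x ^ 2

lemma sqNorm_eq (x : Cn m) : sqNorm x = ‖x.1‖ ^ 2 + ∑ j, ‖x.2 j‖ ^ 2 := by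
  have h : ∀ z : ℂ, ‖z‖ ^ 2 = z.re ^ 2 + z.im ^ 2 := fun z => by
    rw [Complex.sq_norm, Complex.normSq_apply]; ring
  simp only [sqNorm, sum_idx, co_inl_zero, co_inl_one, co_inr_zero, co_inr_one, h]

lemma sqNorm_nonneg (x : Cn m) : 0 ≤ sqNorm x := Finset.sum_nonneg fun _ _ => sq_nonneg _

lemma norm_sq_le_sqNorm (x : Cn m) : ‖x‖ ^ 2 ≤ sqNorm x := by
  rw [sqNorm_eq]
  have hs : ∀ j, ‖x.2 j‖ ^ 2 ≤ ∑ j, ‖x.2 j‖ ^ 2 := fun j =>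
    Finset.single_le_sum (f := fun j => ‖x.2 j‖ ^ 2) (fun _ _ => sq_nonneg _) (Finset.mem_univ j)
  have hs0 : 0 ≤ ∑ j, ‖x.2 j‖ ^ 2 := Finset.sum_nonneg fun _ _ => sq_nonneg _
  rw [← Real.le_sqrt (norm_nonneg _) (by positivity), Prod.norm_def, max_le_iff]
  constructor
  · exact Real.le_sqrt_of_sq_le (by linarith)
  · rw [pi_norm_le_iff_of_nonneg (Real.sqrt_nonneg _)]
    intro j
    exact Real.le_sqrt_of_sq_le (by nlinarith [hs j, sq_nonneg ‖x.1‖])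

lemma sqNorm_le (x : Cn m) : sqNorm x ≤ (m + 1) * ‖x‖ ^ 2 := by
  rw [sqNorm_eq]
  have h1 : ‖x.1‖ ^ 2 ≤ ‖x‖ ^ 2 := by gcongr; exact norm_fst_le x
  have h2 : ∑ j, ‖x.2 j‖ ^ 2 ≤ ∑ _j : Fin m, ‖x‖ ^ 2 := Finset.sum_le_sum fun j _ => by
    gcongr; exact (norm_le_pi_norm x.2 j).trans (norm_snd_le x)
  simp at h2
  linarith

lemma sqNorm_smul (t : ℝ) (x : Cn m) : sqNorm (t • x) = t ^ 2 * sqNorm x := by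
  simp only [sqNorm, Finset.mul_sum, map_smul, smul_eq_mul, mul_pow]

/-- The partial derivative in the direction `dir i`. -/
def pd (i : Idx m) (f : Cn m → ℝ) (x : Cn m) : ℝ := fderiv ℝ f x (dir i)

/-- The Euclidean Laplacian. -/
def lap (f : Cn m → ℝ) (x : Cn m) : ℝ := ∑ i, pd i (pd i f) x

lemma fderiv_apply_eq_sum (f : Cn m → ℝ) (x v : Cn m) :
    fderiv ℝ f x v = ∑ i, co i v * pd i f x := by
  conv_lhs => rw [← sum_co_smul_dir v]
  simp [pd]

lemma fderiv_eq_sum (f : Cn m → ℝ) (x : Cn m) :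
    fderiv ℝ f x = ∑ i, pd i f x • co i := by
  refine ContinuousLinearMap.ext fun v => ?_
  rw [fderiv_apply_eq_sum]
  simp only [sum_apply, smul_apply, smul_eq_mul, mul_comm]

lemma pd_congr {f g : Cn m → ℝ} {x : Cn m} (h : f =ᶠ[𝓝 x] g) (i : Idx m) :
    pd i f x = pd i g x := by
  simp only [pd, h.fderiv_eq]

lemma pd_eventuallyEq {f g : Cn m → ℝ} {x : Cn m} (h : f =ᶠ[𝓝 x] g) (i : Idx m) :
    pd i f =ᶠ[𝓝 x] pd i g := by
  filter_upwards [h.eventuallyEq_nhds] with y hy using pd_congr hy i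

lemma lap_congr {f g : Cn m → ℝ} {x : Cn m} (h : f =ᶠ[𝓝 x] g) : lap f x = lap g x :=
  Finset.sum_congr rfl fun i _ => pd_congr (pd_eventuallyEq h i) i

lemma contDiff_pd {f : Cn m → ℝ} (hf : ContDiff ℝ ∞ f) (i : Idx m) : ContDiff ℝ ∞ (pd i f) :=
  (hf.fderiv_right (m := ∞) (by simp)).clm_apply contDiff_const

lemma hasCompactSupport_pd {f : Cn m → ℝ} (hf : HasCompactSupport f) (i : Idx m) :
    HasCompactSupport (pd i f) := hf.fderiv_apply ℝ _

lemma tsupport_pd_subset (f : Cn m → ℝ) (i : Idx m) : tsupport (pd i f) ⊆ tsupport f :=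
  tsupport_fderiv_apply_subset ℝ _

lemma tsupport_lap_subset (f : Cn m → ℝ) : tsupport (lap f) ⊆ tsupport f := by
  refine closure_minimal (fun x hx => ?_) (isClosed_tsupport f)
  by_contra h
  refine hx (Finset.sum_eq_zero fun i _ => ?_)
  exact image_eq_zero_of_notMem_tsupport
    (fun h' => h (tsupport_pd_subset f i (tsupport_pd_subset _ i h')))

lemma contDiff_lap {f : Cn m → ℝ} (hf : ContDiff ℝ ∞ f) : ContDiff ℝ ∞ (lap f) :=
  ContDiff.sum fun i _ => contDiff_pd (contDiff_pd hf i) i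

lemma pd_add {f g : Cn m → ℝ} {x : Cn m} (hf : DifferentiableAt ℝ f x)
    (hg : DifferentiableAt ℝ g x) (i : Idx m) :
    pd i (fun y => f y + g y) x = pd i f x + pd i g x := by
  simp [pd, fderiv_fun_add hf hg]

lemma pd_sub {f g : Cn m → ℝ} {x : Cn m} (hf : DifferentiableAt ℝ f x)
    (hg : DifferentiableAt ℝ g x) (i : Idx m) :
    pd i (fun y => f y - g y) x = pd i f x - pd i g x := by
  simp [pd, fderiv_fun_sub hf hg]

lemma pd_const_mul {f : Cn m → ℝ} {x : Cn m} (hf : DifferentiableAt ℝ f x) (c : ℝ) (i : Idx m) :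
    pd i (fun y => c * f y) x = c * pd i f x := by
  simp [pd, fderiv_const_mul hf]

lemma pd_mul {f g : Cn m → ℝ} {x : Cn m} (hf : DifferentiableAt ℝ f x)
    (hg : DifferentiableAt ℝ g x) (i : Idx m) :
    pd i (fun y => f y * g y) x = f x * pd i g x + g x * pd i f x := by
  simp [pd, fderiv_fun_mul hf hg]

lemma hasFDerivAt_sqNorm (x : Cn m) :
    HasFDerivAt (sqNorm (m := m)) (∑ i, (2 * co i x) • co i) x := by
  refine HasFDerivAt.fun_sum fun i _ => ?_
  simpa using ((co i).hasFDerivAt (x := x)).pow 2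

lemma contDiff_sqNorm {n : WithTop ℕ∞} : ContDiff ℝ n (sqNorm (m := m)) :=
  ContDiff.sum fun i _ => ((co i).contDiff).pow 2

lemma continuous_sqNorm : Continuous (sqNorm (m := m)) := contDiff_sqNorm.continuous (n := 0)

lemma pd_comp_sqNorm {H H' : ℝ → ℝ} (hH : ∀ s, HasDerivAt H (H' s) s) (i : Idx m) (x : Cn m) :
    pd i (fun y => H (sqNorm y)) x = 2 * (co i x * H' (sqNorm x)) := by
  have := (hH (sqNorm x)).comp_hasFDerivAt x (hasFDerivAt_sqNorm x)
  have e : fderiv ℝ (fun y : Cn m => H (sqNorm y)) x = _ := this.fderiv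
  rw [pd, e]
  simp only [smul_apply, sum_apply, co_dir, smul_eq_mul,
    mul_ite, mul_one, mul_zero, Finset.sum_ite_eq', Finset.mem_univ, if_true]
  ring

lemma card_idx : Fintype.card (Idx m) = 2 * (m + 1) := by
  simp; ring

lemma lap_comp_sqNorm {H H' H'' : ℝ → ℝ} (hH : ∀ s, HasDerivAt H (H' s) s)
    (hH' : ∀ s, HasDerivAt H' (H'' s) s) (x : Cn m) :
    lap (fun y => H (sqNorm y)) x =
      4 * (m + 1) * H' (sqNorm x) + 4 * sqNorm x * H'' (sqNorm x) := by
  have h2 : ∀ i, pd i (pd i fun y => H (sqNorm y)) x =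
      2 * H' (sqNorm x) + 4 * (co i x ^ 2 * H'' (sqNorm x)) := by
    intro i
    have e : (pd i fun y => H (sqNorm y)) = fun x => 2 * (co i x * H' (sqNorm x)) := by
      funext y; exact pd_comp_sqNorm hH i y
    have d1 : DifferentiableAt ℝ (fun x : Cn m => H' (sqNorm x)) x :=
      ((hH' (sqNorm x)).comp_hasFDerivAt x (hasFDerivAt_sqNorm x)).differentiableAt
    have d0 : DifferentiableAt ℝ (fun x : Cn m => co i x) x := (co i).differentiableAt
    rw [e, pd_const_mul (d0.fun_mul d1), pd_mul d0 d1, pd_comp_sqNorm hH']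
    have : pd i (fun x => co i x) x = 1 := by
      simp [pd, (co i).fderiv, co_dir]
    rw [this]; ring
  simp only [lap, h2, Finset.sum_add_distrib, ← Finset.mul_sum, ← Finset.sum_mul]
  simp only [Finset.sum_const, Finset.card_univ, card_idx, ← sqNorm.eq_1]
  simp
  ring

/-! ### The kernels -/

/-- Take B = T / sⁿ with T a smooth monotone step. Then n B + s B' = s T' / sⁿ, which is
nonnegative, and which vanishes where T is constant. -/
lemma exists_radial_profile (n : ℕ) (hn : 1 ≤ n) :
    ∃ B : ℝ → ℝ, ContDiff ℝ ∞ B ∧ (∀ s, 1 ≤ s → B s = (s ^ n)⁻¹) ∧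
      (∀ s, 0 ≤ s → 0 ≤ n * B s + s * deriv B s) ∧
      (∃ s, 0 < s ∧ n * B s + s * deriv B s ≠ 0) := by
  let T : ℝ → ℝ := fun s => Real.smoothTransition (2 * s - 1)
  have hT : ContDiff ℝ ∞ T := Real.smoothTransition.contDiff.comp (by fun_prop)
  have hT0 : ∀ s ≤ 1 / 2, T s = 0 := fun s hs =>
    Real.smoothTransition.zero_of_nonpos (by linarith)
  have hT1 : ∀ s, 1 ≤ s → T s = 1 := fun s hs =>
    Real.smoothTransition.one_of_one_le (by linarith)
  have hmono : Monotone T := fun a b hab => Real.smoothTransition.monotone (by linarith)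
  have hB : ContDiff ℝ ∞ (fun s => T s * (s ^ n)⁻¹) := by
    rw [contDiff_iff_contDiffAt]
    intro s
    rcases lt_or_ge s (1 / 2) with hs | hs
    · refine (contDiffAt_const (c := (0 : ℝ))).congr_of_eventuallyEq ?_
      filter_upwards [Iio_mem_nhds hs] with y hy
      rw [hT0 y (le_of_lt hy), zero_mul]
    · exact hT.contDiffAt.mul ((contDiffAt_id.pow n).inv (by simp; intro h; linarith))
  have hderiv : ∀ s, 0 < s → n * (T s * (s ^ n)⁻¹) + s * deriv (fun s => T s * (s ^ n)⁻¹) s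
      = s * deriv T s * (s ^ n)⁻¹ := by
    intro s hs
    have h1 : HasDerivAt T (deriv T s) s := (hT.differentiable (by simp) s).hasDerivAt
    have h2 := h1.mul ((hasDerivAt_pow n s).inv (by positivity))
    have e : deriv (fun s => T s * (s ^ n)⁻¹) s = _ := h2.deriv
    rw [e]
    obtain ⟨k, rfl⟩ : ∃ k, n = k + 1 := ⟨n - 1, by omega⟩
    simp only [Pi.inv_apply, Nat.add_sub_cancel, pow_succ]
    field_simp
    ring
  refine ⟨fun s => T s * (s ^ n)⁻¹, hB, ?_, ?_, ?_⟩
  · intro s hs; simp [hT1 s hs]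
  · intro s hs
    rcases hs.eq_or_lt with rfl | hs
    · simp [hT0 0 (by norm_num)]
    · rw [hderiv s hs]
      have := hmono.deriv_nonneg (x := s)
      positivity
  -- The mean value theorem on [1/2, 1], where T climbs from 0 to 1.
  · obtain ⟨c, hc, hc'⟩ := exists_deriv_eq_slope T (a := 1 / 2) (b := 1) (by norm_num)
      hT.continuous.continuousOn (hT.differentiable (by simp)).differentiableOn
    have h0 : 0 < c := by linarith [hc.1]
    refine ⟨c, h0, ?_⟩
    rw [hderiv c h0, hc', hT1 1 le_rfl, hT0 (1 / 2) le_rfl]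
    positivity

/-- Integrating from the base point 1 makes the primitive vanish together with h on s ≥ 1, so that
the radial function built from it keeps its support in the unit ball. -/
lemma exists_contDiff_primitive {h : ℝ → ℝ} (hh : ContDiff ℝ ∞ h) (h0 : ∀ s, 1 ≤ s → h s = 0) :
    ∃ H : ℝ → ℝ, ContDiff ℝ ∞ H ∧ (∀ s, HasDerivAt H (h s) s) ∧ ∀ s, 1 ≤ s → H s = 0 := by
  have hd : ∀ s, HasDerivAt (fun s => ∫ τ in (1 : ℝ)..s, h τ) (h s) s := fun s =>
    intervalIntegral.integral_hasDerivAt_right (hh.continuous.intervalIntegrable _ _)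
      (hh.continuous.stronglyMeasurableAtFilter _ _) hh.continuous.continuousAt
  refine ⟨fun s => ∫ τ in (1 : ℝ)..s, h τ, ?_, hd, ?_⟩
  · rw [contDiff_infty_iff_deriv]
    refine ⟨fun s => (hd s).differentiableAt, ?_⟩
    rwa [show deriv (fun s => ∫ τ in (1 : ℝ)..s, h τ) = h from funext fun s => (hd s).deriv]
  · intro s hs
    refine intervalIntegral.integral_zero_ae ?_
    refine ae_of_all _ fun τ hτ => ?_
    rw [uIoc_of_le hs] at hτ
    exact h0 τ hτ.1.le

/-- A mollifier `η` such that `η - 2 ^ N η (2 ·)` is the Laplacian of a test function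
(`N = 2 m + 2` is the real dimension). -/
lemma exists_mollifier (m : ℕ) : ∃ η Φ : Cn m → ℝ, ContDiff ℝ ∞ η ∧ ContDiff ℝ ∞ Φ ∧
    (∀ x, 1 < ‖x‖ → η x = 0) ∧ (∀ x, 1 < ‖x‖ → Φ x = 0) ∧ ∫ x, η x = 1 ∧
    ∀ x, lap Φ x = η x - 2 ^ (2 * (m + 1)) * η ((2 : ℝ) • x) := by
  obtain ⟨B, hB, hB1, hpos, s₀, hs₀, hne⟩ := exists_radial_profile (m + 1) (by omega)
  have hBd : ∀ s, HasDerivAt B (deriv B s) s := fun s =>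
    (hB.differentiable (by simp) s).hasDerivAt
  have hB' : ContDiff ℝ ∞ (deriv B) := (contDiff_infty_iff_deriv.1 hB).2
  set a : ℝ → ℝ := fun s => ((m + 1 : ℕ) : ℝ) * B s + s * deriv B s with ha
  have hac : ContDiff ℝ ∞ a := by
    exact (contDiff_const.mul hB).add (contDiff_id.mul hB')
  have ha1 : ∀ s, 1 ≤ s → a s = 0 := by
    have key : ∀ s, 1 < s → a s = 0 := by
      intro s hs
      have hs0 : (0 : ℝ) < s := by linarith
      have e : B =ᶠ[𝓝 s] fun s => (s ^ (m + 1))⁻¹ := by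
        filter_upwards [Ioi_mem_nhds hs] with y hy using hB1 y (le_of_lt hy)
      have h2 := ((hasDerivAt_pow (m + 1) s).inv (by positivity)).deriv
      simp only [ha]
      rw [e.deriv_eq, hB1 s hs.le]
      have e2 : deriv (fun s : ℝ => (s ^ (m + 1))⁻¹) s = _ := h2
      rw [e2]
      simp only [Nat.add_sub_cancel, pow_succ]
      field_simp
      push_cast
      ring
    -- The formula for B holds on a neighbourhood of s only when s > 1; the endpoint follows by
    -- continuity.
    intro s hs
    rcases hs.eq_or_lt with rfl | hs
    · have h1 : Tendsto a (𝓝[>] 1) (𝓝 (a 1)) := hac.continuous.continuousAt.tendsto.mono_left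
        nhdsWithin_le_nhds
      have h2 : Tendsto a (𝓝[>] 1) (𝓝 0) := by
        refine tendsto_const_nhds.congr' ?_
        filter_upwards [self_mem_nhdsWithin] with y hy using (key y hy).symm
      exact tendsto_nhds_unique h1 h2
    · exact key s hs
  -- With n = m + 1 and H' = h, the Laplacian of H(|x|²) is 4 (n h + s h'). For this h it equals
  -- a(s) - 4ⁿ a(4s) at s = |x|², which is the desired combination since |2x|² = 4s and 2^(2n) = 4ⁿ.
  set h : ℝ → ℝ := fun s => (B s - 4 ^ (m + 1) * B (4 * s)) / 4 with hh
  have hhc : ContDiff ℝ ∞ h := by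
    exact (hB.sub (contDiff_const.mul (hB.comp (contDiff_const.mul contDiff_id)))).div_const _
  have hh1 : ∀ s, 1 ≤ s → h s = 0 := by
    intro s hs
    have : (0 : ℝ) < s := by linarith
    simp only [hh, hB1 s hs, hB1 (4 * s) (by linarith)]
    rw [mul_pow]
    field_simp
    simp
  obtain ⟨H, hH, hHd, hH1⟩ := exists_contDiff_primitive hhc hh1
  have hhd : ∀ s, HasDerivAt h ((deriv B s - 4 ^ (m + 1) * (deriv B (4 * s) * 4)) / 4) s := by
    intro s
    have h4 : HasDerivAt (fun s : ℝ => 4 * s) 4 s := by simpa using (hasDerivAt_id s).const_mul 4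
    exact ((hBd s).sub (((hBd (4 * s)).comp s h4).const_mul _)).div_const 4
  have hsup : ∀ x : Cn m, 1 < ‖x‖ → 1 ≤ sqNorm x := fun x hx => by
    have := norm_sq_le_sqNorm x
    nlinarith
  set η₀ : Cn m → ℝ := fun x => a (sqNorm x) with hη₀
  have hη₀c : ContDiff ℝ ∞ η₀ := hac.comp contDiff_sqNorm
  have hη₀s : ∀ x, 1 < ‖x‖ → η₀ x = 0 := fun x hx => ha1 _ (hsup x hx)
  have hcs : HasCompactSupport η₀ :=
    HasCompactSupport.of_support_subset_isCompact (isCompact_closedBall 0 1) fun x hx => by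
      by_contra hc
      exact hx (hη₀s x (by simpa using hc))
  have hint : 0 < ∫ x, η₀ x := by
    refine hη₀c.continuous.integral_pos_of_hasCompactSupport_nonneg_nonzero hcs
      (fun x => hpos _ (sqNorm_nonneg x)) (x := (((Real.sqrt s₀ : ℝ) : ℂ), 0)) ?_
    simp only [hη₀, sqNorm_eq]
    simp [ha]
    rw [Real.sq_sqrt hs₀.le]
    simpa using hne
  set c := ∫ x, η₀ x with hc
  have hlap : ∀ x : Cn m, lap (fun x => H (sqNorm x)) x =
      η₀ x - 2 ^ (2 * (m + 1)) * η₀ ((2 : ℝ) • x) := by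
    intro x
    rw [lap_comp_sqNorm hHd hhd]
    simp only [hη₀, ha, hh, sqNorm_smul]
    have e : (2 : ℝ) ^ (2 * (m + 1)) = 4 ^ (m + 1) := by rw [pow_mul]; norm_num
    rw [e, show (2 : ℝ) ^ 2 = 4 by norm_num]
    push_cast
    ring
  refine ⟨fun x => c⁻¹ * η₀ x, fun x => c⁻¹ * H (sqNorm x), contDiff_const.mul hη₀c,
    contDiff_const.mul (hH.comp contDiff_sqNorm), ?_, ?_, ?_, ?_⟩
  · intro x hx; simp [hη₀s x hx]
  · intro x hx; simp [hH1 _ (hsup x hx)]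
  · rw [integral_const_mul]
    exact inv_mul_cancel₀ hint.ne'
  · intro x
    have hs : ContDiff ℝ ∞ fun x : Cn m => H (sqNorm x) := hH.comp contDiff_sqNorm
    have e : lap (fun x : Cn m => c⁻¹ * H (sqNorm x)) x = c⁻¹ * lap (fun x => H (sqNorm x)) x := by
      simp only [lap, Finset.mul_sum]
      refine Finset.sum_congr rfl fun i _ => ?_
      rw [← pd_const_mul ((contDiff_pd hs i).differentiable (by simp) x)]
      congr 1
      funext y
      exact pd_const_mul (hs.differentiable (by simp) y) _ _
    rw [e, hlap]; ring

/-! ### Mollification -/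

instance volume_isAddHaarMeasure : (volume : Measure (Cn m)).IsAddHaarMeasure :=
  Measure.prod.instIsAddHaarMeasure (volume : Measure ℂ) (volume : Measure (Fin m → ℂ))

/-- The convolution of a locally integrable function `g` with a test function `k`. -/
def cv (k g : Cn m → ℝ) (x : Cn m) : ℝ := ∫ y, g y * k (x - y)

/-- The function `x ↦ k (x / t)`. -/
def sc (t : ℝ) (k : Cn m → ℝ) (x : Cn m) : ℝ := k (t⁻¹ • x)

/-- `Δ u = f` in the sense of distributions on an open set, for the Euclidean Laplacian. -/
def WeakOn (Ω : Set (Cn m)) (u f : Cn m → ℝ) : Prop :=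
  ∀ φ : Cn m → ℝ, ContDiff ℝ ∞ φ → HasCompactSupport φ → tsupport φ ⊆ Ω →
    ∫ x, u x * lap φ x = ∫ x, f x * φ x

lemma cv_eq_convolution (k g : Cn m → ℝ) :
    cv k g = convolution g k (ContinuousLinearMap.mul ℝ ℝ) volume := rfl

section cv
variable {k g : Cn m → ℝ} (hk : ContDiff ℝ ∞ k) (hs : HasCompactSupport k)
  (hg : LocallyIntegrable g)
include hk hs hg

lemma contDiff_cv : ContDiff ℝ ∞ (cv k g) :=
  hs.contDiff_convolution_right (n := ⊤) (ContinuousLinearMap.mul ℝ ℝ) hg hk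

lemma integrable_cv (x : Cn m) : Integrable fun y => g y * k (x - y) :=
  hs.convolutionExists_right (ContinuousLinearMap.mul ℝ ℝ) hg hk.continuous x

lemma pd_cv (i : Idx m) : pd i (cv k g) = cv (pd i k) g := by
  funext x
  have h := hs.hasFDerivAt_convolution_right (ContinuousLinearMap.mul ℝ ℝ) hg
    (hk.of_le (by simp)) x
  rw [pd, cv_eq_convolution, h.fderiv,
    convolution_precompR_apply _ hg (hs.fderiv ℝ) (hk.continuous_fderiv (by simp))]
  rfl

end cv

lemma hasCompactSupport_of_eq_zero {k : Cn m → ℝ} {t : ℝ} (h : ∀ x, t < ‖x‖ → k x = 0) :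
    HasCompactSupport k :=
  HasCompactSupport.of_support_subset_isCompact (isCompact_closedBall 0 t) fun x hx => by
    by_contra hc
    exact hx (h x (by simpa using hc))

lemma contDiff_sc {k : Cn m → ℝ} (hk : ContDiff ℝ ∞ k) (t : ℝ) : ContDiff ℝ ∞ (sc t k) :=
  hk.comp (contDiff_const_smul _)

lemma sc_eq_zero {k : Cn m → ℝ} (h : ∀ x, 1 < ‖x‖ → k x = 0) {t : ℝ} (ht : 0 < t) (x : Cn m)
    (hx : t < ‖x‖) : sc t k x = 0 := by
  refine h _ ?_
  rw [norm_smul, norm_inv, Real.norm_of_nonneg ht.le, ← div_eq_inv_mul, lt_div_iff₀ ht]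
  linarith

lemma pd_eq_zero {k : Cn m → ℝ} {t : ℝ} (h : ∀ x, t < ‖x‖ → k x = 0) (i : Idx m) (x : Cn m)
    (hx : t < ‖x‖) : pd i k x = 0 := by
  have : k =ᶠ[𝓝 x] fun _ => 0 := by
    filter_upwards [(isOpen_lt continuous_const continuous_norm).mem_nhds hx] with y hy using h y hy
  rw [pd_congr this]
  simp [pd]

lemma pd_sc {k : Cn m → ℝ} (hk : ContDiff ℝ ∞ k) (t : ℝ) (i : Idx m) :
    pd i (sc t k) = fun x => t⁻¹ * sc t (pd i k) x := by
  funext x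
  have h := ((hk.differentiable (by simp) (t⁻¹ • x)).hasFDerivAt).comp x
    ((hasFDerivAt_id x).const_smul t⁻¹)
  have e : fderiv ℝ (sc t k) x = _ := h.fderiv
  rw [pd, e]
  simp [sc, pd]

lemma lap_sc {k : Cn m → ℝ} (hk : ContDiff ℝ ∞ k) (t : ℝ) (x : Cn m) :
    lap (sc t k) x = t⁻¹ ^ 2 * sc t (lap k) x := by
  simp only [lap, sc, Finset.mul_sum]
  refine Finset.sum_congr rfl fun i _ => ?_
  rw [pd_sc hk, pd_const_mul ((contDiff_sc (contDiff_pd hk i) t).differentiable (by simp) x),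
    pd_sc (contDiff_pd hk i)]
  simp only [sc]
  ring

lemma integral_pd_eq_zero {k : Cn m → ℝ} (hk : ContDiff ℝ ∞ k) (hs : HasCompactSupport k)
    (i : Idx m) : ∫ x, pd i k x = 0 := by
  have h := integral_bilinear_fderiv_right_eq_neg_left_of_integrable (μ := volume)
    (f := fun _ : Cn m => (1 : ℝ)) (g := k) (v := dir i) (B := ContinuousLinearMap.mul ℝ ℝ)
    (by simp) (by
      have := (contDiff_pd hk i).continuous.integrable_of_hasCompactSupport (μ := volume)
        (hasCompactSupport_pd hs i)
      unfold pd at this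
      simpa using this)
    (by simpa using hk.continuous.integrable_of_hasCompactSupport hs)
    (fun x _ => differentiableAt_const _) (fun x _ => hk.differentiable (by simp) x)
  simpa [pd] using h

lemma integral_sc {k : Cn m → ℝ} {t : ℝ} (ht : 0 < t) :
    ∫ x, sc t k x = t ^ (2 * (m + 1)) * ∫ x, k x := by
  have h := Measure.integral_comp_inv_smul_of_nonneg (volume : Measure (Cn m)) k ht.le
  have e : Module.finrank ℝ (Cn m) = 2 * (m + 1) := by
    simp [Module.finrank_prod, Module.finrank_pi_fintype]; ring
  rw [e] at h
  simpa [sc] using h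

/-- The volume of the unit ball. -/
def omega (m : ℕ) : ℝ := (volume (ball (0 : Cn m) 1)).toReal

lemma omega_nonneg : 0 ≤ omega m := ENNReal.toReal_nonneg

lemma volume_closedBall_toReal (x : Cn m) {t : ℝ} (ht : 0 ≤ t) :
    (volume (closedBall x t)).toReal = t ^ (2 * (m + 1)) * omega m := by
  have e : Module.finrank ℝ (Cn m) = 2 * (m + 1) := by
    simp [Module.finrank_prod, Module.finrank_pi_fintype]; ring
  rw [Measure.addHaar_closedBall _ _ ht, e, ENNReal.toReal_mul,
    ENNReal.toReal_ofReal (by positivity), omega]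

lemma abs_cv_le {k g : Cn m → ℝ} {t K G : ℝ} (ht : 0 < t) (h0 : ∀ x, 1 < ‖x‖ → k x = 0)
    (hK : ∀ x, |k x| ≤ K) (x : Cn m)
    (hG : ∀ᵐ y, y ∈ closedBall x t → |g y| ≤ G) :
    |cv (sc t k) g x| ≤ K * G * (t ^ (2 * (m + 1)) * omega m) := by
  have hK0 : 0 ≤ K := (abs_nonneg _).trans (hK 0)
  have e : cv (sc t k) g x = ∫ y in closedBall x t, g y * sc t k (x - y) := by
    refine (setIntegral_eq_integral_of_forall_compl_eq_zero fun y hy => ?_).symm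
    rw [sc_eq_zero h0 ht (x - y) (by simpa [dist_eq_norm, norm_sub_rev] using hy), mul_zero]
  rw [e, ← volume_closedBall_toReal x ht.le, ← Real.norm_eq_abs]
  refine norm_setIntegral_le_of_norm_le_const_ae measure_closedBall_lt_top ?_
  rw [ae_restrict_iff' measurableSet_closedBall]
  filter_upwards [hG] with y hy hyt
  rw [norm_mul, mul_comm, Real.norm_eq_abs, Real.norm_eq_abs]
  have := hy hyt
  have h2 := hK (t⁻¹ • (x - y))
  exact mul_le_mul h2 this (abs_nonneg _) hK0

lemma cv_sub_const {k g : Cn m → ℝ} (hk : ContDiff ℝ ∞ k) (hs : HasCompactSupport k)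
    (hg : LocallyIntegrable g) (c : ℝ) (x : Cn m) :
    cv k (fun y => g y - c) x = cv k g x - c * ∫ y, k y := by
  have h1 : Integrable fun y => c * k (x - y) :=
    ((hk.continuous.integrable_of_hasCompactSupport hs).comp_sub_left x).const_mul c
  simp only [cv, sub_mul]
  rw [integral_sub (integrable_cv hk hs hg x) h1, integral_const_mul, integral_sub_left_eq_self]

lemma pd_comp_sub_left (k : Cn m → ℝ) (hk : ContDiff ℝ ∞ k) (x : Cn m) (i : Idx m) :
    pd i (fun y => k (x - y)) = fun y => - pd i k (x - y) := by
  funext y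
  have h := ((hk.differentiable (by simp) (x - y)).hasFDerivAt).comp y
    ((hasFDerivAt_id y).const_sub x)
  have e : fderiv ℝ (fun y => k (x - y)) y = _ := h.fderiv
  rw [pd, e]
  simp [pd]

lemma lap_comp_sub_left (k : Cn m → ℝ) (hk : ContDiff ℝ ∞ k) (x y : Cn m) :
    lap (fun y => k (x - y)) y = lap k (x - y) := by
  refine Finset.sum_congr rfl fun i _ => ?_
  rw [pd_comp_sub_left k hk]
  have h : ContDiff ℝ ∞ fun y => pd i k (x - y) :=
    (contDiff_pd hk i).comp (contDiff_const.sub contDiff_id)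
  have e : (fun y => - pd i k (x - y)) = fun y => (-1) * pd i k (x - y) := by funext y; ring
  rw [e, pd_const_mul (h.differentiable (by simp) y), pd_comp_sub_left _ (contDiff_pd hk i)]
  ring

/-- The reflected translate y ↦ k (x - y) is an admissible test function once its supporting ball
lies in Ω. -/
lemma WeakOn.cv_eq {Ω : Set (Cn m)} {u f k : Cn m → ℝ} (h : WeakOn Ω u f) (hk : ContDiff ℝ ∞ k)
    {t : ℝ} (h0 : ∀ x, t < ‖x‖ → k x = 0) {x : Cn m} (hx : closedBall x t ⊆ Ω) :
    cv (lap k) u x = cv k f x := by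
  have hc : ContDiff ℝ ∞ fun y => k (x - y) := hk.comp (contDiff_const.sub contDiff_id)
  have hsup : tsupport (fun y => k (x - y)) ⊆ closedBall x t := by
    refine closure_minimal (fun y hy => ?_) isClosed_closedBall
    by_contra hn
    exact hy (h0 _ (by simpa [dist_eq_norm, norm_sub_rev] using hn))
  have := h _ hc ((isCompact_closedBall x t).of_isClosed_subset (isClosed_tsupport _) hsup)
    (hsup.trans hx)
  simp only [lap_comp_sub_left k hk] at this
  exact this

lemma exists_bound_of_hasCompactSupport {k : Cn m → ℝ} (hk : Continuous k)
    (hs : HasCompactSupport k) : ∃ K : ℝ, ∀ x, |k x| ≤ K := by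
  obtain ⟨K, hK⟩ := hk.bounded_above_of_compact_support hs
  exact ⟨K, hK⟩

/-! ### Limits of functions together with their derivatives -/

lemma norm_co_le (i : Idx m) : ‖co i‖ ≤ 1 :=
  ContinuousLinearMap.opNorm_le_bound _ zero_le_one fun x => by simpa using abs_co_le i x

lemma norm_fderiv_le {f : Cn m → ℝ} {x : Cn m} {K : ℝ} (h : ∀ i, |pd i f x| ≤ K) :
    ‖fderiv ℝ f x‖ ≤ 2 * (m + 1) * K := by
  have hK : 0 ≤ K := (abs_nonneg _).trans (h (.inl 0))
  rw [fderiv_eq_sum]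
  calc ‖∑ i, pd i f x • co i‖ ≤ ∑ i : Idx m, K := by
        refine norm_sum_le_of_le _ fun i _ => ?_
        rw [norm_smul, Real.norm_eq_abs]
        exact (mul_le_mul (h i) (norm_co_le i) (norm_nonneg _) hK).trans (by simp)
    _ = _ := by rw [Finset.sum_const, Finset.card_univ, card_idx]; simp

lemma contDiffOn_pd {n : WithTop ℕ∞} {v : Cn m → ℝ} {s : Set (Cn m)} (hs : IsOpen s)
    (h : ContDiffOn ℝ (n + 1) v s) (i : Idx m) : ContDiffOn ℝ n (pd i v) s :=
  (h.fderiv_of_isOpen hs le_rfl).clm_apply contDiffOn_const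

lemma contDiffOn_of_pd {n : WithTop ℕ∞} (hn : n ≠ ⊤) {v : Cn m → ℝ} {s : Set (Cn m)}
    (hs : IsOpen s) (hd : DifferentiableOn ℝ v s) (h : ∀ i, ContDiffOn ℝ n (pd i v) s) :
    ContDiffOn ℝ (n + 1) v s := by
  rw [contDiffOn_succ_iff_fderiv_of_isOpen hs]
  refine ⟨hd, fun h => absurd h (by simpa using hn), ?_⟩
  have e : fderiv ℝ v = fun x => ∑ i, pd i v x • co i := funext fun x => fderiv_eq_sum v x
  rw [e]
  exact ContDiffOn.sum fun i _ => (h i).smul contDiffOn_const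

lemma exists_tendstoUniformlyOn {X : Type*} {s : Set X} {F : ℕ → X → ℝ} {a : ℕ → ℝ}
    (ha : Summable a) (h : ∀ k, ∀ x ∈ s, |F (k + 1) x - F k x| ≤ a k) :
    ∃ g, TendstoUniformlyOn F g atTop s := by
  have h1 := tendstoUniformlyOn_tsum_nat ha (f := fun k x => F (k + 1) x - F k x) (s := s) h
  refine ⟨fun x => F 0 x + ∑' k, (F (k + 1) x - F k x), ?_⟩
  rw [Metric.tendstoUniformlyOn_iff] at h1 ⊢
  intro ε hε
  filter_upwards [h1 ε hε] with n hn x hx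
  have := hn x hx
  rw [Finset.sum_range_sub (fun k => F k x)] at this
  rw [Real.dist_eq] at this ⊢
  convert this using 2
  ring

lemma hasFDerivAt_of_tendstoUniformlyOn_pd {s : Set (Cn m)} (hs : IsOpen s)
    {F : ℕ → Cn m → ℝ} {g : Cn m → ℝ} {g' : Idx m → Cn m → ℝ}
    (hF : ∀ n, ContDiff ℝ ∞ (F n)) (hg : ∀ x ∈ s, Tendsto (fun n => F n x) atTop (𝓝 (g x)))
    (hg' : ∀ i, TendstoUniformlyOn (fun n => pd i (F n)) (g' i) atTop s) {x : Cn m} (hx : x ∈ s) :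
    HasFDerivAt g (∑ i, g' i x • co i) x := by
  refine hasFDerivAt_of_tendstoUniformlyOn (f' := fun n x => fderiv ℝ (F n) x)
    (g' := fun x => ∑ i, g' i x • co i) (l := atTop) hs ?_
    (fun n x _ => ((hF n).differentiable (by simp) x).hasFDerivAt) hg hx
  rw [Metric.tendstoUniformlyOn_iff]
  intro ε hε
  have hc : (0 : ℝ) < Fintype.card (Idx m) := by rw [card_idx]; positivity
  have := fun i => Metric.tendstoUniformlyOn_iff.1 (hg' i) (ε / Fintype.card (Idx m))
    (div_pos hε hc)
  filter_upwards [eventually_all.2 this] with n hn x hx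
  rw [fderiv_eq_sum, dist_eq_norm, ← Finset.sum_sub_distrib]
  calc ‖∑ i, (g' i x • co i - pd i (F n) x • co i)‖
      ≤ ∑ i, ‖g' i x • co i - pd i (F n) x • co i‖ := norm_sum_le _ _
    _ < ∑ i : Idx m, ε / Fintype.card (Idx m) := by
        refine Finset.sum_lt_sum_of_nonempty ⟨.inl 0, Finset.mem_univ _⟩ fun i _ => ?_
        have e : g' i x • co i - pd i (F n) x • co i = (g' i x - pd i (F n) x) • co i :=
          (sub_smul _ _ _).symm
        rw [e, norm_smul, ← dist_eq_norm]
        exact (mul_le_of_le_one_right dist_nonneg (norm_co_le i)).trans_lt (hn i x hx)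
    _ = ε := by
        rw [Finset.sum_const, Finset.card_univ, nsmul_eq_mul]; field_simp

/-- Summable increments give uniform convergence of the functions and of their first and second
partial derivatives, so the limit may be differentiated twice. -/
lemma exists_contDiffOn_two_limit {s : Set (Cn m)} (hs : IsOpen s) {F : ℕ → Cn m → ℝ}
    (hF : ∀ n, ContDiff ℝ ∞ (F n)) {a : ℕ → ℝ} (ha : Summable a)
    (h0 : ∀ k, ∀ x ∈ s, |F (k + 1) x - F k x| ≤ a k)
    (h1 : ∀ i, ∀ k, ∀ x ∈ s, |pd i (F (k + 1)) x - pd i (F k) x| ≤ a k)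
    (h2 : ∀ i j, ∀ k, ∀ x ∈ s, |pd j (pd i (F (k + 1))) x - pd j (pd i (F k)) x| ≤ a k) :
    ∃ v, ContDiffOn ℝ 2 v s ∧ ∀ x ∈ s, Tendsto (fun n => F n x) atTop (𝓝 (v x)) ∧
      (∀ i, Tendsto (fun n => pd i (F n) x) atTop (𝓝 (pd i v x))) ∧
      ∀ i j, Tendsto (fun n => pd j (pd i (F n)) x) atTop (𝓝 (pd j (pd i v) x)) := by
  obtain ⟨v, hv⟩ := exists_tendstoUniformlyOn ha h0
  choose v' hv' using fun i => exists_tendstoUniformlyOn (F := fun n => pd i (F n)) ha (h1 i)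
  choose v'' hv'' using fun i j =>
    exists_tendstoUniformlyOn (F := fun n => pd j (pd i (F n))) ha (h2 i j)
  have d1 : ∀ x ∈ s, HasFDerivAt v (∑ i, v' i x • co i) x := fun x hx =>
    hasFDerivAt_of_tendstoUniformlyOn_pd hs hF (fun x hx => hv.tendsto_at hx) hv' hx
  have d2 : ∀ i, ∀ x ∈ s, HasFDerivAt (v' i) (∑ j, v'' i j x • co j) x := fun i x hx =>
    hasFDerivAt_of_tendstoUniformlyOn_pd hs (fun n => contDiff_pd (hF n) i)
      (fun x hx => (hv' i).tendsto_at hx) (hv'' i) hx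
  have e1 : ∀ i, ∀ x ∈ s, pd i v x = v' i x := fun i x hx => by
    rw [pd, (d1 x hx).fderiv]
    simp [-Fintype.sum_sum_type, co_dir]
  have e1' : ∀ i, ∀ x ∈ s, pd i v =ᶠ[𝓝 x] v' i := fun i x hx => by
    filter_upwards [hs.mem_nhds hx] with y hy using e1 i y hy
  have e2' : ∀ i j, ∀ x ∈ s, pd j (v' i) x = v'' i j x := fun i j x hx => by
    rw [pd, (d2 i x hx).fderiv]
    simp [-Fintype.sum_sum_type, co_dir]
  have e2 : ∀ i j, ∀ x ∈ s, pd j (pd i v) x = v'' i j x := fun i j x hx => by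
    rw [pd_congr (e1' i x hx), e2' i j x hx]
  refine ⟨v, ?_, fun x hx => ⟨hv.tendsto_at hx, fun i => ?_, fun i j => ?_⟩⟩
  · have c2 : ∀ i j, ContinuousOn (v'' i j) s := fun i j =>
      (hv'' i j).continuousOn (Frequently.of_forall fun n =>
        (contDiff_pd (contDiff_pd (hF n) i) j).continuous.continuousOn)
    have c1 : ∀ i, ContDiffOn ℝ (0 + 1) (v' i) s := fun i =>
      contDiffOn_of_pd (by simp) hs
        (fun x hx => (d2 i x hx).differentiableAt.differentiableWithinAt)
        fun j => contDiffOn_zero.2 ((c2 i j).congr (e2' i j))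
    have := contDiffOn_of_pd (n := 0 + 1) (by simp) hs
      (fun x hx => (d1 x hx).differentiableAt.differentiableWithinAt)
      fun i => (c1 i).congr (e1 i)
    exact this.of_le (by norm_num [← one_add_one_eq_two])
  · rw [e1 i x hx]; exact (hv' i).tendsto_at hx
  · rw [e2 i j x hx]; exact (hv'' i j).tendsto_at hx

lemma abs_sub_le_of_pd_le {f : Cn m → ℝ} {s : Set (Cn m)} (hs : Convex ℝ s)
    (hd : ∀ x ∈ s, DifferentiableAt ℝ f x) {K : ℝ} (h : ∀ i, ∀ x ∈ s, |pd i f x| ≤ K)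
    {x y : Cn m} (hx : x ∈ s) (hy : y ∈ s) : |f x - f y| ≤ 2 * (m + 1) * K * ‖x - y‖ := by
  have := hs.norm_image_sub_le_of_norm_fderiv_le hd (fun x hx => norm_fderiv_le fun i => h i x hx)
    hy hx
  simpa using this

/-- A dyadic sum: `∑ min (t ^ α) (ρ t ^ (α - 1)) ≤ C ρ ^ α`, where `t = t₀ / 2 ^ k`. -/
lemma exists_sum_min_le {α : ℝ} (h0 : 0 < α) (h1 : α < 1) : ∃ C : ℝ, 0 ≤ C ∧
    ∀ (n : ℕ) (t ρ : ℝ), 0 < t → 0 < ρ →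
      ∑ k ∈ Finset.range n, min ((t / 2 ^ k) ^ α) (ρ * (t / 2 ^ k) ^ (α - 1)) ≤ C * ρ ^ α := by
  have hq0 : (0 : ℝ) < 2 ^ (-α) := by positivity
  have hq1 : (2 : ℝ) ^ (-α) < 1 := Real.rpow_lt_one_of_one_lt_of_neg (by norm_num) (by linarith)
  set S := (1 - (2 : ℝ) ^ (-α))⁻¹ with hS
  have hS0 : 0 < S := inv_pos.2 (by linarith)
  have hp : (1 : ℝ) < 2 ^ (1 - α) := Real.one_lt_rpow (by norm_num) (by linarith)
  set E := ((2 : ℝ) ^ (1 - α) - 1)⁻¹ with hE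
  have hE0 : 0 < E := inv_pos.2 (by linarith)
  have hhalf : ∀ (t : ℝ) (k : ℕ), t / 2 ^ (k + 1) = t / 2 / 2 ^ k := fun t k => by
    rw [pow_succ]; field_simp
  -- The first entry of the minimum alone gives a geometric series of ratio 2^(-α). This is
  -- efficient when t ≤ ρ.
  have small : ∀ (n : ℕ) (t ρ : ℝ), 0 < t → 0 < ρ →
      ∑ k ∈ Finset.range n, min ((t / 2 ^ k) ^ α) (ρ * (t / 2 ^ k) ^ (α - 1)) ≤ S * t ^ α := by
    intro n
    induction n with
    | zero => intro t ρ ht _; simp; positivity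
    | succ n ih =>
      intro t ρ ht hρ
      rw [Finset.sum_range_succ']
      simp only [hhalf]
      have h := ih (t / 2) ρ (by positivity) hρ
      have e : (t / 2) ^ α = 2 ^ (-α) * t ^ α := by
        rw [Real.div_rpow ht.le (by norm_num), Real.rpow_neg (by norm_num)]; ring
      have e2 : S * 2 ^ (-α) + 1 = S := by
        have : S * (1 - (2 : ℝ) ^ (-α)) = 1 := inv_mul_cancel₀ (by linarith)
        linear_combination -this
      have h3 : min ((t / 2 ^ 0) ^ α) (ρ * (t / 2 ^ 0) ^ (α - 1)) ≤ t ^ α := by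
        simp
      rw [e] at h
      have : S * t ^ α = S * (2 ^ (-α) * t ^ α) + t ^ α := by
        conv_lhs => rw [← e2]
        ring
      linarith
  -- The subtracted term closes the induction. Halving t multiplies t^(α-1) by 2^(1-α), and E
  -- 2^(1-α) = E + 1, so the gain pays exactly for the new summand ρ t^(α-1).
  have big : ∀ (n : ℕ) (t ρ : ℝ), 0 < ρ → ρ < t →
      ∑ k ∈ Finset.range n, min ((t / 2 ^ k) ^ α) (ρ * (t / 2 ^ k) ^ (α - 1)) ≤
        (S + 1 + E) * ρ ^ α - E * (ρ * t ^ (α - 1)) := by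
    intro n
    induction n with
    | zero =>
      intro t ρ hρ ht
      have h3 : t ^ (α - 1) ≤ ρ ^ (α - 1) :=
        Real.rpow_le_rpow_of_nonpos hρ ht.le (by linarith)
      have h4 : ρ * ρ ^ (α - 1) = ρ ^ α := by
        rw [← Real.rpow_one_add' hρ.le (by linarith)]; congr 1; ring
      have h5 : ρ * t ^ (α - 1) ≤ ρ ^ α := by rw [← h4]; gcongr
      have h6 : (0 : ℝ) < ρ ^ α := by positivity
      simp
      nlinarith
    | succ n ih =>
      intro t ρ hρ ht
      have ht0 : 0 < t := hρ.trans ht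
      rw [Finset.sum_range_succ']
      simp only [hhalf]
      have h3 : t ^ (α - 1) ≤ ρ ^ (α - 1) :=
        Real.rpow_le_rpow_of_nonpos hρ ht.le (by linarith)
      have h4 : ρ * ρ ^ (α - 1) = ρ ^ α := by
        rw [← Real.rpow_one_add' hρ.le (by linarith)]; congr 1; ring
      have h5 : ρ * t ^ (α - 1) ≤ ρ ^ α := by rw [← h4]; gcongr
      have h6 : min ((t / 2 ^ 0) ^ α) (ρ * (t / 2 ^ 0) ^ (α - 1)) ≤ ρ * t ^ (α - 1) := by
        simp
      rcases lt_or_ge ρ (t / 2) with h | h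
      · have h7 := ih (t / 2) ρ hρ h
        have e : (t / 2) ^ (α - 1) = 2 ^ (1 - α) * t ^ (α - 1) := by
          rw [Real.div_rpow ht0.le (by norm_num), show α - 1 = -(1 - α) by ring,
            Real.rpow_neg (by norm_num : (0 : ℝ) ≤ 2)]
          field_simp
        have e2 : E * 2 ^ (1 - α) = E + 1 := by
          have : (2 : ℝ) ^ (1 - α) - 1 ≠ 0 := by linarith
          rw [hE]; field_simp; ring
        have e3 : E * (ρ * (t / 2) ^ (α - 1)) = (E + 1) * (ρ * t ^ (α - 1)) := by
          rw [e, ← e2]; ring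
        rw [e3] at h7
        linarith
      · have h7 := small n (t / 2) ρ (by positivity) hρ
        have h8 : S * (t / 2) ^ α ≤ S * ρ ^ α := by gcongr
        nlinarith
  refine ⟨S + 1 + E, by positivity, fun n t ρ ht hρ => ?_⟩
  rcases lt_or_ge ρ t with h | h
  · refine (big n t ρ hρ h).trans ?_
    have : 0 ≤ E * (ρ * t ^ (α - 1)) := by positivity
    linarith
  · refine (small n t ρ ht hρ).trans ?_
    have : t ^ α ≤ ρ ^ α := by gcongr
    have h6 : (0 : ℝ) < ρ ^ α := by positivity
    nlinarith

/-! ### Interior Schauder estimates in Euclidean space -/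

/-- Smooth kernels supported in the closed unit ball. -/
structure IsKernel (k : Cn m → ℝ) : Prop where
  contDiff : ContDiff ℝ ∞ k
  eq_zero : ∀ x, 1 < ‖x‖ → k x = 0

/-- The normalized mollification of `g` at scale `t`. -/
def mol (k g : Cn m → ℝ) (t : ℝ) (x : Cn m) : ℝ := (t ^ (2 * (m + 1)))⁻¹ * cv (sc t k) g x

lemma IsKernel.pd {k : Cn m → ℝ} (hk : IsKernel k) (i : Idx m) :
    IsKernel (ConeSchauder.pd i k) :=
  ⟨contDiff_pd hk.contDiff i, fun x hx => pd_eq_zero hk.eq_zero i x hx⟩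

lemma IsKernel.hasCompactSupport {k : Cn m → ℝ} (hk : IsKernel k) : HasCompactSupport k :=
  hasCompactSupport_of_eq_zero hk.eq_zero

lemma IsKernel.hasCompactSupport_sc {k : Cn m → ℝ} (hk : IsKernel k) {t : ℝ} (ht : 0 < t) :
    HasCompactSupport (sc t k) :=
  hasCompactSupport_of_eq_zero fun x hx => sc_eq_zero hk.eq_zero ht x hx

lemma IsKernel.exists_bound {k : Cn m → ℝ} (hk : IsKernel k) : ∃ K, ∀ x, |k x| ≤ K :=
  exists_bound_of_hasCompactSupport hk.contDiff.continuous hk.hasCompactSupport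

lemma IsKernel.exists_bound_three {k : Cn m → ℝ} (hk : IsKernel k) : ∃ K, 0 ≤ K ∧
    (∀ x, |k x| ≤ K) ∧ (∀ i x, |ConeSchauder.pd i k x| ≤ K) ∧
    (∀ i j x, |ConeSchauder.pd j (ConeSchauder.pd i k) x| ≤ K) ∧
    ∀ i j l x, |ConeSchauder.pd l (ConeSchauder.pd j (ConeSchauder.pd i k)) x| ≤ K := by
  obtain ⟨K0, h0⟩ := hk.exists_bound
  choose K1 h1 using fun i => (hk.pd i).exists_bound
  choose K2 h2 using fun p : Idx m × Idx m => ((hk.pd p.1).pd p.2).exists_bound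
  choose K3 h3 using fun p : Idx m × Idx m × Idx m =>
    (((hk.pd p.1).pd p.2.1).pd p.2.2).exists_bound
  obtain ⟨L1, l1⟩ := Finite.exists_le K1
  obtain ⟨L2, l2⟩ := Finite.exists_le K2
  obtain ⟨L3, l3⟩ := Finite.exists_le K3
  have a := le_max_left (max K0 L1) (max L2 L3)
  have b := le_max_right (max K0 L1) (max L2 L3)
  have c1 := (le_max_left K0 L1).trans a
  have c2 := (le_max_right K0 L1).trans a
  have c3 := (le_max_left L2 L3).trans b
  have c4 := (le_max_right L2 L3).trans b
  exact ⟨max (max K0 L1) (max L2 L3), ((abs_nonneg _).trans (h0 0)).trans c1,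
    fun x => (h0 x).trans c1, fun i x => ((h1 i x).trans (l1 i)).trans c2,
    fun i j x => ((h2 (i, j) x).trans (l2 _)).trans c3,
    fun i j l x => ((h3 (i, j, l) x).trans (l3 _)).trans c4⟩

section mol
variable {k g : Cn m → ℝ} {t : ℝ} (hk : IsKernel k) (ht : 0 < t)
include hk ht

lemma contDiff_mol (hg : LocallyIntegrable g) : ContDiff ℝ ∞ (mol k g t) :=
  contDiff_const.mul (contDiff_cv (contDiff_sc hk.contDiff t) (hk.hasCompactSupport_sc ht) hg)

lemma pd_mol (hg : LocallyIntegrable g) (i : Idx m) :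
    pd i (mol k g t) = fun x => t⁻¹ * mol (pd i k) g t x := by
  funext x
  have hc := contDiff_cv (contDiff_sc hk.contDiff t) (hk.hasCompactSupport_sc ht) hg
  have e : pd i (mol k g t) x = _ := pd_const_mul (hc.differentiable (by simp) x) _ i
  rw [e, pd_cv (contDiff_sc hk.contDiff t) (hk.hasCompactSupport_sc ht) hg, pd_sc hk.contDiff]
  simp only [mol, cv]
  rw [← mul_assoc, mul_comm t⁻¹, mul_assoc, ← integral_const_mul t⁻¹]
  congr 2
  funext y
  ring

lemma abs_mol_le {K G : ℝ} (hK : ∀ x, |k x| ≤ K) (x : Cn m)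
    (hG : ∀ᵐ y, y ∈ closedBall x t → |g y| ≤ G) : |mol k g t x| ≤ K * G * omega m := by
  have h := abs_cv_le ht hk.eq_zero hK x hG
  have hp : 0 < t ^ (2 * (m + 1)) := by positivity
  rw [mol, abs_mul, abs_of_pos (inv_pos.2 hp), inv_mul_le_iff₀ hp]
  linarith

lemma mol_sub_const (hg : LocallyIntegrable g) (c : ℝ) (x : Cn m) :
    mol k (fun y => g y - c) t x = mol k g t x - c * ∫ y, k y := by
  rw [mol, cv_sub_const (contDiff_sc hk.contDiff t) (hk.hasCompactSupport_sc ht) hg,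
    integral_sc ht, mol]
  have hp : 0 < t ^ (2 * (m + 1)) := by positivity
  field_simp

lemma abs_mol_sub_le (hg : LocallyIntegrable g) {K G c : ℝ} (hK : ∀ x, |k x| ≤ K) (x : Cn m)
    (hG : ∀ᵐ y, y ∈ closedBall x t → |g y - c| ≤ G) :
    |mol k g t x - c * ∫ y, k y| ≤ K * G * omega m := by
  rw [← mol_sub_const hk ht hg]
  exact abs_mol_le hk ht hK x hG

end mol

/-- Test the equation against Φ at scale t. The Laplacian of the scaled Φ is t⁻² times the
difference of the kernels η at scales t and t/2, the factor 2^(2(m+1)) being the renormalisation of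
the finer one. -/
lemma mol_half_sub {η Φ u f : Cn m → ℝ} (hη : IsKernel η) (hΦ : IsKernel Φ)
    (h : ∀ x, lap Φ x = η x - 2 ^ (2 * (m + 1)) * η ((2 : ℝ) • x)) {Ω : Set (Cn m)}
    (hu : LocallyIntegrable u) (hw : WeakOn Ω u f) {t : ℝ} (ht : 0 < t) {x : Cn m}
    (hx : closedBall x t ⊆ Ω) :
    mol η u (t / 2) x - mol η u t x = - t ^ 2 * mol Φ f t x := by
  have e1 := hw.cv_eq (contDiff_sc hΦ.contDiff t) (fun y => sc_eq_zero hΦ.eq_zero ht y) hx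
  have i1 := integrable_cv (contDiff_sc hη.contDiff t) (hη.hasCompactSupport_sc ht) hu x
  have i2 := integrable_cv (contDiff_sc hη.contDiff (t / 2))
    (hη.hasCompactSupport_sc (half_pos ht)) hu x
  have e2 : cv (lap (sc t Φ)) u x =
      t⁻¹ ^ 2 * (cv (sc t η) u x - 2 ^ (2 * (m + 1)) * cv (sc (t / 2) η) u x) := by
    simp only [cv]
    rw [← integral_const_mul (2 ^ (2 * (m + 1)) : ℝ), ← integral_sub i1 (i2.const_mul _),
      ← integral_const_mul]
    congr 1
    funext y
    rw [lap_sc hΦ.contDiff]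
    simp only [sc, h, smul_smul]
    have : (t / 2)⁻¹ = 2 * t⁻¹ := by field_simp
    rw [this]
    ring
  rw [e2] at e1
  have hp : t ^ (2 * (m + 1)) ≠ 0 := by positivity
  rw [mol, mol, mol, ← e1, div_pow]
  field_simp
  ring

/-- Cutting off outside Ω is invisible to test functions supported in Ω, and makes bounded data on a
ball locally integrable on the whole space. -/
lemma WeakOn.congr_indicator {Ω : Set (Cn m)} {u f : Cn m → ℝ} (h : WeakOn Ω u f) :
    WeakOn Ω (Ω.indicator u) (Ω.indicator f) := by
  intro φ h1 h2 h3
  have e1 : ∀ x, Ω.indicator u x * lap φ x = u x * lap φ x := fun x => by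
    by_cases hx : x ∈ Ω
    · rw [indicator_of_mem hx]
    · rw [image_eq_zero_of_notMem_tsupport (f := lap φ) fun h' => hx (h3 (tsupport_lap_subset φ h'))]
      simp
  have e2 : ∀ x, Ω.indicator f x * φ x = f x * φ x := fun x => by
    by_cases hx : x ∈ Ω
    · rw [indicator_of_mem hx]
    · rw [image_eq_zero_of_notMem_tsupport fun h' => hx (h3 h')]
      simp
  simp only [e1, e2]
  exact h φ h1 h2 h3

lemma locallyIntegrable_indicator_ball {g : Cn m → ℝ} {x₀ : Cn m} {R G : ℝ}
    (hg : AEStronglyMeasurable g (volume.restrict (ball x₀ R)))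
    (hG : ∀ᵐ x, x ∈ ball x₀ R → |g x| ≤ G) : LocallyIntegrable ((ball x₀ R).indicator g) := by
  refine Integrable.locallyIntegrable ?_
  rw [integrable_indicator_iff measurableSet_ball]
  have : IsFiniteMeasure (volume.restrict (ball x₀ R)) := ⟨by simpa using measure_ball_lt_top⟩
  refine Integrable.of_bound hg G ?_
  rw [ae_restrict_iff' measurableSet_ball]
  simpa using hG

/-- Mollifications at scales `t k → 0` converge almost everywhere. -/
lemma ae_tendsto_mol {η g : Cn m → ℝ} (hη : IsKernel η) (h1 : ∫ x, η x = 1)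
    (hg : LocallyIntegrable g) {t : ℕ → ℝ} (ht : ∀ k, 0 < t k) (ht0 : Tendsto t atTop (𝓝 0)) :
    ∀ᵐ x, Tendsto (fun k => mol η g (t k) x) atTop (𝓝 (g x)) := by
  obtain ⟨K, hK⟩ := hη.exists_bound
  have hK0 : 0 ≤ K := (abs_nonneg _).trans (hK 0)
  -- Lebesgue differentiation: as η has integral one, the error at x is at most `K * omega m` times
  -- the mean of |g - g x| over the ball of radius t k.
  filter_upwards [IsUnifLocDoublingMeasure.ae_tendsto_average_norm_sub
    (volume : Measure (Cn m)) hg 1] with x hx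
  have hl : Tendsto t atTop (𝓝[>] 0) :=
    tendsto_nhdsWithin_iff.2 ⟨ht0, Eventually.of_forall ht⟩
  have h2 := hx (fun _ : ℕ => x) t hl
    (Eventually.of_forall fun k => mem_closedBall_self (by linarith [ht k]))
  rw [tendsto_iff_norm_sub_tendsto_zero]
  refine squeeze_zero (fun _ => norm_nonneg _) (fun k => ?_)
    (by simpa using h2.const_mul (K * omega m))
  have e := mol_sub_const hη (ht k) hg (g x) x
  rw [h1, mul_one] at e
  rw [← e, average_eq, mol]
  have hv : (volume.real (closedBall x (t k))) = t k ^ (2 * (m + 1)) * omega m :=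
    volume_closedBall_toReal x (ht k).le
  have hint : Integrable (fun y => ‖g y - g x‖) (volume.restrict (closedBall x (t k))) :=
    ((hg.integrableOn_isCompact (isCompact_closedBall x (t k))).sub
      ((continuous_const (y := g x)).locallyIntegrable.integrableOn_isCompact
        (isCompact_closedBall x (t k)))).norm
  have hle : ‖cv (sc (t k) η) (fun y => g y - g x) x‖ ≤
      ∫ y in closedBall x (t k), K * ‖g y - g x‖ := by
    have e : cv (sc (t k) η) (fun y => g y - g x) x =
        ∫ y in closedBall x (t k), (g y - g x) * sc (t k) η (x - y) := by
      refine (setIntegral_eq_integral_of_forall_compl_eq_zero fun y hy => ?_).symm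
      rw [sc_eq_zero hη.eq_zero (ht k) (x - y)
        (by simpa [dist_eq_norm, norm_sub_rev] using hy), mul_zero]
    rw [e]
    refine norm_integral_le_of_norm_le (hint.const_mul K) (ae_of_all _ fun y => ?_)
    rw [norm_mul, mul_comm]
    exact mul_le_mul_of_nonneg_right (hK _) (norm_nonneg _)
  rw [integral_const_mul] at hle
  rw [measureReal_restrict_apply_univ, hv, norm_mul, norm_inv,
    Real.norm_of_nonneg (pow_nonneg (ht k).le _), smul_eq_mul]
  have hω : 0 < omega m :=
    ENNReal.toReal_pos (measure_ball_pos _ _ one_pos).ne' measure_ball_lt_top.ne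
  have hp : 0 < t k ^ (2 * (m + 1)) := pow_pos (ht k) _
  calc _ ≤ (t k ^ (2 * (m + 1)))⁻¹ * (K * ∫ y in closedBall x (t k), ‖g y - g x‖) := by gcongr
    _ = _ := by simp only [Real.norm_eq_abs]; field_simp

/-- Each derivative of the increment costs a factor t⁻¹ and differentiates the kernel. The
conclusion has the shape of the hypothesis, so the lemma can be iterated. -/
lemma pd_sub_pd_eq {f₁ f₂ k g : Cn m → ℝ} {t c : ℝ} {s : Set (Cn m)} (hs : IsOpen s)
    (h1 : ContDiff ℝ ∞ f₁) (h2 : ContDiff ℝ ∞ f₂) (hk : IsKernel k) (ht : 0 < t)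
    (hg : LocallyIntegrable g) (h : ∀ x ∈ s, f₁ x - f₂ x = c * mol k g t x) (i : Idx m) :
    ∀ x ∈ s, pd i f₁ x - pd i f₂ x = c * t⁻¹ * mol (pd i k) g t x := by
  intro x hx
  have e : (fun y => f₁ y - f₂ y) =ᶠ[𝓝 x] fun y => c * mol k g t y := by
    filter_upwards [hs.mem_nhds hx] with y hy using h y hy
  rw [← pd_sub (h1.differentiable (by simp) x) (h2.differentiable (by simp) x), pd_congr e,
    pd_const_mul ((contDiff_mol hk ht hg).differentiable (by simp) x), pd_mol hk ht hg, mul_assoc]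

lemma abs_le_add_sum {F : ℕ → ℝ} {b : ℕ → ℝ} (h : ∀ k, |F (k + 1) - F k| ≤ b k) (n : ℕ) :
    |F n| ≤ |F 0| + ∑ k ∈ Finset.range n, b k := by
  have e : F n = F 0 + ∑ k ∈ Finset.range n, (F (k + 1) - F k) := by
    rw [Finset.sum_range_sub]; ring
  rw [e]
  refine (abs_add_le _ _).trans (add_le_add_right ?_ _)
  exact (Finset.abs_sum_le_sum_abs _ _).trans (Finset.sum_le_sum fun k _ => h k)

lemma div_two_pow_rpow {t : ℝ} (ht : 0 < t) (α : ℝ) (k : ℕ) :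
    (t / 2 ^ k) ^ α = t ^ α * ((2 : ℝ) ^ (-α)) ^ k := by
  rw [Real.div_rpow ht.le (by positivity), ← Real.rpow_natCast, ← Real.rpow_natCast,
    ← Real.rpow_mul (by norm_num), ← Real.rpow_mul (by norm_num), div_eq_mul_inv,
    ← Real.rpow_neg (by norm_num)]
  congr 2
  ring

lemma exists_mem_of_compl_null {G : Set (Cn m)} (hG : volume Gᶜ = 0) (x : Cn m) {t : ℝ}
    (ht : 0 < t) : ∃ y ∈ G, y ∈ ball x t := by
  by_contra! h
  have : ball x t ⊆ Gᶜ := fun y hy hyG => h y hyG hy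
  exact (measure_ball_pos volume x ht).ne' (measure_mono_null this hG)

lemma lap_const_mul_cv {k g : Cn m → ℝ} (hk : ContDiff ℝ ∞ k) (hs : HasCompactSupport k)
    (hg : LocallyIntegrable g) (c : ℝ) (x : Cn m) :
    lap (fun x => c * cv k g x) x = c * cv (lap k) g x := by
  have e2 : ∀ i, pd i (pd i (fun x => c * cv k g x)) x = c * cv (pd i (pd i k)) g x := by
    intro i
    have e3 : pd i (fun x => c * cv k g x) = fun x => c * cv (pd i k) g x := by
      funext y
      rw [← pd_cv hk hs hg]
      exact pd_const_mul ((contDiff_cv hk hs hg).differentiable (by simp) y) _ i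
    rw [e3, pd_const_mul ((contDiff_cv (contDiff_pd hk i) (hasCompactSupport_pd hs i)
      hg).differentiable (by simp) x), pd_cv (contDiff_pd hk i) (hasCompactSupport_pd hs i) hg]
  simp only [lap, e2, ← Finset.mul_sum]
  congr 1
  simp only [cv, lap, Finset.mul_sum]
  exact (integral_finsetSum _ fun i _ => integrable_cv (contDiff_pd (contDiff_pd hk i) i)
    (hasCompactSupport_pd (hasCompactSupport_pd hs i) i) hg x).symm

set_option maxHeartbeats 2000000 in
/-- Interior Schauder estimates for bounded distributional solutions of `Δ u = f`, where `f` is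
Hölder continuous on a set of full measure. -/
theorem exists_schauder (m : ℕ) {α : ℝ} (h0 : 0 < α) (h1 : α < 1) : ∃ C : ℝ, 0 ≤ C ∧
    ∀ (x₀ : Cn m) (t M A : ℝ) (u f : Cn m → ℝ) (G : Set (Cn m)), 0 < t → 0 ≤ M → 0 ≤ A →
      AEStronglyMeasurable u (volume.restrict (ball x₀ (4 * t))) →
      AEStronglyMeasurable f (volume.restrict (ball x₀ (4 * t))) →
      (∀ᵐ x, x ∈ ball x₀ (4 * t) → |u x| ≤ M) → volume Gᶜ = 0 →
      (∀ x ∈ ball x₀ (4 * t), x ∈ G → ∀ y ∈ ball x₀ (4 * t), y ∈ G →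
        |f x - f y| ≤ A * ‖x - y‖ ^ α) →
      WeakOn (ball x₀ (4 * t)) u f →
      ∃ v : Cn m → ℝ, ContDiffOn ℝ 2 v (ball x₀ (2 * t)) ∧
        (∀ᵐ x, x ∈ ball x₀ (2 * t) → v x = u x) ∧
        (∀ x ∈ ball x₀ (2 * t), x ∈ G → lap v x = f x) ∧
        (∀ x ∈ ball x₀ (2 * t), ∀ i, |pd i v x| * t ≤ C * (M + A * t ^ (2 + α))) ∧
        (∀ x ∈ ball x₀ (2 * t), ∀ i j, |pd j (pd i v) x| * t ^ 2 ≤ C * (M + A * t ^ (2 + α))) ∧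
        ∀ x ∈ ball x₀ (2 * t), ∀ y ∈ ball x₀ (2 * t), ∀ i j,
          |pd j (pd i v) x - pd j (pd i v) y| * t ^ (2 + α) ≤
            C * (M + A * t ^ (2 + α)) * ‖x - y‖ ^ α := by
  obtain ⟨η, Φ, hη', hΦ', hη0, hΦ0, hη1, hlap⟩ := exists_mollifier m
  have hη : IsKernel η := ⟨hη', hη0⟩
  have hΦ : IsKernel Φ := ⟨hΦ', hΦ0⟩
  obtain ⟨K₁, hK₁, a0, a1, a2, a3⟩ := hη.exists_bound_three
  obtain ⟨K₂, hK₂, b0, b1, b2, b3⟩ := hΦ.exists_bound_three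
  obtain ⟨Cα, hCα, hsum⟩ := exists_sum_min_le h0 h1
  set q : ℝ := 2 ^ (-α) with hq
  have hq0 : 0 < q := by positivity
  have hq1 : q < 1 := Real.rpow_lt_one_of_one_lt_of_neg (by norm_num) (by linarith)
  -- This dominates the factor 4^(-k) of τ k ^ 2 by q ^ k, so that a single geometric majorant
  -- serves the increments of all orders.
  have hq2 : 1 / 4 ≤ q := by
    have : (2 : ℝ) ^ (-1 : ℝ) ≤ q := Real.rpow_le_rpow_of_exponent_le (by norm_num) (by linarith)
    rw [Real.rpow_neg_one] at this
    linarith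
  set S := (1 - q)⁻¹ with hS
  have hS0 : 0 < S := inv_pos.2 (by linarith)
  set K := K₁ + K₂ with hK
  have hK1 : K₁ ≤ K := by linarith
  have hK2 : K₂ ≤ K := by linarith
  have hK0 : 0 ≤ K := by linarith
  have hω : 0 ≤ omega m := omega_nonneg
  set L := K * omega m with hL
  have hL0 : 0 ≤ L := by positivity
  refine ⟨8 * (m + 1) * L * (1 + S + Cα), by positivity, ?_⟩
  intro x₀ t M A u f G ht hM hA hum hfm hub hG hf hw
  set s := ball x₀ (2 * t) with hs
  have hso : IsOpen s := isOpen_ball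
  set u' := (ball x₀ (4 * t)).indicator u with hu'
  set f' := (ball x₀ (4 * t)).indicator f with hf'
  have hw' : WeakOn (ball x₀ (4 * t)) u' f' := hw.congr_indicator
  have hGae : ∀ᵐ x, x ∈ G := hG
  -- A point of G yields an essential bound B for f. It serves for integrability and for the
  -- summability of the increments, and does not enter the final constant.
  obtain ⟨g₀, hg₀, hg₀'⟩ := exists_mem_of_compl_null hG x₀ (t := 4 * t) (by positivity)
  have hfb : ∃ B, 0 ≤ B ∧ ∀ᵐ x, x ∈ ball x₀ (4 * t) → |f x| ≤ B := by
    refine ⟨|f g₀| + A * (8 * t) ^ α, by positivity, ?_⟩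
    filter_upwards [hGae] with x hx hxb
    have h := hf x hxb hx g₀ hg₀' hg₀
    have hd : ‖x - g₀‖ ≤ 8 * t := by
      rw [← dist_eq_norm]
      have := dist_triangle_right x g₀ x₀
      have := mem_ball.1 hxb
      have := mem_ball.1 hg₀'
      linarith
    have h2 : ‖x - g₀‖ ^ α ≤ (8 * t) ^ α := by gcongr
    have h3 : A * ‖x - g₀‖ ^ α ≤ A * (8 * t) ^ α := by gcongr
    have h4 := abs_sub_abs_le_abs_sub (f x) (f g₀)
    linarith
  obtain ⟨B, hB0, hfB⟩ := hfb
  have hui : LocallyIntegrable u' := locallyIntegrable_indicator_ball hum hub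
  have hfi : LocallyIntegrable f' := locallyIntegrable_indicator_ball hfm hfB
  have hub' : ∀ᵐ x, |u' x| ≤ M := by
    filter_upwards [hub] with x hx
    by_cases hxb : x ∈ ball x₀ (4 * t)
    · rw [hu', indicator_of_mem hxb]; exact hx hxb
    · rw [hu', indicator_of_notMem hxb]; simpa using hM
  have hfB' : ∀ᵐ x, |f' x| ≤ B := by
    filter_upwards [hfB] with x hx
    by_cases hxb : x ∈ ball x₀ (4 * t)
    · rw [hf', indicator_of_mem hxb]; exact hx hxb
    · rw [hf', indicator_of_notMem hxb]; simpa using hB0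
  have hsub : ∀ x ∈ s, ∀ τ ≤ t, closedBall x τ ⊆ ball x₀ (4 * t) := by
    intro x hx τ hτ y hy
    have h1 := mem_ball.1 hx
    have h2 := mem_closedBall.1 hy
    have := dist_triangle y x x₀
    exact mem_ball.2 (by linarith)
  have hosc' : ∀ x ∈ s, ∀ τ, 0 < τ → τ ≤ t → ∀ g ∈ G, g ∈ closedBall x τ →
      ∀ᵐ y, y ∈ closedBall x τ → |f' y - f g| ≤ 2 * A * τ ^ α := by
    intro x hx τ hτ hτt g hg hgx
    filter_upwards [hGae] with y hyG hy
    have hyb := hsub x hx τ hτt hy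
    rw [hf', indicator_of_mem hyb]
    refine (hf y hyb hyG g (hsub x hx τ hτt hgx) hg).trans ?_
    have hd : ‖y - g‖ ≤ 2 * τ := by
      rw [← dist_eq_norm]
      have := dist_triangle_right y g x
      have := mem_closedBall.1 hy
      have := mem_closedBall.1 hgx
      linarith
    have h2 : ‖y - g‖ ^ α ≤ (2 * τ) ^ α := by gcongr
    have h3 : (2 : ℝ) ^ α ≤ 2 := by
      conv_rhs => rw [← Real.rpow_one 2]
      exact Real.rpow_le_rpow_of_exponent_le (by norm_num) h1.le
    have h4 : (2 * τ) ^ α ≤ 2 * τ ^ α := by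
      rw [Real.mul_rpow (by norm_num) hτ.le]; gcongr
    calc A * ‖y - g‖ ^ α ≤ A * (2 * τ ^ α) := by gcongr; exact h2.trans h4
      _ = _ := by ring
  have hosc : ∀ x ∈ s, ∀ τ, 0 < τ → τ ≤ t →
      ∃ c, ∀ᵐ y, y ∈ closedBall x τ → |f' y - c| ≤ 2 * A * τ ^ α := by
    intro x hx τ hτ hτt
    obtain ⟨g, hg, hgx⟩ := exists_mem_of_compl_null hG x hτ
    exact ⟨f g, hosc' x hx τ hτ hτt g hg (ball_subset_closedBall hgx)⟩
  set τ : ℕ → ℝ := fun k => t / 2 ^ k with hτ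
  have hτ0 : ∀ k, 0 < τ k := fun k => by positivity
  have hτt : ∀ k, τ k ≤ t := fun k => div_le_self ht.le (one_le_pow₀ (by norm_num))
  have hττ : ∀ k, τ (k + 1) = τ k / 2 := fun k => by simp only [hτ, pow_succ]; field_simp
  have hτα : ∀ k, τ k ^ α = t ^ α * q ^ k := fun k => div_two_pow_rpow ht α k
  have htend : Tendsto τ atTop (𝓝 0) := by
    have := (tendsto_pow_atTop_nhds_zero_of_lt_one (r := (1 / 2 : ℝ)) (by norm_num)
      (by norm_num)).const_mul t
    simpa [hτ, div_eq_mul_inv] using this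
  set F : ℕ → Cn m → ℝ := fun k => mol η u' (τ k) with hF
  have hFc : ∀ k, ContDiff ℝ ∞ (F k) := fun k => contDiff_mol hη (hτ0 k) hui
  have d0 : ∀ k, ∀ x ∈ s, F (k + 1) x - F k x = - τ k ^ 2 * mol Φ f' (τ k) x := by
    intro k x hx
    have := mol_half_sub hη hΦ hlap hui hw' (hτ0 k) (hsub x hx _ (hτt k))
    rw [← hττ] at this
    exact this
  have d1 := fun i k => pd_sub_pd_eq hso (hFc (k + 1)) (hFc k) hΦ (hτ0 k) hfi (d0 k) i
  have d2 := fun i j k => pd_sub_pd_eq hso (contDiff_pd (hFc (k + 1)) i) (contDiff_pd (hFc k) i)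
    (hΦ.pd i) (hτ0 k) hfi (d1 i k) j
  have d3 := fun i j l k => pd_sub_pd_eq hso (contDiff_pd (contDiff_pd (hFc (k + 1)) i) j)
    (contDiff_pd (contDiff_pd (hFc k) i) j) ((hΦ.pd i).pd j) (hτ0 k) hfi (d2 i j k) l
  -- A differentiated kernel has mean zero, so a constant may be subtracted from f at no cost, and
  -- its Hölder condition provides the factor τ n ^ α.
  have bnd : ∀ {k : Cn m → ℝ}, IsKernel k → ∀ i, (∀ x, |pd i k x| ≤ K₂) → ∀ n, ∀ x ∈ s,
      |mol (pd i k) f' (τ n) x| ≤ 2 * A * L * τ n ^ α := by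
    intro k hk i hki n x hx
    obtain ⟨c, hc⟩ := hosc x hx (τ n) (hτ0 n) (hτt n)
    have := abs_mol_sub_le (hk.pd i) (hτ0 n) hfi (fun x => (hki x).trans hK2) x hc
    rw [integral_pd_eq_zero hk.contDiff hk.hasCompactSupport, mul_zero, sub_zero] at this
    refine this.trans (le_of_eq ?_)
    rw [hL]; ring
  have B0 : ∀ k, ∀ x ∈ s, |F (k + 1) x - F k x| ≤ τ k ^ 2 * (L * B) := by
    intro k x hx
    rw [d0 k x hx, abs_mul, abs_neg, abs_of_nonneg (sq_nonneg _)]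
    gcongr
    refine (abs_mol_le hΦ (hτ0 k) (fun x => (b0 x).trans hK2) x
      (hfB'.mono fun y hy _ => hy)).trans (le_of_eq ?_)
    rw [hL]; ring
  have B1 : ∀ i k, ∀ x ∈ s, |pd i (F (k + 1)) x - pd i (F k) x| ≤
      τ k * (2 * A * L * τ k ^ α) := by
    intro i k x hx
    have e : -τ k ^ 2 * (τ k)⁻¹ = - τ k := by have := (hτ0 k).ne'; field_simp
    rw [d1 i k x hx, e, abs_mul, abs_neg, abs_of_pos (hτ0 k)]
    exact mul_le_mul_of_nonneg_left (bnd hΦ i (b1 i) k x hx) (hτ0 k).le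
  have B2 : ∀ i j k, ∀ x ∈ s, |pd j (pd i (F (k + 1))) x - pd j (pd i (F k)) x| ≤
      2 * A * L * τ k ^ α := by
    intro i j k x hx
    have e : -τ k ^ 2 * (τ k)⁻¹ * (τ k)⁻¹ = - 1 := by have := (hτ0 k).ne'; field_simp
    rw [d2 i j k x hx, e, abs_mul, abs_neg, abs_one, one_mul]
    exact bnd (hΦ.pd i) j (b2 i j) k x hx
  have B3 : ∀ i j l k, ∀ x ∈ s,
      |pd l (pd j (pd i (F (k + 1)))) x - pd l (pd j (pd i (F k))) x| ≤
      2 * A * L * τ k ^ (α - 1) := by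
    intro i j l k x hx
    have e : -τ k ^ 2 * (τ k)⁻¹ * (τ k)⁻¹ * (τ k)⁻¹ = - (τ k)⁻¹ := by
      have := (hτ0 k).ne'; field_simp
    rw [d3 i j l k x hx, e, abs_mul, abs_neg, abs_of_pos (inv_pos.2 (hτ0 k))]
    have h3 := bnd ((hΦ.pd i).pd j) l (b3 i j l) k x hx
    have e3 : τ k ^ (α - 1) = (τ k)⁻¹ * τ k ^ α := by
      rw [Real.rpow_sub_one (hτ0 k).ne']; ring
    rw [e3]
    calc _ ≤ (τ k)⁻¹ * (2 * A * L * τ k ^ α) :=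
          mul_le_mul_of_nonneg_left h3 (inv_pos.2 (hτ0 k)).le
      _ = _ := by ring
  set a : ℕ → ℝ := fun k => (t ^ 2 * (L * B) + (t + 1) * (2 * A * L * t ^ α)) * q ^ k with ha
  have hsa : Summable a := (summable_geometric_of_lt_one hq0.le hq1).mul_left _
  have hq4 : ∀ k, τ k ^ 2 ≤ t ^ 2 * q ^ k := by
    intro k
    have e : τ k ^ 2 = t ^ 2 * (1 / 4) ^ k := by
      simp only [hτ, div_pow, ← pow_mul, mul_comm k 2]
      rw [pow_mul]; norm_num; field_simp
    rw [e]
    gcongr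
  have hA1 : 0 ≤ 2 * A * L * t ^ α := by positivity
  obtain ⟨v, hv, hvl⟩ := exists_contDiffOn_two_limit hso hFc hsa
    (fun k x hx => by
      refine (B0 k x hx).trans ?_
      have h5 := mul_le_mul_of_nonneg_right (hq4 k) (mul_nonneg hL0 hB0)
      have h6 : 0 ≤ (t + 1) * (2 * A * L * t ^ α) * q ^ k := by positivity
      simp only [ha]; linarith)
    (fun i k x hx => by
      refine (B1 i k x hx).trans ?_
      rw [hτα]
      have h5 : τ k * (2 * A * L * (t ^ α * q ^ k)) ≤ t * (2 * A * L * (t ^ α * q ^ k)) :=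
        mul_le_mul_of_nonneg_right (hτt k) (by positivity)
      have h6 : 0 ≤ t ^ 2 * (L * B) * q ^ k := by positivity
      have h7 : 0 ≤ (2 * A * L * t ^ α) * q ^ k := by positivity
      simp only [ha]; linarith)
    (fun i j k x hx => by
      refine (B2 i j k x hx).trans ?_
      rw [hτα]
      have h6 : 0 ≤ t ^ 2 * (L * B) * q ^ k := by positivity
      have h7 : 0 ≤ t * (2 * A * L * t ^ α) * q ^ k := by positivity
      simp only [ha]; linarith)
  have hsumα : ∀ n, ∑ k ∈ Finset.range n, τ k ^ α ≤ S * t ^ α := by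
    intro n
    simp only [hτα]
    rw [← Finset.mul_sum, mul_comm S]
    gcongr
    rw [hS, ← tsum_geometric_of_lt_one hq0.le hq1]
    exact (summable_geometric_of_lt_one hq0.le hq1).sum_le_tsum _ fun _ _ => by positivity
  have hbase : ∀ {k : Cn m → ℝ}, IsKernel k → (∀ x, |k x| ≤ K₁) → ∀ x, |mol k u' t x| ≤ L * M := by
    intro k hk hkb x
    refine (abs_mol_le hk ht (fun x => (hkb x).trans hK1) x
      (hub'.mono fun y hy _ => hy)).trans (le_of_eq ?_)
    rw [hL]; ring
  have hF0 : F 0 = mol η u' t := by simp [hF, hτ]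
  have hp1 : ∀ i, pd i (F 0) = fun x => t⁻¹ * mol (pd i η) u' t x := fun i => by
    rw [hF0]; exact pd_mol hη ht hui i
  have hp2 : ∀ i j, pd j (pd i (F 0)) = fun x => t⁻¹ ^ 2 * mol (pd j (pd i η)) u' t x := by
    intro i j
    funext x
    rw [hp1, pd_const_mul ((contDiff_mol (hη.pd i) ht hui).differentiable (by simp) x),
      pd_mol (hη.pd i) ht hui]
    ring
  have hp3 : ∀ i j l, pd l (pd j (pd i (F 0))) =
      fun x => t⁻¹ ^ 3 * mol (pd l (pd j (pd i η))) u' t x := by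
    intro i j l
    funext x
    rw [hp2, pd_const_mul ((contDiff_mol ((hη.pd i).pd j) ht hui).differentiable (by simp) x),
      pd_mol ((hη.pd i).pd j) ht hui]
    ring
  have htp : t ^ (2 + α) = t ^ 2 * t ^ α := by
    rw [Real.rpow_add ht]; norm_num
  set Q := M + A * t ^ (2 + α) with hQ
  have hQ0 : 0 ≤ Q := by positivity
  have hm1 : (1 : ℝ) ≤ m + 1 := by have : (0 : ℝ) ≤ m := m.cast_nonneg; linarith
  have hfin : L * M + 2 * A * L * S * (t ^ 2 * t ^ α) ≤ 8 * (m + 1) * L * (1 + S + Cα) * Q := by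
    have e1 : L * M ≤ L * Q := by gcongr; rw [hQ]; have := mul_nonneg hA (Real.rpow_nonneg ht.le (2 + α)); linarith
    have e2 : 2 * A * L * S * (t ^ 2 * t ^ α) ≤ 2 * S * L * Q := by
      rw [← htp]
      calc 2 * A * L * S * t ^ (2 + α) = 2 * S * L * (A * t ^ (2 + α)) := by ring
        _ ≤ _ := by gcongr; rw [hQ]; linarith
    have e3 : 8 * 1 * L * (1 + S + 0) * Q ≤ 8 * (m + 1) * L * (1 + S + Cα) * Q := by gcongr
    have : 0 ≤ L * Q := by positivity
    have : 0 ≤ S * L * Q := by positivity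
    nlinarith
  refine ⟨v, hv, ?_, ?_, ?_, ?_, ?_⟩
  · filter_upwards [ae_tendsto_mol hη hη1 hui hτ0 htend] with x hx hxs
    have e : u' x = u x := indicator_of_mem (hsub x hxs t le_rfl (mem_closedBall_self ht.le)) _
    rw [← e]
    exact tendsto_nhds_unique (hvl x hxs).1 hx
  · intro x hx hxG
    have hl1 : Tendsto (fun n => lap (F n) x) atTop (𝓝 (lap v x)) :=
      tendsto_finsetSum _ fun i _ => (hvl x hx).2.2 i i
    -- Mollification commutes with the equation. At a point of G the mollified right-hand side
    -- converges to the value f x itself, by the Hölder condition and not merely almost everywhere.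
    have hl2 : Tendsto (fun n => lap (F n) x) atTop (𝓝 (f x)) := by
      have e : ∀ n, lap (F n) x = mol η f' (τ n) x := by
        intro n
        have hc := contDiff_sc hη.contDiff (τ n)
        have hcs := hη.hasCompactSupport_sc (hτ0 n)
        have e1 := hw'.cv_eq hc (fun y => sc_eq_zero hη.eq_zero (hτ0 n) y) (hsub x hx _ (hτt n))
        rw [mol, ← e1]
        exact lap_const_mul_cv hc hcs hui _ x
      simp only [e]
      rw [tendsto_iff_norm_sub_tendsto_zero]
      have hz : Tendsto (fun n => K * (2 * A * τ n ^ α) * omega m) atTop (𝓝 0) := by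
        have h6 := (htend.rpow_const (p := α) (Or.inr h0.le)).const_mul (2 * A)
        rw [Real.zero_rpow h0.ne', mul_zero] at h6
        simpa using (h6.const_mul K).mul_const (omega m)
      refine squeeze_zero (fun _ => norm_nonneg _) (fun n => ?_) hz
      have := abs_mol_sub_le hη (hτ0 n) hfi (fun x => (a0 x).trans hK1) x
        (hosc' x hx (τ n) (hτ0 n) (hτt n) x hxG (mem_closedBall_self (hτ0 n).le))
      rwa [hη1, mul_one] at this
    exact tendsto_nhds_unique hl1 hl2
  · intro x hx i
    have hb : |pd i v x| ≤ t⁻¹ * (L * M) + t * (2 * A * L * (S * t ^ α)) := by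
      refine le_of_tendsto ((hvl x hx).2.1 i).abs (Eventually.of_forall fun n => ?_)
      refine (abs_le_add_sum (F := fun n => pd i (F n) x) (fun k => B1 i k x hx) n).trans ?_
      refine add_le_add ?_ ?_
      · simp only [hp1]
        rw [abs_mul, abs_of_pos (inv_pos.2 ht)]
        exact mul_le_mul_of_nonneg_left (hbase (hη.pd i) (a1 i) x) (inv_pos.2 ht).le
      · calc _ ≤ ∑ k ∈ Finset.range n, t * (2 * A * L * τ k ^ α) := by
              refine Finset.sum_le_sum fun k _ => ?_
              have := hτ0 k
              exact mul_le_mul_of_nonneg_right (hτt k) (by positivity)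
          _ = t * (2 * A * L * ∑ k ∈ Finset.range n, τ k ^ α) := by simp only [Finset.mul_sum]
          _ ≤ _ := by gcongr; exact hsumα n
    refine (mul_le_mul_of_nonneg_right hb ht.le).trans (le_trans (le_of_eq ?_) hfin)
    field_simp
  · intro x hx i j
    have hb : |pd j (pd i v) x| ≤ t⁻¹ ^ 2 * (L * M) + 2 * A * L * (S * t ^ α) := by
      refine le_of_tendsto ((hvl x hx).2.2 i j).abs (Eventually.of_forall fun n => ?_)
      refine (abs_le_add_sum (F := fun n => pd j (pd i (F n)) x)
        (fun k => B2 i j k x hx) n).trans ?_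
      refine add_le_add ?_ ?_
      · simp only [hp2]
        rw [abs_mul, abs_of_nonneg (by positivity : 0 ≤ t⁻¹ ^ 2)]
        exact mul_le_mul_of_nonneg_left (hbase ((hη.pd i).pd j) (a2 i j) x) (by positivity)
      · rw [← Finset.mul_sum]
        gcongr; exact hsumα n
    refine (mul_le_mul_of_nonneg_right hb (sq_nonneg t)).trans (le_trans (le_of_eq ?_) hfin)
    field_simp
  · intro x hx y hy i j
    rcases eq_or_ne x y with rfl | hxy
    · simp only [sub_self, abs_zero, zero_mul, norm_zero]
      have := Real.rpow_nonneg (le_refl (0 : ℝ)) α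
      positivity
    set ρ := ‖x - y‖ with hρ
    have hρ0 : 0 < ρ := norm_pos_iff.2 (sub_ne_zero.2 hxy)
    have hρt : ρ ≤ 4 * t := by
      rw [hρ, ← dist_eq_norm]
      have := dist_triangle_right x y x₀
      have := mem_ball.1 hx
      have := mem_ball.1 hy
      linarith
    have hcv : Convex ℝ s := convex_ball _ _
    have hb : |pd j (pd i v) x - pd j (pd i v) y| ≤
        2 * (m + 1) * (t⁻¹ ^ 3 * (L * M)) * ρ + 4 * (m + 1) * A * L * (Cα * ρ ^ α) := by
      refine le_of_tendsto (((hvl x hx).2.2 i j).sub ((hvl y hy).2.2 i j)).abs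
        (Eventually.of_forall fun n => ?_)
      -- An increment at scale τ is bounded by τ^α through its size at both points, and by ρ τ^(α-1)
      -- through its gradient, that is, through third derivatives. The dyadic sum of the minimum is
      -- O(ρ^α).
      refine (abs_le_add_sum (F := fun n => pd j (pd i (F n)) x - pd j (pd i (F n)) y)
        (b := fun k => 4 * (m + 1) * A * L * min (τ k ^ α) (ρ * τ k ^ (α - 1))) (fun k => ?_)
        n).trans ?_
      · have e : pd j (pd i (F (k + 1))) x - pd j (pd i (F (k + 1))) y -
            (pd j (pd i (F k)) x - pd j (pd i (F k)) y) =
            (pd j (pd i (F (k + 1))) x - pd j (pd i (F k)) x) -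
            (pd j (pd i (F (k + 1))) y - pd j (pd i (F k)) y) := by ring
        rw [e, mul_min_of_nonneg _ _ (by positivity), le_min_iff]
        constructor
        · refine (abs_sub _ _).trans ?_
          have h5 := B2 i j k x hx
          have h6 := B2 i j k y hy
          have h7 : 0 ≤ A * L * τ k ^ α := by have := hτ0 k; positivity
          nlinarith
        · have hdd : ∀ k, Differentiable ℝ (pd j (pd i (F k))) := fun k =>
            (contDiff_pd (contDiff_pd (hFc k) i) j).differentiable (by simp)
          have h5 := abs_sub_le_of_pd_le hcv
            (f := fun z => pd j (pd i (F (k + 1))) z - pd j (pd i (F k)) z)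
            (fun z _ => (hdd _ z).fun_sub (hdd _ z))
            (fun l z hz => by
              rw [pd_sub (hdd _ z) (hdd _ z)]; exact B3 i j l k z hz) hx hy
          refine h5.trans (le_of_eq ?_)
          rw [← hρ]
          ring
      · refine add_le_add ?_ ?_
        · refine abs_sub_le_of_pd_le hcv (fun z _ => (contDiff_pd (contDiff_pd (hFc 0) i)
            j).differentiable (by simp) z) (fun l z _ => ?_) hx hy
          rw [hp3, abs_mul, abs_of_nonneg (by positivity : 0 ≤ t⁻¹ ^ 3)]
          exact mul_le_mul_of_nonneg_left (hbase (((hη.pd i).pd j).pd l) (a3 i j l) z)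
            (by positivity)
        · rw [← Finset.mul_sum]
          gcongr
          exact hsum n t ρ ht hρ0
    -- Since ρ ≤ 4 t, the Lipschitz bound for the coarsest mollification is also a Hölder bound.
    have hρα : t⁻¹ ^ 3 * ρ * t ^ (2 + α) ≤ 4 * ρ ^ α := by
      have e1 : ρ = ρ ^ α * ρ ^ (1 - α) := by rw [← Real.rpow_add hρ0]; simp
      have e2 : ρ ^ (1 - α) ≤ 4 * t ^ (1 - α) := by
        calc ρ ^ (1 - α) ≤ (4 * t) ^ (1 - α) := by
              apply Real.rpow_le_rpow hρ0.le hρt; linarith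
          _ = 4 ^ (1 - α) * t ^ (1 - α) := Real.mul_rpow (by norm_num) ht.le
          _ ≤ 4 * t ^ (1 - α) := by
              gcongr
              conv_rhs => rw [← Real.rpow_one 4]
              exact Real.rpow_le_rpow_of_exponent_le (by norm_num) (by linarith)
      have e3 : t ^ (1 - α) * t ^ (2 + α) = t ^ 3 := by
        rw [← Real.rpow_add ht, ← Real.rpow_natCast]; congr 1; norm_num
      calc t⁻¹ ^ 3 * ρ * t ^ (2 + α) = t⁻¹ ^ 3 * (ρ ^ α * ρ ^ (1 - α)) * t ^ (2 + α) := by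
            rw [← e1]
        _ ≤ t⁻¹ ^ 3 * (ρ ^ α * (4 * t ^ (1 - α))) * t ^ (2 + α) := by gcongr
        _ = 4 * ρ ^ α * (t⁻¹ ^ 3 * (t ^ (1 - α) * t ^ (2 + α))) := by ring
        _ = _ := by rw [e3]; field_simp
    have hρ' : 0 < ρ ^ α := by positivity
    have hT : 0 < t ^ (2 + α) := by positivity
    calc _ ≤ (2 * (m + 1) * (t⁻¹ ^ 3 * (L * M)) * ρ + 4 * (m + 1) * A * L * (Cα * ρ ^ α)) *
          t ^ (2 + α) := by gcongr
      _ = 2 * (m + 1) * (L * M) * (t⁻¹ ^ 3 * ρ * t ^ (2 + α)) +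
          4 * (m + 1) * L * Cα * (A * t ^ (2 + α)) * ρ ^ α := by ring
      _ ≤ 2 * (m + 1) * (L * M) * (4 * ρ ^ α) +
          4 * (m + 1) * L * Cα * (A * t ^ (2 + α)) * ρ ^ α := by gcongr
      _ ≤ 2 * (m + 1) * (L * Q) * (4 * ρ ^ α) +
          4 * (m + 1) * L * Cα * Q * ρ ^ α := by
          have hMQ : M ≤ Q := by
            rw [hQ]; have := mul_nonneg hA hT.le; linarith
          have hAQ : A * t ^ (2 + α) ≤ Q := by rw [hQ]; linarith
          gcongr
      _ ≤ _ := by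
          have h5 : 0 ≤ (m + 1) * L * Q * ρ ^ α * Cα := by positivity
          have h6 : 0 ≤ (m + 1) * L * Q * ρ ^ α * S := by positivity
          nlinarith

/-! ### Classical and distributional solutions -/

lemma integrable_mul_of_tsupport {Ω : Set (Cn m)} {g φ : Cn m → ℝ} (hg : ContinuousOn g Ω)
    (hφ : Continuous φ) (hc : HasCompactSupport φ) (hs : tsupport φ ⊆ Ω) :
    Integrable fun x => g x * φ x := by
  have h1 : IntegrableOn (fun x => g x * φ x) (tsupport φ) :=
    ((hg.mono hs).mul hφ.continuousOn).integrableOn_compact hc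
  refine (integrableOn_iff_integrable_of_support_subset fun x hx => ?_).1 h1
  exact subset_tsupport φ (right_ne_zero_of_mul hx)

/-- Two integrations by parts. Differentiability of v matters only on the support of the test
function. -/
lemma weakOn_of_contDiffOn {Ω : Set (Cn m)} (hΩ : IsOpen Ω) {v f : Cn m → ℝ}
    (hv : ContDiffOn ℝ 2 v Ω) (hf : ∀ x ∈ Ω, lap v x = f x) : WeakOn Ω v f := by
  intro φ hφ hc hs
  have hv1 : ∀ i, ContDiffOn ℝ 1 (pd i v) Ω := fun i => contDiffOn_pd hΩ
    (hv.of_le (by norm_num [← one_add_one_eq_two])) i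
  have hv2 : ∀ i j, ContinuousOn (pd j (pd i v)) Ω := fun i j =>
    contDiffOn_zero.1 (contDiffOn_pd hΩ ((hv1 i).of_le (by simp)) j)
  have hs1 : ∀ i, tsupport (pd i φ) ⊆ Ω := fun i => (tsupport_pd_subset φ i).trans hs
  have hs2 : ∀ i j, tsupport (pd j (pd i φ)) ⊆ Ω := fun i j =>
    (tsupport_pd_subset _ j).trans (hs1 i)
  have hc1 : ∀ i, HasCompactSupport (pd i φ) := fun i => hasCompactSupport_pd hc i
  have hc2 : ∀ i j, HasCompactSupport (pd j (pd i φ)) := fun i j => hasCompactSupport_pd (hc1 i) j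
  have hφ1 : ∀ i, ContDiff ℝ ∞ (pd i φ) := fun i => contDiff_pd hφ i
  have hφ2 : ∀ i j, ContDiff ℝ ∞ (pd j (pd i φ)) := fun i j => contDiff_pd (hφ1 i) j
  have I1 : ∀ i, ∫ x, v x * pd i (pd i φ) x = - ∫ x, pd i v x * pd i φ x := fun i =>
    integral_bilinear_fderiv_right_eq_neg_left_of_integrable (μ := volume) (f := v)
      (g := pd i φ) (v := dir i) (B := ContinuousLinearMap.mul ℝ ℝ)
      (integrable_mul_of_tsupport (hv1 i).continuousOn (hφ1 i).continuous (hc1 i) (hs1 i))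
      (integrable_mul_of_tsupport hv.continuousOn (hφ2 i i).continuous (hc2 i i) (hs2 i i))
      (integrable_mul_of_tsupport hv.continuousOn (hφ1 i).continuous (hc1 i) (hs1 i))
      (fun x hx => (hv.differentiableOn (by simp)).differentiableAt (hΩ.mem_nhds (hs1 i hx)))
      (fun x _ => (hφ1 i).differentiable (by simp) x)
  have I2 : ∀ i, ∫ x, pd i v x * pd i φ x = - ∫ x, pd i (pd i v) x * φ x := fun i =>
    integral_bilinear_fderiv_right_eq_neg_left_of_integrable (μ := volume) (f := pd i v)
      (g := φ) (v := dir i) (B := ContinuousLinearMap.mul ℝ ℝ)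
      (integrable_mul_of_tsupport (hv2 i i) hφ.continuous hc hs)
      (integrable_mul_of_tsupport (hv1 i).continuousOn (hφ1 i).continuous (hc1 i) (hs1 i))
      (integrable_mul_of_tsupport (hv1 i).continuousOn hφ.continuous hc hs)
      (fun x hx => ((hv1 i).differentiableOn (by simp)).differentiableAt (hΩ.mem_nhds (hs hx)))
      (fun x _ => hφ.differentiable (by simp) x)
  have e : ∀ x, f x * φ x = lap v x * φ x := fun x => by
    by_cases hx : x ∈ Ω
    · rw [hf x hx]
    · rw [image_eq_zero_of_notMem_tsupport fun h' => hx (hs h'), mul_zero, mul_zero]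
  simp only [e]
  simp only [lap, Finset.mul_sum, Finset.sum_mul]
  rw [integral_finsetSum _ fun i _ => integrable_mul_of_tsupport hv.continuousOn
      (hφ2 i i).continuous (hc2 i i) (hs2 i i),
    integral_finsetSum _ fun i _ => integrable_mul_of_tsupport (hv2 i i) hφ.continuous hc hs]
  exact Finset.sum_congr rfl fun i _ => by rw [I1, I2, neg_neg]

/-! ### Removing the axis -/

/-- The real-valued logarithmic cutoff, as a function of the square of the distance to the axis. -/
def logCut (L s : ℝ) : ℝ := if s ≤ 0 then 0 else Real.smoothTransition (2 + Real.log s / L)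

lemma logCut_eq_zero {L s : ℝ} (hL : 0 < L) (hs : s ≤ Real.exp (-(2 * L))) : logCut L s = 0 := by
  unfold logCut
  split_ifs with h
  · rfl
  · refine Real.smoothTransition.zero_of_nonpos ?_
    have : Real.log s ≤ -(2 * L) := by
      rw [← Real.log_exp (-(2 * L))]; exact Real.log_le_log (by linarith) hs
    have : Real.log s / L ≤ -2 := by rw [div_le_iff₀ hL]; linarith
    linarith

lemma logCut_eq_one {L s : ℝ} (hL : 0 < L) (hs : Real.exp (-L) ≤ s) : logCut L s = 1 := by
  have h0 : 0 < s := (Real.exp_pos _).trans_le hs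
  rw [logCut, if_neg (not_le.2 h0)]
  refine Real.smoothTransition.one_of_one_le ?_
  have : -L ≤ Real.log s := by
    rw [← Real.log_exp (-L)]; exact Real.log_le_log (Real.exp_pos _) hs
  have : -1 ≤ Real.log s / L := by rw [le_div_iff₀ hL]; linarith
  linarith

lemma logCut_nonneg (L s : ℝ) : 0 ≤ logCut L s := by
  unfold logCut; split_ifs
  · exact le_rfl
  · exact Real.smoothTransition.nonneg _

lemma logCut_le_one (L s : ℝ) : logCut L s ≤ 1 := by
  unfold logCut; split_ifs
  · exact zero_le_one
  · exact Real.smoothTransition.le_one _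

lemma contDiff_logCut {L : ℝ} (hL : 0 < L) : ContDiff ℝ ∞ (logCut L) := by
  rw [contDiff_iff_contDiffAt]
  intro s
  rcases le_or_gt s 0 with hs | hs
  · refine (contDiffAt_const (c := (0 : ℝ))).congr_of_eventuallyEq ?_
    filter_upwards [Iio_mem_nhds (hs.trans_lt (Real.exp_pos (-(2 * L))))] with y hy
    exact logCut_eq_zero hL (le_of_lt hy)
  · have e : logCut L =ᶠ[𝓝 s] fun s => Real.smoothTransition (2 + Real.log s / L) := by
      filter_upwards [Ioi_mem_nhds hs] with y hy
      rw [logCut, if_neg (not_le.2 hy)]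
    refine ContDiffAt.congr_of_eventuallyEq ?_ e
    exact Real.smoothTransition.contDiff.contDiffAt.comp s
      (contDiffAt_const.add ((Real.contDiffAt_log.2 hs.ne').div_const _))

/-- The derivatives of the cutoff. -/
lemma exists_logCut_bound : ∃ C : ℝ, 0 ≤ C ∧ ∀ L s : ℝ, 0 < L → 0 < s →
    |s * deriv (logCut L) s| ≤ C / L ∧
    |4 * s * deriv (logCut L) s + 4 * s * (s * deriv (deriv (logCut L)) s)| ≤ C / L ^ 2 := by
  set T : ℝ → ℝ := Real.smoothTransition with hT
  have hTc : ContDiff ℝ ∞ T := Real.smoothTransition.contDiff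
  have hT' : ContDiff ℝ ∞ (deriv T) := (contDiff_infty_iff_deriv.1 hTc).2
  have hT'' : ContDiff ℝ ∞ (deriv (deriv T)) := (contDiff_infty_iff_deriv.1 hT').2
  have hz : ∀ x, x ∉ Icc (0 : ℝ) 1 → deriv T x = 0 := by
    intro x hx
    rw [mem_Icc, not_and_or, not_le, not_le] at hx
    rcases hx with hx | hx
    · have e : T =ᶠ[𝓝 x] fun _ => 0 := by
        filter_upwards [Iio_mem_nhds hx] with y hy
        exact Real.smoothTransition.zero_of_nonpos (le_of_lt hy)
      rw [e.deriv_eq]; simp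
    · have e : T =ᶠ[𝓝 x] fun _ => 1 := by
        filter_upwards [Ioi_mem_nhds hx] with y hy
        exact Real.smoothTransition.one_of_one_le (le_of_lt hy)
      rw [e.deriv_eq]; simp
  have hcs : HasCompactSupport (deriv T) := HasCompactSupport.intro isCompact_Icc hz
  obtain ⟨C1, hC1⟩ := hT'.continuous.bounded_above_of_compact_support hcs
  obtain ⟨C2, hC2⟩ := hT''.continuous.bounded_above_of_compact_support hcs.deriv
  have hC10 : 0 ≤ C1 := (norm_nonneg _).trans (hC1 0)
  have hC20 : 0 ≤ C2 := (norm_nonneg _).trans (hC2 0)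
  refine ⟨C1 + 4 * C2, by positivity, fun L s hL hs => ?_⟩
  have d1 : ∀ y, 0 < y → HasDerivAt (logCut L) (deriv T (2 + Real.log y / L) * (y⁻¹ / L)) y := by
    intro y hy
    have e : logCut L =ᶠ[𝓝 y] fun s => T (2 + Real.log s / L) := by
      filter_upwards [Ioi_mem_nhds hy] with z hz
      rw [logCut, if_neg (not_le.2 hz)]
    refine HasDerivAt.congr_of_eventuallyEq ?_ e
    exact ((hTc.differentiable (by simp) _).hasDerivAt).comp y
      (((Real.hasDerivAt_log hy.ne').div_const L).const_add 2)
  have d2 : HasDerivAt (deriv (logCut L)) (deriv (deriv T) (2 + Real.log s / L) * (s⁻¹ / L) *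
      (s⁻¹ / L) + deriv T (2 + Real.log s / L) * (-(s ^ 2)⁻¹ / L)) s := by
    have e : deriv (logCut L) =ᶠ[𝓝 s] fun y => deriv T (2 + Real.log y / L) * (y⁻¹ / L) := by
      filter_upwards [Ioi_mem_nhds hs] with z hz using (d1 z hz).deriv
    refine HasDerivAt.congr_of_eventuallyEq ?_ e
    exact (((hT'.differentiable (by simp) _).hasDerivAt).comp s
      (((Real.hasDerivAt_log hs.ne').div_const L).const_add 2)).mul
      ((hasDerivAt_inv hs.ne').div_const L)
  rw [(d1 s hs).deriv, d2.deriv]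
  constructor
  · have e : s * (deriv T (2 + Real.log s / L) * (s⁻¹ / L)) =
        deriv T (2 + Real.log s / L) / L := by field_simp
    rw [e, abs_div, abs_of_pos hL]
    have := hC1 (2 + Real.log s / L)
    rw [Real.norm_eq_abs] at this
    gcongr
    linarith
  -- The logarithm of the distance to the axis is harmonic, so the terms in T' cancel and only T'' /
  -- L² survives. This extra factor 1/L is the gain of a logarithmic cutoff.
  · have e : 4 * s * (deriv T (2 + Real.log s / L) * (s⁻¹ / L)) +
        4 * s * (s * (deriv (deriv T) (2 + Real.log s / L) * (s⁻¹ / L) * (s⁻¹ / L) +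
          deriv T (2 + Real.log s / L) * (-(s ^ 2)⁻¹ / L))) =
        4 * deriv (deriv T) (2 + Real.log s / L) / L ^ 2 := by field_simp; ring
    rw [e, abs_div, abs_of_pos (by positivity : 0 < L ^ 2), abs_mul, abs_of_pos (by norm_num)]
    have := hC2 (2 + Real.log s / L)
    rw [Real.norm_eq_abs] at this
    gcongr
    linarith

/-- The integral of `|ξ|⁻²` over an annulus. -/
lemma integral_annulus {L : ℝ} (hL : 0 < L) :
    IntegrableOn (fun ξ : ℂ => ‖ξ‖⁻¹ ^ 2) {ξ | ‖ξ‖ ∈ Icc (Real.exp (-L)) (Real.exp (-L / 2))} ∧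
    ∫ ξ in {ξ : ℂ | ‖ξ‖ ∈ Icc (Real.exp (-L)) (Real.exp (-L / 2))}, ‖ξ‖⁻¹ ^ 2 =
      (volume.real (ball (0 : ℂ) 1)) * L := by
  have hms : MeasurableSet {ξ : ℂ | ‖ξ‖ ∈ Icc (Real.exp (-L)) (Real.exp (-L / 2))} :=
    measurable_norm measurableSet_Icc
  constructor
  · have hcomp : IsCompact {ξ : ℂ | ‖ξ‖ ∈ Icc (Real.exp (-L)) (Real.exp (-L / 2))} := by
      refine (isCompact_closedBall (0 : ℂ) (Real.exp (-L / 2))).of_isClosed_subset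
        (isClosed_Icc.preimage continuous_norm) fun ξ hξ => ?_
      simpa using hξ.2
    have hcont : ContinuousOn (fun ξ : ℂ => ‖ξ‖⁻¹ ^ 2)
        {ξ : ℂ | ‖ξ‖ ∈ Icc (Real.exp (-L)) (Real.exp (-L / 2))} :=
      (continuous_norm.continuousOn.inv₀ fun ξ hξ => ((Real.exp_pos _).trans_le hξ.1).ne').pow 2
    exact hcont.integrableOn_compact hcomp
  · have h := integral_fun_norm_addHaar (volume : Measure ℂ)
      ((Icc (Real.exp (-L)) (Real.exp (-L / 2))).indicator fun y : ℝ => y⁻¹ ^ 2)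
    rw [← integral_indicator hms]
    have e1 : ({ξ : ℂ | ‖ξ‖ ∈ Icc (Real.exp (-L)) (Real.exp (-L / 2))}.indicator
        fun ξ => ‖ξ‖⁻¹ ^ 2) = fun ξ => (Icc (Real.exp (-L)) (Real.exp (-L / 2))).indicator
        (fun y : ℝ => y⁻¹ ^ 2) ‖ξ‖ := by
      funext ξ; simp [indicator_apply]
    rw [e1, h, Complex.finrank_real_complex]
    have e2 : ∫ y in Ioi (0 : ℝ), y ^ (2 - 1) • (Icc (Real.exp (-L)) (Real.exp (-L / 2))).indicator
        (fun y : ℝ => y⁻¹ ^ 2) y = L / 2 := by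
      have e3 : ∀ y, y ^ (2 - 1) • (Icc (Real.exp (-L)) (Real.exp (-L / 2))).indicator
          (fun y : ℝ => y⁻¹ ^ 2) y =
          (Icc (Real.exp (-L)) (Real.exp (-L / 2))).indicator (fun y : ℝ => y⁻¹) y := by
        intro y
        by_cases hy : y ∈ Icc (Real.exp (-L)) (Real.exp (-L / 2))
        · have : y ≠ 0 := ((Real.exp_pos _).trans_le hy.1).ne'
          simp only [indicator_of_mem hy]
          simp; field_simp
        · simp [indicator_of_notMem hy]
      have hle : Real.exp (-L) ≤ Real.exp (-L / 2) := Real.exp_le_exp.2 (by linarith)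
      simp only [e3]
      have hint : Ioi (0 : ℝ) ∩ Icc (Real.exp (-L)) (Real.exp (-L / 2)) =
          Icc (Real.exp (-L)) (Real.exp (-L / 2)) :=
        inter_eq_right.2 fun y hy => (Real.exp_pos _).trans_le hy.1
      rw [setIntegral_indicator measurableSet_Icc, hint, integral_Icc_eq_integral_Ioc,
        ← intervalIntegral.integral_of_le hle,
        integral_inv_of_pos (Real.exp_pos _) (Real.exp_pos _), ← Real.exp_sub, Real.log_exp]
      ring
    rw [e2]
    simp
    ring

/-- The square of the distance to the axis. -/
def axSq (x : Cn m) : ℝ := co (.inl 0) x ^ 2 + co (.inl 1) x ^ 2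

lemma axSq_eq (x : Cn m) : axSq x = ‖x.1‖ ^ 2 := by
  rw [axSq, co_inl_zero, co_inl_one, Complex.sq_norm, Complex.normSq_apply]; ring

lemma hasFDerivAt_axSq (x : Cn m) : HasFDerivAt (axSq (m := m))
    ((2 * co (.inl 0) x) • co (.inl 0) + (2 * co (.inl 1) x) • co (.inl 1)) x := by
  have h : ∀ i : Idx m, HasFDerivAt (fun x => co i x ^ 2) ((2 * co i x) • co i) x := fun i => by
    simpa using ((co i).hasFDerivAt (x := x)).pow 2
  exact (h (.inl 0)).fun_add (h (.inl 1))

lemma contDiff_axSq {n : WithTop ℕ∞} : ContDiff ℝ n (axSq (m := m)) :=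
  ((co _).contDiff.pow 2).add ((co _).contDiff.pow 2)

/-- `1` for the directions normal to the axis, `0` for the tangential ones. -/
def normalCoord (i : Idx m) : ℝ := if i = .inl 0 ∨ i = .inl 1 then 1 else 0

lemma pd_comp_axSq {H : ℝ → ℝ} (hH : Differentiable ℝ H) (i : Idx m) (x : Cn m) :
    pd i (fun y => H (axSq y)) x = 2 * (normalCoord i * (co i x * deriv H (axSq x))) := by
  have := ((hH (axSq x)).hasDerivAt).comp_hasFDerivAt x (hasFDerivAt_axSq x)
  have e : fderiv ℝ (fun y : Cn m => H (axSq y)) x = _ := this.fderiv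
  rw [pd, e]
  simp only [smul_apply, add_apply, co_dir, smul_eq_mul, normalCoord]
  induction i using forall_idx <;> simp <;> ring

lemma lap_comp_axSq {H : ℝ → ℝ} (hH : ContDiff ℝ ∞ H) (x : Cn m) :
    lap (fun y => H (axSq y)) x =
      4 * deriv H (axSq x) + 4 * (axSq x * deriv (deriv H) (axSq x)) := by
  have hd : Differentiable ℝ H := hH.differentiable (by simp)
  have hd' : Differentiable ℝ (deriv H) :=
    ((contDiff_infty_iff_deriv.1 hH).2).differentiable (by simp)
  have h2 : ∀ i, pd i (pd i fun y => H (axSq y)) x = 2 * normalCoord i *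
      (2 * (normalCoord i * (co i x ^ 2 * deriv (deriv H) (axSq x))) + deriv H (axSq x)) := by
    intro i
    have e : (pd i fun y => H (axSq y)) =
        fun x => (2 * normalCoord i) * (co i x * deriv H (axSq x)) := by
      funext y; rw [pd_comp_axSq hd i y]; ring
    have d1 : DifferentiableAt ℝ (fun x : Cn m => deriv H (axSq x)) x :=
      ((hd' (axSq x)).hasDerivAt.comp_hasFDerivAt x (hasFDerivAt_axSq x)).differentiableAt
    have d0 : DifferentiableAt ℝ (fun x : Cn m => co i x) x := (co i).differentiableAt
    rw [e, pd_const_mul (d0.fun_mul d1), pd_mul d0 d1, pd_comp_axSq hd']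
    have : pd i (fun x => co i x) x = 1 := by simp [pd, (co i).fderiv, co_dir]
    rw [this]; ring
  rw [lap, sum_idx]
  simp only [h2]
  simp [normalCoord, axSq]
  ring

/-- The cutoff near the axis. -/
def axCut (L : ℝ) (x : Cn m) : ℝ := logCut L (axSq x)

lemma contDiff_axCut {L : ℝ} (hL : 0 < L) : ContDiff ℝ ∞ (axCut (m := m) L) :=
  (contDiff_logCut hL).comp contDiff_axSq

/-- The bound for the derivatives of the cutoff. -/
def annWeight (L : ℝ) (ξ : ℂ) : ℝ :=
  {ξ : ℂ | ‖ξ‖ ∈ Icc (Real.exp (-L)) (Real.exp (-L / 2))}.indicator (fun ξ => ‖ξ‖⁻¹ ^ 2) ξ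

/-- The Laplacian of H(|z₁|²) is |z₁|⁻² times the combination bounded in `exists_logCut_bound`. The
gradient is only O(1 / (L |z₁|)), but |z₁| ≤ exp (-L/2) ≤ 2/L on the annulus brings it under the
same weight. -/
lemma exists_axCut_bound (m : ℕ) : ∃ C : ℝ, 0 ≤ C ∧ ∀ (L : ℝ) (x : Cn m), 1 ≤ L →
    (∀ i, |pd i (axCut L) x| ≤ C / L ^ 2 * annWeight L x.1) ∧
    |lap (axCut L) x| ≤ C / L ^ 2 * annWeight L x.1 := by
  obtain ⟨C, hC, hb⟩ := exists_logCut_bound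
  refine ⟨4 * C, by positivity, fun L x hL => ?_⟩
  have hL0 : 0 < L := by linarith
  have hd : Differentiable ℝ (logCut L) := (contDiff_logCut hL0).differentiable (by simp)
  have hlc : lap (axCut L) x = _ := lap_comp_axSq (contDiff_logCut hL0) x
  have hpc : ∀ i, pd i (axCut L) x = _ := fun i => pd_comp_axSq hd i x
  by_cases hx : ‖x.1‖ ∈ Icc (Real.exp (-L)) (Real.exp (-L / 2))
  · have hr0 : 0 < ‖x.1‖ := (Real.exp_pos _).trans_le hx.1
    have hs0 : 0 < axSq x := by rw [axSq_eq]; positivity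
    have hw : annWeight L x.1 = ‖x.1‖⁻¹ ^ 2 := by rw [annWeight, indicator_of_mem]; exact hx
    have hrL : ‖x.1‖ ≤ 2 / L := by
      refine hx.2.trans ?_
      rw [neg_div, Real.exp_neg, le_div_iff₀ hL0, inv_mul_le_iff₀ (Real.exp_pos _)]
      have := Real.add_one_le_exp (L / 2)
      linarith
    obtain ⟨b1, b2⟩ := hb L (axSq x) hL0 hs0
    rw [hw]
    constructor
    · intro i
      have hco : |co i x * normalCoord i| ≤ ‖x.1‖ := by
        induction i using forall_idx with
        | h0 => simpa [normalCoord, co_inl_zero] using Complex.abs_re_le_norm x.1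
        | h1 => simpa [normalCoord, co_inl_one] using Complex.abs_im_le_norm x.1
        | h2 j => simp [normalCoord]
        | h3 j => simp [normalCoord]
      have e : 2 * (normalCoord i * (co i x * deriv (logCut L) (axSq x))) =
          2 * (co i x * normalCoord i) * (‖x.1‖⁻¹ ^ 2 * (axSq x * deriv (logCut L) (axSq x))) := by
        rw [axSq_eq]; field_simp
      rw [hpc, e, abs_mul, abs_mul 2, abs_mul (‖x.1‖⁻¹ ^ 2), abs_of_pos (zero_lt_two (α := ℝ)),
        abs_of_nonneg (by positivity : 0 ≤ ‖x.1‖⁻¹ ^ 2)]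
      calc _ ≤ 2 * (2 / L) * (‖x.1‖⁻¹ ^ 2 * (C / L)) := by
            gcongr; exact hco.trans hrL
        _ = _ := by field_simp; ring
    · have e : 4 * deriv (logCut L) (axSq x) + 4 * (axSq x * deriv (deriv (logCut L)) (axSq x)) =
          ‖x.1‖⁻¹ ^ 2 * (4 * axSq x * deriv (logCut L) (axSq x) +
            4 * axSq x * (axSq x * deriv (deriv (logCut L)) (axSq x))) := by
        rw [axSq_eq]; field_simp
      rw [hlc, e, abs_mul, abs_of_nonneg (by positivity : 0 ≤ ‖x.1‖⁻¹ ^ 2), mul_comm]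
      refine mul_le_mul_of_nonneg_right (b2.trans ?_) (by positivity)
      gcongr
      linarith
  · have hw : annWeight L x.1 = 0 :=
      indicator_of_notMem (show x.1 ∉ {ξ : ℂ | ‖ξ‖ ∈ Icc _ _} from hx) _
    have hconst : ∃ c : ℝ, axCut L =ᶠ[𝓝 x] fun _ => c := by
      have hcn : Continuous fun y : Cn m => ‖y.1‖ := continuous_fst.norm
      rw [mem_Icc, not_and_or, not_le, not_le] at hx
      rcases hx with hx | hx
      · refine ⟨0, ?_⟩
        filter_upwards [(isOpen_lt hcn continuous_const).mem_nhds hx] with y hy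
        refine logCut_eq_zero hL0 ?_
        rw [axSq_eq]
        calc ‖y.1‖ ^ 2 ≤ Real.exp (-L) ^ 2 := by gcongr
          _ = _ := by rw [← Real.exp_nat_mul]; congr 1; push_cast; ring
      · refine ⟨1, ?_⟩
        filter_upwards [(isOpen_lt continuous_const hcn).mem_nhds hx] with y hy
        refine logCut_eq_one hL0 ?_
        rw [axSq_eq]
        calc Real.exp (-L) = Real.exp (-L / 2) ^ 2 := by
              rw [← Real.exp_nat_mul]; congr 1; push_cast; ring
          _ ≤ _ := by gcongr
    obtain ⟨c, hc⟩ := hconst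
    rw [hw, mul_zero]
    have z : ∀ i, pd i (axCut L) x = 0 := fun i => by rw [pd_congr hc]; simp [pd]
    refine ⟨fun i => by rw [z]; simp, ?_⟩
    rw [lap_congr hc]
    have z2 : ∀ i, pd i (fun _ : Cn m => c) = fun _ => 0 := fun i => by funext y; simp [pd]
    simp only [lap, z2]
    simp [pd]

lemma isClosed_divisor : IsClosed (divisor m) := isClosed_eq continuous_fst continuous_const

lemma volume_divisor : volume (divisor m) = 0 := by
  have e : divisor m = ({0} : Set ℂ) ×ˢ univ := by ext p; simp [divisor]
  rw [e, Measure.volume_eq_prod, Measure.prod_prod]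
  simp

lemma lap_mul {f g : Cn m → ℝ} (hf : ContDiff ℝ ∞ f) (hg : ContDiff ℝ ∞ g) (x : Cn m) :
    lap (fun y => f y * g y) x = g x * lap f x +
      (f x * lap g x + ∑ i, 2 * (pd i f x * pd i g x)) := by
  have hd : ∀ {k : Cn m → ℝ}, ContDiff ℝ ∞ k → Differentiable ℝ k := fun h =>
    h.differentiable (by simp)
  have h : ∀ i, pd i (pd i fun y => f y * g y) x = g x * pd i (pd i f) x +
      (f x * pd i (pd i g) x + 2 * (pd i f x * pd i g x)) := by
    intro i
    have e : (pd i fun y => f y * g y) = fun y => f y * pd i g y + g y * pd i f y := by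
      funext y; exact pd_mul (hd hf y) (hd hg y) i
    have hf' := hd (contDiff_pd hf i)
    have hg' := hd (contDiff_pd hg i)
    rw [e, pd_add ((hd hf x).fun_mul (hg' x)) ((hd hg x).fun_mul (hf' x)), pd_mul (hd hf x) (hg' x),
      pd_mul (hd hg x) (hf' x)]
    ring
  simp only [lap, h, Finset.sum_add_distrib, Finset.mul_sum]

lemma annWeight_nonneg (L : ℝ) (ξ : ℂ) : 0 ≤ annWeight L ξ :=
  indicator_nonneg (fun _ _ => by positivity) _

/-- Distributional solutions off the axis which are bounded solve the equation across the
axis. -/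
lemma WeakOn.of_diff_divisor {Ω : Set (Cn m)} (hΩ : IsOpen Ω) {u f : Cn m → ℝ} {M B : ℝ}
    (hum : AEStronglyMeasurable u (volume.restrict Ω))
    (hfm : AEStronglyMeasurable f (volume.restrict Ω))
    (hu : ∀ᵐ x, x ∈ Ω → |u x| ≤ M) (hf : ∀ᵐ x, x ∈ Ω → |f x| ≤ B)
    (h : WeakOn (Ω \ divisor m) u f) : WeakOn Ω u f := by
  intro φ hφ hc hs
  have hz : ∀ {k : Cn m → ℝ}, tsupport k ⊆ tsupport φ → ∀ x ∉ Ω, k x = 0 := fun hk x hx =>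
    image_eq_zero_of_notMem_tsupport fun h' => hx (hs (hk h'))
  have hms : MeasurableSet Ω := hΩ.measurableSet
  obtain ⟨M', hM', hu'⟩ : ∃ M', 0 ≤ M' ∧ ∀ᵐ x, |Ω.indicator u x| ≤ M' := by
    refine ⟨max M 0, le_max_right _ _, ?_⟩
    filter_upwards [hu] with x hx
    by_cases hxb : x ∈ Ω
    · rw [indicator_of_mem hxb]; exact (hx hxb).trans (le_max_left _ _)
    · rw [indicator_of_notMem hxb]; simp
  have hf' : ∀ᵐ x, |Ω.indicator f x| ≤ max B 0 := by
    filter_upwards [hf] with x hx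
    by_cases hxb : x ∈ Ω
    · rw [indicator_of_mem hxb]; exact (hx hxb).trans (le_max_left _ _)
    · rw [indicator_of_notMem hxb]; simp
  have hum' : AEStronglyMeasurable (Ω.indicator u) volume :=
    (aestronglyMeasurable_indicator_iff hms).2 hum
  have hfm' : AEStronglyMeasurable (Ω.indicator f) volume :=
    (aestronglyMeasurable_indicator_iff hms).2 hfm
  have hie : ∀ (g k : Cn m → ℝ), tsupport k ⊆ tsupport φ →
      (fun x => g x * k x) = fun x => Ω.indicator g x * k x := fun g k hk => by
    funext x
    by_cases hx : x ∈ Ω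
    · rw [indicator_of_mem hx]
    · rw [hz hk x hx, mul_zero, mul_zero]
  rw [hie u _ (tsupport_lap_subset φ), hie f φ Subset.rfl]
  set U := Ω.indicator u with hU
  set F := Ω.indicator f with hF
  obtain ⟨C, hC, hcut⟩ := exists_axCut_bound m
  obtain ⟨K0, hK0⟩ := exists_bound_of_hasCompactSupport hφ.continuous hc
  choose K1 hK1 using fun i => exists_bound_of_hasCompactSupport (contDiff_pd hφ i).continuous
    (hasCompactSupport_pd hc i)
  obtain ⟨K2, hK2⟩ := Finite.exists_le K1
  set K := max K0 K2 with hK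
  have hKa : ∀ x, |φ x| ≤ K := fun x => (hK0 x).trans (le_max_left _ _)
  have hKb : ∀ i x, |pd i φ x| ≤ K := fun i x => ((hK1 i x).trans (hK2 i)).trans (le_max_right _ _)
  have hKn : 0 ≤ K := (abs_nonneg _).trans (hKa 0)
  obtain ⟨ρ, hρ⟩ := hc.isCompact.isBounded.subset_closedBall (0 : Cn m)
  have hmul : ∀ {g k : Cn m → ℝ} {b : ℝ}, AEStronglyMeasurable g volume → (∀ᵐ x, |g x| ≤ b) →
      ContDiff ℝ ∞ k → HasCompactSupport k → Integrable fun x => g x * k x := fun hg hb hk hkc =>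
    (hk.continuous.integrable_of_hasCompactSupport hkc).bdd_mul hg hb
  -- The product φ χ_n vanishes near the axis and is admissible. The commutator term is O(L⁻²) times
  -- a weight whose integral grows like L, where L = n + 1, so for bounded u its contribution is
  -- O(1/L) and disappears in the limit.
  let χ : ℕ → Cn m → ℝ := fun n => axCut ((n : ℝ) + 1)
  have hL0 : ∀ n : ℕ, (0 : ℝ) < (n : ℝ) + 1 := fun n => by positivity
  have hχc : ∀ n, ContDiff ℝ ∞ (χ n) := fun n => contDiff_axCut (hL0 n)
  have hχ1 : ∀ n x, |χ n x| ≤ 1 := fun n x => abs_le.2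
    ⟨(by norm_num : (-1 : ℝ) ≤ 0).trans (logCut_nonneg _ _), logCut_le_one _ _⟩
  have hχlim : ∀ᵐ x : Cn m, Tendsto (fun n => χ n x) atTop (𝓝 1) := by
    have : ∀ᵐ x : Cn m, x ∉ divisor m := by
      rw [ae_iff]; simpa using volume_divisor (m := m)
    filter_upwards [this] with x hx
    have hp : 0 < axSq x := by
      rw [axSq_eq]; exact pow_pos (norm_pos_iff.2 hx) 2
    have ht : Tendsto (fun n : ℕ => Real.exp (-((n : ℝ) + 1))) atTop (𝓝 0) :=
      Real.tendsto_exp_neg_atTop_nhds_zero.comp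
        (tendsto_atTop_add_const_right _ _ tendsto_natCast_atTop_atTop)
    refine tendsto_const_nhds.congr' ?_
    filter_upwards [ht.eventually_lt_const hp] with n hn
    exact (logCut_eq_one (hL0 n) hn.le).symm
  have heq : ∀ n, ∫ x, U x * lap (fun y => φ y * χ n y) x = ∫ x, F x * (φ x * χ n x) := by
    intro n
    have h1 : tsupport (fun y => φ y * χ n y) ⊆ tsupport φ :=
      closure_mono fun x hx => left_ne_zero_of_mul hx
    have h2 : tsupport (fun y => φ y * χ n y) ⊆ (divisor m)ᶜ := by
      have h3 : tsupport (fun y => φ y * χ n y) ⊆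
          {x | Real.exp (-(2 * ((n : ℝ) + 1))) ≤ axSq x} := by
        refine closure_minimal (fun x hx => ?_)
          (isClosed_le continuous_const (contDiff_axSq (n := 0)).continuous)
        by_contra hn
        exact right_ne_zero_of_mul hx (logCut_eq_zero (hL0 n) (le_of_lt (not_le.1 hn)))
      intro x hx hxd
      have h4 : Real.exp (-(2 * ((n : ℝ) + 1))) ≤ axSq x := h3 hx
      rw [axSq_eq, show x.1 = 0 from hxd, norm_zero] at h4
      have := Real.exp_pos (-(2 * ((n : ℝ) + 1)))
      norm_num at h4
      linarith
    have e := h _ (hφ.mul (hχc n)) (hc.mul_right) fun x hx => ⟨hs (h1 hx), h2 hx⟩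
    rwa [hie u _ ((tsupport_lap_subset _).trans h1), hie f _ h1] at e
  have lim1 : Tendsto (fun n => ∫ x, F x * (φ x * χ n x)) atTop (𝓝 (∫ x, F x * φ x)) := by
    have hi := hmul hfm' hf' hφ hc
    refine tendsto_integral_of_dominated_convergence (fun x => ‖F x * φ x‖)
      (fun n => (hmul hfm' hf' (hφ.mul (hχc n)) hc.mul_right).aestronglyMeasurable)
      hi.norm (fun n => ae_of_all _ fun x => ?_) ?_
    · rw [← mul_assoc, norm_mul _ (χ n x)]
      exact mul_le_of_le_one_right (norm_nonneg _) (hχ1 n x)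
    · filter_upwards [hχlim] with x hx
      simpa using (hx.const_mul (φ x)).const_mul (F x)
  have hlapc : HasCompactSupport (lap φ) :=
    hc.mono' ((subset_tsupport _).trans (tsupport_lap_subset φ))
  have lim2 : Tendsto (fun n => ∫ x, U x * (lap φ x * χ n x)) atTop (𝓝 (∫ x, U x * lap φ x)) := by
    have hi := hmul hum' hu' (contDiff_lap hφ) hlapc
    refine tendsto_integral_of_dominated_convergence (fun x => ‖U x * lap φ x‖)
      (fun n => (hmul hum' hu' ((contDiff_lap hφ).mul (hχc n))
        hlapc.mul_right).aestronglyMeasurable)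
      hi.norm (fun n => ae_of_all _ fun x => ?_) ?_
    · rw [← mul_assoc, norm_mul _ (χ n x)]
      exact mul_le_of_le_one_right (norm_nonneg _) (hχ1 n x)
    · filter_upwards [hχlim] with x hx
      simpa using (hx.const_mul (lap φ x)).const_mul (U x)
  let E : ℕ → Cn m → ℝ := fun n x => φ x * lap (χ n) x + ∑ i, 2 * (pd i φ x * pd i (χ n) x)
  have hEc : ∀ n, ContDiff ℝ ∞ (E n) := fun n =>
    (hφ.mul (contDiff_lap (hχc n))).add (ContDiff.sum fun i _ =>
      contDiff_const.mul ((contDiff_pd hφ i).mul (contDiff_pd (hχc n) i)))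
  have hEz : ∀ n, ∀ x ∉ tsupport φ, E n x = 0 := by
    intro n x hx
    simp only [E]
    rw [image_eq_zero_of_notMem_tsupport hx, zero_mul, zero_add]
    refine Finset.sum_eq_zero fun i _ => ?_
    rw [image_eq_zero_of_notMem_tsupport fun h' => hx (tsupport_pd_subset φ i h')]
    simp
  have hEs : ∀ n, HasCompactSupport (E n) := fun n => HasCompactSupport.intro hc (hEz n)
  have lim3 : Tendsto (fun n => ∫ x, U x * E n x) atTop (𝓝 0) := by
    set V := volume.real (closedBall (0 : Fin m → ℂ) ρ) with hV
    set c := M' * (K * C + 4 * (m + 1) * (K * C)) with hc'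
    have hb : ∀ n : ℕ, ‖∫ x, U x * E n x‖ ≤
        c * (volume.real (ball (0 : ℂ) 1)) * V * ((n : ℝ) + 1)⁻¹ := by
      intro n
      set L := (n : ℝ) + 1 with hL
      have hL1 : 1 ≤ L := by rw [hL]; have : (0 : ℝ) ≤ n := n.cast_nonneg; linarith
      have hLp : 0 < L := by linarith
      have hw : Integrable (annWeight L) := by
        have := (integral_annulus hLp).1
        exact (integrable_indicator_iff (measurable_norm measurableSet_Icc)).2 this
      have hw2 : ∫ ξ, annWeight L ξ = volume.real (ball (0 : ℂ) 1) * L := by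
        rw [← (integral_annulus hLp).2]
        exact integral_indicator (measurable_norm measurableSet_Icc)
      have hχ2 : Integrable ((closedBall (0 : Fin m → ℂ) ρ).indicator fun _ => (1 : ℝ)) :=
        (integrable_indicator_iff measurableSet_closedBall).2
          (integrableOn_const measure_closedBall_lt_top.ne)
      have hχ3 : ∫ z, (closedBall (0 : Fin m → ℂ) ρ).indicator (fun _ => (1 : ℝ)) z = V := by
        rw [integral_indicator measurableSet_closedBall]; simp [hV]
      have hprod : Integrable (fun x : Cn m => annWeight L x.1 *
          (closedBall (0 : Fin m → ℂ) ρ).indicator (fun _ => (1 : ℝ)) x.2) :=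
        hw.mul_prod hχ2
      have hpi : ∫ x : Cn m, annWeight L x.1 *
          (closedBall (0 : Fin m → ℂ) ρ).indicator (fun _ => (1 : ℝ)) x.2 =
          (volume.real (ball (0 : ℂ) 1) * L) * V := by
        rw [← hw2, ← hχ3]
        exact integral_prod_mul _ _
      have hle := norm_integral_le_of_norm_le (f := fun x => U x * E n x)
        (hprod.const_mul (c / L ^ 2)) (by
          filter_upwards [hu'] with x hx
          by_cases hxs : x ∈ tsupport φ
          · have h2 : x.2 ∈ closedBall (0 : Fin m → ℂ) ρ := by
              have := hρ hxs
              rw [mem_closedBall_zero_iff] at this ⊢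
              exact (norm_snd_le x).trans this
            rw [indicator_of_mem h2, mul_one, norm_mul]
            obtain ⟨c1, c2⟩ := hcut L x hL1
            have hw0 := annWeight_nonneg L x.1
            have hE : ‖E n x‖ ≤ (K * C + 4 * (m + 1) * (K * C)) / L ^ 2 * annWeight L x.1 := by
              calc ‖E n x‖ ≤ |φ x * lap (χ n) x| + |∑ i, 2 * (pd i φ x * pd i (χ n) x)| :=
                    abs_add_le _ _
                _ ≤ K * (C / L ^ 2 * annWeight L x.1) +
                    ∑ i : Idx m, 2 * (K * (C / L ^ 2 * annWeight L x.1)) := by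
                    refine add_le_add ?_ ((Finset.abs_sum_le_sum_abs _ _).trans
                      (Finset.sum_le_sum fun i _ => ?_))
                    · rw [abs_mul]
                      exact mul_le_mul (hKa x) c2 (abs_nonneg _) hKn
                    · rw [abs_mul, abs_mul, abs_of_pos (zero_lt_two (α := ℝ))]
                      exact mul_le_mul_of_nonneg_left
                        (mul_le_mul (hKb i x) (c1 i) (abs_nonneg _) hKn) zero_le_two
                _ = _ := by
                    rw [Finset.sum_const, Finset.card_univ, card_idx, nsmul_eq_mul]
                    push_cast
                    ring
            calc ‖U x‖ * ‖E n x‖ ≤ M' * ((K * C + 4 * (m + 1) * (K * C)) / L ^ 2 *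
                  annWeight L x.1) := mul_le_mul hx hE (norm_nonneg _) hM'
              _ = _ := by rw [hc']; ring
          · rw [hEz n x hxs, mul_zero, norm_zero]
            have := annWeight_nonneg L x.1
            have h9 : 0 ≤ (closedBall (0 : Fin m → ℂ) ρ).indicator (fun _ => (1 : ℝ)) x.2 :=
              indicator_nonneg (fun _ _ => zero_le_one) _
            positivity)
      rw [integral_const_mul, hpi] at hle
      refine hle.trans (le_of_eq ?_)
      field_simp
    refine squeeze_zero_norm hb ?_
    simpa using (tendsto_one_div_add_atTop_nhds_zero_nat (𝕜 := ℝ)).const_mul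
      (c * (volume.real (ball (0 : ℂ) 1)) * V)
  have heq2 : ∀ n, ∫ x, U x * lap (fun y => φ y * χ n y) x =
      (∫ x, U x * (lap φ x * χ n x)) + ∫ x, U x * E n x := by
    intro n
    refine Eq.trans ?_ (integral_add (hmul hum' hu' ((contDiff_lap hφ).mul (hχc n))
      hlapc.mul_right) (hmul hum' hu' (hEc n) (hEs n)))
    congr 1
    funext x
    rw [lap_mul hφ (hχc n)]
    simp only [E]
    ring
  have lim4 := lim2.add lim3
  rw [add_zero] at lim4
  exact tendsto_nhds_unique (lim4.congr fun n => by rw [← heq n, heq2 n]) lim1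

/-! ### Local isometries from Euclidean space to the cone -/

/-- The map `(ζ, z') ↦ (e^{iθ} (a ζ)^{1/β}, z')`, a local isometry from Euclidean space to the
cone when `|a| = 1`. -/
def lift (β : ℝ) (a : ℂ) (θ : ℝ) (x : Cn m) : Cn m :=
  (Complex.exp (Complex.log (a * x.1) / β + θ * Complex.I), x.2)

/-- The differential of `lift`. -/
def liftDeriv (β : ℝ) (a : ℂ) (θ : ℝ) (x : Cn m) : Cn m →L[ℝ] Cn m :=
  (((lift β a θ x).1 / (β * x.1)) • ContinuousLinearMap.fst ℝ ℂ (Fin m → ℂ)).prod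
    (ContinuousLinearMap.snd ℝ ℂ (Fin m → ℂ))

lemma liftDeriv_apply (β : ℝ) (a : ℂ) (θ : ℝ) (x v : Cn m) :
    liftDeriv β a θ x v = ((lift β a θ x).1 / (β * x.1) * v.1, v.2) := by
  simp [liftDeriv]

lemma lift_fst_ne_zero (β : ℝ) (a : ℂ) (θ : ℝ) (x : Cn m) : (lift β a θ x).1 ≠ 0 :=
  Complex.exp_ne_zero _

lemma fst_ne_zero_of_mem {a : ℂ} {x : Cn m} (hx : a * x.1 ∈ Complex.slitPlane) : x.1 ≠ 0 :=
  right_ne_zero_of_mul (Complex.slitPlane_ne_zero hx)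

lemma hasFDerivAt_lift (β : ℝ) (a : ℂ) (θ : ℝ) {x : Cn m} (hx : a * x.1 ∈ Complex.slitPlane) :
    HasFDerivAt (lift β a θ) (liftDeriv β a θ x) x := by
  have hx0 := Complex.slitPlane_ne_zero hx
  have ha : a ≠ 0 := left_ne_zero_of_mul hx0
  have hx1 : x.1 ≠ 0 := right_ne_zero_of_mul hx0
  have h1 : HasDerivAt (fun ζ : ℂ => Complex.exp (Complex.log (a * ζ) / β + θ * Complex.I))
      ((lift β a θ x).1 / (β * x.1)) x.1 := by
    have h := (((((hasDerivAt_id x.1).const_mul a).clog hx).div_const (β : ℂ)).add_const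
      (θ * Complex.I : ℂ)).cexp
    refine h.congr_deriv ?_
    have e : (lift β a θ x).1 = Complex.exp (Complex.log (a * x.1) / β + θ * Complex.I) := rfl
    simp only [id, mul_one, e]
    by_cases hβ : (β : ℂ) = 0
    · simp [hβ]
    · field_simp
  have h2 := (h1.hasFDerivAt.restrictScalars ℝ).comp x
    (ContinuousLinearMap.fst ℝ ℂ (Fin m → ℂ)).hasFDerivAt
  have h3 := h2.prodMk (ContinuousLinearMap.snd ℝ ℂ (Fin m → ℂ)).hasFDerivAt
  refine h3.congr_fderiv ?_
  refine ContinuousLinearMap.ext fun v => ?_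
  rw [liftDeriv_apply]
  simp [mul_comm]

lemma contDiffAt_lift (β : ℝ) (a : ℂ) (θ : ℝ) {x : Cn m} (hx : a * x.1 ∈ Complex.slitPlane)
    {n : WithTop ℕ∞} : ContDiffAt ℝ n (lift β a θ) x := by
  have h1 : ContDiffAt ℂ n (fun ζ : ℂ => Complex.exp (Complex.log (a * ζ) / β + θ * Complex.I))
      x.1 := by
    have h2 : ContDiffAt ℂ n (fun ζ : ℂ => Complex.log (a * ζ)) x.1 :=
      (Complex.contDiffAt_log hx).comp x.1 (contDiffAt_const.mul contDiffAt_id)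
    exact ((h2.div_const _).add contDiffAt_const).cexp
  exact ((h1.restrict_scalars ℝ).comp x contDiffAt_fst).prodMk contDiffAt_snd

lemma norm_lift_fst {β : ℝ} {a : ℂ} (ha : ‖a‖ = 1) (θ : ℝ) {x : Cn m} :
    ‖(lift β a θ x).1‖ = Real.exp (Real.log ‖x.1‖ / β) := by
  rw [lift, Complex.norm_exp]
  congr 1
  rw [Complex.add_re, Complex.div_ofReal_re, Complex.log_re, norm_mul, ha, one_mul]
  simp

lemma rad_lift {β : ℝ} (hβ : 0 < β) {a : ℂ} (ha : ‖a‖ = 1) (θ : ℝ) {x : Cn m} (hx : x.1 ≠ 0) :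
    rad β (lift β a θ x) = ‖x.1‖ := by
  rw [rad, norm_lift_fst ha θ, ← Real.exp_mul, div_mul_cancel₀ _ hβ.ne',
    Real.exp_log (norm_pos_iff.2 hx)]

lemma rad_one (x : Cn m) : rad 1 x = ‖x.1‖ := Real.rpow_one _

/-- The factors `1`, `i` of the normal frame fields. -/
def unit (k : Fin 2) : ℂ := if k = 0 then 1 else Complex.I

lemma unit_zero : unit 0 = 1 := rfl
lemma unit_one : unit 1 = Complex.I := rfl

lemma frame_inl (β : ℝ) (k : Fin 2) (x : Cn m) :
    frame β (.inl k) x = (((β * rad β x)⁻¹ : ℝ) * (unit k * x.1), 0) := by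
  simp [frame, unit]

lemma frame_inr (β : ℝ) (j : Fin m × Fin 2) (x : Cn m) : frame β (.inr j) x = dir (.inr j) := rfl

/-- This is the infinitesimal form of the isometry. The value β = 1 stands for Euclidean space with
its polar frame. -/
lemma liftDeriv_frame {β : ℝ} (hβ : 0 < β) {a : ℂ} (ha : ‖a‖ = 1) (θ : ℝ) {x : Cn m}
    (hx : x.1 ≠ 0) (i : Idx m) :
    liftDeriv β a θ x (frame 1 i x) = frame β i (lift β a θ x) := by
  rw [liftDeriv_apply]
  rcases i with k | ⟨j, k⟩
  · rw [frame_inl, frame_inl, rad_lift hβ ha θ hx, rad_one]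
    have : ‖x.1‖ ≠ 0 := norm_ne_zero_iff.2 hx
    have hβ' : (β : ℂ) ≠ 0 := by exact_mod_cast hβ.ne'
    ext1
    · push_cast
      field_simp
    · rfl
  · simp [frame]

lemma differentiableAt_rad (β : ℝ) {p : Cn m} (hp : p.1 ≠ 0) {n : WithTop ℕ∞} :
    ContDiffAt ℝ n (rad (m := m) β) p :=
  ((contDiffAt_norm ℝ hp).comp p contDiffAt_fst).rpow_const_of_ne (norm_ne_zero_iff.2 hp)

lemma rad_pos (β : ℝ) {p : Cn m} (hp : p.1 ≠ 0) : 0 < rad β p :=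
  Real.rpow_pos_of_pos (norm_pos_iff.2 hp) _

lemma contDiffAt_frame {β : ℝ} (hβ : 0 < β) (i : Idx m) {p : Cn m} (hp : p.1 ≠ 0)
    {n : WithTop ℕ∞} : ContDiffAt ℝ n (frame β i) p := by
  rcases i with k | j
  · have e : (frame β (.inl k) : Cn m → Cn m) =
        fun x => (((β * rad β x)⁻¹ : ℝ) • (unit k * x.1), 0) := by
      funext x; rw [frame_inl]; simp
    rw [e]
    have h1 : ContDiffAt ℝ n (fun x : Cn m => (β * rad β x)⁻¹) p :=
      (contDiffAt_const.mul (differentiableAt_rad β hp)).inv (mul_pos hβ (rad_pos β hp)).ne'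
    have h2 : ContDiffAt ℝ n (fun x : Cn m => unit k * x.1) p := contDiffAt_const.mul contDiffAt_fst
    exact (h1.fun_smul h2).prodMk contDiffAt_const
  · exact contDiffAt_const

lemma eventually_fst_ne_zero {p : Cn m} (hp : p.1 ≠ 0) : ∀ᶠ q in 𝓝 p, q.1 ≠ 0 :=
  continuous_fst.continuousAt.eventually_ne hp

section lift
variable {β : ℝ} (hβ : 0 < β) {a : ℂ} (ha : ‖a‖ = 1) (θ : ℝ) {x : Cn m}
  (hx : a * x.1 ∈ Complex.slitPlane) {v : Cn m → ℝ}
include hβ ha hx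

lemma D_lift (hv : DifferentiableAt ℝ v (lift β a θ x)) (i : Idx m) :
    D β i v (lift β a θ x) = D 1 i (fun y => v (lift β a θ y)) x := by
  have h := hv.hasFDerivAt.comp x (hasFDerivAt_lift β a θ hx)
  have e : fderiv ℝ (fun y => v (lift β a θ y)) x = _ := h.fderiv
  rw [D, D, e, ContinuousLinearMap.comp_apply, liftDeriv_frame hβ ha θ (fst_ne_zero_of_mem hx)]

omit hβ ha in
lemma eventually_lift : ∀ᶠ y in 𝓝 x, a * y.1 ∈ Complex.slitPlane :=
  (continuous_const.mul continuous_fst).continuousAt.eventually_mem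
    (Complex.isOpen_slitPlane.mem_nhds hx)

omit hx a ha x in
lemma differentiableAt_D {p : Cn m} (hp : p.1 ≠ 0) (hv : ContDiffAt ℝ 2 v p) (i : Idx m) :
    DifferentiableAt ℝ (D β i v) p := by
  have h1 : ContDiffAt ℝ 1 (fderiv ℝ v) p := hv.fderiv_right (by norm_num [← one_add_one_eq_two])
  exact (h1.clm_apply (contDiffAt_frame hβ i hp)).differentiableAt (by simp)

/-- The frames correspond under `lift`, and the connection coefficients involve only r, which `lift`
preserves. -/
lemma hess_lift (hv : ContDiffAt ℝ 2 v (lift β a θ x)) (i j : Idx m) :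
    hess β v (lift β a θ x) i j = hess 1 (fun y => v (lift β a θ y)) x i j := by
  have hx0 := fst_ne_zero_of_mem hx
  have hd : ∀ᶠ y in 𝓝 x, DifferentiableAt ℝ v (lift β a θ y) := by
    have h1 : ∀ᶠ p in 𝓝 (lift β a θ x), DifferentiableAt ℝ v p := by
      filter_upwards [hv.eventually (by simp)] with p hp using hp.differentiableAt (by simp)
    exact (hasFDerivAt_lift β a θ hx).continuousAt.eventually h1
  have e : (fun y => D β j v (lift β a θ y)) =ᶠ[𝓝 x] D 1 j (fun y => v (lift β a θ y)) := by
    filter_upwards [hd, eventually_lift hx] with y hy hy' using D_lift hβ ha θ hy' hy j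
  have h2 : D β i (D β j v) (lift β a θ x) = D 1 i (D 1 j fun y => v (lift β a θ y)) x := by
    rw [D_lift hβ ha θ hx (differentiableAt_D hβ (lift_fst_ne_zero β a θ x) hv j)]
    change fderiv ℝ (fun y => D β j v (lift β a θ y)) x (frame 1 i x) = _
    rw [Filter.EventuallyEq.fderiv_eq e]
    rfl
  have hd0 := hd.self_of_nhds
  rw [hess, hess, h2]
  simp only [connection, D_lift hβ ha θ hx hd0, rad_lift hβ ha θ hx0, rad_one]

lemma laplacian_lift_aux (hv : ContDiffAt ℝ 2 v (lift β a θ x)) :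
    laplacian β v (lift β a θ x) = laplacian 1 (fun y => v (lift β a θ y)) x := by
  simp only [laplacian, hess_lift hβ ha θ hx hv]

end lift

/-- The second derivative as a bilinear form. -/
def D2 (U : Cn m → ℝ) (x v w : Cn m) : ℝ := fderiv ℝ (fderiv ℝ U) x v w

lemma D2_add_left (U : Cn m → ℝ) (x v v' w : Cn m) :
    D2 U x (v + v') w = D2 U x v w + D2 U x v' w := by simp [D2]
lemma D2_add_right (U : Cn m → ℝ) (x v w w' : Cn m) :
    D2 U x v (w + w') = D2 U x v w + D2 U x v w' := by simp [D2]
lemma D2_smul_left (U : Cn m → ℝ) (x v w : Cn m) (c : ℝ) :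
    D2 U x (c • v) w = c * D2 U x v w := by simp [D2]
lemma D2_smul_right (U : Cn m → ℝ) (x v w : Cn m) (c : ℝ) :
    D2 U x v (c • w) = c * D2 U x v w := by simp [D2]

lemma fderiv_differentiableAt {U : Cn m → ℝ} {x : Cn m} (hU : ContDiffAt ℝ 2 U x) :
    DifferentiableAt ℝ (fderiv ℝ U) x :=
  (hU.fderiv_right (m := 1) (by norm_num [← one_add_one_eq_two])).differentiableAt (by simp)

lemma pd_pd_eq_D2 {U : Cn m → ℝ} {x : Cn m} (hU : ContDiffAt ℝ 2 U x) (i j : Idx m) :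
    pd i (pd j U) x = D2 U x (dir i) (dir j) := by
  have h := (fderiv_differentiableAt hU).hasFDerivAt.clm_apply
    (hasFDerivAt_const (dir j : Cn m) x)
  have e : fderiv ℝ (pd j U) x = _ := h.fderiv
  rw [pd, e]
  simp [D2]

/-- The derivative of the Euclidean polar frame along itself. -/
lemma fderiv_frame {x : Cn m} (hx : x.1 ≠ 0) (i j : Idx m) :
    fderiv ℝ (frame 1 j) x (frame 1 i x) =
      if i = .inl 1 ∧ j = .inl 0 then (rad 1 x)⁻¹ • frame 1 (.inl 1) x
      else if i = .inl 1 ∧ j = .inl 1 then -((rad 1 x)⁻¹ • frame 1 (.inl 0) x)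
      else 0 := by
  have hr : ‖x.1‖ ≠ 0 := norm_ne_zero_iff.2 hx
  have hr' : (‖x.1‖ : ℂ) ≠ 0 := by exact_mod_cast hr
  have hd : DifferentiableAt ℝ (frame (m := m) 1 j) x :=
    (contDiffAt_frame one_pos j hx (n := 1)).differentiableAt (by simp)
  rcases j with k | j
  swap
  · have e : (frame 1 (.inr j) : Cn m → Cn m) = fun _ => dir (.inr j) := rfl
    rw [e]; simp
  rcases i with l | i
  swap
  · have hγ : HasDerivAt (fun t : ℝ => x + t • (dir (.inr i) : Cn m)) (dir (.inr i)) 0 := by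
      simpa using ((hasDerivAt_id (0 : ℝ)).smul_const (dir (.inr i) : Cn m)).const_add x
    have hc := (hd.hasFDerivAt.comp_hasDerivAt_of_eq (0 : ℝ) hγ (by simp))
    have e : (frame 1 (.inl k) ∘ fun t : ℝ => x + t • (dir (.inr i) : Cn m)) =
        fun _ => frame 1 (.inl k) x := by
      funext t
      simp [frame_inl, rad_one, dir]
    rw [e] at hc
    rw [frame_inr, ← hc.deriv]
    simp
  set r := ‖x.1‖ with hrdef
  -- A curve whose velocity at time 0 is the field with index l: a ray for l = 0, a circle for l =
  -- 1. The frame is constant along the first and rotates at rate 1/r along the second, so its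
  -- derivative can be read off.
  have hγ : HasDerivAt (fun t : ℝ => ((x.1 * Complex.exp (unit l * (t / r : ℝ)), x.2) : Cn m))
      (frame 1 (.inl l) x) 0 := by
    have h1 : HasDerivAt (fun t : ℝ => ((t / r : ℝ) : ℂ)) ((1 / r : ℝ) : ℂ) 0 :=
      ((hasDerivAt_id (0 : ℝ)).div_const r).ofReal_comp
    have h2 := ((h1.const_mul (unit l)).cexp.const_mul x.1).prodMk (hasDerivAt_const (0 : ℝ) x.2)
    convert h2 using 1
    rw [frame_inl, rad_one]
    simp
    ring
  have hc := (hd.hasFDerivAt.comp_hasDerivAt_of_eq (0 : ℝ) hγ (by simp))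
  have e : ∀ t : ℝ, frame 1 (.inl k) ((x.1 * Complex.exp (unit l * (t / r : ℝ)), x.2) : Cn m) =
      ((‖Complex.exp (unit l * (t / r : ℝ))‖⁻¹ : ℝ) * Complex.exp (unit l * (t / r : ℝ)) *
        (r⁻¹ * (unit k * x.1)), 0) := by
    intro t
    rw [frame_inl, rad_one]
    ext1
    · simp only [norm_mul, one_mul, mul_inv]
      push_cast
      ring
    · rfl
  have hl : l = 0 ∨ l = 1 := by fin_cases l <;> simp
  rcases hl with rfl | rfl
  · have e2 : (frame 1 (.inl k) ∘ fun t : ℝ => ((x.1 * Complex.exp (unit 0 * (t / r : ℝ)), x.2) :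
        Cn m)) = fun _ => ((r⁻¹ * (unit k * x.1), 0) : Cn m) := by
      funext t
      rw [Function.comp_apply, e, unit_zero, one_mul, ← Complex.ofReal_exp, Complex.norm_real,
        Real.norm_of_nonneg (Real.exp_pos _).le, ← Complex.ofReal_mul,
        inv_mul_cancel₀ (Real.exp_pos _).ne']
      simp
    rw [e2] at hc
    rw [← hc.deriv]
    simp
  · have e2 : (frame 1 (.inl k) ∘ fun t : ℝ => ((x.1 * Complex.exp (unit 1 * (t / r : ℝ)), x.2) :
        Cn m)) = fun t => ((Complex.exp (unit 1 * (t / r : ℝ)) * (r⁻¹ * (unit k * x.1)), 0) :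
        Cn m) := by
      funext t
      rw [Function.comp_apply, e, unit_one, mul_comm Complex.I, Complex.norm_exp_ofReal_mul_I]
      simp
    have h1 : HasDerivAt (fun t : ℝ => ((t / r : ℝ) : ℂ)) ((1 / r : ℝ) : ℂ) 0 :=
      ((hasDerivAt_id (0 : ℝ)).div_const r).ofReal_comp
    have h2 := ((h1.const_mul (unit 1)).cexp.mul_const (r⁻¹ * (unit k * x.1) : ℂ)).prodMk
      (hasDerivAt_const (0 : ℝ) (0 : Fin m → ℂ))
    rw [e2] at hc
    rw [hc.unique h2, rad_one, ← hrdef]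
    have hk : k = 0 ∨ k = 1 := by fin_cases k <;> simp
    rcases hk with rfl | rfl
    · simp [frame_inl, rad_one, unit_zero, unit_one, ← hrdef]
      ring
    · simp [frame_inl, rad_one, unit_zero, unit_one, ← hrdef]
      linear_combination (r : ℂ)⁻¹ ^ 2 * x.1 * Complex.I_sq

/-- The connection term is the derivative of one frame field along another, by `fderiv_frame`;
subtracting it leaves the tensorial second derivative. -/
lemma hess_one {U : Cn m → ℝ} {x : Cn m} (hx : x.1 ≠ 0) (hU : ContDiffAt ℝ 2 U x) (i j : Idx m) :
    hess 1 U x i j = D2 U x (frame 1 i x) (frame 1 j x) := by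
  have hd : DifferentiableAt ℝ (frame (m := m) 1 j) x :=
    (contDiffAt_frame one_pos j hx (n := 1)).differentiableAt (by simp)
  have h := (fderiv_differentiableAt hU).hasFDerivAt.clm_apply hd.hasFDerivAt
  have e : fderiv ℝ (D 1 j U) x = _ := h.fderiv
  rw [hess, D, e]
  have h2 := fderiv_frame hx i j
  simp only [add_apply, ContinuousLinearMap.comp_apply, ContinuousLinearMap.flip_apply, h2]
  simp only [connection, D2, D]
  split_ifs <;> simp

/-- The normal part of the polar frame is a rotation of the standard basis, and the trace is
invariant. -/
lemma laplacian_one {U : Cn m → ℝ} {x : Cn m} (hx : x.1 ≠ 0) (hU : ContDiffAt ℝ 2 U x) :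
    laplacian 1 U x = lap U x := by
  have hr : ‖x.1‖ ≠ 0 := norm_ne_zero_iff.2 hx
  simp only [laplacian, lap, hess_one hx hU, pd_pd_eq_D2 hU, Fintype.sum_sum_type,
    Fin.sum_univ_two, frame_inr]
  congr 1
  set p := ‖x.1‖⁻¹ * x.1.re
  set q := ‖x.1‖⁻¹ * x.1.im
  have e0 : frame 1 (.inl 0) x = p • (dir (.inl 0) : Cn m) + q • (dir (.inl 1) : Cn m) := by
    rw [frame_inl, rad_one]
    ext1
    · have h := Complex.re_add_im x.1
      simp [dir, unit_zero, p, q]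
      linear_combination (-(‖x.1‖ : ℂ)⁻¹) * h
    · simp [dir]
  have e1 : frame 1 (.inl 1) x = (-q) • (dir (.inl 0) : Cn m) + p • (dir (.inl 1) : Cn m) := by
    rw [frame_inl, rad_one]
    ext1
    · have h := Complex.re_add_im x.1
      simp [dir, unit_one, p, q]
      linear_combination (-(‖x.1‖ : ℂ)⁻¹ * Complex.I) * h + (‖x.1‖ : ℂ)⁻¹ * x.1.im * Complex.I_sq
    · simp [dir]
  have hpq : p ^ 2 + q ^ 2 = 1 := by
    have : x.1.re ^ 2 + x.1.im ^ 2 = ‖x.1‖ ^ 2 := by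
      rw [Complex.sq_norm, Complex.normSq_apply]; ring
    simp only [p, q, mul_pow, ← mul_add, this]
    field_simp
  rw [e0, e1]
  simp only [D2_add_left, D2_add_right, D2_smul_left, D2_smul_right]
  linear_combination (D2 U x (dir (.inl 0)) (dir (.inl 0)) +
    D2 U x (dir (.inl 1)) (dir (.inl 1))) * hpq

lemma laplacian_lift {β : ℝ} (hβ : 0 < β) {a : ℂ} (ha : ‖a‖ = 1) (θ : ℝ) {x : Cn m}
    (hx : a * x.1 ∈ Complex.slitPlane) {v : Cn m → ℝ} (hv : ContDiffAt ℝ 2 v (lift β a θ x)) :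
    laplacian β v (lift β a θ x) = lap (fun y => v (lift β a θ y)) x := by
  rw [laplacian_lift_aux hβ ha θ hx hv, laplacian_one (fst_ne_zero_of_mem hx)]
  exact hv.comp x (contDiffAt_lift β a θ hx)

/-! ### The geodesic distance of the cone -/

lemma tangentNorm_nonneg (β : ℝ) (p v : Cn m) : 0 ≤ tangentNorm β p v := Real.sqrt_nonneg _

lemma norm_snd_le_tangentNorm (β : ℝ) (p v : Cn m) : ‖v.2‖ ≤ tangentNorm β p v := by
  refine (pi_norm_le_iff_of_nonneg (tangentNorm_nonneg β p v)).2 fun j => Real.le_sqrt_of_sq_le ?_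
  have h1 : ‖v.2 j‖ ^ 2 ≤ ∑ j, ‖v.2 j‖ ^ 2 :=
    Finset.single_le_sum (f := fun j => ‖v.2 j‖ ^ 2) (fun _ _ => by positivity) (Finset.mem_univ j)
  have h2 : 0 ≤ β ^ 2 * ‖p.1‖ ^ (2 * β - 2) * ‖v.1‖ ^ 2 := by positivity
  linarith

lemma norm_fst_le_tangentNorm (β : ℝ) {p : Cn m} (hp : p.1 ≠ 0) (v : Cn m) :
    β * rad β p / ‖p.1‖ * ‖v.1‖ ≤ tangentNorm β p v := by
  refine Real.le_sqrt_of_sq_le ?_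
  have hp' : 0 < ‖p.1‖ := norm_pos_iff.2 hp
  have e : ‖p.1‖ ^ (2 * β - 2) = (rad β p / ‖p.1‖) ^ 2 := by
    rw [rad, Real.rpow_sub hp', mul_comm 2 β, Real.rpow_mul hp'.le, div_pow]
    norm_cast
  have h : 0 ≤ ∑ j, ‖v.2 j‖ ^ 2 := by positivity
  rw [e, mul_div_assoc, mul_pow, mul_pow]
  linarith

/-- Integrate the derivative of Ψ ∘ γ along any competing curve. The bound on the derivative is
required at every point, including the divisor, where `tangentNorm` may lose its normal part; hence
the use of maps that are cut off there. -/
lemma enorm_sub_le_coneDist {E : Type*} [NormedAddCommGroup E] [NormedSpace ℝ E] [CompleteSpace E]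
    {Ψ : Cn m → E} {β L : ℝ} (hΨ : ContDiff ℝ 1 Ψ) (hL : 0 < L)
    (h : ∀ p v, ‖fderiv ℝ Ψ p v‖ ≤ L * tangentNorm β p v) (x y : Cn m) :
    ‖Ψ x - Ψ y‖ₑ ≤ ENNReal.ofReal L * coneDist β x y := by
  have hL0 : ENNReal.ofReal L ≠ 0 := (ENNReal.ofReal_pos.2 hL).ne'
  have key : ‖Ψ x - Ψ y‖ₑ / ENNReal.ofReal L ≤ coneDist β x y := by
    refine le_iInf₂ fun γ hγ => ENNReal.div_le_of_le_mul' ?_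
    obtain ⟨hγ, rfl, rfl⟩ := hγ
    have hc : ContDiff ℝ 1 (Ψ ∘ γ) := hΨ.comp hγ
    have hd : ∀ t, HasDerivAt (Ψ ∘ γ) (fderiv ℝ Ψ (γ t) (deriv γ t)) t := fun t =>
      ((hΨ.differentiable (by simp)) (γ t)).hasFDerivAt.comp_hasDerivAt t
        ((hγ.differentiable (by simp)) t).hasDerivAt
    have hcd : Continuous fun t => fderiv ℝ Ψ (γ t) (deriv γ t) := by
      have := hc.continuous_deriv (by simp)
      simpa only [funext fun t => (hd t).deriv] using this
    have hi := intervalIntegral.integral_eq_sub_of_hasDerivAt (fun t _ => hd t)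
      (hcd.intervalIntegrable 0 1)
    rw [← enorm_neg, neg_sub, show Ψ (γ 1) - Ψ (γ 0) = (Ψ ∘ γ) 1 - (Ψ ∘ γ) 0 from rfl, ← hi,
      intervalIntegral.integral_of_le zero_le_one, ← integral_Icc_eq_integral_Ioc]
    refine (enorm_integral_le_lintegral_enorm _).trans ?_
    rw [curveLength, ← lintegral_const_mul' _ _ ENNReal.ofReal_ne_top]
    refine lintegral_mono fun t => ?_
    rw [← ENNReal.ofReal_mul hL.le, ← ofReal_norm]
    exact ENNReal.ofReal_le_ofReal (h _ _)
  rw [ENNReal.div_le_iff' hL0 ENNReal.ofReal_ne_top] at key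
  exact key

lemma tangentNorm_liftDeriv {β : ℝ} (hβ : 0 < β) {a : ℂ} (ha : ‖a‖ = 1) (θ : ℝ) {x : Cn m}
    (hx : x.1 ≠ 0) (v : Cn m) :
    tangentNorm β (lift β a θ x) (liftDeriv β a θ x v) = √(sqNorm v) := by
  have hx' : 0 < ‖x.1‖ := norm_pos_iff.2 hx
  have hp : 0 < ‖(lift β a θ x).1‖ := norm_pos_iff.2 (lift_fst_ne_zero β a θ x)
  have e : ‖(lift β a θ x).1‖ ^ (2 * β - 2) = (‖x.1‖ / ‖(lift β a θ x).1‖) ^ 2 := by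
    rw [← rad_lift hβ ha θ hx, rad, Real.rpow_sub hp, mul_comm 2 β, Real.rpow_mul hp.le, div_pow]
    norm_cast
  rw [tangentNorm, liftDeriv_apply, sqNorm_eq, e]
  congr 2
  simp only [norm_mul, norm_div, Complex.norm_real, Real.norm_of_nonneg hβ.le]
  field_simp

/-- The half-plane Re (a ζ) > 0 is convex, so the Euclidean segment lifts to a competing curve of
the same length. -/
lemma coneDist_lift_le {β : ℝ} (hβ : 0 < β) {a : ℂ} (ha : ‖a‖ = 1) (θ : ℝ) {x y : Cn m}
    (hx : 0 < (a * x.1).re) (hy : 0 < (a * y.1).re) :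
    coneDist β (lift β a θ x) (lift β a θ y) ≤ ENNReal.ofReal √(sqNorm (x - y)) := by
  -- A competitor must be C¹ on all of ℝ. This parameter stays in [0, 1] at all times, so the path
  -- never leaves the segment nor, therefore, the half-plane.
  set s : ℝ → ℝ := fun t => (1 - Real.cos (Real.pi * t)) / 2
  have hs0 : ∀ t, 0 ≤ s t := fun t => by have := Real.cos_le_one (Real.pi * t); simp only [s]; linarith
  have hs1 : ∀ t, s t ≤ 1 := fun t => by
    have := Real.neg_one_le_cos (Real.pi * t); simp only [s]; linarith
  have hsd : ∀ t, HasDerivAt s (Real.pi / 2 * Real.sin (Real.pi * t)) t := fun t => by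
    have h := ((((hasDerivAt_id t).const_mul Real.pi).cos).const_sub 1).div_const 2
    refine h.congr_deriv ?_
    simp
    ring
  have hsc : ContDiff ℝ 1 s := by
    refine (contDiff_const.sub ?_).div_const 2
    exact Real.contDiff_cos.comp (contDiff_const.mul contDiff_id)
  have hpos : ∀ t, 0 < (a * (x + s t • (y - x)).1).re := fun t => by
    have e : (a * (x + s t • (y - x)).1).re = (1 - s t) * (a * x.1).re + s t * (a * y.1).re := by
      simp
      ring
    rw [e]
    rcases (hs0 t).eq_or_lt with h | h
    · rw [← h]; simpa using hx
    · have := mul_pos h hy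
      have h2 := mul_nonneg (sub_nonneg.2 (hs1 t)) hx.le
      linarith
  have hsl : ∀ t, a * (x + s t • (y - x)).1 ∈ Complex.slitPlane := fun t => Or.inl (hpos t)
  have hline : ContDiff ℝ 1 fun t => x + s t • (y - x) := contDiff_const.add (hsc.smul contDiff_const)
  have hγ : ContDiff ℝ 1 fun t => lift β a θ (x + s t • (y - x)) :=
    contDiff_iff_contDiffAt.2 fun t =>
      ContDiffAt.comp (g := lift β a θ) t (contDiffAt_lift β a θ (hsl t)) hline.contDiffAt
  refine (iInf₂_le (fun t => lift β a θ (x + s t • (y - x)))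
    ⟨hγ, by simp [s], by simp [s]⟩).trans ?_
  have hd : ∀ t, deriv (fun t => lift β a θ (x + s t • (y - x))) t =
      liftDeriv β a θ (x + s t • (y - x)) ((Real.pi / 2 * Real.sin (Real.pi * t)) • (y - x)) :=
    fun t => (HasFDerivAt.comp_hasDerivAt (l := lift β a θ) t (hasFDerivAt_lift β a θ (hsl t))
      (((hsd t).smul_const (y - x)).const_add x)).deriv
  have hsin : ∀ t ∈ Icc (0 : ℝ) 1, 0 ≤ Real.pi / 2 * Real.sin (Real.pi * t) := fun t ht =>
    mul_nonneg (by positivity) (Real.sin_nonneg_of_nonneg_of_le_pi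
      (mul_nonneg Real.pi_pos.le ht.1) (by nlinarith [Real.pi_pos, ht.2]))
  have hcont : Continuous fun t => Real.pi / 2 * Real.sin (Real.pi * t) := by fun_prop
  have hlen : ∀ t ∈ Icc (0 : ℝ) 1, tangentNorm β (lift β a θ (x + s t • (y - x)))
      (deriv (fun t => lift β a θ (x + s t • (y - x))) t) =
      Real.pi / 2 * Real.sin (Real.pi * t) * √(sqNorm (x - y)) := fun t ht => by
    rw [hd, tangentNorm_liftDeriv hβ ha θ (fst_ne_zero_of_mem (hsl t)), sqNorm_smul,
      Real.sqrt_mul (sq_nonneg _), Real.sqrt_sq (hsin t ht), ← neg_sub x y, ← neg_one_smul ℝ (x - y),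
      sqNorm_smul]
    simp
  have hlen' : curveLength β (fun t => lift β a θ (x + s t • (y - x))) =
      ∫⁻ t in Icc (0 : ℝ) 1,
        ENNReal.ofReal (Real.pi / 2 * Real.sin (Real.pi * t) * √(sqNorm (x - y))) :=
    setLIntegral_congr_fun measurableSet_Icc fun t ht => congrArg ENNReal.ofReal (hlen t ht)
  rw [hlen', ← ofReal_integral_eq_lintegral_ofReal]
  · refine ENNReal.ofReal_le_ofReal (le_of_eq ?_)
    rw [integral_mul_const, integral_Icc_eq_integral_Ioc,
      ← intervalIntegral.integral_of_le zero_le_one,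
      intervalIntegral.integral_eq_sub_of_hasDerivAt (fun t _ => hsd t)
        (hcont.intervalIntegrable 0 1)]
    simp [s]
  · exact (hcont.mul continuous_const).integrableOn_Icc
  · exact (ae_restrict_iff' measurableSet_Icc).2 (Eventually.of_forall fun t ht =>
      mul_nonneg (hsin t ht) (Real.sqrt_nonneg _))

/-! Lower bounds for the distance come from test maps that are constant near the divisor. -/

lemma exists_smoothTransition_deriv_bound :
    ∃ K : ℝ, 0 ≤ K ∧ ∀ s, |deriv Real.smoothTransition s| ≤ K := by
  have hc : Continuous fun s => |deriv Real.smoothTransition s| :=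
    (Real.smoothTransition.contDiff (n := 1)).continuous_deriv (by simp) |>.abs
  obtain ⟨K, hK⟩ := (isCompact_Icc (a := (0 : ℝ)) (b := 1)).bddAbove_image hc.continuousOn
  have hK0 : 0 ≤ K := (abs_nonneg _).trans (hK (mem_image_of_mem _ (left_mem_Icc.2 zero_le_one)))
  refine ⟨K, hK0, fun s => ?_⟩
  rcases lt_or_ge s 0 with h | h
  · have e : Real.smoothTransition =ᶠ[𝓝 s] fun _ => 0 := by
      filter_upwards [Iio_mem_nhds h] with t ht
      exact Real.smoothTransition.zero_of_nonpos (le_of_lt ht)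
    rw [e.deriv_eq]; simpa using hK0
  rcases lt_or_ge 1 s with h' | h'
  · have e : Real.smoothTransition =ᶠ[𝓝 s] fun _ => 1 := by
      filter_upwards [Ioi_mem_nhds h'] with t ht
      exact Real.smoothTransition.one_of_one_le (le_of_lt ht)
    rw [e.deriv_eq]; simpa using hK0
  · exact hK (mem_image_of_mem _ ⟨h, h'⟩)

/-- A smooth cutoff, `0` on `s ≤ ρ / 4` and `1` on `s ≥ ρ / 2`. -/
def radCut (ρ s : ℝ) : ℝ := Real.smoothTransition (4 * (s / ρ) - 1)

lemma radCut_eq_zero {ρ s : ℝ} (hρ : 0 < ρ) (hs : s ≤ ρ / 4) : radCut ρ s = 0 := by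
  refine Real.smoothTransition.zero_of_nonpos ?_
  have : s / ρ ≤ 1 / 4 := by rw [div_le_iff₀ hρ]; linarith
  linarith

lemma radCut_eq_one {ρ s : ℝ} (hρ : 0 < ρ) (hs : ρ / 2 ≤ s) : radCut ρ s = 1 := by
  refine Real.smoothTransition.one_of_one_le ?_
  have : 1 / 2 ≤ s / ρ := by rw [le_div_iff₀ hρ]; linarith
  linarith

/-- The second bound follows from the first, since the derivative vanishes for s > ρ/2. -/
lemma exists_radCut_deriv_bound :
    ∃ K : ℝ, 0 ≤ K ∧ ∀ ρ s, 0 < ρ → ∃ d, HasDerivAt (radCut ρ) d s ∧ |d| * ρ ≤ K ∧ |d| * s ≤ K := by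
  obtain ⟨K, hK0, hK⟩ := exists_smoothTransition_deriv_bound
  refine ⟨4 * K, by positivity, fun ρ s hρ => ?_⟩
  have h1 := ((Real.smoothTransition.contDiff (n := 1)).differentiable (by simp)
    (4 * (s / ρ) - 1)).hasDerivAt
  have h2 : HasDerivAt (fun s : ℝ => 4 * (s / ρ) - 1) (4 * (1 / ρ)) s :=
    (((hasDerivAt_id s).div_const ρ).const_mul 4).sub_const 1
  have h3 : |deriv Real.smoothTransition (4 * (s / ρ) - 1) * (4 * (1 / ρ))| * ρ ≤ 4 * K := by
    rw [abs_mul, abs_of_pos (by positivity : 0 < 4 * (1 / ρ))]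
    have := hK (4 * (s / ρ) - 1)
    calc _ = 4 * |deriv Real.smoothTransition (4 * (s / ρ) - 1)| := by
          rw [mul_assoc, mul_assoc, one_div_mul_cancel hρ.ne']; ring
      _ ≤ _ := by linarith
  refine ⟨_, h1.comp s h2, h3, ?_⟩
  rcases le_or_gt s (ρ / 2) with h | h
  · exact (mul_le_mul_of_nonneg_left (by linarith) (abs_nonneg _)).trans h3
  · have e : radCut ρ =ᶠ[𝓝 s] fun _ => 1 := by
      filter_upwards [Ioi_mem_nhds h] with t ht
      exact radCut_eq_one hρ (le_of_lt ht)
    have h4 := (h1.comp s h2).unique ((hasDerivAt_const s (1 : ℝ)).congr_of_eventuallyEq e)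
    rw [h4]
    simpa using hK0

lemma contDiff_radCut (ρ : ℝ) {n : ℕ∞} : ContDiff ℝ n (radCut ρ) :=
  Real.smoothTransition.contDiff.comp
    ((contDiff_const.mul (contDiff_id.div_const _)).sub contDiff_const)

lemma continuous_rad {β : ℝ} (hβ : 0 ≤ β) : Continuous (rad (m := m) β) :=
  continuous_fst.norm.rpow_const fun _ => Or.inr hβ

lemma rad_eq_zero {β : ℝ} (hβ : β ≠ 0) {p : Cn m} (hp : p.1 = 0) : rad β p = 0 := by
  rw [rad, hp, norm_zero, Real.zero_rpow hβ]

lemma exists_hasFDerivAt_norm {z : ℂ} (hz : z ≠ 0) :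
    ∃ ν : ℂ →L[ℝ] ℝ, HasFDerivAt (fun w : ℂ => ‖w‖) ν z ∧ ∀ w, |ν w| ≤ ‖w‖ := by
  have h : DifferentiableAt ℝ (fun w : ℂ => ‖w‖) z :=
    (contDiffAt_norm ℝ hz (n := 1)).differentiableAt (by simp)
  refine ⟨_, h.hasFDerivAt, fun w => ?_⟩
  have := norm_fderiv_le_of_lipschitz ℝ (x₀ := z) (lipschitzWith_one_norm (E := ℂ))
  calc _ ≤ ‖fderiv ℝ (fun w : ℂ => ‖w‖) z‖ * ‖w‖ := ContinuousLinearMap.le_opNorm _ _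
    _ ≤ 1 * ‖w‖ := by gcongr; simpa using this
    _ = _ := one_mul _

lemma exists_hasFDerivAt_rad {β : ℝ} (hβ : 0 < β) {p : Cn m} (hp : p.1 ≠ 0) :
    ∃ ν : Cn m →L[ℝ] ℝ, HasFDerivAt (rad β) ν p ∧ ∀ v, |ν v| ≤ tangentNorm β p v := by
  obtain ⟨ν, h1, h2⟩ := exists_hasFDerivAt_norm hp
  have hp' : 0 < ‖p.1‖ := norm_pos_iff.2 hp
  have h3 : HasFDerivAt (fun q : Cn m => ‖q.1‖) (ν.comp (ContinuousLinearMap.fst ℝ ℂ (Fin m → ℂ))) p :=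
    h1.comp p hasFDerivAt_fst
  refine ⟨_, h3.rpow_const (p := β) (Or.inl hp'.ne'), fun v => ?_⟩
  refine le_trans ?_ (norm_fst_le_tangentNorm β hp v)
  have e : β * rad β p / ‖p.1‖ = β * ‖p.1‖ ^ (β - 1) := by
    rw [rad, Real.rpow_sub_one hp'.ne', mul_div_assoc]
  have h4 : 0 ≤ β * ‖p.1‖ ^ (β - 1) := by positivity
  simp only [smul_apply, ContinuousLinearMap.comp_apply, smul_eq_mul, abs_mul,
    abs_of_nonneg h4, e]
  exact mul_le_mul_of_nonneg_left (h2 _) h4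

/-- The angular coordinate `z₁ / |z₁|`. -/
def ang (p : Cn m) : ℂ := (‖p.1‖⁻¹ : ℝ) • p.1

lemma norm_ang_le (p : Cn m) : ‖ang p‖ ≤ 1 := by
  rw [ang, norm_smul, norm_inv, norm_norm]
  exact inv_mul_le_one

lemma exists_hasFDerivAt_ang {p : Cn m} (hp : p.1 ≠ 0) :
    ∃ ν : Cn m →L[ℝ] ℂ, HasFDerivAt ang ν p ∧ ∀ v, ‖ν v‖ ≤ 2 * ‖v.1‖ / ‖p.1‖ := by
  obtain ⟨ν, h1, h2⟩ := exists_hasFDerivAt_norm hp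
  have hp' : 0 < ‖p.1‖ := norm_pos_iff.2 hp
  have h3 : HasFDerivAt (fun q : Cn m => ‖q.1‖) (ν.comp (ContinuousLinearMap.fst ℝ ℂ (Fin m → ℂ))) p :=
    h1.comp p hasFDerivAt_fst
  have h4 := (hasDerivAt_inv hp'.ne').comp_hasFDerivAt p h3
  refine ⟨_, h4.smul (hasFDerivAt_fst (𝕜 := ℝ) (p := p)), fun v => ?_⟩
  have h5 := h2 v.1
  simp only [add_apply, smul_apply,
    ContinuousLinearMap.smulRight_apply, ContinuousLinearMap.comp_apply,
    ContinuousLinearMap.coe_fst', Function.comp_apply]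
  refine (norm_add_le _ _).trans ?_
  rw [norm_smul, norm_smul, norm_inv, norm_norm, smul_eq_mul, norm_mul, norm_neg, norm_inv,
    norm_pow, norm_norm, Real.norm_eq_abs]
  have : (‖p.1‖ ^ 2)⁻¹ * |ν v.1| * ‖p.1‖ ≤ (‖p.1‖ ^ 2)⁻¹ * ‖v.1‖ * ‖p.1‖ := by gcongr
  refine (add_le_add_right this _).trans (le_of_eq ?_)
  field_simp
  ring

/-- A map cut off near the divisor is a test map for the distance. -/
lemma cutoff_test {E : Type*} [NormedAddCommGroup E] [NormedSpace ℝ E] {β ρ K : ℝ} (hβ : 0 < β)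
    (hρ : 0 < ρ) {F : Cn m → E} (hK : 0 ≤ K)
    (hF : ∀ p : Cn m, p.1 ≠ 0 → ContDiffAt ℝ 1 F p)
    (hz : ∀ p : Cn m, rad β p ≤ ρ / 4 → F p = 0)
    (hb : ∀ p : Cn m, p.1 ≠ 0 → ∀ v, ‖fderiv ℝ F p v‖ ≤ K * tangentNorm β p v) :
    ContDiff ℝ 1 F ∧ ∀ p v, ‖fderiv ℝ F p v‖ ≤ K * tangentNorm β p v := by
  have h0 : ∀ p : Cn m, p.1 = 0 → F =ᶠ[𝓝 p] fun _ => 0 := fun p hp => by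
    have h : rad β p < ρ / 4 := by rw [rad_eq_zero hβ.ne' hp]; positivity
    filter_upwards [(continuous_rad hβ.le).continuousAt.eventually_lt continuousAt_const h]
      with q hq using hz q hq.le
  constructor
  · refine contDiff_iff_contDiffAt.2 fun p => ?_
    by_cases hp : p.1 = 0
    · exact contDiffAt_const.congr_of_eventuallyEq (h0 p hp)
    · exact hF p hp
  · intro p v
    by_cases hp : p.1 = 0
    · rw [(h0 p hp).fderiv_eq]
      simpa using mul_nonneg hK (tangentNorm_nonneg β p v)
    · exact hb p hp v

/-- Three test maps are used: z', r, and the angular coordinate multiplied by βρ, the last two cut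
off near the divisor. Both points have r ≥ ρ/2, where the cutoff equals one. The constant depends
neither on β nor on the dimension. -/
lemma exists_coneDist_lower : ∃ C : ℝ, 0 < C ∧ ∀ (m : ℕ) (β : ℝ) (x y : Cn m), 0 < β → β ≤ 1 →
    x.1 ≠ 0 → |rad β x - rad β y| < rad β x / 2 →
    ENNReal.ofReal (‖x.2 - y.2‖ + |rad β x - rad β y| + β * rad β x * ‖ang x - ang y‖) ≤
      ENNReal.ofReal C * coneDist β x y := by
  obtain ⟨K, hK0, hK⟩ := exists_radCut_deriv_bound
  refine ⟨1 + (1 + K) + (8 + K), by positivity, fun m β x y hβ hβ1 hx hxy => ?_⟩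
  set ρ := rad β x with hρdef
  have hρ : 0 < ρ := rad_pos β hx
  have hnn : ∀ s, 0 ≤ radCut ρ s := fun s => Real.smoothTransition.nonneg _
  have hle : ∀ s, radCut ρ s ≤ 1 := fun s => Real.smoothTransition.le_one _
  have hcx : radCut ρ (rad β x) = 1 := radCut_eq_one hρ (by rw [← hρdef]; linarith)
  have hcy : radCut ρ (rad β y) = 1 := radCut_eq_one hρ (by
    have := (abs_lt.1 hxy).2
    linarith)
  have h1 : ‖x.2 - y.2‖ₑ ≤ ENNReal.ofReal 1 * coneDist β x y := by
    refine enorm_sub_le_coneDist (Ψ := fun p : Cn m => p.2) contDiff_snd one_pos (fun p v => ?_) x y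
    rw [fderiv_snd, one_mul]
    exact norm_snd_le_tangentNorm β p v
  have hcut : ∀ p : Cn m, p.1 ≠ 0 → ∃ ν : Cn m →L[ℝ] ℝ,
      HasFDerivAt (fun p => radCut ρ (rad β p)) ν p ∧ (∀ v, |ν v| * ρ ≤ K * tangentNorm β p v) ∧
        ∀ v, |ν v| * rad β p ≤ K * tangentNorm β p v := by
    intro p hp
    obtain ⟨ν, hν, hb⟩ := exists_hasFDerivAt_rad hβ hp
    obtain ⟨d, hd, hdK, hdK'⟩ := hK ρ (rad β p) hρ
    refine ⟨_, hd.comp_hasFDerivAt p hν, fun v => ?_, fun v => ?_⟩ <;>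
    simp only [smul_apply, smul_eq_mul, abs_mul]
    · calc |d| * |ν v| * ρ = |d| * ρ * |ν v| := by ring
        _ ≤ K * tangentNorm β p v := mul_le_mul hdK (hb v) (abs_nonneg _) hK0
    · calc |d| * |ν v| * rad β p = |d| * rad β p * |ν v| := by ring
        _ ≤ K * tangentNorm β p v := mul_le_mul hdK' (hb v) (abs_nonneg _) hK0
  have hcd : ∀ p : Cn m, p.1 ≠ 0 → ContDiffAt ℝ 1 (fun p => radCut ρ (rad β p)) p := fun p hp =>
    (contDiff_radCut ρ (n := 1)).contDiffAt.comp p (differentiableAt_rad β hp)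
  have h2 : ‖rad β x - rad β y‖ₑ ≤ ENNReal.ofReal (1 + K) * coneDist β x y := by
    obtain ⟨hΨ, hb⟩ := cutoff_test (F := fun p : Cn m => radCut ρ (rad β p) * rad β p)
      (K := 1 + K) hβ hρ (by positivity) (fun p hp => (hcd p hp).mul (differentiableAt_rad β hp))
      (fun p hp => by simp only [radCut_eq_zero hρ hp, zero_mul]) (fun p hp v => by
        obtain ⟨ν, hν, -, hb⟩ := hcut p hp
        obtain ⟨μ, hμ, hb'⟩ := exists_hasFDerivAt_rad hβ hp
        rw [(hν.fun_mul hμ).fderiv]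
        simp only [add_apply, smul_apply, smul_eq_mul]
        refine (norm_add_le _ _).trans ?_
        rw [norm_mul, norm_mul, Real.norm_of_nonneg (hnn _), Real.norm_of_nonneg (rad_pos β hp).le,
          mul_comm (rad β p)]
        have h5 := mul_le_mul (hle (rad β p)) (hb' v) (abs_nonneg _) zero_le_one
        have h6 := hb v
        simp only [← Real.norm_eq_abs] at h5 h6
        linarith)
    have := enorm_sub_le_coneDist hΨ (by positivity) hb x y
    simpa only [hcx, hcy, one_mul] using this
  have h3 : ‖(β * ρ) • (ang x - ang y)‖ₑ ≤ ENNReal.ofReal (8 + K) * coneDist β x y := by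
    obtain ⟨hΨ, hb⟩ := cutoff_test (F := fun p : Cn m => (β * ρ) • radCut ρ (rad β p) • ang p)
      (K := 8 + K) hβ hρ (by positivity) (fun p hp => by
        have h4 : ContDiffAt ℝ 1 (ang (m := m)) p :=
          ContDiffAt.fun_smul (((contDiffAt_norm ℝ hp).comp p contDiffAt_fst).inv
            (norm_ne_zero_iff.2 hp)) contDiffAt_fst
        exact contDiffAt_const.fun_smul ((hcd p hp).fun_smul h4))
      (fun p hp => by simp only [radCut_eq_zero hρ hp, zero_smul, smul_zero]) (fun p hp v => by
        obtain ⟨ν, hν, hb, -⟩ := hcut p hp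
        obtain ⟨μ, hμ, hb'⟩ := exists_hasFDerivAt_ang hp
        rw [((hν.fun_smul hμ).fun_const_smul (β * ρ)).fderiv]
        simp only [add_apply, smul_apply, ContinuousLinearMap.smulRight_apply]
        have hT := tangentNorm_nonneg β p v
        have hp' : 0 < ‖p.1‖ := norm_pos_iff.2 hp
        rw [norm_smul, Real.norm_of_nonneg (by positivity)]
        have h5 : ‖ν v • ang p‖ ≤ |ν v| := by
          rw [norm_smul, Real.norm_eq_abs]
          exact mul_le_of_le_one_right (abs_nonneg _) (norm_ang_le p)
        -- The cutoff vanishes for r ≤ ρ/4, so where it does not, ρ ≤ 4 r; together with the factor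
        -- 2 in the derivative of `ang` this produces 8.
        have h6 : β * ρ * ‖radCut ρ (rad β p) • μ v‖ ≤ 8 * tangentNorm β p v := by
          rcases le_or_gt (rad β p) (ρ / 4) with h | h
          · rw [radCut_eq_zero hρ h, zero_smul, norm_zero]; linarith
          · have h7 : ‖radCut ρ (rad β p) • μ v‖ ≤ 2 * ‖v.1‖ / ‖p.1‖ := by
              rw [norm_smul, Real.norm_of_nonneg (hnn _)]
              exact (mul_le_of_le_one_left (norm_nonneg _) (hle _)).trans (hb' v)
            calc _ ≤ β * (4 * rad β p) * (2 * ‖v.1‖ / ‖p.1‖) := by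
                  have := rad_pos β hp
                  exact mul_le_mul (mul_le_mul_of_nonneg_left (by linarith) hβ.le) h7
                    (norm_nonneg _) (by positivity)
              _ = 8 * (β * rad β p / ‖p.1‖ * ‖v.1‖) := by ring
              _ ≤ _ := by gcongr; exact norm_fst_le_tangentNorm β hp v
        have h8 : β * ρ * |ν v| ≤ K * tangentNorm β p v := by
          have := hb v
          have h9 : β * (|ν v| * ρ) ≤ 1 * (|ν v| * ρ) := by gcongr
          linarith
        have h10 : β * ρ * ‖radCut ρ (rad β p) • μ v + ν v • ang p‖ ≤
            β * ρ * (‖radCut ρ (rad β p) • μ v‖ + |ν v|) := by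
          gcongr
          exact (norm_add_le _ _).trans (add_le_add le_rfl h5)
        linarith)
    have := enorm_sub_le_coneDist hΨ (by positivity) hb x y
    simpa only [hcx, hcy, one_smul, ← smul_sub] using this
  have e : ENNReal.ofReal (‖x.2 - y.2‖ + |rad β x - rad β y| + β * rad β x * ‖ang x - ang y‖) =
      ‖x.2 - y.2‖ₑ + ‖rad β x - rad β y‖ₑ + ‖(β * ρ) • (ang x - ang y)‖ₑ := by
    rw [ENNReal.ofReal_add (by positivity) (by positivity), ENNReal.ofReal_add (by positivity)
      (by positivity), ← ofReal_norm, ← ofReal_norm, ← ofReal_norm,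
      norm_smul, Real.norm_eq_abs, Real.norm_of_nonneg (by positivity : 0 ≤ β * ρ)]
  rw [e, ENNReal.ofReal_add (by positivity) (by positivity), ENNReal.ofReal_add (by positivity)
      (by positivity), add_mul, add_mul]
  exact add_le_add (add_le_add h1 h2) h3

/-! ### Transfer of the equation to Euclidean charts -/

/-- The sector chart, inverse to `lift β 1 θ`. -/
def sect (β θ : ℝ) : Cn m → Cn m := lift β⁻¹ (Complex.exp (-(θ * Complex.I))) 0

lemma sect_eq (β θ : ℝ) (p : Cn m) : sect β θ p =
    (Complex.exp (β * Complex.log (Complex.exp (-(θ * Complex.I)) * p.1)), p.2) := by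
  simp [sect, lift, div_eq_mul_inv, mul_comm]

lemma lift_one_eq (β θ : ℝ) (x : Cn m) : lift β 1 θ x =
    (Complex.exp (Complex.log x.1 / β + θ * Complex.I), x.2) := by
  simp [lift]

lemma lift_sect {β : ℝ} (hβ : 0 < β) (hβ1 : β ≤ 1) (θ : ℝ) {p : Cn m} (hp : p.1 ≠ 0) :
    lift β 1 θ (sect β θ p) = p := by
  have hβ' : (β : ℂ) ≠ 0 := by exact_mod_cast hβ.ne'
  rw [lift_one_eq, sect_eq]
  set w := Complex.exp (-(θ * Complex.I)) * p.1 with hw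
  have hw0 : w ≠ 0 := mul_ne_zero (Complex.exp_ne_zero _) hp
  have him : ((β : ℂ) * Complex.log w).im = β * Complex.arg w := by simp [Complex.log_im]
  have h1 := Complex.neg_pi_lt_arg w
  have h2 := Complex.arg_le_pi w
  have hpi := Real.pi_pos
  rw [Complex.log_exp (by rw [him]; nlinarith) (by rw [him]; nlinarith),
    mul_div_cancel_left₀ _ hβ', Complex.exp_add, Complex.exp_log hw0, hw]
  ext1
  · simp only
    rw [mul_comm, ← mul_assoc, ← Complex.exp_add]
    simp
  · rfl

/-- The sector of Euclidean space on which `lift β 1 θ` is injective. -/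
def sector (m : ℕ) (β : ℝ) : Set (Cn m) := {x | 0 < x.1.re ∧ |Complex.arg x.1| < β * Real.pi}

lemma sector_mem_nhds {β : ℝ} {x : Cn m} (hx : x ∈ sector m β) : sector m β ∈ 𝓝 x := by
  have h1 : ContinuousAt (fun y : Cn m => |Complex.arg y.1|) x :=
    ((Complex.continuousAt_arg (Or.inl hx.1)).comp continuous_fst.continuousAt).abs
  have h2 : ContinuousAt (fun y : Cn m => y.1.re) x :=
    (Complex.continuous_re.comp continuous_fst).continuousAt
  filter_upwards [h1.eventually_lt continuousAt_const hx.2,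
    continuousAt_const.eventually_lt h2 hx.1] with y h3 h4 using ⟨h4, h3⟩

lemma mem_slitPlane_of_sector {β : ℝ} {x : Cn m} (hx : x ∈ sector m β) :
    1 * x.1 ∈ Complex.slitPlane := by
  rw [one_mul]; exact Or.inl hx.1

section sector
variable {β : ℝ} (hβ : 0 < β) (θ : ℝ) {x : Cn m} (hx : x ∈ sector m β)
include hβ hx

lemma log_exp_div : Complex.log (Complex.exp (Complex.log x.1 / β)) = Complex.log x.1 / β := by
  have him : (Complex.log x.1 / β).im = Complex.arg x.1 / β := by
    rw [Complex.div_ofReal_im, Complex.log_im]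
  have h1 : |Complex.arg x.1 / β| < Real.pi := by
    rw [abs_div, abs_of_pos hβ, div_lt_iff₀ hβ, mul_comm]; exact hx.2
  rw [abs_lt] at h1
  exact Complex.log_exp (by rw [him]; exact h1.1) (by rw [him]; exact h1.2.le)

omit hβ hx in
lemma exp_neg_mul_lift : Complex.exp (-(θ * Complex.I)) * (lift β 1 θ x).1 =
    Complex.exp (Complex.log x.1 / β) := by
  rw [lift_one_eq, ← Complex.exp_add]
  congr 1
  ring

lemma lift_mem_slit : Complex.exp (-(θ * Complex.I)) * (lift β 1 θ x).1 ∈ Complex.slitPlane := by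
  rw [exp_neg_mul_lift θ, Complex.mem_slitPlane_iff_arg]
  refine ⟨?_, Complex.exp_ne_zero _⟩
  rw [← Complex.log_im, log_exp_div hβ hx, Complex.div_ofReal_im, Complex.log_im]
  have h1 : Complex.arg x.1 / β < Real.pi := by
    rw [div_lt_iff₀ hβ, mul_comm]; exact (abs_lt.1 hx.2).2
  exact h1.ne

lemma sect_lift : sect β θ (lift β 1 θ x) = x := by
  have hβ' : (β : ℂ) ≠ 0 := by exact_mod_cast hβ.ne'
  rw [sect_eq, exp_neg_mul_lift θ, log_exp_div hβ hx, mul_div_cancel₀ _ hβ',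
    Complex.exp_log (fst_ne_zero_of_mem (mem_slitPlane_of_sector hx))]
  rfl

end sector

lemma contDiffAt_sect (β θ : ℝ) {p : Cn m}
    (hp : Complex.exp (-(θ * Complex.I)) * p.1 ∈ Complex.slitPlane) {n : WithTop ℕ∞} :
    ContDiffAt ℝ n (sect β θ) p := contDiffAt_lift _ _ _ hp

/-- The differential is multiplication by a complex number c on the first factor, with real
determinant |c|², and this is the inverse of the volume density of the cone. -/
lemma abs_det_liftDeriv {β : ℝ} (hβ : 0 < β) {a : ℂ} (ha : ‖a‖ = 1) (θ : ℝ) {x : Cn m}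
    (hx : x.1 ≠ 0) :
    |(liftDeriv β a θ x).det| * (β ^ 2 * ‖(lift β a θ x).1‖ ^ (2 * β - 2)) = 1 := by
  set c : ℂ := (lift β a θ x).1 / (β * x.1) with hc
  have e : (liftDeriv β a θ x : Cn m →ₗ[ℝ] Cn m) =
      (LinearMap.mulLeft ℝ c).prodMap LinearMap.id := by
    refine LinearMap.ext fun v => ?_
    simp [liftDeriv_apply, hc]
  have hd : (liftDeriv β a θ x).det = ‖c‖ ^ 2 := by
    rw [ContinuousLinearMap.det, e, LinearMap.det_prodMap, LinearMap.det_id, mul_one,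
      ← Complex.normSq_eq_norm_sq, ← Algebra.norm_complex_apply]
    rfl
  have hp : 0 < ‖(lift β a θ x).1‖ := norm_pos_iff.2 (lift_fst_ne_zero β a θ x)
  have hx' : 0 < ‖x.1‖ := norm_pos_iff.2 hx
  have e2 : ‖(lift β a θ x).1‖ ^ (2 * β - 2) = (‖x.1‖ / ‖(lift β a θ x).1‖) ^ 2 := by
    rw [← rad_lift hβ ha θ hx, rad, Real.rpow_sub hp, mul_comm 2 β, Real.rpow_mul hp.le, div_pow]
    norm_cast
  rw [hd, abs_of_nonneg (by positivity), e2, hc, norm_div, norm_mul, Complex.norm_real,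
    Real.norm_of_nonneg hβ.le]
  field_simp

lemma laplacian_eq_zero {β : ℝ} {φ : Cn m → ℝ} {p : Cn m} (hp : p ∉ tsupport φ) :
    laplacian β φ p = 0 := by
  have h0 : φ =ᶠ[𝓝 p] fun _ => 0 := notMem_tsupport_iff_eventuallyEq.1 hp
  have h1 : ∀ j, D β j φ =ᶠ[𝓝 p] fun _ => 0 := fun j => by
    filter_upwards [h0.fderiv (𝕜 := ℝ)] with q hq
    rw [D, hq]; simp
  have h2 : ∀ j, D β j φ p = 0 := fun j => (h1 j).self_of_nhds
  refine Finset.sum_eq_zero fun i _ => ?_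
  rw [hess, D, (h1 i).fderiv_eq]
  simp only [connection, h2]
  simp

/-- Transplantation of a test function to the cone. -/
lemma exists_transplant {β : ℝ} (hβ : 0 < β) (hβ1 : β ≤ 1) (θ : ℝ) {B : Set (Cn m)} (hB : B ⊆ sector m β)
    {φ : Cn m → ℝ} (hφ : ContDiff ℝ ∞ φ) (hc : HasCompactSupport φ) (hs : tsupport φ ⊆ B) :
    ∃ ψ : Cn m → ℝ, ContDiff ℝ ∞ ψ ∧ HasCompactSupport ψ ∧ tsupport ψ ⊆ lift β 1 θ '' B ∧
      ∀ x ∈ sector m β, ψ (lift β 1 θ x) = φ x := by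
  classical
  set U : Set (Cn m) := {p | Complex.exp (-(θ * Complex.I)) * p.1 ∈ Complex.slitPlane}
  have hU : IsOpen U := Complex.isOpen_slitPlane.preimage (continuous_const.mul continuous_fst)
  -- The support of φ has compact image inside the slit domain U, so extending by zero across the
  -- slit preserves smoothness.
  set ψ : Cn m → ℝ := U.indicator fun p => φ (sect β θ p)
  have hcont : ContinuousOn (lift (m := m) β 1 θ) (tsupport φ) := fun x hx =>
    ((hasFDerivAt_lift β 1 θ
      (mem_slitPlane_of_sector (hB (hs hx)))).continuousAt).continuousWithinAt
  have hK : IsCompact (lift (m := m) β 1 θ '' tsupport φ) := hc.isCompact.image_of_continuousOn hcont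
  have hz : ∀ p, p ∉ lift (m := m) β 1 θ '' tsupport φ → ψ p = 0 := fun p hp => by
    by_contra h
    have hpU : p ∈ U := mem_of_indicator_ne_zero h
    simp only [ψ, indicator_of_mem hpU] at h
    exact hp ⟨_, subset_tsupport φ h, lift_sect hβ hβ1 θ (fst_ne_zero_of_mem hpU)⟩
  refine ⟨ψ, contDiff_iff_contDiffAt.2 fun p => ?_,
    HasCompactSupport.of_support_subset_isCompact hK
      fun p (hp : ψ p ≠ 0) => by_contra fun h => hp (hz p h),
    (closure_minimal (fun p (hp : ψ p ≠ 0) => by_contra fun h => hp (hz p h)) hK.isClosed).trans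
      (image_mono hs), fun x hx => ?_⟩
  · by_cases hp : p ∈ U
    · refine ((hφ.contDiffAt (x := sect β θ p)).comp p (contDiffAt_sect β θ hp)).congr_of_eventuallyEq ?_
      filter_upwards [hU.mem_nhds hp] with q hq using indicator_of_mem hq _
    · have hp' : p ∉ lift (m := m) β 1 θ '' tsupport φ := by
        rintro ⟨x, hx, rfl⟩
        exact hp (lift_mem_slit hβ θ (hB (hs hx)))
      refine (contDiffAt_const (c := (0 : ℝ))).congr_of_eventuallyEq ?_
      filter_upwards [hK.isClosed.isOpen_compl.mem_nhds hp'] with q hq using hz q hq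
  · simp only [ψ]
    rw [indicator_of_mem (show lift β 1 θ x ∈ U from lift_mem_slit hβ θ hx), sect_lift hβ θ hx]

/-- Test functions in the chart transplant to the cone, their Laplacians correspond, and in the
change of variables the Jacobian cancels the volume density. -/
lemma WeakOn.of_isWeakSolution {β : ℝ} (hβ : 0 < β) (hβ1 : β ≤ 1) (θ : ℝ) {O B : Set (Cn m)} (hO : IsOpen O)
    (hB : B ⊆ sector m β) (hBo : IsOpen B) (hBO : ∀ x ∈ B, lift β 1 θ x ∈ O) {u f : Cn m → ℝ}
    (h : IsWeakSolution β O u f) :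
    WeakOn B (fun x => u (lift β 1 θ x)) (fun x => f (lift β 1 θ x)) := by
  intro φ hφ hc hs
  obtain ⟨ψ, hψ, hψc, hψs, hψe⟩ := exists_transplant hβ hβ1 θ hB hφ hc hs
  have hI : lift β 1 θ '' B ⊆ O := image_subset_iff.2 hBO
  have key : ∀ g h : Cn m → ℝ, (∀ p ∉ tsupport ψ, h p = 0) → (∀ x ∉ B, g x = 0) →
      (∀ x ∈ B, h (lift β 1 θ x) = g x) → ∫ p in O, h p ∂(coneVolume m β) = ∫ x, g x := by
    intro g h h1 h1' h2
    have hw : Measurable fun p : Cn m => ENNReal.ofReal (β ^ 2 * ‖p.1‖ ^ (2 * β - 2)) := by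
      fun_prop
    rw [coneVolume, setIntegral_withDensity_eq_setIntegral_toReal_smul hw (by simp) _ hO.measurableSet,
      setIntegral_eq_of_subset_of_forall_sdiff_eq_zero hO.measurableSet hI,
      integral_image_eq_integral_abs_det_fderiv_smul volume hBo.measurableSet
        (fun x hx => (hasFDerivAt_lift β 1 θ
          (mem_slitPlane_of_sector (hB hx))).hasFDerivWithinAt),
      ← setIntegral_eq_integral_of_forall_compl_eq_zero (s := B) h1']
    · refine setIntegral_congr_fun hBo.measurableSet fun x hx => ?_
      have hd := abs_det_liftDeriv hβ (norm_one) θ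
        (fst_ne_zero_of_mem (mem_slitPlane_of_sector (hB hx)))
      simp only [smul_eq_mul]
      rw [ENNReal.toReal_ofReal (by positivity), ← mul_assoc, hd, one_mul, h2 x hx]
    · intro x hx y hy hxy
      rw [← sect_lift hβ θ (hB hx), hxy, sect_lift hβ θ (hB hy)]
    · intro p hp
      rw [h1 p fun h' => hp.2 (hψs h'), smul_zero]
  have h1 := h ψ hψ hψc fun p hp => by
    obtain ⟨x, hx, rfl⟩ := hψs hp
    exact ⟨hBO x hx, lift_fst_ne_zero _ _ _ _⟩
  rw [key (fun x => u (lift β 1 θ x) * lap φ x) _ (fun p hp => by rw [laplacian_eq_zero hp, mul_zero])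
      (fun x hx => by
        rw [image_eq_zero_of_notMem_tsupport (f := lap φ) fun h' => hx (hs (tsupport_lap_subset φ h')),
          mul_zero]) fun x hx => ?_,
    key (fun x => f (lift β 1 θ x) * φ x) _ (fun p hp => by
      rw [image_eq_zero_of_notMem_tsupport hp, mul_zero])
      (fun x hx => by
        rw [image_eq_zero_of_notMem_tsupport fun h' => hx (hs h'), mul_zero])
      fun x hx => by simp only [hψe x (hB hx)]] at h1
  · exact h1
  · rw [laplacian_lift hβ norm_one θ (mem_slitPlane_of_sector (hB hx))
      (hψ.contDiffAt.of_le (by norm_cast))]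
    congr 1
    refine lap_congr ?_
    filter_upwards [sector_mem_nhds (hB hx)] with y hy using hψe y hy

/-- The exceptional set upstairs is contained in the image of a null set under the differentiable
map `sect`, hence is null. -/
lemma ae_lift {β : ℝ} (hβ : 0 < β) (θ : ℝ) {P : Cn m → Prop} (h : ∀ᵐ p, P p) :
    ∀ᵐ x : Cn m, x ∈ sector m β → P (lift β 1 θ x) := by
  set N : Set (Cn m) := {p | ¬ P p} ∩
    {p | Complex.exp (-(θ * Complex.I)) * p.1 ∈ Complex.slitPlane}
  have h1 : volume (sect β θ '' N) = 0 := by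
    refine addHaar_image_eq_zero_of_differentiableOn_of_addHaar_eq_zero volume
      (fun p hp => ?_) (measure_mono_null inter_subset_left h)
    exact ((contDiffAt_sect β θ hp.2 (n := 1)).differentiableAt (by simp)).differentiableWithinAt
  refine measure_mono_null (fun x hx => ?_) h1
  simp only [mem_compl_iff, mem_ofPred_eq, Classical.not_imp] at hx
  exact ⟨lift β 1 θ x, ⟨hx.2, lift_mem_slit hβ θ hx.1⟩, sect_lift hβ θ hx.1⟩

lemma exists_lift_eq {β : ℝ} (hβ : 0 < β) (hβ1 : β ≤ 1) (p : Cn m) (hp : p.1 ≠ 0) :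
    ∃ x ∈ sector m β, lift β 1 (Complex.arg p.1) x = p := by
  have e : Complex.exp (-(Complex.arg p.1 * Complex.I)) * p.1 = (‖p.1‖ : ℝ) := by
    conv_lhs => rw [← Complex.norm_mul_exp_arg_mul_I p.1]
    rw [mul_comm, mul_assoc, ← Complex.exp_add]
    simp
  have hn : 0 < ‖p.1‖ := norm_pos_iff.2 hp
  refine ⟨sect β (Complex.arg p.1) p, ?_, lift_sect hβ hβ1 _ hp⟩
  have e2 : (sect β (Complex.arg p.1) p).1 = (Real.exp (β * Real.log ‖p.1‖) : ℝ) := by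
    rw [sect_eq, e, ← Complex.ofReal_log hn.le]
    push_cast
    rfl
  rw [sector, mem_ofPred_eq, e2, Complex.ofReal_re, Complex.arg_ofReal_of_nonneg (Real.exp_pos _).le]
  simp [Real.exp_pos, hβ, Real.pi_pos]

/-! ### Gluing local representatives into a classical solution off the divisor -/

lemma laplacian_congr {β : ℝ} {v w : Cn m → ℝ} {p : Cn m} (h : v =ᶠ[𝓝 p] w) :
    laplacian β v p = laplacian β w p := by
  have h1 : ∀ j, D β j v =ᶠ[𝓝 p] D β j w := fun j => by
    filter_upwards [h.fderiv (𝕜 := ℝ)] with z hz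
    rw [D, D, hz]
  have h2 : ∀ j, D β j v p = D β j w p := fun j => (h1 j).self_of_nhds
  refine Finset.sum_congr rfl fun i _ => ?_
  have h3 : D β i (D β i v) p = D β i (D β i w) p := by rw [D, (h1 i).fderiv_eq]; rfl
  simp only [hess, h3, connection, h2]

lemma eqOn_of_ae {N : Set (Cn m)} (hN : IsOpen N) {V W u : Cn m → ℝ} (hV : ContinuousOn V N)
    (hW : ContinuousOn W N) (h1 : ∀ᵐ q, q ∈ N → V q = u q) (h2 : ∀ᵐ q, q ∈ N → W q = u q) :
    EqOn V W N := by
  refine Measure.eqOn_open_of_ae_eq (μ := volume) ?_ hN hV hW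
  rw [EventuallyEq, ae_restrict_iff' hN.measurableSet]
  filter_upwards [h1, h2] with z h1 h2 hz
  rw [h1 hz, h2 hz]

/-- Local `C²` representatives of a function can be glued. -/
lemma exists_glue {Ω : Set (Cn m)} {u : Cn m → ℝ}
    (h : ∀ p ∈ Ω, ∃ (N : Set (Cn m)) (V : Cn m → ℝ), IsOpen N ∧ p ∈ N ∧ N ⊆ Ω ∧
      ContDiffOn ℝ 2 V N ∧ ∀ᵐ q, q ∈ N → V q = u q) :
    ∃ v : Cn m → ℝ, ContDiffOn ℝ 2 v Ω ∧ ∀ᵐ q, q ∈ Ω → v q = u q := by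
  choose! N V hN hpN hNΩ hV hVu using h
  -- The value at q comes from the neighbourhood chosen at q. The choice is immaterial, since
  -- continuous representatives of the same u agree on overlaps.
  set v : Cn m → ℝ := fun q => V q q
  have hv : ∀ p ∈ Ω, ∀ q ∈ N p, v q = V p q := by
    intro p hp q hq
    have hq' := hNΩ p hp hq
    exact eqOn_of_ae ((hN p hp).inter (hN q hq'))
      ((hV q hq').continuousOn.mono inter_subset_right)
      ((hV p hp).continuousOn.mono inter_subset_left)
      ((hVu q hq').mono fun z h hz => h hz.2) ((hVu p hp).mono fun z h hz => h hz.1)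
      ⟨hq, hpN q hq'⟩
  refine ⟨v, fun p hp => ?_, ?_⟩
  · refine (((hV p hp).contDiffAt ((hN p hp).mem_nhds (hpN p hp))).congr_of_eventuallyEq
      ?_).contDiffWithinAt
    filter_upwards [(hN p hp).mem_nhds (hpN p hp)] with q hq using hv p hp q hq
  · have h1 : volume {q | q ∈ Ω ∧ v q ≠ u q} = 0 := by
      refine measure_null_of_locally_null _ fun p hp => ?_
      refine ⟨N p ∩ {q | q ∈ Ω ∧ v q ≠ u q}, inter_comm (N p) _ ▸
        inter_mem_nhdsWithin _ ((hN p hp.1).mem_nhds (hpN p hp.1)), ?_⟩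
      refine measure_mono_null (fun q hq => ?_) (hVu p hp.1)
      simp only [mem_compl_iff, mem_ofPred_eq, Classical.not_imp]
      exact ⟨hq.1, by rw [← hv p hp.1 q hq.1]; exact hq.2.2⟩
    refine measure_mono_null (fun q hq => ?_) h1
    simpa using hq

/-- The Hölder condition for the cone distance, in terms of real numbers. -/
def ConeHolder (β α A : ℝ) (O : Set (Cn m)) (f : Cn m → ℝ) : Prop :=
  ∀ x ∈ O, ∀ y ∈ O, ENNReal.ofReal |f x - f y| ≤ ENNReal.ofReal A * coneDist β x y ^ α

lemma ConeHolder.lift_le {β α A : ℝ} {O : Set (Cn m)} {f : Cn m → ℝ} (hf : ConeHolder β α A O f)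
    (hβ : 0 < β) (hα : 0 ≤ α) (hA : 0 ≤ A) {a : ℂ} (ha : ‖a‖ = 1) (θ : ℝ) {x y : Cn m}
    (hx : 0 < (a * x.1).re) (hy : 0 < (a * y.1).re) (hxO : lift β a θ x ∈ O)
    (hyO : lift β a θ y ∈ O) :
    |f (lift β a θ x) - f (lift β a θ y)| ≤ A * √(sqNorm (x - y)) ^ α := by
  have h1 := (hf _ hxO _ hyO).trans (mul_le_mul_right
    (ENNReal.rpow_le_rpow (coneDist_lift_le hβ ha θ hx hy) hα) _)
  rw [ENNReal.ofReal_rpow_of_nonneg (Real.sqrt_nonneg _) hα, ← ENNReal.ofReal_mul hA] at h1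
  exact (ENNReal.ofReal_le_ofReal_iff (by positivity)).1 h1

lemma sqrt_sqNorm_rpow_le {α : ℝ} (hα : 0 ≤ α) (x : Cn m) :
    √(sqNorm x) ^ α ≤ √(m + 1) ^ α * ‖x‖ ^ α := by
  rw [← Real.mul_rpow (Real.sqrt_nonneg _) (norm_nonneg _)]
  refine Real.rpow_le_rpow (Real.sqrt_nonneg _) ?_ hα
  refine (Real.sqrt_le_sqrt (sqNorm_le x)).trans_eq ?_
  rw [Real.sqrt_mul (by positivity), Real.sqrt_sq (norm_nonneg x)]

/-- The standing assumptions on the equation `Δ u = f` on an open set. -/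
structure IsConeSolution (β α A M : ℝ) (O : Set (Cn m)) (u f : Cn m → ℝ) : Prop where
  isOpen : IsOpen O
  aesm : AEStronglyMeasurable u (volume.restrict O)
  bound : ∀ᵐ p, p ∈ O → |u p| ≤ M
  holder : ConeHolder β α A O f
  weak : IsWeakSolution β O u f

section regularity
variable {β α A M : ℝ} {O : Set (Cn m)} {u f : Cn m → ℝ} (h : IsConeSolution β α A M O u f)
  (hβ : 0 < β) (hβ1 : β ≤ 1) (hα : 0 < α) (hα1 : α < 1) (hA : 0 ≤ A) (hM : 0 ≤ M)
include h hβ hβ1 hα hα1 hA hM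

/-- A small ball in a sector chart carries the equation to the Euclidean one. There
`exists_schauder` applies with a full set of good points, and `sect` transports the result back. -/
lemma IsConeSolution.exists_local {p : Cn m} (hp : p ∈ O \ divisor m) :
    ∃ (N : Set (Cn m)) (V : Cn m → ℝ), IsOpen N ∧ p ∈ N ∧ N ⊆ O \ divisor m ∧
      ContDiffOn ℝ 2 V N ∧ (∀ᵐ q, q ∈ N → V q = u q) ∧ ∀ q ∈ N, laplacian β V q = f q := by
  obtain ⟨x₀, hx₀, hxp⟩ := exists_lift_eq hβ hβ1 p hp.2
  set θ := Complex.arg p.1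
  have hcont : ∀ {x : Cn m}, x ∈ sector m β → ContinuousAt (lift β 1 θ) x := fun hx =>
    (hasFDerivAt_lift β 1 θ (mem_slitPlane_of_sector hx)).continuousAt
  have hn : ∀ᶠ x in 𝓝 x₀, x ∈ sector m β ∧ lift β 1 θ x ∈ O :=
    Filter.Eventually.and (sector_mem_nhds hx₀)
      ((hcont hx₀).eventually_mem (h.isOpen.mem_nhds (by rw [hxp]; exact hp.1)))
  obtain ⟨ε, hε, hball⟩ := Metric.eventually_nhds_iff_ball.1 hn
  set t := ε / 4
  have ht : 0 < t := by positivity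
  have e4 : 4 * t = ε := by simp only [t]; ring
  have hsub : ball x₀ (2 * t) ⊆ ball x₀ (4 * t) := ball_subset_ball (by linarith)
  rw [← e4] at hball
  have hS : ball x₀ (4 * t) ⊆ sector m β := fun x hx => (hball x hx).1
  have hcO : ContinuousOn (lift (m := m) β 1 θ) (ball x₀ (4 * t)) := fun x hx =>
    (hcont (hS hx)).continuousWithinAt
  have hre : ∀ {x : Cn m}, x ∈ sector m β → 0 < (1 * x.1).re := fun hx => by
    rw [one_mul]; exact hx.1
  obtain ⟨C, -, hSch⟩ := exists_schauder m hα hα1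
  have hfh : ∀ x ∈ ball x₀ (4 * t), ∀ y ∈ ball x₀ (4 * t),
      |f (lift β 1 θ x) - f (lift β 1 θ y)| ≤ A * √(m + 1) ^ α * ‖x - y‖ ^ α := fun x hx y hy => by
    refine (h.holder.lift_le hβ hα.le hA norm_one θ (hre (hS hx)) (hre (hS hy)) (hball x hx).2
      (hball y hy).2).trans ?_
    rw [mul_assoc]
    exact mul_le_mul_of_nonneg_left (sqrt_sqNorm_rpow_le hα.le _) hA
  have hfc : ContinuousOn (fun x => f (lift β 1 θ x)) (ball x₀ (4 * t)) := by
    have : HolderOnWith (A * √(m + 1) ^ α).toNNReal α.toNNReal (fun x => f (lift β 1 θ x))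
        (ball x₀ (4 * t)) := fun x hx y hy => by
      rw [edist_dist, edist_dist, ← ENNReal.ofReal_coe_nnreal, ENNReal.ofReal_rpow_of_nonneg
        dist_nonneg (by simp), ← ENNReal.ofReal_mul (by simp), Real.coe_toNNReal _ (by positivity),
        Real.coe_toNNReal _ hα.le, Real.dist_eq, dist_eq_norm]
      exact ENNReal.ofReal_le_ofReal (hfh x hx y hy)
    exact this.continuousOn (by simpa using hα)
  have hum : AEStronglyMeasurable (fun x => u (lift β 1 θ x)) (volume.restrict (ball x₀ (4 * t))) := by
    obtain ⟨u', hu', huu⟩ := h.aesm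
    rw [EventuallyEq, ae_restrict_iff' h.isOpen.measurableSet] at huu
    refine (hu'.measurable.comp_aemeasurable
      (hcO.aemeasurable measurableSet_ball)).aestronglyMeasurable.congr ?_
    rw [EventuallyEq, ae_restrict_iff' measurableSet_ball]
    filter_upwards [ae_lift hβ θ huu] with x hx hxB
    exact (hx (hS hxB) (hball x hxB).2).symm
  obtain ⟨v, hv, hvu, hvf, -⟩ := hSch x₀ t M (A * √(m + 1) ^ α) (fun x => u (lift β 1 θ x))
    (fun x => f (lift β 1 θ x)) univ ht hM (by positivity) hum
    (hfc.aestronglyMeasurable measurableSet_ball)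
    (by filter_upwards [ae_lift hβ θ h.bound] with x hx hxB using hx (hS hxB) (hball x hxB).2)
    (by simp) (fun x hx _ y hy _ => hfh x hx y hy)
    (WeakOn.of_isWeakSolution hβ hβ1 θ h.isOpen hS isOpen_ball (fun x hx => (hball x hx).2) h.weak)
  have hS2 : ball x₀ (2 * t) ⊆ sector m β := hsub.trans hS
  set U : Set (Cn m) := {p | Complex.exp (-(θ * Complex.I)) * p.1 ∈ Complex.slitPlane}
  have hU : IsOpen U := Complex.isOpen_slitPlane.preimage (continuous_const.mul continuous_fst)
  have hsc : ContinuousOn (sect (m := m) β θ) U := fun q hq =>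
    (contDiffAt_sect β θ hq (n := 0)).continuousAt.continuousWithinAt
  set N : Set (Cn m) := U ∩ sect β θ ⁻¹' ball x₀ (2 * t)
  have hN : IsOpen N := hsc.isOpen_inter_preimage hU isOpen_ball
  have hNl : ∀ q ∈ N, lift β 1 θ (sect β θ q) = q := fun q hq =>
    lift_sect hβ hβ1 θ (fst_ne_zero_of_mem hq.1)
  have hVc : ContDiffOn ℝ 2 (fun q => v (sect β θ q)) N := fun q hq =>
    ((hv.contDiffAt (isOpen_ball.mem_nhds hq.2)).comp q (contDiffAt_sect β θ hq.1)).contDiffWithinAt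
  refine ⟨N, fun q => v (sect β θ q), hN, ?_, ?_, hVc, ?_, ?_⟩
  · rw [← hxp]
    refine ⟨lift_mem_slit hβ θ hx₀, ?_⟩
    rw [mem_preimage, sect_lift hβ θ hx₀]
    exact mem_ball_self (by positivity)
  · intro q hq
    rw [← hNl q hq]
    exact ⟨(hball _ (hsub hq.2)).2, lift_fst_ne_zero _ _ _ _⟩
  · have h1 : volume (lift β 1 θ '' {x | x ∈ ball x₀ (2 * t) ∧ v x ≠ u (lift β 1 θ x)}) = 0 := by
      refine addHaar_image_eq_zero_of_differentiableOn_of_addHaar_eq_zero volume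
        (fun x hx => ((hasFDerivAt_lift β 1 θ
          (mem_slitPlane_of_sector (hS2 hx.1))).differentiableAt).differentiableWithinAt)
        (measure_mono_null (fun x hx => ?_) hvu)
      simpa using hx
    refine measure_mono_null (fun q hq => ?_) h1
    simp only [mem_compl_iff, mem_ofPred_eq, Classical.not_imp] at hq
    refine ⟨sect β θ q, ⟨hq.1.2, ?_⟩, hNl q hq.1⟩
    rw [hNl q hq.1]
    exact hq.2
  · intro q hq
    have e := laplacian_lift hβ norm_one θ (mem_slitPlane_of_sector (hS2 hq.2))
      (v := fun q => v (sect β θ q)) (by rw [hNl q hq]; exact hVc.contDiffAt (hN.mem_nhds hq))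
    rw [hNl q hq] at e
    have h2 : (fun y => v (sect β θ (lift β 1 θ y))) =ᶠ[𝓝 (sect β θ q)] v := by
      filter_upwards [sector_mem_nhds (hS2 hq.2)] with y hy
      rw [sect_lift hβ θ hy]
    rw [e, lap_congr h2, hvf _ hq.2 (mem_univ _), hNl q hq]

lemma IsConeSolution.exists_rep : ∃ v : Cn m → ℝ, ContDiffOn ℝ 2 v (O \ divisor m) ∧
    (∀ᵐ q, q ∈ O → v q = u q) ∧ (∀ q ∈ O \ divisor m, laplacian β v q = f q) ∧
    ∀ q ∈ O \ divisor m, |v q| ≤ M := by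
  have hO : IsOpen (O \ divisor m) := h.isOpen.sdiff isClosed_divisor
  obtain ⟨v, hvc, hvu⟩ := exists_glue (Ω := O \ divisor m) (u := u) fun p hp => by
    obtain ⟨N, V, h1, h2, h3, h4, h5, -⟩ := h.exists_local hβ hβ1 hα hα1 hA hM hp
    exact ⟨N, V, h1, h2, h3, h4, h5⟩
  refine ⟨v, hvc, ?_, fun q hq => ?_, fun q hq => ?_⟩
  · filter_upwards [hvu, measure_eq_zero_iff_ae_notMem.1 (volume_divisor (m := m))] with q h1 h2 h3
      using h1 ⟨h3, h2⟩
  · obtain ⟨N, V, h1, h2, h3, h4, h5, h6⟩ := h.exists_local hβ hβ1 hα hα1 hA hM hq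
    rw [← h6 q h2]
    refine laplacian_congr ?_
    filter_upwards [h1.mem_nhds h2] with z hz
    exact eqOn_of_ae h1 (hvc.continuousOn.mono h3) h4.continuousOn
      (hvu.mono fun z h hz => h (h3 hz)) h5 hz
  -- By continuity a violation of the bound would persist on a nonempty open set, which has positive
  -- measure.
  · by_contra hc
    rw [not_le] at hc
    have hw : IsOpen ((O \ divisor m) ∩ (fun q => |v q|) ⁻¹' Ioi M) :=
      hvc.continuousOn.abs.isOpen_inter_preimage hO isOpen_Ioi
    have h1 := hw.measure_pos volume ⟨q, hq, hc⟩
    refine h1.ne' (measure_mono_null (fun z hz => ?_)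
      (ae_iff.1 (hvu.and h.bound)))
    intro hcon
    have := hcon.2 hz.1.1
    rw [← hcon.1 hz.1] at this
    exact (not_le.2 hz.2) this

end regularity

/-! ### Second derivatives of functions of one variable -/

/-- `g` has second derivative `d` at `x`. -/
def HasSnd (g : ℝ → ℝ) (d x : ℝ) : Prop :=
  ∃ g' : ℝ → ℝ, (∀ᶠ s in 𝓝 x, HasDerivAt g (g' s) s) ∧ HasDerivAt g' d x

namespace HasSnd
variable {g h : ℝ → ℝ} {d e x : ℝ}

lemma add (hg : HasSnd g d x) (hh : HasSnd h e x) : HasSnd (fun s => g s + h s) (d + e) x := by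
  obtain ⟨g', a1, a2⟩ := hg
  obtain ⟨h', b1, b2⟩ := hh
  exact ⟨fun s => g' s + h' s, (a1.and b1).mono fun s hs => hs.1.fun_add hs.2, a2.fun_add b2⟩

lemma sub (hg : HasSnd g d x) (hh : HasSnd h e x) : HasSnd (fun s => g s - h s) (d - e) x := by
  obtain ⟨g', a1, a2⟩ := hg
  obtain ⟨h', b1, b2⟩ := hh
  exact ⟨fun s => g' s - h' s, (a1.and b1).mono fun s hs => hs.1.fun_sub hs.2, a2.fun_sub b2⟩

lemma const_mul (c : ℝ) (hg : HasSnd g d x) : HasSnd (fun s => c * g s) (c * d) x := by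
  obtain ⟨g', a1, a2⟩ := hg
  exact ⟨fun s => c * g' s, a1.mono fun s hs => hs.const_mul c, a2.const_mul c⟩

lemma mul_const (hg : HasSnd g d x) (c : ℝ) : HasSnd (fun s => g s * c) (d * c) x := by
  simpa only [mul_comm] using hg.const_mul c

lemma const (c x : ℝ) : HasSnd (fun _ => c) 0 x :=
  ⟨fun _ => 0, Eventually.of_forall fun s => hasDerivAt_const s c, hasDerivAt_const x 0⟩

lemma sum {ι : Type*} {S : Finset ι} {g : ι → ℝ → ℝ} {d : ι → ℝ}
    (h : ∀ i ∈ S, HasSnd (g i) (d i) x) : HasSnd (fun s => ∑ i ∈ S, g i s) (∑ i ∈ S, d i) x := by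
  classical
  induction S using Finset.induction_on with
  | empty => simpa using const 0 x
  | insert i S hi ih =>
    simp only [Finset.sum_insert hi]
    exact (h i (by simp)).add (ih fun j hj => h j (by simp [hj]))

lemma const_add_comp (c : ℝ) (hg : HasSnd g d (c + x)) : HasSnd (fun s => g (c + s)) d x := by
  obtain ⟨g', a1, a2⟩ := hg
  refine ⟨fun s => g' (c + s), ?_, a2.comp_const_add c x⟩
  exact ((continuous_const.add continuous_id).tendsto' x (c + x) rfl).eventually
    (p := fun y => HasDerivAt g (g' y) y) a1 |>.mono fun s hs => hs.comp_const_add c s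

lemma const_sub_comp (c : ℝ) (hg : HasSnd g d (c - x)) : HasSnd (fun s => g (c - s)) d x := by
  obtain ⟨g', a1, a2⟩ := hg
  refine ⟨fun s => -g' (c - s), ?_, by simpa using (a2.comp_const_sub c x).fun_neg⟩
  exact ((continuous_const.sub continuous_id).tendsto' x (c - x) rfl).eventually
    (p := fun y => HasDerivAt g (g' y) y) a1 |>.mono fun s hs => hs.comp_const_sub c s

lemma exp (c x : ℝ) : HasSnd (fun s => Real.exp (c * s)) (c ^ 2 * Real.exp (c * x)) x := by
  have h : ∀ s, HasDerivAt (fun s => Real.exp (c * s)) (c * Real.exp (c * s)) s := fun s => by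
    simpa [mul_comm] using ((hasDerivAt_id s).const_mul c).exp
  refine ⟨_, Eventually.of_forall h, ((h x).const_mul c).congr_deriv ?_⟩
  ring

lemma cos (c x : ℝ) : HasSnd (fun s => Real.cos (c * s)) (-c ^ 2 * Real.cos (c * x)) x := by
  have h : ∀ s, HasDerivAt (fun s => Real.cos (c * s)) (-c * Real.sin (c * s)) s := fun s => by
    simpa [mul_comm] using ((hasDerivAt_id s).const_mul c).cos
  have h' : HasDerivAt (fun s => Real.sin (c * s)) (c * Real.cos (c * x)) x := by
    simpa [mul_comm] using ((hasDerivAt_id x).const_mul c).sin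
  refine ⟨_, Eventually.of_forall h, (h'.const_mul (-c)).congr_deriv ?_⟩
  ring

lemma affine_pow (n : ℕ) (c e x : ℝ) : HasSnd (fun s => (c + s * e) ^ n)
    (n * (n - 1 : ℕ) * (c + x * e) ^ (n - 2) * e ^ 2) x := by
  have h : ∀ (n : ℕ) (s : ℝ), HasDerivAt (fun s => (c + s * e) ^ n) (n * (c + s * e) ^ (n - 1) * e) s :=
    fun n s => by
      simpa using (((hasDerivAt_id s).mul_const e).const_add c).fun_pow n
  refine ⟨_, Eventually.of_forall (h n), (((h (n - 1) x).const_mul (n : ℝ)).mul_const e).congr_deriv ?_⟩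
  rw [show n - 1 - 1 = n - 2 by omega]
  ring

/-- If d < 0, the second derivative test applied to -g makes x a local maximum of g as well; then g
is locally constant and d = 0. -/
lemma nonneg_of_isLocalMin (hg : HasSnd g d x) (hx : IsLocalMin g x) : 0 ≤ d := by
  obtain ⟨g', a1, a2⟩ := hg
  by_contra hd
  rw [not_le] at hd
  have e1 : deriv g =ᶠ[𝓝 x] g' := a1.mono fun s hs => hs.deriv
  have h2 : 0 < deriv (deriv fun s => -g s) x := by
    have e2 : deriv (fun s => -g s) =ᶠ[𝓝 x] fun s => -g' s := a1.mono fun s hs => hs.fun_neg.deriv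
    rw [e2.deriv_eq, a2.fun_neg.deriv]
    linarith
  have h3 := isLocalMin_of_deriv_deriv_pos h2
    (by rw [a1.self_of_nhds.fun_neg.deriv, ← a1.self_of_nhds.deriv, hx.deriv_eq_zero, neg_zero])
    a1.self_of_nhds.continuousAt.neg
  have e3 : g =ᶠ[𝓝 x] fun _ => g x := by
    filter_upwards [hx, h3] with s h4 h5
    linarith
  have e4 : g' =ᶠ[𝓝 x] fun _ => 0 := by
    filter_upwards [e1, e3.eventuallyEq_nhds] with s h6 h7
    rw [← h6, h7.deriv_eq, deriv_const]
  have := a2.unique ((hasDerivAt_const x (0 : ℝ)).congr_of_eventuallyEq e4)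
  linarith

end HasSnd

/-! ### Polar coordinates of the cone -/

/-- The point with `r = e^σ` and angle `θ`. -/
def pol (β σ θ : ℝ) (z : Fin m → ℂ) : Cn m := (Complex.exp ((σ / β : ℝ) + θ * Complex.I), z)

lemma pol_fst_ne_zero (β σ θ : ℝ) (z : Fin m → ℂ) : (pol β σ θ z).1 ≠ 0 := Complex.exp_ne_zero _

lemma norm_pol (β σ θ : ℝ) (z : Fin m → ℂ) : ‖(pol β σ θ z).1‖ = Real.exp (σ / β) := by
  rw [pol, Complex.norm_exp]
  simp

lemma rad_pol {β : ℝ} (hβ : 0 < β) (σ θ : ℝ) (z : Fin m → ℂ) :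
    rad β (pol β σ θ z) = Real.exp σ := by
  rw [rad, norm_pol, ← Real.exp_mul, div_mul_cancel₀ _ hβ.ne']

lemma pol_add_two_pi (β σ θ : ℝ) (z : Fin m → ℂ) (n : ℤ) :
    pol β σ (θ + n * (2 * Real.pi)) z = pol β σ θ z := by
  rw [pol, pol]
  ext1
  · simp only
    refine Complex.exp_eq_exp_iff_exists_int.2 ⟨n, ?_⟩
    push_cast
    ring
  · rfl

lemma lift_eq_pol {β : ℝ} {a : ℂ} (ha : ‖a‖ = 1) (θ : ℝ) (x : Cn m) :
    lift β a θ x = pol β (Real.log ‖x.1‖) (θ + Complex.arg (a * x.1) / β) x.2 := by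
  rw [lift, pol, Complex.log, norm_mul, ha, one_mul]
  ext1
  · simp only
    push_cast
    congr 1
    ring
  · rfl

lemma pol_eq_lift {β : ℝ} (hβ : 0 < β) (σ θ φ : ℝ) (z : Fin m → ℂ) (h1 : -Real.pi < β * φ)
    (h2 : β * φ ≤ Real.pi) :
    pol β σ (θ + φ) z = lift β 1 θ (Complex.exp (σ + (β * φ : ℝ) * Complex.I), z) := by
  have hβ' : (β : ℂ) ≠ 0 := by exact_mod_cast hβ.ne'
  rw [lift_one_eq, pol]
  simp only
  rw [Complex.log_exp (by simpa using h1) (by simpa using h2)]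
  ext1
  · simp only
    push_cast
    congr 1
    field_simp
    ring
  · rfl

lemma hasDerivAt_pol_sigma {β : ℝ} (hβ : 0 < β) (σ θ : ℝ) (z : Fin m → ℂ) :
    HasDerivAt (fun s => pol β s θ z) (Real.exp σ • frame β (.inl 0) (pol β σ θ z)) σ := by
  have h1 : HasDerivAt (fun s : ℝ => ((s / β : ℝ) : ℂ) + θ * Complex.I) ((1 / β : ℝ) : ℂ) σ :=
    (((hasDerivAt_id σ).div_const β).ofReal_comp).add_const _
  refine (h1.cexp.prodMk (hasDerivAt_const σ z)).congr_deriv ?_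
  rw [frame_inl, rad_pol hβ, unit_zero, one_mul]
  have hβ' : (β : ℂ) ≠ 0 := by exact_mod_cast hβ.ne'
  have he : ((Real.exp σ : ℝ) : ℂ) ≠ 0 := by exact_mod_cast (Real.exp_pos σ).ne'
  ext1
  · simp only [Prod.smul_fst, Complex.real_smul, pol]
    push_cast at he ⊢
    field_simp
  · simp

lemma hasDerivAt_pol_theta {β : ℝ} (hβ : 0 < β) (σ θ : ℝ) (z : Fin m → ℂ) :
    HasDerivAt (fun s => pol β σ s z) ((β * Real.exp σ) • frame β (.inl 1) (pol β σ θ z)) θ := by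
  have h1 : HasDerivAt (fun s : ℝ => ((σ / β : ℝ) : ℂ) + s * Complex.I) (1 * Complex.I) θ :=
    ((hasDerivAt_id θ).ofReal_comp.mul_const _).const_add _
  refine (h1.cexp.prodMk (hasDerivAt_const θ z)).congr_deriv ?_
  rw [frame_inl, rad_pol hβ, unit_one]
  have hβ' : (β : ℂ) ≠ 0 := by exact_mod_cast hβ.ne'
  have he : ((Real.exp σ : ℝ) : ℂ) ≠ 0 := by exact_mod_cast (Real.exp_pos σ).ne'
  ext1
  · simp only [Prod.smul_fst, Complex.real_smul, pol]
    push_cast at he ⊢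
    field_simp
  · simp

lemma hasDerivAt_comp_frame {β : ℝ} {v : Cn m → ℝ} {γ : ℝ → Cn m} {c t : ℝ} {i : Idx m}
    (hv : DifferentiableAt ℝ v (γ t)) (hγ : HasDerivAt γ (c • frame β i (γ t)) t) :
    HasDerivAt (fun s => v (γ s)) (c * D β i v (γ t)) t := by
  refine (hv.hasFDerivAt.comp_hasDerivAt t hγ).congr_deriv ?_
  simp [D]

/-- Second derivatives along integral curves of the frame. -/
lemma hasSnd_comp_frame {β : ℝ} (hβ : 0 < β) {O : Set (Cn m)} (hO : IsOpen O) {v : Cn m → ℝ}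
    (hv : ContDiffOn ℝ 2 v (O \ divisor m)) {γ : ℝ → Cn m} {c : ℝ → ℝ} {c' t : ℝ} {i : Idx m}
    (ht : γ t ∈ O \ divisor m) (hγ : ∀ s, HasDerivAt γ (c s • frame β i (γ s)) s)
    (hc : HasDerivAt c c' t) :
    HasSnd (fun s => v (γ s))
      (c' * D β i v (γ t) + c t ^ 2 * D β i (D β i v) (γ t)) t := by
  have hO' : IsOpen (O \ divisor m) := hO.sdiff isClosed_divisor
  have hcv : ∀ p ∈ O \ divisor m, ContDiffAt ℝ 2 v p := fun p hp => hv.contDiffAt (hO'.mem_nhds hp)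
  refine ⟨fun s => c s * D β i v (γ s), ?_, ?_⟩
  · filter_upwards [(hγ t).continuousAt.eventually_mem (hO'.mem_nhds ht)] with s hs
    exact hasDerivAt_comp_frame ((hcv _ hs).differentiableAt (by simp)) (hγ s)
  · have h := hc.fun_mul (hasDerivAt_comp_frame (differentiableAt_D hβ ht.2 (hcv _ ht) i) (hγ t))
    refine h.congr_deriv ?_
    ring

/-! ### Angular oscillation -/

/-- Angles within π of θ are scaled by β ≤ 1/4 into |arg| ≤ π/4 in the chart. Both points thus lie
in the half-plane where the cone distance is at most the Euclidean one, which is at most 2 e^σ. -/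
lemma ConeHolder.pol_le {β α A : ℝ} {O : Set (Cn m)} {f : Cn m → ℝ} (hf : ConeHolder β α A O f)
    (hβ : 0 < β) (hβ1 : β ≤ 1 / 4) (hα : 0 ≤ α) (hα1 : α ≤ 1) (hA : 0 ≤ A) {σ θ φ φ' : ℝ}
    {z : Fin m → ℂ} (hφ : |φ| ≤ Real.pi) (hφ' : |φ'| ≤ Real.pi) (h1 : pol β σ (θ + φ) z ∈ O)
    (h2 : pol β σ (θ + φ') z ∈ O) :
    |f (pol β σ (θ + φ) z) - f (pol β σ (θ + φ') z)| ≤ 2 * A * Real.exp (α * σ) := by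
  have hpi := Real.pi_pos
  have key : ∀ ψ : ℝ, |ψ| ≤ Real.pi → pol β σ (θ + ψ) z =
      lift β 1 θ (Complex.exp (σ + (β * ψ : ℝ) * Complex.I), z) ∧
      0 < (1 * (Complex.exp (σ + (β * ψ : ℝ) * Complex.I))).re ∧
      ‖Complex.exp (σ + (β * ψ : ℝ) * Complex.I)‖ = Real.exp σ := by
    intro ψ hψ
    have h4 : |β * ψ| ≤ Real.pi / 4 := by
      rw [abs_mul, abs_of_pos hβ]
      calc β * |ψ| ≤ 1 / 4 * Real.pi := mul_le_mul hβ1 hψ (abs_nonneg _) (by norm_num)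
        _ = _ := by ring
    rw [abs_le] at h4
    refine ⟨pol_eq_lift hβ σ θ ψ z (by linarith) (by linarith), ?_, ?_⟩
    · rw [one_mul, Complex.exp_re]
      have : 0 < Real.cos (β * ψ) := Real.cos_pos_of_mem_Ioo ⟨by linarith, by linarith⟩
      have h5 := mul_pos (Real.exp_pos σ) this
      simpa using h5
    · rw [Complex.norm_exp]; simp
  obtain ⟨e1, r1, n1⟩ := key φ hφ
  obtain ⟨e2, r2, n2⟩ := key φ' hφ'
  rw [e1] at h1 ⊢
  rw [e2] at h2 ⊢
  refine (hf.lift_le hβ hα hA norm_one θ r1 r2 h1 h2).trans ?_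
  have h6 : √(sqNorm (((Complex.exp (σ + (β * φ : ℝ) * Complex.I), z) : Cn m) -
      (Complex.exp (σ + (β * φ' : ℝ) * Complex.I), z))) ≤ 2 * Real.exp σ := by
    rw [sqNorm_eq]
    simp only [Prod.fst_sub, Prod.snd_sub, sub_self, Pi.zero_apply, norm_zero]
    simp only [ne_eq, OfNat.ofNat_ne_zero, not_false_eq_true, zero_pow, Finset.sum_const_zero,
      add_zero]
    rw [Real.sqrt_sq (norm_nonneg _)]
    refine (norm_sub_le _ _).trans ?_
    rw [n1, n2]
    linarith
  calc _ ≤ A * (2 * Real.exp σ) ^ α := by gcongr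
    _ = A * (2 ^ α * Real.exp (α * σ)) := by
        rw [Real.mul_rpow (by norm_num) (Real.exp_pos _).le, ← Real.exp_mul, mul_comm σ]
    _ ≤ A * (2 * Real.exp (α * σ)) := by
        gcongr
        calc (2 : ℝ) ^ α ≤ 2 ^ (1 : ℝ) := Real.rpow_le_rpow_of_exponent_le (by norm_num) hα1
          _ = 2 := Real.rpow_one 2
    _ = _ := by ring

/-- The power sums of the tangential real coordinates centred at `z₀`. -/
def powSum (n : ℕ) (z₀ z : Fin m → ℂ) : ℝ := ∑ i : Fin m × Fin 2, co (.inr i) (0, z - z₀) ^ n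

lemma powSum_nonneg {n : ℕ} (hn : Even n) (z₀ z : Fin m → ℂ) : 0 ≤ powSum n z₀ z :=
  Finset.sum_nonneg fun _ _ => hn.pow_nonneg _

lemma powSum_self {n : ℕ} (hn : n ≠ 0) (z : Fin m → ℂ) : powSum n z z = 0 := by
  refine Finset.sum_eq_zero fun i _ => ?_
  rw [sub_self, show ((0, 0) : Cn m) = 0 from rfl, map_zero, zero_pow hn]

lemma continuous_powSum (n : ℕ) (z₀ : Fin m → ℂ) : Continuous (powSum n z₀) :=
  continuous_finsetSum _ fun i _ => ((co (.inr i)).continuous.comp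
    (continuous_const.prodMk (continuous_id.sub continuous_const))).pow n

/-- Some complex coordinate has modulus at least δ, and a⁴ + b⁴ ≥ (a² + b²)² / 2. -/
lemma le_powSum_four {z₀ z : Fin m → ℂ} {δ : ℝ} (hδ : 0 < δ) (h : δ ≤ ‖z - z₀‖) :
    δ ^ 4 / 2 ≤ powSum 4 z₀ z := by
  obtain ⟨j, hj⟩ : ∃ j, δ ≤ ‖(z - z₀) j‖ := by
    by_contra! hc
    exact absurd h (not_le.2 ((pi_norm_lt_iff hδ).2 hc))
  have h1 : δ ^ 2 ≤ ((z - z₀) j).re ^ 2 + ((z - z₀) j).im ^ 2 := by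
    have : ‖(z - z₀) j‖ ^ 2 = ((z - z₀) j).re ^ 2 + ((z - z₀) j).im ^ 2 := by
      rw [Complex.sq_norm, Complex.normSq_apply]; ring
    rw [← this]
    gcongr
  have h2 : ∑ k : Fin 2, co (.inr (j, k)) ((0, z - z₀) : Cn m) ^ 4 ≤ powSum 4 z₀ z := by
    rw [powSum, Fintype.sum_prod_type]
    exact Finset.single_le_sum (f := fun j => ∑ k : Fin 2, co (.inr (j, k)) ((0, z - z₀) : Cn m) ^ 4)
      (fun _ _ => by positivity) (Finset.mem_univ j)
  rw [Fin.sum_univ_two, co_inr_zero, co_inr_one] at h2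
  refine le_trans ?_ h2
  have h3 : δ ^ 4 ≤ (((z - z₀) j).re ^ 2 + ((z - z₀) j).im ^ 2) ^ 2 := by
    calc δ ^ 4 = (δ ^ 2) ^ 2 := by ring
      _ ≤ _ := by gcongr
  simp only
  nlinarith [sq_nonneg (((z - z₀) j).re ^ 2 - ((z - z₀) j).im ^ 2)]

lemma hasSnd_powSum (n : ℕ) (z₀ z : Fin m → ℂ) (j : Fin m × Fin 2) :
    HasSnd (fun s : ℝ => powSum n z₀ (z + s • (dir (.inr j) : Cn m).2))
      (n * (n - 1 : ℕ) * co (.inr j) (0, z - z₀) ^ (n - 2)) 0 := by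
  have e : ∀ (i : Fin m × Fin 2) (s : ℝ), co (.inr i) (0, z + s • (dir (.inr j) : Cn m).2 - z₀) =
      co (.inr i) (0, z - z₀) + s * (if i = j then 1 else 0) := by
    intro i s
    have : ((0, z + s • (dir (.inr j) : Cn m).2 - z₀) : Cn m) = (0, z - z₀) + s • dir (.inr j) := by
      ext1
      · simp [dir]
      · simp only [Prod.snd_add, Prod.smul_snd]
        abel
    rw [this, map_add, map_smul, co_dir, smul_eq_mul]
    simp
  simp only [powSum, e]
  have h := HasSnd.sum (S := Finset.univ) (x := 0) fun (i : Fin m × Fin 2) _ =>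
    HasSnd.affine_pow n (co (.inr i) (0, z - z₀)) (if i = j then 1 else 0) 0
  convert h using 1
  simp

/-- The barrier. -/
def bar (K s a c ε : ℝ) (z₀ : Fin m → ℂ) (σ : ℝ) (z : Fin m → ℂ) : ℝ :=
  K * Real.exp (s * σ) + a * powSum 4 z₀ z + 2 * a * (Real.exp (2 * σ) * powSum 2 z₀ z) +
    c * Real.exp (3 * σ) + ε * Real.exp (-1 * σ)

section bar
variable {K s a c ε : ℝ} (z₀ : Fin m → ℂ) (σ : ℝ) (z : Fin m → ℂ)

lemma hasSnd_bar_sigma : HasSnd (fun σ => bar K s a c ε z₀ σ z)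
    (K * (s ^ 2 * Real.exp (s * σ)) + 0 + 2 * a * (2 ^ 2 * Real.exp (2 * σ) * powSum 2 z₀ z) +
      c * (3 ^ 2 * Real.exp (3 * σ)) + ε * ((-1) ^ 2 * Real.exp (-1 * σ))) σ :=
  (((((HasSnd.exp s σ).const_mul K).add (HasSnd.const _ _)).add
    (((HasSnd.exp 2 σ).mul_const _).const_mul _)).add ((HasSnd.exp 3 σ).const_mul c)).add
    ((HasSnd.exp (-1) σ).const_mul ε)

lemma hasSnd_bar_tangential (j : Fin m × Fin 2) :
    HasSnd (fun t : ℝ => bar K s a c ε z₀ σ (z + t • (dir (.inr j) : Cn m).2))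
      (12 * a * co (.inr j) (0, z - z₀) ^ 2 + 4 * a * Real.exp (2 * σ)) 0 := by
  have h := ((((HasSnd.const (K * Real.exp (s * σ)) 0).add ((hasSnd_powSum 4 z₀ z j).const_mul a)).add
    (((hasSnd_powSum 2 z₀ z j).const_mul (Real.exp (2 * σ))).const_mul (2 * a))).add
    (HasSnd.const (c * Real.exp (3 * σ)) 0)).add (HasSnd.const (ε * Real.exp (-1 * σ)) 0)
  unfold bar
  convert h using 1
  norm_num
  ring

lemma continuous_bar : Continuous fun q : ℝ × (Fin m → ℂ) => bar K s a c ε z₀ q.1 q.2 := by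
  have := continuous_powSum 4 z₀
  have := continuous_powSum 2 z₀
  unfold bar
  fun_prop

variable (hK : 0 ≤ K) (ha : 0 ≤ a) (hc : 0 ≤ c) (hε : 0 ≤ ε)
include hK ha hc hε

/-- All terms are nonnegative. The first bound serves on the lateral face |z - z₀| = δ, the second
on the outer face r = δ, the third on the inner face close to the divisor. -/
lemma bar_bounds : a * powSum 4 z₀ z ≤ bar K s a c ε z₀ σ z ∧
    c * Real.exp (3 * σ) ≤ bar K s a c ε z₀ σ z ∧ ε * Real.exp (-1 * σ) ≤ bar K s a c ε z₀ σ z ∧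
    K * Real.exp (s * σ) ≤ bar K s a c ε z₀ σ z := by
  have h1 : 0 ≤ K * Real.exp (s * σ) := by positivity
  have h2 : 0 ≤ a * powSum 4 z₀ z := mul_nonneg ha (powSum_nonneg (by decide) _ _)
  have h3 : 0 ≤ 2 * a * (Real.exp (2 * σ) * powSum 2 z₀ z) :=
    mul_nonneg (by positivity) (mul_nonneg (Real.exp_pos _).le (powSum_nonneg (by decide) _ _))
  have h4 : 0 ≤ c * Real.exp (3 * σ) := by positivity
  have h5 : 0 ≤ ε * Real.exp (-1 * σ) := by positivity
  unfold bar
  exact ⟨by linarith, by linarith, by linarith, by linarith⟩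

end bar

/-- `cos (7π/16)`, a lower bound for `cos (7βτ/2)` on `|τ| ≤ π/2`, `β ≤ 1/4`. -/
def cosMin : ℝ := Real.cos (7 * Real.pi / 16)

lemma cosMin_pos : 0 < cosMin :=
  Real.cos_pos_of_mem_Ioo ⟨by have := Real.pi_pos; linarith, by have := Real.pi_pos; linarith⟩

lemma cosMin_le_one : cosMin ≤ 1 := Real.cos_le_one _

lemma cosMin_le {β τ : ℝ} (hβ : 0 < β) (hβ1 : β ≤ 1 / 4) (hτ : |τ| ≤ Real.pi / 2) :
    cosMin ≤ Real.cos (7 / 2 * β * τ) := by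
  have hpi := Real.pi_pos
  rw [← Real.cos_abs (7 / 2 * β * τ)]
  have h : |7 / 2 * β * τ| ≤ 7 * Real.pi / 16 := by
    rw [abs_mul, abs_of_pos (by positivity : 0 < 7 / 2 * β)]
    calc 7 / 2 * β * |τ| ≤ 7 / 2 * (1 / 4) * (Real.pi / 2) := by gcongr
      _ = _ := by ring
  exact Real.cos_le_cos_of_nonneg_of_le_pi (abs_nonneg _) (by linarith) h

/-- The inequality behind the barrier. -/
lemma bar_superharmonic {C₀ c₀ K s α a ε A F e₂ es e₃ e₁ S₂ S₄ : ℝ} {n : ℕ} (hc₀ : 0 < c₀)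
    (hC₀ : c₀ ≤ C₀) (hA : 0 ≤ A) (ha : 0 ≤ a) (hε : 0 < ε) (hK : K = A / c₀) (hs : s = 2 + α)
    (hα : 0 < α) (hα1 : α < 1) (he₁ : 0 < e₁) (he₂ : 0 < e₂) (he₃ : 0 < e₃) (hes : 0 < es)
    (h23 : e₂ * e₂ ≤ e₃) (hS₂ : 0 ≤ S₂) (hS₄ : 0 ≤ S₄) (hF : -(2 * A * es) ≤ e₂ * F)
    (h : 0 ≤ C₀ * (K * (s ^ 2 * es) + 0 + 2 * a * (2 ^ 2 * e₂ * S₂) +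
        (1 + 8 * n) * a * (3 ^ 2 * e₃) + ε * ((-1) ^ 2 * e₁)) -
      (7 / 2) ^ 2 * C₀ * (K * es + a * S₄ + 2 * a * (e₂ * S₂) + (1 + 8 * n) * a * e₃ + ε * e₁) +
      e₂ * (C₀ * (12 * a * S₂ + (2 * n) * (4 * a * e₂))) - e₂ * F) : False := by
  -- A radial term with exponent p is multiplied by p² - 49/4. The K term has s² ≤ 9, and the
  -- remaining -13/4 beats the factor 2 in front of A because A ≤ C₀ K. The tangential Laplacian 12
  -- a e₂ S₂ of the fourth powers is absorbed by the quadratic term, as 8 + 12 < 49/2. That term in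
  -- turn produces 8 n a e₂², which the coefficient 1 + 8 n of a e₃ absorbs through e₂² ≤ e₃. The ε
  -- term makes the inequality strict.
  have hC : 0 < C₀ := hc₀.trans_le hC₀
  have hK0 : 0 ≤ K := by rw [hK]; positivity
  have hKA : A ≤ C₀ * K := by
    calc A = c₀ * K := by rw [hK]; field_simp
      _ ≤ C₀ * K := by gcongr
  have hss : s ^ 2 ≤ 9 := by rw [hs]; nlinarith
  have t1 : 0 ≤ C₀ * K * es * (9 - s ^ 2) := by
    have : 0 ≤ 9 - s ^ 2 := by linarith
    positivity
  have t2 : A * es ≤ C₀ * K * es := by gcongr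
  have t3 : 0 ≤ C₀ * a * S₄ := by positivity
  have t4 : 0 ≤ C₀ * a * e₂ * S₂ := by positivity
  have t5 : 0 ≤ C₀ * a * (3 * n) * (e₃ - e₂ * e₂) := by
    have : 0 ≤ e₃ - e₂ * e₂ := by linarith
    positivity
  have t6 : 0 ≤ C₀ * a * e₃ := by positivity
  have t7 : 0 < C₀ * (ε * e₁) := by positivity
  have t8 : 0 ≤ C₀ * a * e₃ * n := by positivity
  have t9 : 0 ≤ A * es := by positivity
  nlinarith

lemma laplacian_eq_sum (β : ℝ) (v : Cn m → ℝ) (p : Cn m) : laplacian β v p =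
    D β (.inl 0) (D β (.inl 0) v) p + (D β (.inl 1) (D β (.inl 1) v) p +
      (rad β p)⁻¹ * D β (.inl 0) v p) + ∑ j, D β (.inr j) (D β (.inr j) v) p := by
  rw [laplacian, sum_idx]
  simp [hess, connection, Fintype.sum_prod_type]

lemma continuous_pol (β : ℝ) : Continuous fun q : ℝ × ℝ × (Fin m → ℂ) => pol β q.1 q.2.1 q.2.2 := by
  unfold pol
  fun_prop

/-- The oscillation estimate on a cylinder, by the maximum principle. -/
lemma angular_osc_aux {β α A M δ : ℝ} (hβ : 0 < β) (hβ1 : β ≤ 1 / 4) (hα : 0 < α) (hα1 : α < 1)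
    (hA : 0 ≤ A) (hM : 0 ≤ M) (hδ : 0 < δ) (hδ1 : δ ≤ 1) {O : Set (Cn m)} (hO : IsOpen O)
    {v f : Cn m → ℝ} (hv : ContDiffOn ℝ 2 v (O \ divisor m))
    (hvf : ∀ p ∈ O \ divisor m, laplacian β v p = f p) (hvM : ∀ p ∈ O \ divisor m, |v p| ≤ M)
    (hf : ConeHolder β α A O f) {z₀ : Fin m → ℂ}
    (hQ : ∀ p : Cn m, p.1 ≠ 0 → rad β p ≤ δ → p.2 ∈ closedBall z₀ δ → p ∈ O)
    {θ₀ σ τ : ℝ} (hτ : |τ| ≤ Real.pi / 2) (hσ : Real.exp σ ≤ δ) {ε : ℝ} (hε : 0 < ε) :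
    v (pol β σ (θ₀ + τ) z₀) - v (pol β σ (θ₀ + Real.pi - τ) z₀) ≤
      Real.cos (7 / 2 * β * τ) * bar (A / cosMin) (2 + α) (4 * M / (cosMin * δ ^ 4))
        ((1 + 8 * m) * (4 * M / (cosMin * δ ^ 4))) ε z₀ σ z₀ := by
  have hpi := Real.pi_pos
  have hc := cosMin_pos
  set K := A / cosMin with hK
  set a := 4 * M / (cosMin * δ ^ 4) with ha
  set c := (1 + 8 * m) * a with hcdef
  have hK0 : 0 ≤ K := by positivity
  have ha0 : 0 ≤ a := by positivity
  have hc0 : 0 ≤ c := by positivity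
  have hac : a ≤ c := by
    have : (0 : ℝ) ≤ 8 * m * a := by positivity
    rw [hcdef]; linarith
  have haM : cosMin * (a * (δ ^ 4 / 2)) = 2 * M := by rw [ha]; field_simp; ring
  have hO' : IsOpen (O \ divisor m) := hO.sdiff isClosed_divisor
  -- Reflecting the angle in θ₀ + π/2 gives a difference that vanishes at τ = ±π/2, so no boundary
  -- values are needed on those faces. The claim is that G ≥ 0 on the cylinder.
  set G : ℝ × ℝ × (Fin m → ℂ) → ℝ := fun q => Real.cos (7 / 2 * β * q.2.1) *
    bar K (2 + α) a c ε z₀ q.1 q.2.2 - (v (pol β q.1 (θ₀ + q.2.1) q.2.2) -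
      v (pol β q.1 (θ₀ + Real.pi - q.2.1) q.2.2)) with hG
  -- At σ = σm the singular term satisfies cosMin ε e^(-σ) ≥ 2 M + 1, which exceeds the trivial
  -- bound for the oscillation; the minimum keeps the given σ in range.
  set σm := min σ (-Real.log ((2 * M + 1) / (cosMin * ε)))
  set Q : Set (ℝ × ℝ × (Fin m → ℂ)) := Icc σm (Real.log δ) ×ˢ Icc (-(Real.pi / 2)) (Real.pi / 2) ×ˢ
    closedBall z₀ δ with hQdef
  have hσδ : σ ≤ Real.log δ := (Real.le_log_iff_exp_le hδ).2 hσ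
  have hmemO : ∀ q ∈ Q, ∀ θ, pol β q.1 θ q.2.2 ∈ O \ divisor m := fun q hq θ =>
    ⟨hQ _ (pol_fst_ne_zero _ _ _ _) (by
      rw [rad_pol hβ]; exact (Real.le_log_iff_exp_le hδ).1 hq.1.2) hq.2.2, pol_fst_ne_zero _ _ _ _⟩
  have hbar0 : ∀ q : ℝ × ℝ × (Fin m → ℂ), 0 < bar K (2 + α) a c ε z₀ q.1 q.2.2 := fun q =>
    lt_of_lt_of_le (by positivity) (bar_bounds z₀ q.1 q.2.2 hK0 ha0 hc0 hε.le).2.2.1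
  have hcos : ∀ q ∈ Q, cosMin ≤ Real.cos (7 / 2 * β * q.2.1) := fun q hq =>
    cosMin_le hβ hβ1 (abs_le.2 ⟨hq.2.1.1, hq.2.1.2⟩)
  have hGc : ContinuousOn G Q := by
    have h1 : Continuous fun q : ℝ × ℝ × (Fin m → ℂ) => bar K (2 + α) a c ε z₀ q.1 q.2.2 :=
      (continuous_bar z₀).comp (continuous_fst.prodMk continuous_snd.snd)
    have h2 : Continuous fun q : ℝ × ℝ × (Fin m → ℂ) => pol β q.1 (θ₀ + q.2.1) q.2.2 :=
      (continuous_pol β).comp (by fun_prop :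
        Continuous fun q : ℝ × ℝ × (Fin m → ℂ) => (q.1, θ₀ + q.2.1, q.2.2))
    have h3 : Continuous fun q : ℝ × ℝ × (Fin m → ℂ) => pol β q.1 (θ₀ + Real.pi - q.2.1) q.2.2 :=
      (continuous_pol β).comp (by fun_prop :
        Continuous fun q : ℝ × ℝ × (Fin m → ℂ) => (q.1, θ₀ + Real.pi - q.2.1, q.2.2))
    refine ContinuousOn.sub (Continuous.continuousOn (by fun_prop)) (ContinuousOn.sub ?_ ?_)
    · exact hv.continuousOn.comp h2.continuousOn fun q hq => hmemO q hq _
    · exact hv.continuousOn.comp h3.continuousOn fun q hq => hmemO q hq _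
  have hQc : IsCompact Q := isCompact_Icc.prod (isCompact_Icc.prod (isCompact_closedBall _ _))
  have hp₀ : (σ, τ, z₀) ∈ Q :=
    ⟨⟨min_le_left _ _, hσδ⟩, ⟨(abs_le.1 hτ).1, (abs_le.1 hτ).2⟩, mem_closedBall_self hδ.le⟩
  obtain ⟨q, hq, hmin⟩ := hQc.exists_isMinOn ⟨_, hp₀⟩ hGc
  suffices hGq : 0 ≤ G q by
    have := hGq.trans (hmin hp₀)
    simp only [hG] at this
    linarith
  by_contra hneg
  rw [not_le] at hneg
  -- At a negative minimum every lower bound for the barrier, times cosMin, stays below 2 M. On each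
  -- face in σ or z one term of the barrier contradicts this, so the minimum is not on those faces.
  have hbig : ∀ B, B ≤ bar K (2 + α) a c ε z₀ q.1 q.2.2 → cosMin * B < 2 * M := by
    intro B hB
    have h1 : cosMin * B ≤ Real.cos (7 / 2 * β * q.2.1) * bar K (2 + α) a c ε z₀ q.1 q.2.2 :=
      (mul_le_mul_of_nonneg_left hB hc.le).trans (mul_le_mul_of_nonneg_right (hcos q hq)
        (hbar0 q).le)
    have h2 := abs_le.1 (hvM _ (hmemO q hq (θ₀ + q.2.1)))
    have h3 := abs_le.1 (hvM _ (hmemO q hq (θ₀ + Real.pi - q.2.1)))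
    simp only [hG] at hneg
    linarith
  obtain ⟨bb1, bb2, bb3, bb4⟩ := bar_bounds (K := K) (s := 2 + α) (a := a) (c := c) (ε := ε)
    z₀ q.1 q.2.2 hK0 ha0 hc0 hε.le
  have hi1 : σm < q.1 := by
    refine lt_of_le_of_ne hq.1.1 fun he => ?_
    have h1 := hbig _ bb3
    have h2 : (2 * M + 1) / (cosMin * ε) ≤ Real.exp (-1 * q.1) := by
      rw [← Real.log_le_iff_le_exp (by positivity), ← he]
      have := min_le_right σ (-Real.log ((2 * M + 1) / (cosMin * ε)))
      linarith
    rw [div_le_iff₀ (by positivity)] at h2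
    nlinarith
  have hi2 : q.1 < Real.log δ := by
    refine lt_of_le_of_ne hq.1.2 fun he => ?_
    have h1 := hbig _ bb2
    rw [he, mul_comm 3, Real.exp_mul, Real.exp_log hδ] at h1
    have h2 : a * (δ ^ 4 / 2) ≤ c * δ ^ (3 : ℝ) := by
      have h3 : δ ^ (3 : ℝ) = δ ^ 3 := by norm_cast
      rw [h3]
      refine mul_le_mul hac ?_ (by positivity) hc0
      have : δ ^ 4 ≤ δ ^ 3 := pow_le_pow_of_le_one hδ.le hδ1 (by norm_num)
      have : 0 < δ ^ 4 := by positivity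
      linarith
    have := mul_le_mul_of_nonneg_left h2 hc.le
    linarith
  have hi3 : q.2.2 ∈ ball z₀ δ := by
    rw [mem_ball, dist_eq_norm]
    by_contra hle
    rw [not_lt] at hle
    have h1 := hbig _ bb1
    have h2 := mul_le_mul_of_nonneg_left (mul_le_mul_of_nonneg_left (le_powSum_four hδ hle) ha0) hc.le
    linarith
  have hτne : ∀ e : ℝ, (e = 1 ∨ e = -1) → q.2.1 ≠ e * (Real.pi / 2) := by
    intro e he hqe
    have h1 : pol β q.1 (θ₀ + Real.pi - q.2.1) q.2.2 = pol β q.1 (θ₀ + q.2.1) q.2.2 := by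
      rcases he with rfl | rfl
      · rw [hqe]; congr 1; ring
      · rw [← pol_add_two_pi β q.1 (θ₀ + q.2.1) q.2.2 1, hqe]; congr 1; push_cast; ring
    simp only [hG, h1] at hneg
    have := mul_pos (hc.trans_le (hcos q hq)) (hbar0 q)
    linarith
  have hi4 : -(Real.pi / 2) < q.2.1 := lt_of_le_of_ne hq.2.1.1 fun he =>
    hτne (-1) (Or.inr rfl) (by rw [← he]; ring)
  have hi5 : q.2.1 < Real.pi / 2 := lt_of_le_of_ne hq.2.1.2 fun he =>
    hτne 1 (Or.inl rfl) (by rw [he]; ring)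
  have hQn : Q ∈ 𝓝 q := prod_mem_nhds (Icc_mem_nhds hi1 hi2)
    (prod_mem_nhds (Icc_mem_nhds hi4 hi5) (closedBall_mem_nhds_of_mem hi3))
  have hloc : IsLocalMin G q := hmin.isLocalMin hQn
  have hslice : ∀ (γ : ℝ → ℝ × ℝ × (Fin m → ℂ)) (t : ℝ), ContinuousAt γ t → γ t = q →
      IsLocalMin (fun s => G (γ s)) t := by
    intro γ t hγ ht
    have h1 : Tendsto γ (𝓝 t) (𝓝 q) := by rw [← ht]; exact hγ
    filter_upwards [h1.eventually hloc] with s hs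
    rw [ht]
    exact hs
  obtain ⟨σ', τ', z'⟩ := q
  simp only at hi1 hi2 hi3 hi4 hi5 hcos hbig
  set C₀ := Real.cos (7 / 2 * β * τ') with hC₀
  set p₁ := pol β σ' (θ₀ + τ') z' with hp₁
  set p₂ := pol β σ' (θ₀ + Real.pi - τ') z' with hp₂
  have hm₁ : p₁ ∈ O \ divisor m := hmemO _ hq _
  have hm₂ : p₂ ∈ O \ divisor m := hmemO _ hq _
  -- In the variable σ = log r one has r² Δ = ∂_σ² + β⁻² ∂_θ² + r² Σ ∂_j². The second derivatives of
  -- G along the coordinate curves are nonnegative at the interior minimum, and their weighted sum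
  -- contradicts `bar_superharmonic`.
  have s1 := ((hasSnd_bar_sigma (K := K) (s := 2 + α) (a := a) (c := c) (ε := ε) z₀ σ' z').const_mul
    C₀).sub ((hasSnd_comp_frame hβ hO hv (i := .inl 0) hm₁
      (fun s => hasDerivAt_pol_sigma hβ s (θ₀ + τ') z') (Real.hasDerivAt_exp σ')).sub
    (hasSnd_comp_frame hβ hO hv (i := .inl 0) hm₂
      (fun s => hasDerivAt_pol_sigma hβ s (θ₀ + Real.pi - τ') z') (Real.hasDerivAt_exp σ')))
  have n1 := s1.nonneg_of_isLocalMin (hslice (fun s => (s, τ', z')) σ'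
    (by fun_prop) rfl)
  have s2 := ((HasSnd.cos (7 / 2 * β) τ').mul_const (bar K (2 + α) a c ε z₀ σ' z')).sub
    ((HasSnd.const_add_comp θ₀ (hasSnd_comp_frame hβ hO hv (i := .inl 1) hm₁
      (fun s => hasDerivAt_pol_theta hβ σ' s z') (hasDerivAt_const _ (β * Real.exp σ')))).sub
    (HasSnd.const_sub_comp (θ₀ + Real.pi) (hasSnd_comp_frame hβ hO hv (i := .inl 1) hm₂
      (fun s => hasDerivAt_pol_theta hβ σ' s z') (hasDerivAt_const _ (β * Real.exp σ')))))
  have n2 := s2.nonneg_of_isLocalMin (hslice (fun s => (σ', s, z')) τ' (by fun_prop) rfl)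
  have hγ : ∀ (θ : ℝ) (j : Fin m × Fin 2) (s : ℝ),
      HasDerivAt (fun s : ℝ => pol β σ' θ (z' + s • (dir (.inr j) : Cn m).2))
        ((1 : ℝ) • frame β (.inr j) (pol β σ' θ (z' + s • (dir (.inr j) : Cn m).2))) s := by
    intro θ j s
    have h1 : HasDerivAt (fun s : ℝ => z' + s • (dir (.inr j) : Cn m).2) (dir (.inr j) : Cn m).2 s := by
      simpa using ((hasDerivAt_id s).smul_const (dir (.inr j) : Cn m).2).const_add z'
    refine ((hasDerivAt_const s _).prodMk h1).congr_deriv ?_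
    rw [frame_inr, one_smul]
    rfl
  have n3 : ∀ j : Fin m × Fin 2, 0 ≤ C₀ * (12 * a * co (.inr j) (0, z' - z₀) ^ 2 +
      4 * a * Real.exp (2 * σ')) - (D β (.inr j) (D β (.inr j) v) p₁ -
        D β (.inr j) (D β (.inr j) v) p₂) := by
    intro j
    have e0 : z' + (0 : ℝ) • (dir (.inr j) : Cn m).2 = z' := by simp
    have h1 := hasSnd_comp_frame hβ hO hv (i := .inr j) (t := 0) (by rw [e0]; exact hm₁)
      (hγ (θ₀ + τ') j) (hasDerivAt_const 0 (1 : ℝ))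
    have h2 := hasSnd_comp_frame hβ hO hv (i := .inr j) (t := 0) (by rw [e0]; exact hm₂)
      (hγ (θ₀ + Real.pi - τ') j) (hasDerivAt_const 0 (1 : ℝ))
    rw [e0] at h1 h2
    have s3 := ((hasSnd_bar_tangential (K := K) (s := 2 + α) (a := a) (c := c) (ε := ε)
      z₀ σ' z' j).const_mul C₀).sub (h1.sub h2)
    have := s3.nonneg_of_isLocalMin (hslice (fun s => (σ', τ', z' + s • (dir (.inr j) : Cn m).2)) 0
      (by fun_prop) (by simp))
    simpa using this
  have n3' := Finset.sum_nonneg fun j (_ : j ∈ Finset.univ) => n3 j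
  rw [Finset.sum_sub_distrib, Finset.sum_sub_distrib, ← Finset.mul_sum, Finset.sum_add_distrib,
    ← Finset.mul_sum, Finset.sum_const, Finset.card_univ, Fintype.card_prod, Fintype.card_fin,
    Fintype.card_fin, nsmul_eq_mul] at n3'
  push_cast at n3'
  change 0 ≤ C₀ * (12 * a * powSum 2 z₀ z' + m * 2 * (4 * a * Real.exp (2 * σ'))) - _ at n3'
  have hF1 := laplacian_eq_sum β v p₁
  have hF2 := laplacian_eq_sum β v p₂
  rw [hvf _ hm₁, rad_pol hβ] at hF1
  rw [hvf _ hm₂, rad_pol hβ] at hF2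
  have hFd : |f p₁ - f p₂| ≤ 2 * A * Real.exp (α * σ') := by
    -- The two points are symmetric about the angle θ₀ + π/2 and within π of it, so one sector chart
    -- contains both.
    have e1 : p₁ = pol β σ' ((θ₀ + Real.pi / 2) + (τ' - Real.pi / 2)) z' := by
      rw [hp₁]; congr 1; ring
    have e2 : p₂ = pol β σ' ((θ₀ + Real.pi / 2) + (Real.pi / 2 - τ')) z' := by
      rw [hp₂]; congr 1; ring
    have o1 := hm₁.1
    have o2 := hm₂.1
    rw [e1] at o1 ⊢
    rw [e2] at o2 ⊢
    exact hf.pol_le hβ hβ1 hα.le hα1.le hA (abs_le.2 ⟨by linarith, by linarith⟩)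
      (abs_le.2 ⟨by linarith, by linarith⟩) o1 o2
  have ee : Real.exp ((2 + α) * σ') = Real.exp (2 * σ') * Real.exp (α * σ') := by
    rw [← Real.exp_add]; ring_nf
  have e2 : Real.exp (2 * σ') = Real.exp σ' ^ 2 := by rw [← Real.exp_nat_mul]; norm_num
  have hσ0 : σ' ≤ 0 := hi2.le.trans (Real.log_nonpos hδ.le hδ1)
  refine bar_superharmonic (n := m) (F := f p₁ - f p₂) (S₂ := powSum 2 z₀ z') (S₄ := powSum 4 z₀ z')
    (e₁ := Real.exp (-1 * σ')) (e₂ := Real.exp (2 * σ')) (e₃ := Real.exp (3 * σ'))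
    (es := Real.exp ((2 + α) * σ')) (C₀ := C₀) hc (hcos _ hq) hA ha0 hε hK rfl hα hα1
    (Real.exp_pos _) (Real.exp_pos _) (Real.exp_pos _) (Real.exp_pos _) ?_
    (powSum_nonneg (by decide) _ _) (powSum_nonneg (by decide) _ _) ?_ ?_
  · rw [← Real.exp_add]; exact Real.exp_le_exp.2 (by linarith)
  · rw [ee]
    have h1 := (abs_le.1 hFd).1
    have h2 := mul_le_mul_of_nonneg_left h1 (Real.exp_pos (2 * σ')).le
    linarith
  · have n4 := mul_nonneg (Real.exp_pos (2 * σ')).le n3'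
    have n5 := mul_nonneg (by positivity : 0 ≤ (β ^ 2)⁻¹) n2
    simp only [zero_mul, zero_add, mul_pow] at n5
    have hne : Real.exp σ' ≠ 0 := (Real.exp_pos _).ne'
    rw [hF1, hF2]
    have n6 : (β ^ 2)⁻¹ * (-((7 / 2 : ℝ) ^ 2 * β ^ 2) * Real.cos (7 / 2 * β * τ') *
        bar K (2 + α) a c ε z₀ σ' z' - (β ^ 2 * Real.exp σ' ^ 2 * D β (.inl 1) (D β (.inl 1) v) p₁ -
        β ^ 2 * Real.exp σ' ^ 2 * D β (.inl 1) (D β (.inl 1) v) p₂)) =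
        -((7 / 2 : ℝ) ^ 2 * C₀ * bar K (2 + α) a c ε z₀ σ' z') -
        Real.exp (2 * σ') * (D β (.inl 1) (D β (.inl 1) v) p₁ -
          D β (.inl 1) (D β (.inl 1) v) p₂) := by
      rw [e2, hC₀]
      field_simp
    have n5' : 0 ≤ -((7 / 2 : ℝ) ^ 2 * C₀ * bar K (2 + α) a c ε z₀ σ' z') -
        Real.exp (2 * σ') * (D β (.inl 1) (D β (.inl 1) v) p₁ -
          D β (.inl 1) (D β (.inl 1) v) p₂) := by
      rw [← n6]
      refine n5.trans_eq ?_
      ring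
    have n7 : ∀ X : ℝ, Real.exp (2 * σ') * ((Real.exp σ')⁻¹ * X) = Real.exp σ' * X := by
      intro X
      rw [e2]
      field_simp
    have hd1 := n7 (D β (.inl 0) v p₁)
    have hd2 := n7 (D β (.inl 0) v p₂)
    rw [← e2] at n1
    unfold bar at n5'
    linarith

/-! ### Bounded classical solutions on the ball and their angular oscillation -/

lemma isOpen_coneBall {β : ℝ} (hβ : 0 ≤ β) (ρ : ℝ) : IsOpen (coneBall m β ρ) := by
  refine isOpen_lt (((continuous_rad hβ).pow 2).add ?_) continuous_const
  exact continuous_finsetSum _ fun j _ => (((continuous_apply j).comp continuous_snd).norm).pow 2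

/-- Bounded classical solutions off the divisor, on the ball of radius `1/2`. -/
structure IsClassical (β α A M : ℝ) (v f : Cn m → ℝ) : Prop where
  pos : 0 < β
  le : β ≤ 1 / 4
  hα : 0 < α
  hα1 : α < 1
  hA : 0 ≤ A
  hM : 0 ≤ M
  contDiffOn : ContDiffOn ℝ 2 v (coneBall m β (1 / 2) \ divisor m)
  eq : ∀ p ∈ coneBall m β (1 / 2) \ divisor m, laplacian β v p = f p
  bound : ∀ p ∈ coneBall m β (1 / 2) \ divisor m, |v p| ≤ M
  holder : ConeHolder β α A (coneBall m β (1 / 2)) f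

lemma IsClassical.congr {β α A M : ℝ} {v w f : Cn m → ℝ} (h : IsClassical β α A M v f)
    (hw : ∀ p : Cn m, p.1 ≠ 0 → w p = v p) : IsClassical β α A M w f where
  pos := h.pos
  le := h.le
  hα := h.hα
  hα1 := h.hα1
  hA := h.hA
  hM := h.hM
  contDiffOn := h.contDiffOn.congr fun p hp => hw p hp.2
  eq := fun p hp => by
    rw [← h.eq p hp]
    refine laplacian_congr ?_
    filter_upwards [eventually_fst_ne_zero hp.2] with q hq using hw q hq
  bound := fun p hp => by rw [hw p hp.2]; exact h.bound p hp
  holder := h.holder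

/-- A quantitative triangle inequality: small perturbations stay in a larger ball. -/
lemma sum_sq_le {ι : Type*} [Fintype ι] {x y : ι → ℂ} {δ : ℝ} (hδ : 0 ≤ δ) (hδ1 : δ ≤ 1)
    (hx : ∀ j, ‖x j‖ ≤ 1 / 2) (h : ∀ j, ‖y j - x j‖ ≤ δ) :
    ∑ j, ‖y j‖ ^ 2 ≤ ∑ j, ‖x j‖ ^ 2 + Fintype.card ι * (2 * δ) := by
  rw [← nsmul_eq_mul, ← Finset.card_univ, ← Finset.sum_const, ← Finset.sum_add_distrib]
  refine Finset.sum_le_sum fun j _ => ?_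
  have h1 : ‖y j‖ ≤ ‖x j‖ + δ := by
    have := norm_add_le (x j) (y j - x j)
    rw [add_sub_cancel] at this
    linarith [h j]
  have h2 : ‖y j‖ ^ 2 ≤ (‖x j‖ + δ) ^ 2 := by gcongr
  nlinarith [norm_nonneg (x j), hx j]

lemma norm_le_half_of_sum {ι : Type*} [Fintype ι] {x : ι → ℂ} {ρ : ℝ} (hρ : ρ ≤ 1 / 2) (hρ0 : 0 ≤ ρ)
    (h : ∑ j, ‖x j‖ ^ 2 ≤ ρ ^ 2) (j : ι) : ‖x j‖ ≤ 1 / 2 := by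
  have h1 := Finset.single_le_sum (f := fun j => ‖x j‖ ^ 2) (fun _ _ => by positivity)
    (Finset.mem_univ j)
  exact (abs_le_of_sq_le_sq' (h1.trans h) hρ0).2.trans hρ

/-- For r ≤ δ the cylinder estimate is centred at the point itself, where the power sums vanish and
the barrier is O(r^(2+α)) up to the term in ε. For r > δ the bound 2 M suffices. -/
lemma exists_angular_osc_le (m : ℕ) {ρ : ℝ} (hρ : 0 < ρ) (hρ1 : ρ < 1 / 2) : ∃ C : ℝ, 0 ≤ C ∧
    ∀ (β α A M : ℝ) (v f : Cn m → ℝ), IsClassical β α A M v f →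
      ∀ (σ θ θ' : ℝ) (z : Fin m → ℂ), pol β σ θ z ∈ coneBall m β ρ → θ' ∈ Ico θ (θ + 2 * Real.pi) →
        v (pol β σ θ z) - v (pol β σ θ' z) ≤ C * (A + M) * Real.exp ((2 + α) * σ) := by
  -- On the cylinder r ≤ δ, ‖z' - z‖ ≤ δ, the sum r² + |z'|² exceeds |z|² by at most δ² + 2 m δ ≤ (2
  -- m + 1) δ, so the cylinder stays in the ball of radius 1/2.
  set δ : ℝ := (1 / 4 - ρ ^ 2) / (2 * m + 1) with hδdef
  have hρ2 : ρ ^ 2 < 1 / 4 := by nlinarith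
  have hδ : 0 < δ := div_pos (by linarith) (by positivity)
  have hδ1 : δ ≤ 1 := by
    rw [hδdef, div_le_one (by positivity)]
    have : (0 : ℝ) ≤ m := m.cast_nonneg
    nlinarith
  have hδ2 : δ * (2 * m + 1) = 1 / 4 - ρ ^ 2 := by rw [hδdef]; field_simp
  have hc := cosMin_pos
  have hc1 := cosMin_le_one
  have hδ4 : cosMin * δ ^ 4 ≤ δ ^ 3 := by
    calc cosMin * δ ^ 4 ≤ 1 * δ ^ 3 := by
          refine mul_le_mul hc1 (pow_le_pow_of_le_one hδ.le hδ1 (by norm_num)) (by positivity)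
            (by norm_num)
      _ = _ := one_mul _
  set C : ℝ := (1 + 8 * m) * (4 / (cosMin * δ ^ 4)) with hC
  have hC0 : 0 ≤ C := by positivity
  have hC1 : 4 / (cosMin * δ ^ 4) ≤ C := by
    rw [hC]
    exact le_mul_of_one_le_left (by positivity) (by have : (0 : ℝ) ≤ m := m.cast_nonneg; linarith)
  have hC2 : 1 / cosMin ≤ C := by
    refine le_trans ?_ hC1
    have : cosMin * δ ^ 4 ≤ cosMin * 1 := by
      gcongr
      exact pow_le_one₀ hδ.le hδ1
    rw [div_le_div_iff₀ hc (by positivity)]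
    linarith
  have hC3 : 2 / δ ^ 3 ≤ C := by
    refine le_trans ?_ hC1
    rw [div_le_div_iff₀ (by positivity) (by positivity)]
    linarith [pow_pos hδ 3]
  refine ⟨C, hC0, fun β α A M v f h σ θ θ' z hp hθ => ?_⟩
  have hβ := h.pos
  have hA := h.hA
  have hM := h.hM
  have hpi := Real.pi_pos
  have hp' : Real.exp σ ^ 2 + ∑ j, ‖z j‖ ^ 2 < ρ ^ 2 := by
    have := hp
    simp only [coneBall, mem_ofPred_eq, rad_pol hβ] at this
    exact this
  have hzj : ∑ j, ‖z j‖ ^ 2 ≤ ρ ^ 2 := by linarith [sq_nonneg (Real.exp σ)]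
  have hσ0 : σ ≤ 0 := by
    rw [← Real.exp_le_one_iff]
    have h0 : (0 : ℝ) ≤ ∑ j, ‖z j‖ ^ 2 := by positivity
    exact (abs_le_of_sq_le_sq' (by linarith : Real.exp σ ^ 2 ≤ 1 ^ 2) zero_le_one).2
  have hAll : ∀ θ, pol β σ θ z ∈ coneBall m β (1 / 2) \ divisor m := fun θ => by
    refine ⟨?_, pol_fst_ne_zero _ _ _ _⟩
    simp only [coneBall, mem_ofPred_eq, rad_pol hβ]
    change Real.exp σ ^ 2 + ∑ j, ‖z j‖ ^ 2 < _
    linarith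
  rcases le_or_gt (Real.exp σ) δ with hσ | hσ
  · refine le_of_forall_pos_le_add fun η hη => ?_
    have hQ : ∀ p : Cn m, p.1 ≠ 0 → rad β p ≤ δ → p.2 ∈ closedBall z δ → p ∈ coneBall m β (1 / 2) := by
      intro p hp0 hr hb
      have h1 := sum_sq_le (x := z) (y := p.2) hδ.le hδ1 (norm_le_half_of_sum hρ1.le hρ.le hzj)
        fun j => (norm_le_pi_norm (p.2 - z) j).trans (by rwa [mem_closedBall, dist_eq_norm] at hb)
      rw [Fintype.card_fin] at h1
      have h2 : rad β p ^ 2 ≤ δ * 1 := by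
        rw [sq]
        exact mul_le_mul hr (hr.trans hδ1) (rad_pos β hp0).le hδ.le
      have h3 : 0 < Real.exp σ ^ 2 := by positivity
      change rad β p ^ 2 + ∑ j, ‖p.2 j‖ ^ 2 < (1 / 2) ^ 2
      linarith
    -- These θ₀ and τ put θ and θ' into reflected position, and θ' - θ ∈ [0, 2π) gives |τ| ≤ π/2.
    -- With ε = η e^σ the singular term of the barrier is exactly η, which is arbitrary.
    have h1 := angular_osc_aux hβ h.le h.hα h.hα1 hA hM hδ hδ1 (isOpen_coneBall hβ.le _)
      h.contDiffOn h.eq h.bound h.holder hQ (θ₀ := (θ + θ' - Real.pi) / 2) (σ := σ)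
      (τ := (θ - θ' + Real.pi) / 2) (abs_le.2 ⟨by linarith [hθ.2], by linarith [hθ.1]⟩) hσ
      (ε := η * Real.exp σ) (by positivity)
    rw [show (θ + θ' - Real.pi) / 2 + (θ - θ' + Real.pi) / 2 = θ by ring,
      show (θ + θ' - Real.pi) / 2 + Real.pi - (θ - θ' + Real.pi) / 2 = θ' by ring] at h1
    refine h1.trans ?_
    have hb0 : 0 ≤ bar (A / cosMin) (2 + α) (4 * M / (cosMin * δ ^ 4))
        ((1 + 8 * m) * (4 * M / (cosMin * δ ^ 4))) (η * Real.exp σ) z σ z :=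
      le_trans (by positivity) (bar_bounds z σ z (by positivity) (by positivity) (by positivity)
        (by positivity)).2.2.1
    refine (mul_le_of_le_one_left hb0 (Real.cos_le_one _)).trans ?_
    rw [bar, powSum_self (by norm_num), powSum_self (by norm_num)]
    have e1 : η * Real.exp σ * Real.exp (-1 * σ) = η := by
      rw [mul_assoc, ← Real.exp_add]; simp
    have e2 : Real.exp (3 * σ) ≤ Real.exp ((2 + α) * σ) :=
      Real.exp_le_exp.2 (by nlinarith [h.hα1])
    have e3 : A / cosMin * Real.exp ((2 + α) * σ) ≤ C * A * Real.exp ((2 + α) * σ) := by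
      have : A / cosMin ≤ C * A := by
        calc A / cosMin = 1 / cosMin * A := by ring
          _ ≤ C * A := by gcongr
      gcongr
    have e4 : (1 + 8 * m) * (4 * M / (cosMin * δ ^ 4)) * Real.exp (3 * σ) ≤
        C * M * Real.exp ((2 + α) * σ) := by
      have : (1 + 8 * m) * (4 * M / (cosMin * δ ^ 4)) = C * M := by rw [hC]; ring
      rw [this]
      gcongr
    rw [e1, show C * (A + M) * Real.exp ((2 + α) * σ) =
      C * A * Real.exp ((2 + α) * σ) + C * M * Real.exp ((2 + α) * σ) by ring]
    simp only [mul_zero, add_zero]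
    linarith
  · have h1 := abs_le.1 (h.bound _ (hAll θ))
    have h2 := abs_le.1 (h.bound _ (hAll θ'))
    have h3 : δ ^ 3 ≤ Real.exp ((2 + α) * σ) := by
      calc δ ^ 3 ≤ Real.exp σ ^ 3 := by gcongr
        _ = Real.exp (3 * σ) := by rw [← Real.exp_nat_mul]; norm_num
        _ ≤ _ := Real.exp_le_exp.2 (by nlinarith [h.hα1])
    have h4 : 2 ≤ C * Real.exp ((2 + α) * σ) := by
      calc 2 = 2 / δ ^ 3 * δ ^ 3 := by field_simp
        _ ≤ _ := by gcongr
    have h5 : 2 * M ≤ C * (A + M) * Real.exp ((2 + α) * σ) := by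
      have h6 := mul_le_mul_of_nonneg_right h4 hM
      have h7 : 0 ≤ C * A * Real.exp ((2 + α) * σ) := by positivity
      calc 2 * M ≤ C * Real.exp ((2 + α) * σ) * M + C * A * Real.exp ((2 + α) * σ) := by linarith
        _ = _ := by ring
    linarith

lemma exists_angular_osc (m : ℕ) {ρ : ℝ} (hρ : 0 < ρ) (hρ1 : ρ < 1 / 2) : ∃ C : ℝ, 0 ≤ C ∧
    ∀ (β α A M : ℝ) (v f : Cn m → ℝ), IsClassical β α A M v f →
      ∀ (σ θ θ' : ℝ) (z : Fin m → ℂ), pol β σ θ z ∈ coneBall m β ρ →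
        |v (pol β σ θ z) - v (pol β σ θ' z)| ≤ C * (A + M) * Real.exp ((2 + α) * σ) := by
  obtain ⟨C, hC0, hC⟩ := exists_angular_osc_le m hρ hρ1
  refine ⟨C, hC0, fun β α A M v f h σ θ θ' z hp => ?_⟩
  have key : ∀ θ θ' : ℝ, pol β σ θ z ∈ coneBall m β ρ →
      v (pol β σ θ z) - v (pol β σ θ' z) ≤ C * (A + M) * Real.exp ((2 + α) * σ) := by
    intro θ θ' hp
    obtain ⟨n, hn, -⟩ := existsUnique_add_zsmul_mem_Ico Real.two_pi_pos θ' θ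
    rw [← pol_add_two_pi β σ θ' z n]
    exact hC β α A M v f h σ θ _ z hp (by simpa using hn)
  have hp' : pol β σ θ' z ∈ coneBall m β ρ := by
    simp only [coneBall, mem_ofPred_eq, rad_pol h.pos] at hp ⊢
    exact hp
  exact abs_le.2 ⟨by linarith [key θ' θ hp'], key θ θ' hp⟩

/-! ### Averages over the angle -/

/-- The average over the angle, as a function on Euclidean space. -/
def avg (β : ℝ) (g : Cn m → ℝ) (x : Cn m) : ℝ :=
  (2 * Real.pi)⁻¹ * ∫ θ in 0..2 * Real.pi, g (pol β (Real.log ‖x.1‖) θ x.2)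

/-- The branch a only shifts the angle, and the mean is over a full period. Near any point off the
axis a branch that is smooth there can therefore be used. -/
lemma avg_eq_lift {β : ℝ} {a : ℂ} (ha : ‖a‖ = 1) (g : Cn m → ℝ) (x : Cn m) :
    avg β g x = (2 * Real.pi)⁻¹ * ∫ θ in 0..2 * Real.pi, g (lift β a θ x) := by
  rw [avg]
  congr 1
  simp only [lift_eq_pol ha]
  rw [intervalIntegral.integral_comp_add_right
    (fun θ => g (pol β (Real.log ‖x.1‖) θ x.2)), zero_add, add_comm (2 * Real.pi)]
  have hp : Function.Periodic (fun θ => g (pol β (Real.log ‖x.1‖) θ x.2)) (2 * Real.pi) := fun θ => by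
    have := pol_add_two_pi β (Real.log ‖x.1‖) θ x.2 1
    simp only [Int.cast_one, one_mul] at this
    simp only [this]
  have h := hp.intervalIntegral_add_eq 0 (Complex.arg (a * x.1) / β)
  rwa [zero_add] at h

/-- The Euclidean ball. -/
def eball (m : ℕ) (ρ : ℝ) : Set (Cn m) := {x | sqNorm x < ρ ^ 2}

lemma isOpen_eball (ρ : ℝ) : IsOpen (eball m ρ) := isOpen_lt continuous_sqNorm continuous_const

lemma pol_mem_coneBall {β : ℝ} (hβ : 0 < β) {ρ : ℝ} {x : Cn m} (hx : x.1 ≠ 0) (θ : ℝ) :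
    pol β (Real.log ‖x.1‖) θ x.2 ∈ coneBall m β ρ ↔ x ∈ eball m ρ := by
  simp only [coneBall, eball, mem_ofPred_eq, rad_pol hβ, sqNorm_eq,
    Real.exp_log (norm_pos_iff.2 hx)]
  rfl

lemma lift_mem_coneBall {β : ℝ} (hβ : 0 < β) {ρ : ℝ} {a : ℂ} (ha : ‖a‖ = 1) {x : Cn m}
    (hx : x.1 ≠ 0) (θ : ℝ) : lift β a θ x ∈ coneBall m β ρ ↔ x ∈ eball m ρ := by
  rw [lift_eq_pol ha, pol_mem_coneBall hβ hx]

lemma exists_ball_subset_eball (m : ℕ) {ρ ρ' : ℝ} (hρ : 0 < ρ) (h : ρ < ρ') (hρ' : ρ' ≤ 1 / 2) :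
    ∃ δ : ℝ, 0 < δ ∧ δ ≤ 1 ∧ ∀ x ∈ eball m ρ, ball x δ ⊆ eball m ρ' := by
  have h2 : ρ ^ 2 < ρ' ^ 2 := by gcongr
  have h3 : ρ' ^ 2 ≤ 1 := by nlinarith
  set δ := (ρ' ^ 2 - ρ ^ 2) / (2 * (m + 1)) with hδ
  have hδ0 : 0 < δ := div_pos (by linarith) (by positivity)
  have hδ1 : δ ≤ 1 := by
    rw [hδ, div_le_one (by positivity)]
    have : (0 : ℝ) ≤ m := m.cast_nonneg
    nlinarith
  have hδ2 : δ * (2 * (m + 1)) = ρ' ^ 2 - ρ ^ 2 := by rw [hδ]; field_simp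
  refine ⟨δ, hδ0, hδ1, fun x hx y hy => ?_⟩
  rw [mem_ball, dist_eq_norm] at hy
  simp only [eball, mem_ofPred_eq, sqNorm_eq] at hx ⊢
  have hn : 0 ≤ ∑ j, ‖x.2 j‖ ^ 2 := by positivity
  have h4 := sum_sq_le (x := x.2) (y := y.2) hδ0.le hδ1
    (norm_le_half_of_sum (h.le.trans hρ') hρ.le (by nlinarith [sq_nonneg ‖x.1‖])) fun j =>
    ((norm_le_pi_norm (y.2 - x.2) j).trans (norm_snd_le (y - x))).trans hy.le
  have h5 := sum_sq_le (ι := Unit) (x := fun _ => x.1) (y := fun _ => y.1) hδ0.le hδ1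
    (norm_le_half_of_sum (h.le.trans hρ') hρ.le (by simp; nlinarith)) fun j =>
    (norm_fst_le (y - x)).trans hy.le
  simp only [Fintype.card_fin, Fintype.card_unit, Finset.univ_unique, Finset.sum_singleton,
    Nat.cast_one, one_mul] at h4 h5
  linarith

section avg
variable {β α A M : ℝ} {v f : Cn m → ℝ}

lemma continuous_pol_comp {β : ℝ} (hβ : 0 < β) {g : Cn m → ℝ}
    (hg : ContinuousOn g (coneBall m β (1 / 2) \ divisor m)) {x : Cn m}
    (hx : x ∈ eball m (1 / 2)) (hx0 : x.1 ≠ 0) :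
    Continuous fun θ => g (pol β (Real.log ‖x.1‖) θ x.2) :=
  hg.comp_continuous ((continuous_pol β).comp (by fun_prop :
    Continuous fun θ : ℝ => (Real.log ‖x.1‖, θ, x.2)))
    fun θ => ⟨(pol_mem_coneBall hβ hx0 θ).2 hx, pol_fst_ne_zero _ _ _ _⟩

lemma abs_avg_sub_le {G H : ℝ → ℝ} {K : ℝ} (hG : Continuous G) (hH : Continuous H)
    (h : ∀ θ, |G θ - H θ| ≤ K) : |(2 * Real.pi)⁻¹ * (∫ θ in 0..2 * Real.pi, G θ) -
      (2 * Real.pi)⁻¹ * ∫ θ in 0..2 * Real.pi, H θ| ≤ K := by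
  have hpi := Real.pi_pos
  rw [← mul_sub, ← intervalIntegral.integral_sub (hG.intervalIntegrable _ _)
    (hH.intervalIntegrable _ _), abs_mul, abs_of_pos (by positivity)]
  have := intervalIntegral.norm_integral_le_of_norm_le_const (a := 0) (b := 2 * Real.pi)
    (f := fun θ => G θ - H θ) (C := K) fun θ _ => h θ
  rw [sub_zero, abs_of_pos (by positivity), Real.norm_eq_abs] at this
  rw [inv_mul_le_iff₀ (by positivity)]
  linarith

lemma const_eq_avg (c : ℝ) : (2 * Real.pi)⁻¹ * ∫ _θ in 0..2 * Real.pi, c = c := by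
  have hpi := Real.pi_pos
  rw [intervalIntegral.integral_const, sub_zero, smul_eq_mul]
  field_simp

/-- At equal angle the two points come from positive real first coordinates in one chart, and
replacing first coordinates by their moduli does not increase the distance. -/
lemma ConeHolder.pol_sub_le {O : Set (Cn m)} (hf : ConeHolder β α A O f) (hβ : 0 < β) (hα : 0 < α)
    (hA : 0 ≤ A) {x y : Cn m} (hx : x.1 ≠ 0) (hy : y.1 ≠ 0) (θ : ℝ)
    (hxO : pol β (Real.log ‖x.1‖) θ x.2 ∈ O) (hyO : pol β (Real.log ‖y.1‖) θ y.2 ∈ O) :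
    |f (pol β (Real.log ‖x.1‖) θ x.2) - f (pol β (Real.log ‖y.1‖) θ y.2)| ≤
      A * √(m + 1) ^ α * ‖x - y‖ ^ α := by
  have e : ∀ x : Cn m, pol β (Real.log ‖x.1‖) θ x.2 = lift β 1 θ ((‖x.1‖ : ℂ), x.2) := fun x => by
    rw [lift_eq_pol norm_one, one_mul, Complex.arg_ofReal_of_nonneg (norm_nonneg _)]
    simp
  rw [e] at hxO hyO ⊢
  rw [e y]
  refine (hf.lift_le hβ hα.le hA norm_one θ (by simpa using hx) (by simpa using hy) hxO hyO).trans ?_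
  rw [mul_assoc]
  refine mul_le_mul_of_nonneg_left (le_trans ?_ (sqrt_sqNorm_rpow_le hα.le _)) hA
  refine Real.rpow_le_rpow (Real.sqrt_nonneg _) (Real.sqrt_le_sqrt ?_) hα.le
  rw [sqNorm_eq, sqNorm_eq]
  refine add_le_add ?_ le_rfl
  have h1 : ‖((‖x.1‖ : ℂ), x.2).1 - ((‖y.1‖ : ℂ), y.2).1‖ ≤ ‖x.1 - y.1‖ := by
    simp only
    rw [← Complex.ofReal_sub, Complex.norm_real]
    exact abs_norm_sub_norm_le _ _
  simp only [Prod.fst_sub]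
  gcongr

lemma ConeHolder.continuousOn {O : Set (Cn m)} (hO : IsOpen O) (hf : ConeHolder β α A O f)
    (hβ : 0 < β) (hβ1 : β ≤ 1) (hα : 0 < α) (hA : 0 ≤ A) : ContinuousOn f (O \ divisor m) := by
  intro p hp
  refine ContinuousAt.continuousWithinAt ?_
  obtain ⟨x, hx, hxp⟩ := exists_lift_eq hβ hβ1 p hp.2
  set θ := Complex.arg p.1
  have hl : ContinuousAt (lift β 1 θ) x :=
    (hasFDerivAt_lift β 1 θ (mem_slitPlane_of_sector hx)).continuousAt
  have h1 : ContinuousAt (fun y => f (lift β 1 θ y)) x := by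
    rw [ContinuousAt, tendsto_iff_dist_tendsto_zero]
    have h2 : Tendsto (fun y : Cn m => A * √(sqNorm (y - x)) ^ α) (𝓝 x) (𝓝 0) := by
      have h3 : Continuous fun y : Cn m => A * √(sqNorm (y - x)) ^ α :=
        continuous_const.mul ((continuous_sqNorm.comp
          (continuous_id.sub continuous_const)).sqrt.rpow_const fun _ => Or.inr hα.le)
      have h4 := h3.tendsto x
      have e : sqNorm (x - x) = 0 := by simp [sqNorm_eq]
      simpa only [e, Real.sqrt_zero, Real.zero_rpow hα.ne', mul_zero] using h4
    refine squeeze_zero' (Eventually.of_forall fun _ => dist_nonneg) ?_ h2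
    filter_upwards [sector_mem_nhds hx, hl.eventually_mem (hO.mem_nhds (by rw [hxp]; exact hp.1))]
      with y hy hyO
    exact hf.lift_le hβ hα.le hA norm_one θ (by rw [one_mul]; exact hy.1)
      (by rw [one_mul]; exact hx.1) hyO (by rw [hxp]; exact hp.1)
  have hs : Complex.exp (-(θ * Complex.I)) * p.1 ∈ Complex.slitPlane := by
    rw [← hxp]; exact lift_mem_slit hβ θ hx
  have h2 : ContinuousAt (sect (m := m) β θ) p := (contDiffAt_sect β θ hs (n := 0)).continuousAt
  have e : sect β θ p = x := by rw [← hxp]; exact sect_lift hβ θ hx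
  rw [← e] at h1
  refine (h1.comp h2).congr ?_
  filter_upwards [eventually_fst_ne_zero hp.2] with q hq
  simp [lift_sect hβ hβ1 θ hq]

/-- Fubini's theorem for the average tested against a function. -/
lemma integral_avg_mul {a : ℂ} (ha : ‖a‖ = 1) (hβ : 0 < β) {g : Cn m → ℝ}
    (hg : ContinuousOn g (coneBall m β (1 / 2) \ divisor m)) {B : Set (Cn m)}
    (hB : B ⊆ eball m (1 / 2)) (hBa : ∀ x ∈ B, a * x.1 ∈ Complex.slitPlane) {ψ : Cn m → ℝ}
    (hψ : Continuous ψ) (hc : HasCompactSupport ψ) (hs : tsupport ψ ⊆ B) :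
    ∫ x, avg β g x * ψ x =
      (2 * Real.pi)⁻¹ * ∫ θ in 0..2 * Real.pi, ∫ x, g (lift β a θ x) * ψ x := by
  have hcont : ContinuousOn (fun q : ℝ × Cn m => g (lift β a q.1 q.2) * ψ q.2)
      (univ ×ˢ tsupport ψ) := by
    refine ContinuousOn.mul (hg.comp (fun q hq => ContinuousAt.continuousWithinAt ?_) fun q hq => ?_)
      (by fun_prop)
    · have h1 : ContinuousAt (fun q : ℝ × Cn m => Complex.log (a * q.2.1)) q :=
        (continuousAt_const.mul (continuous_fst.comp continuous_snd).continuousAt).clog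
          (hBa _ (hs hq.2))
      unfold lift
      fun_prop
    · have hx0 := fst_ne_zero_of_mem (hBa _ (hs hq.2))
      exact ⟨(lift_mem_coneBall hβ ha hx0 _).2 (hB (hs hq.2)), lift_fst_ne_zero _ _ _ _⟩
  have hint : Integrable (Function.uncurry fun (θ : ℝ) (x : Cn m) => g (lift β a θ x) * ψ x)
      ((volume.restrict (uIoc 0 (2 * Real.pi))).prod volume) := by
    have h1 : IntegrableOn (fun q : ℝ × Cn m => g (lift β a q.1 q.2) * ψ q.2)
        (uIcc 0 (2 * Real.pi) ×ˢ tsupport ψ) (volume.prod volume) :=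
      (hcont.mono (prod_mono_left (subset_univ _))).integrableOn_compact
        (isCompact_uIcc.prod hc)
    have h2 : IntegrableOn (fun q : ℝ × Cn m => g (lift β a q.1 q.2) * ψ q.2)
        (uIoc 0 (2 * Real.pi) ×ˢ univ) (volume.prod volume) := by
      refine (h1.mono_set (prod_mono_left uIoc_subset_uIcc)).of_forall_sdiff_eq_zero
        (measurableSet_uIoc.prod MeasurableSet.univ) fun q hq => ?_
      have : q.2 ∉ tsupport ψ := fun h' => hq.2 ⟨hq.1.1, h'⟩
      rw [image_eq_zero_of_notMem_tsupport this, mul_zero]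
    rwa [IntegrableOn, ← Measure.prod_restrict, Measure.restrict_univ] at h2
  rw [intervalIntegral_integral_swap hint, ← integral_const_mul]
  refine integral_congr_ae (Eventually.of_forall fun x => ?_)
  simp only
  rw [avg_eq_lift ha, intervalIntegral.integral_mul_const, mul_assoc]

end avg

lemma aestronglyMeasurable_of_continuousOn_diff {Ω : Set (Cn m)} (hΩ : IsOpen Ω) {g : Cn m → ℝ}
    (hg : ContinuousOn g (Ω \ divisor m)) : AEStronglyMeasurable g (volume.restrict Ω) := by
  have h1 := hg.aestronglyMeasurable (μ := volume) (hΩ.sdiff isClosed_divisor).measurableSet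
  rwa [Measure.restrict_congr_set (sdiff_null_ae_eq_self volume_divisor)] at h1

lemma norm_lt_half {x : Cn m} (hx : x ∈ eball m (1 / 2)) : ‖x‖ < 1 / 2 := by
  have h1 := (norm_sq_le_sqNorm x).trans_lt hx
  exact lt_of_pow_lt_pow_left₀ 2 (by norm_num) h1

namespace IsClassical
variable {β α A M : ℝ} {v f : Cn m → ℝ} (h : IsClassical β α A M v f)
include h

lemma contDiffAt {p : Cn m} (hp : p ∈ coneBall m β (1 / 2) \ divisor m) : ContDiffAt ℝ 2 v p :=
  h.contDiffOn.contDiffAt (((isOpen_coneBall h.pos.le _).sdiff isClosed_divisor).mem_nhds hp)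

lemma le_one : β ≤ 1 := h.le.trans (by norm_num)

lemma continuousOn_f : ContinuousOn f (coneBall m β (1 / 2) \ divisor m) :=
  h.holder.continuousOn (isOpen_coneBall h.pos.le _) h.pos h.le_one h.hα h.hA

lemma lift_mem {a : ℂ} (ha : ‖a‖ = 1) {x : Cn m} (hx : x ∈ eball m (1 / 2)) (hx0 : x.1 ≠ 0) (θ : ℝ) :
    lift β a θ x ∈ coneBall m β (1 / 2) \ divisor m :=
  ⟨(lift_mem_coneBall h.pos ha hx0 θ).2 hx, lift_fst_ne_zero _ _ _ _⟩

lemma pol_mem {x : Cn m} (hx : x ∈ eball m (1 / 2)) (hx0 : x.1 ≠ 0) (θ : ℝ) :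
    pol β (Real.log ‖x.1‖) θ x.2 ∈ coneBall m β (1 / 2) \ divisor m :=
  ⟨(pol_mem_coneBall h.pos hx0 θ).2 hx, pol_fst_ne_zero _ _ _ _⟩

lemma abs_avg_le {x : Cn m} (hx : x ∈ eball m (1 / 2)) (hx0 : x.1 ≠ 0) : |avg β v x| ≤ M := by
  have := abs_avg_sub_le (continuous_pol_comp h.pos h.contDiffOn.continuousOn hx hx0)
    (continuous_const (y := (0 : ℝ))) (K := M) fun θ => by
      rw [sub_zero]; exact h.bound _ (h.pol_mem hx hx0 θ)
  rwa [const_eq_avg, sub_zero] at this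

lemma avg_holder {x y : Cn m} (hx : x ∈ eball m (1 / 2)) (hx0 : x.1 ≠ 0)
    (hy : y ∈ eball m (1 / 2)) (hy0 : y.1 ≠ 0) :
    |avg β f x - avg β f y| ≤ A * √(m + 1) ^ α * ‖x - y‖ ^ α :=
  abs_avg_sub_le (continuous_pol_comp h.pos h.continuousOn_f hx hx0)
    (continuous_pol_comp h.pos h.continuousOn_f hy hy0) fun θ =>
    h.holder.pol_sub_le h.pos h.hα h.hA hx0 hy0 θ (h.pol_mem hx hx0 θ).1 (h.pol_mem hy hy0 θ).1

lemma continuousOn_avg_f : ContinuousOn (avg β f) (eball m (1 / 2) \ divisor m) := by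
  have : HolderOnWith (A * √(m + 1) ^ α).toNNReal α.toNNReal (avg β f)
      (eball m (1 / 2) \ divisor m) := fun x hx y hy => by
    have hA := h.hA
    rw [edist_dist, edist_dist, ← ENNReal.ofReal_coe_nnreal, ENNReal.ofReal_rpow_of_nonneg
      dist_nonneg (by simp), ← ENNReal.ofReal_mul (by simp), Real.coe_toNNReal _ (by positivity),
      Real.coe_toNNReal _ h.hα.le, Real.dist_eq, dist_eq_norm]
    exact ENNReal.ofReal_le_ofReal (h.avg_holder hx.1 hx.2 hy.1 hy.2)
  exact this.continuousOn (by simpa using h.hα)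

lemma continuousOn_avg : ContinuousOn (avg β v) (eball m (1 / 2) \ divisor m) := by
  intro x hx
  have hO : IsOpen (eball m (1 / 2) \ divisor m) := (isOpen_eball _).sdiff isClosed_divisor
  refine ContinuousAt.continuousWithinAt (ContinuousAt.mul continuousAt_const ?_)
  refine intervalIntegral.continuousAt_of_dominated_interval (bound := fun _ => M) ?_ ?_ (by simp) ?_
  · filter_upwards [hO.mem_nhds hx] with y hy
    exact (continuous_pol_comp h.pos h.contDiffOn.continuousOn hy.1 hy.2).aestronglyMeasurable
  · filter_upwards [hO.mem_nhds hx] with y hy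
    exact Eventually.of_forall fun θ _ => h.bound _ (h.pol_mem hy.1 hy.2 θ)
  · refine Eventually.of_forall fun θ _ => ?_
    have h1 : ContinuousAt (fun y : Cn m => Real.log ‖y.1‖) x :=
      (continuous_fst.norm.continuousAt).log (norm_ne_zero_iff.2 hx.2)
    have h2 : ContinuousAt (fun y : Cn m => (Real.log ‖y.1‖, θ, y.2)) x :=
      h1.prodMk (continuousAt_const.prodMk continuous_snd.continuousAt)
    have h3 := (continuous_pol (m := m) β).continuousAt.comp (x := x)
      (f := fun y : Cn m => (Real.log ‖y.1‖, θ, y.2)) h2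
    exact ContinuousAt.comp (g := v) (f := fun y : Cn m => pol β (Real.log ‖y.1‖) θ y.2)
      (h.contDiffAt (h.pol_mem hx.1 hx.2 θ)).continuousAt h3

lemma contDiffAt_lift {a : ℂ} (ha : ‖a‖ = 1) {x : Cn m} (hx : x ∈ eball m (1 / 2))
    (hxa : a * x.1 ∈ Complex.slitPlane) (θ : ℝ) : ContDiffAt ℝ 2 (fun y => v (lift β a θ y)) x :=
  (h.contDiffAt (h.lift_mem ha hx (fst_ne_zero_of_mem hxa) θ)).comp x
    (ConeSchauder.contDiffAt_lift β a θ hxa)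

lemma lap_lift {a : ℂ} (ha : ‖a‖ = 1) {x : Cn m} (hx : x ∈ eball m (1 / 2))
    (hxa : a * x.1 ∈ Complex.slitPlane) (θ : ℝ) :
    lap (fun y => v (lift β a θ y)) x = f (lift β a θ x) := by
  have hm := h.lift_mem ha hx (fst_ne_zero_of_mem hxa) θ
  rw [← laplacian_lift h.pos ha θ hxa (h.contDiffAt hm), h.eq _ hm]

/-- For each angle v ∘ lift is a classical, hence weak, solution, and Fubini averages the
identities. In the weak form nothing has to be differentiated under the integral sign. -/
lemma weakOn_avg_of_subset {a : ℂ} (ha : ‖a‖ = 1) {B : Set (Cn m)} (hBo : IsOpen B)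
    (hB : B ⊆ eball m (1 / 2)) (hBa : ∀ x ∈ B, a * x.1 ∈ Complex.slitPlane) :
    WeakOn B (avg β v) (avg β f) := by
  intro φ hφ hc hs
  rw [integral_avg_mul ha h.pos h.contDiffOn.continuousOn hB hBa (contDiff_lap hφ).continuous
    (HasCompactSupport.of_support_subset_isCompact hc ((subset_tsupport _).trans
      (tsupport_lap_subset φ))) ((tsupport_lap_subset φ).trans hs),
    integral_avg_mul ha h.pos h.continuousOn_f hB hBa hφ.continuous hc hs]
  congr 2
  funext θ
  exact weakOn_of_contDiffOn hBo (fun x hx =>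
    (h.contDiffAt_lift ha (hB hx) (hBa x hx) θ).contDiffWithinAt)
    (fun x hx => h.lap_lift ha (hB hx) (hBa x hx) θ) φ hφ hc hs

/-- The weak equation holds near x with the branch a = conj z₁ / |z₁|, which rotates x onto the
positive real axis; `exists_schauder` then supplies a C² representative, equal to the continuous
average. -/
lemma avg_regular {x : Cn m} (hx : x ∈ eball m (1 / 2) \ divisor m) :
    ContDiffAt ℝ 2 (avg β v) x ∧ lap (avg β v) x = avg β f x := by
  have hx0 : x.1 ≠ 0 := hx.2
  have hn : ‖x.1‖ ≠ 0 := norm_ne_zero_iff.2 hx0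
  set a : ℂ := (‖x.1‖ : ℂ)⁻¹ * (starRingEnd ℂ) x.1 with hadef
  have ha : ‖a‖ = 1 := by
    rw [hadef, norm_mul, norm_inv, Complex.norm_real, norm_norm, Complex.norm_conj,
      inv_mul_cancel₀ hn]
  have hax : a * x.1 = (‖x.1‖ : ℝ) := by
    rw [hadef, mul_assoc, mul_comm _ x.1, Complex.mul_conj, Complex.normSq_eq_norm_sq]
    have : (‖x.1‖ : ℂ) ≠ 0 := by exact_mod_cast hn
    push_cast
    field_simp
  set B : Set (Cn m) := (eball m (1 / 2) \ divisor m) ∩ {y | a * y.1 ∈ Complex.slitPlane}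
  have hB : IsOpen B := ((isOpen_eball _).sdiff isClosed_divisor).inter
    (Complex.isOpen_slitPlane.preimage (continuous_const.mul continuous_fst))
  have hxB : x ∈ B := ⟨hx, by
    rw [mem_ofPred_eq, hax]
    exact Complex.ofReal_mem_slitPlane.2 (norm_pos_iff.2 hx0)⟩
  obtain ⟨ε, hε, hball⟩ := Metric.isOpen_iff.1 hB x hxB
  set t := ε / 4
  have ht : 0 < t := by positivity
  have e4 : 4 * t = ε := by simp only [t]; ring
  rw [← e4] at hball
  have hsub : ball x (2 * t) ⊆ ball x (4 * t) := ball_subset_ball (by linarith)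
  obtain ⟨C, -, hS⟩ := exists_schauder m h.hα h.hα1
  have hA := h.hA
  obtain ⟨V, hV, hVu, hVf, -⟩ := hS x t M (A * √(m + 1) ^ α) (avg β v) (avg β f) univ ht h.hM
    (by positivity)
    ((h.continuousOn_avg.mono fun y hy => (hball hy).1).aestronglyMeasurable measurableSet_ball)
    ((h.continuousOn_avg_f.mono fun y hy => (hball hy).1).aestronglyMeasurable measurableSet_ball)
    (Eventually.of_forall fun y hy => h.abs_avg_le (hball hy).1.1 (hball hy).1.2) (by simp)
    (fun y hy _ z hz _ => h.avg_holder (hball hy).1.1 (hball hy).1.2 (hball hz).1.1 (hball hz).1.2)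
    (h.weakOn_avg_of_subset ha isOpen_ball (fun y hy => (hball hy).1.1) fun y hy => (hball hy).2)
  have he : EqOn V (avg β v) (ball x (2 * t)) := eqOn_of_ae isOpen_ball hV.continuousOn
    (h.continuousOn_avg.mono fun y hy => (hball (hsub hy)).1) hVu (Eventually.of_forall fun _ _ => rfl)
  have hn2 : ball x (2 * t) ∈ 𝓝 x := ball_mem_nhds x (by positivity)
  have he' : avg β v =ᶠ[𝓝 x] V := by filter_upwards [hn2] with y hy using (he hy).symm
  exact ⟨(hV.contDiffAt hn2).congr_of_eventuallyEq he', by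
    rw [lap_congr he']; exact hVf x (mem_ball_self (by positivity)) (mem_univ _)⟩

/-- Both averages are bounded and the equation is classical off the axis, so the axis is removable.
-/
lemma weakOn_avg : WeakOn (eball m (1 / 2)) (avg β v) (avg β f) := by
  have hA := h.hA
  have h1 : WeakOn (eball m (1 / 2) \ divisor m) (avg β v) (avg β f) :=
    weakOn_of_contDiffOn ((isOpen_eball _).sdiff isClosed_divisor)
      (fun x hx => (h.avg_regular hx).1.contDiffWithinAt) fun x hx => (h.avg_regular hx).2
  have hae : ∀ᵐ x : Cn m, x ∉ divisor m := measure_eq_zero_iff_ae_notMem.1 volume_divisor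
  set y₀ : Cn m := (1 / 4, 0)
  have hy : y₀ ∈ eball m (1 / 2) := by
    simp [eball, sqNorm_eq, y₀]
    norm_num
  have hy0 : y₀.1 ≠ 0 := by simp [y₀]
  refine WeakOn.of_diff_divisor (isOpen_eball _) (M := M)
    (B := |avg β f y₀| + A * √(m + 1) ^ α)
    (aestronglyMeasurable_of_continuousOn_diff (isOpen_eball _) h.continuousOn_avg)
    (aestronglyMeasurable_of_continuousOn_diff (isOpen_eball _) h.continuousOn_avg_f) ?_ ?_ h1
  · filter_upwards [hae] with x hx0 hx using h.abs_avg_le hx hx0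
  · filter_upwards [hae] with x hx0 hx
    have h2 := h.avg_holder hx hx0 hy hy0
    have h3 : ‖x - y₀‖ ^ α ≤ 1 := Real.rpow_le_one (norm_nonneg _)
      ((norm_sub_le _ _).trans (by linarith [norm_lt_half hx, norm_lt_half hy])) h.hα.le
    have h4 : A * √(m + 1) ^ α * ‖x - y₀‖ ^ α ≤ A * √(m + 1) ^ α * 1 :=
      mul_le_mul_of_nonneg_left h3 (by positivity)
    have h5 := abs_sub_abs_le_abs_sub (avg β f x) (avg β f y₀)
    linarith

/-- The average extends across the axis. -/
lemma exists_avg_extension : ∃ w : Cn m → ℝ, ContDiffOn ℝ 2 w (eball m (1 / 2)) ∧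
    ∀ x ∈ eball m (1 / 2) \ divisor m, w x = avg β v x := by
  have hA := h.hA
  have hae : ∀ᵐ x : Cn m, x ∉ divisor m := measure_eq_zero_iff_ae_notMem.1 volume_divisor
  obtain ⟨C, -, hS⟩ := exists_schauder m h.hα h.hα1
  obtain ⟨w, hw, hwu⟩ := exists_glue (Ω := eball m (1 / 2)) (u := avg β v) fun x hx => by
    obtain ⟨ε, hε, hball⟩ := Metric.isOpen_iff.1 (isOpen_eball (m := m) (1 / 2)) x hx
    set t := ε / 4
    have ht : 0 < t := by positivity
    have e4 : 4 * t = ε := by simp only [t]; ring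
    rw [← e4] at hball
    have hsub : ball x (2 * t) ⊆ ball x (4 * t) := ball_subset_ball (by linarith)
    have hsd : ball x (4 * t) \ divisor m ⊆ eball m (1 / 2) \ divisor m :=
      fun y hy => ⟨hball hy.1, hy.2⟩
    obtain ⟨V, hV, hVu, -⟩ := hS x t M (A * √(m + 1) ^ α) (avg β v) (avg β f) (divisor m)ᶜ ht h.hM
      (by positivity)
      (aestronglyMeasurable_of_continuousOn_diff isOpen_ball (h.continuousOn_avg.mono hsd))
      (aestronglyMeasurable_of_continuousOn_diff isOpen_ball (h.continuousOn_avg_f.mono hsd))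
      (by filter_upwards [hae] with y hy0 hy using h.abs_avg_le (hball hy) hy0)
      (by rw [compl_compl]; exact volume_divisor)
      (fun y hy hy0 z hz hz0 => h.avg_holder (hball hy) hy0 (hball hz) hz0)
      (fun φ h1 h2 h3 => h.weakOn_avg φ h1 h2 (h3.trans hball))
    exact ⟨_, V, isOpen_ball, mem_ball_self (by positivity), hsub.trans hball, hV, hVu⟩
  refine ⟨w, hw, eqOn_of_ae ((isOpen_eball _).sdiff isClosed_divisor)
    (hw.continuousOn.mono sdiff_subset) h.continuousOn_avg (hwu.mono fun y hy hy0 => hy hy0.1)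
    (Eventually.of_forall fun _ _ => rfl)⟩

end IsClassical

/-- The bounds of the interior Schauder estimate. -/
structure HasC2Bound (K α t : ℝ) (x₀ : Cn m) (v : Cn m → ℝ) : Prop where
  fst : ∀ x ∈ ball x₀ (2 * t), ∀ i, |pd i v x| * t ≤ K
  snd : ∀ x ∈ ball x₀ (2 * t), ∀ i j, |pd j (pd i v) x| * t ^ 2 ≤ K
  holder : ∀ x ∈ ball x₀ (2 * t), ∀ y ∈ ball x₀ (2 * t), ∀ i j,
    |pd j (pd i v) x - pd j (pd i v) y| * t ^ (2 + α) ≤ K * ‖x - y‖ ^ α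

/-- The interior Schauder estimate for functions of class `C²`. -/
lemma exists_schauder_classical (m : ℕ) {α : ℝ} (h0 : 0 < α) (h1 : α < 1) : ∃ C : ℝ, 0 ≤ C ∧
    ∀ (x₀ : Cn m) (t M A : ℝ) (w : Cn m → ℝ) (G : Set (Cn m)), 0 < t → 0 ≤ M → 0 ≤ A →
      ContDiffOn ℝ 2 w (ball x₀ (4 * t)) → (∀ᵐ x, x ∈ ball x₀ (4 * t) → |w x| ≤ M) →
      volume Gᶜ = 0 → (∀ x ∈ ball x₀ (4 * t), x ∈ G → ∀ y ∈ ball x₀ (4 * t), y ∈ G →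
        |lap w x - lap w y| ≤ A * ‖x - y‖ ^ α) →
      HasC2Bound (C * (M + A * t ^ (2 + α))) α t x₀ w := by
  obtain ⟨C, hC, hS⟩ := exists_schauder m h0 h1
  refine ⟨C, hC, fun x₀ t M A w G ht hM hA hw hb hG hh => ?_⟩
  have hw1 : ∀ i, ContDiffOn ℝ 1 (pd i w) (ball x₀ (4 * t)) := fun i => contDiffOn_pd isOpen_ball
    (hw.of_le (by norm_num [← one_add_one_eq_two])) i
  have hw2 : ∀ i j, ContinuousOn (pd j (pd i w)) (ball x₀ (4 * t)) := fun i j =>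
    contDiffOn_zero.1 (contDiffOn_pd isOpen_ball ((hw1 i).of_le (by simp)) j)
  have hl : ContinuousOn (lap w) (ball x₀ (4 * t)) := continuousOn_finsetSum _ fun i _ => hw2 i i
  have hsub : ball x₀ (2 * t) ⊆ ball x₀ (4 * t) := ball_subset_ball (by linarith)
  obtain ⟨V, hV, hVu, -, b1, b2, b3⟩ := hS x₀ t M A w (lap w) G ht hM hA
    (hw.continuousOn.aestronglyMeasurable measurableSet_ball)
    (hl.aestronglyMeasurable measurableSet_ball) hb hG hh
    (weakOn_of_contDiffOn isOpen_ball hw fun _ _ => rfl)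
  have he : EqOn V w (ball x₀ (2 * t)) := eqOn_of_ae isOpen_ball hV.continuousOn
    (hw.continuousOn.mono hsub) hVu (Eventually.of_forall fun _ _ => rfl)
  have he' : ∀ x ∈ ball x₀ (2 * t), V =ᶠ[𝓝 x] w := fun x hx => by
    filter_upwards [isOpen_ball.mem_nhds hx] with y hy using he hy
  have e1 : ∀ x ∈ ball x₀ (2 * t), ∀ i, pd i V x = pd i w x := fun x hx i => pd_congr (he' x hx) i
  have e2 : ∀ x ∈ ball x₀ (2 * t), ∀ i j, pd j (pd i V) x = pd j (pd i w) x := fun x hx i j =>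
    pd_congr (pd_eventuallyEq (he' x hx) i) j
  exact ⟨fun x hx i => e1 x hx i ▸ b1 x hx i, fun x hx i j => e2 x hx i j ▸ b2 x hx i j,
    fun x hx y hy i j => e2 x hx i j ▸ e2 y hy i j ▸ b3 x hx y hy i j⟩

/-- Extensions of the average satisfy interior `C^{2,α}` bounds. -/
lemma exists_avg_bound (m : ℕ) {α ρ : ℝ} (h0 : 0 < α) (h1 : α < 1) (hρ : 0 < ρ) (hρ1 : ρ < 1 / 2) :
    ∃ C : ℝ, 0 ≤ C ∧ ∀ (β A M : ℝ) (v f w : Cn m → ℝ), IsClassical β α A M v f →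
      ContDiffOn ℝ 2 w (eball m (1 / 2)) →
      (∀ x ∈ eball m (1 / 2) \ divisor m, w x = avg β v x) →
      (∀ x ∈ eball m ρ, ∀ i, |pd i w x| ≤ C * (A + M)) ∧
      (∀ x ∈ eball m ρ, ∀ i j, |pd j (pd i w) x| ≤ C * (A + M)) ∧
      ∀ x ∈ eball m ρ, ∀ y ∈ eball m ρ, ∀ i j,
        |pd j (pd i w) x - pd j (pd i w) y| ≤ C * (A + M) * ‖x - y‖ ^ α := by
  obtain ⟨C, hC, hS⟩ := exists_schauder_classical m h0 h1
  obtain ⟨δ, hδ, hδ1, hball⟩ := exists_ball_subset_eball m hρ hρ1 le_rfl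
  set t := δ / 4 with ht'
  have ht : 0 < t := by positivity
  have ht1 : t ≤ 1 := by linarith
  have e4 : 4 * t = δ := by rw [ht']; ring
  set C₁ := C * (1 + √(m + 1) ^ α) with hC₁
  have hC₁0 : 0 ≤ C₁ := by positivity
  have key : ∀ (β A M : ℝ) (v f w : Cn m → ℝ), IsClassical β α A M v f →
      ContDiffOn ℝ 2 w (eball m (1 / 2)) →
      (∀ x ∈ eball m (1 / 2) \ divisor m, w x = avg β v x) → ∀ x ∈ eball m ρ,
      HasC2Bound (C₁ * (A + M)) α t x w := by
    intro β A M v f w h hw hwa x hx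
    have hA := h.hA
    have hM := h.hM
    have hb := hball x hx
    rw [← e4] at hb
    have hl : ∀ y ∈ eball m (1 / 2) \ divisor m, lap w y = avg β f y := fun y hy => by
      rw [← (h.avg_regular hy).2]
      refine lap_congr ?_
      filter_upwards [((isOpen_eball _).sdiff isClosed_divisor).mem_nhds hy] with z hz using hwa z hz
    have hae : ∀ᵐ x : Cn m, x ∉ divisor m := measure_eq_zero_iff_ae_notMem.1 volume_divisor
    have h2 := hS x t M (A * √(m + 1) ^ α) w (divisor m)ᶜ ht h.hM (by positivity) (hw.mono hb)
      (by filter_upwards [hae] with y hy0 hy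
          rw [hwa y ⟨hb hy, hy0⟩]; exact h.abs_avg_le (hb hy) hy0)
      (by rw [compl_compl]; exact volume_divisor)
      (fun y hy hy0 z hz hz0 => by
        rw [hl y ⟨hb hy, hy0⟩, hl z ⟨hb hz, hz0⟩]
        exact h.avg_holder (hb hy) hy0 (hb hz) hz0)
    have h3 : C * (M + A * √(m + 1) ^ α * t ^ (2 + α)) ≤ C₁ * (A + M) := by
      have h4 : t ^ (2 + α) ≤ 1 := Real.rpow_le_one ht.le ht1 (by linarith)
      have h5 : A * √(m + 1) ^ α * t ^ (2 + α) ≤ A * √(m + 1) ^ α * 1 := by gcongr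
      have h6 : 0 ≤ √((m : ℝ) + 1) ^ α * M := by positivity
      rw [hC₁, mul_assoc C (1 + _)]
      refine mul_le_mul_of_nonneg_left ?_ hC
      linarith
    exact ⟨fun y hy i => (h2.fst y hy i).trans h3, fun y hy i j => (h2.snd y hy i j).trans h3,
      fun y hy z hz i j => (h2.holder y hy z hz i j).trans (by gcongr)⟩
  have ht2 : 0 < t ^ (2 + α) := by positivity
  set C₂ := C₁ / t ^ (2 + α) with hC₂
  have ht3 : t ^ (2 + α) ≤ t ^ 2 := by
    have h := Real.rpow_le_rpow_of_exponent_ge ht ht1 (by linarith : (2 : ℝ) ≤ 2 + α)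
    calc t ^ (2 + α) ≤ t ^ (2 : ℝ) := h
      _ = t ^ 2 := by norm_cast
  have ht4 : t ^ (2 + α) ≤ t := ht3.trans (by nlinarith)
  have hdiv : ∀ {X s K : ℝ}, 0 ≤ K → t ^ (2 + α) ≤ s → |X| * s ≤ C₁ * K → |X| ≤ C₂ * K := by
    intro X s K hK hs hX
    rw [hC₂, div_mul_eq_mul_div, le_div_iff₀ ht2]
    exact (mul_le_mul_of_nonneg_left hs (abs_nonneg _)).trans hX
  have hC₂0 : 0 ≤ C₂ := by positivity
  set C₃ := C₂ + 2 * C₂ / t ^ α with hC₃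
  have h23 : C₂ ≤ C₃ := by rw [hC₃]; exact le_add_of_nonneg_right (by positivity)
  refine ⟨C₃, by positivity, fun β A M v f w h hw hwa => ?_⟩
  have hA := h.hA
  have hM := h.hM
  have hAM : 0 ≤ A + M := by positivity
  have k := key β A M v f w h hw hwa
  have hs1 : ∀ x ∈ eball m ρ, ∀ i j, |pd j (pd i w) x| ≤ C₂ * (A + M) := fun x hx i j =>
    hdiv hAM ht3 ((k x hx).snd x (mem_ball_self (by positivity)) i j)
  refine ⟨fun x hx i => (hdiv hAM ht4 ((k x hx).fst x (mem_ball_self (by positivity)) i)).trans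
    (by gcongr), fun x hx i j => (hs1 x hx i j).trans (by gcongr), fun x hx y hy i j => ?_⟩
  -- Close points lie in one Schauder ball. For distant ones the sup bound is enough, as ‖x - y‖^α ≥
  -- t^α.
  rcases lt_or_ge ‖x - y‖ t with hxy | hxy
  · have h5 := (k x hx).holder x (mem_ball_self (by positivity)) y
      (by rw [mem_ball, dist_comm, dist_eq_norm]; linarith) i j
    rw [← le_div_iff₀ ht2] at h5
    refine h5.trans ?_
    rw [show C₁ * (A + M) * ‖x - y‖ ^ α / t ^ (2 + α) = C₂ * (A + M) * ‖x - y‖ ^ α by rw [hC₂]; ring]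
    gcongr
  · have h6 : t ^ α ≤ ‖x - y‖ ^ α := Real.rpow_le_rpow ht.le hxy h0.le
    have h7 := (abs_sub _ _).trans (add_le_add (hs1 x hx i j) (hs1 y hy i j))
    refine h7.trans ?_
    calc C₂ * (A + M) + C₂ * (A + M) = 2 * C₂ / t ^ α * (A + M) * t ^ α := by
          field_simp; ring
      _ ≤ C₃ * (A + M) * ‖x - y‖ ^ α := by
          gcongr
          rw [hC₃]
          linarith

/-! ### Decay of the difference to the average -/

lemma pd_pd_sub {U w : Cn m → ℝ} {x : Cn m} (hU : ContDiffAt ℝ 2 U x) (hw : ContDiffAt ℝ 2 w x)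
    (i j : Idx m) :
    pd j (pd i fun y => U y - w y) x = pd j (pd i U) x - pd j (pd i w) x := by
  have hd : ∀ {V : Cn m → ℝ}, ContDiffAt ℝ 2 V x → DifferentiableAt ℝ (pd i V) x := fun hV =>
    (fderiv_differentiableAt hV).clm_apply (differentiableAt_const _)
  rw [← pd_sub (hd hU) (hd hw)]
  refine pd_congr ?_ j
  filter_upwards [hU.eventually (by simp), hw.eventually (by simp)] with y h1 h2
  exact pd_sub (h1.differentiableAt (by simp)) (h2.differentiableAt (by simp)) i

lemma IsClassical.abs_sub_avg_le {β α A M K ρ : ℝ} {v f : Cn m → ℝ} (h : IsClassical β α A M v f)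
    (hosc : ∀ (σ θ θ' : ℝ) (z : Fin m → ℂ), pol β σ θ z ∈ coneBall m β ρ →
        |v (pol β σ θ z) - v (pol β σ θ' z)| ≤ K * Real.exp ((2 + α) * σ)) {a : ℂ} (ha : ‖a‖ = 1)
    (θ : ℝ) {x : Cn m} (hx : x ∈ eball m ρ) (hx' : x ∈ eball m (1 / 2)) (hx0 : x.1 ≠ 0) :
    |v (lift β a θ x) - avg β v x| ≤ K * ‖x.1‖ ^ (2 + α) := by
  rw [Real.rpow_def_of_pos (norm_pos_iff.2 hx0), mul_comm (Real.log _), lift_eq_pol ha,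
    ← const_eq_avg (v (pol β (Real.log ‖x.1‖) (θ + Complex.arg (a * x.1) / β) x.2))]
  exact abs_avg_sub_le continuous_const
    (continuous_pol_comp h.pos h.contDiffOn.continuousOn hx' hx0)
    fun θ' => hosc _ _ _ _ ((pol_mem_coneBall h.pos hx0 _).2 hx)

lemma eball_mono {ρ ρ' : ℝ} (h0 : 0 ≤ ρ) (h : ρ ≤ ρ') : eball m ρ ⊆ eball m ρ' := fun x hx => by
  have : ρ ^ 2 ≤ ρ' ^ 2 := by gcongr
  exact lt_of_lt_of_le hx this

/-- Decay of the difference between a solution in a sector chart and its average. -/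
lemma exists_diff_bound (m : ℕ) {α ρ : ℝ} (h0 : 0 < α) (h1 : α < 1) (hρ : 0 < ρ)
    (hρ1 : ρ < 1 / 2) : ∃ C κ : ℝ, 0 ≤ C ∧ 0 < κ ∧ κ ≤ 1 ∧
    ∀ (β A M : ℝ) (v f w : Cn m → ℝ), IsClassical β α A M v f →
      ContDiffOn ℝ 2 w (eball m (1 / 2)) →
      (∀ x ∈ eball m (1 / 2) \ divisor m, w x = avg β v x) →
      ∀ (θ : ℝ) (x : Cn m), x ∈ eball m ρ → x.1 ≠ 0 → ‖x.1‖ ≤ 2 * x.1.re →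
        |v (lift β 1 θ x) - w x| ≤ C * (A + M) * ‖x.1‖ ^ (2 + α) ∧
        (∀ i, |pd i (fun y => v (lift β 1 θ y) - w y) x| ≤ C * (A + M) * ‖x.1‖ ^ (1 + α)) ∧
        (∀ i j, |pd j (pd i fun y => v (lift β 1 θ y) - w y) x| ≤ C * (A + M) * ‖x.1‖ ^ α) ∧
        ∀ y, ‖x - y‖ < κ * ‖x.1‖ → ∀ i j, |pd j (pd i fun y => v (lift β 1 θ y) - w y) x -
          pd j (pd i fun y => v (lift β 1 θ y) - w y) y| ≤ C * (A + M) * ‖x - y‖ ^ α := by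
  obtain ⟨C, hC, hS⟩ := exists_schauder_classical m h0 h1
  set ρ' := (ρ + 1 / 2) / 2 with hρ'
  have hρρ' : ρ < ρ' := by rw [hρ']; linarith
  have hρ'1 : ρ' < 1 / 2 := by rw [hρ']; linarith
  obtain ⟨δ, hδ, hδ1, hball⟩ := exists_ball_subset_eball m hρ hρρ' hρ'1.le
  obtain ⟨K, hK, hosc⟩ := exists_angular_osc m (hρ.trans hρρ') hρ'1
  -- The ball of radius 4 c r around x must stay in `eball m ρ'` and within r/4 of x; as Re z₁ ≥ r/2
  -- at x, it then lies in the right half-plane.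
  set c := δ / 16 with hc
  have hc0 : 0 < c := by positivity
  have hc1 : c ≤ 1 := by linarith
  set C₁ := C * (8 * K + 2 * √(m + 1) ^ α) with hC₁
  have hC₁0 : 0 ≤ C₁ := by positivity
  have hKC : K ≤ K + C₁ / c ^ 3 := le_add_of_nonneg_right (by positivity)
  have hCC : C₁ / c ^ 3 ≤ K + C₁ / c ^ 3 := le_add_of_nonneg_left hK
  refine ⟨K + C₁ / c ^ 3, 2 * c, by positivity, by positivity, by linarith,
    fun β A M v f w h hw hwa θ x hx hx0 hre => ?_⟩
  have hA := h.hA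
  have hM := h.hM
  set r := ‖x.1‖ with hr
  have hr0 : 0 < r := norm_pos_iff.2 hx0
  have hxh : x ∈ eball m (1 / 2) := eball_mono hρ.le hρ1.le hx
  have hr1 : r ≤ 1 := (norm_fst_le x).trans (by linarith [norm_lt_half hxh])
  set t := c * r with ht
  have ht0 : 0 < t := by positivity
  have htδ : 4 * t ≤ δ := by
    rw [ht, hc]
    nlinarith
  have htr : 4 * t ≤ r / 4 := by
    rw [ht, hc]
    nlinarith
  have hb1 : ball x (4 * t) ⊆ eball m ρ' := (ball_subset_ball htδ).trans (hball x hx)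
  have hb2 : ball x (4 * t) ⊆ eball m (1 / 2) := hb1.trans
    (eball_mono (hρ.le.trans hρρ'.le) hρ'1.le)
  have hdist : ∀ y ∈ ball x (4 * t), ‖y.1 - x.1‖ ≤ r / 4 := fun y hy => by
    rw [mem_ball, dist_eq_norm] at hy
    exact ((norm_fst_le (y - x)).trans hy.le).trans htr
  have hre' : ∀ y ∈ ball x (4 * t), 0 < (1 * y.1).re := fun y hy => by
    have h2 := (Complex.abs_re_le_norm (y.1 - x.1)).trans (hdist y hy)
    rw [Complex.sub_re] at h2
    have h3 := (abs_le.1 h2).1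
    rw [one_mul]
    linarith
  have hslit : ∀ y ∈ ball x (4 * t), 1 * y.1 ∈ Complex.slitPlane := fun y hy => Or.inl (hre' y hy)
  have hny : ∀ y ∈ ball x (4 * t), ‖y.1‖ ≤ 2 * r := fun y hy => by
    have h2 := norm_le_norm_add_norm_sub x.1 y.1
    have h3 := hdist y hy
    rw [norm_sub_rev] at h3
    linarith
  set W : Cn m → ℝ := fun y => v (lift β 1 θ y) - w y with hW
  have hU : ∀ y ∈ ball x (4 * t), ContDiffAt ℝ 2 (fun y => v (lift β 1 θ y)) y := fun y hy =>
    h.contDiffAt_lift norm_one (hb2 hy) (hslit y hy) θ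
  have hwc : ∀ y ∈ ball x (4 * t), ContDiffAt ℝ 2 w y := fun y hy =>
    hw.contDiffAt ((isOpen_eball _).mem_nhds (hb2 hy))
  have hWb : ∀ y ∈ eball m ρ', 1 * y.1 ∈ Complex.slitPlane →
      |W y| ≤ K * (A + M) * ‖y.1‖ ^ (2 + α) := fun y hy hy1 => by
    have hy0 := fst_ne_zero_of_mem hy1
    have hyh := eball_mono (hρ.le.trans hρρ'.le) hρ'1.le hy
    simp only [hW]
    rw [hwa y ⟨hyh, hy0⟩]
    exact h.abs_sub_avg_le (hosc β α A M v f h) norm_one θ hy hyh hy0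
  have hlap : ∀ y ∈ ball x (4 * t), lap W y = f (lift β 1 θ y) - avg β f y := fun y hy => by
    have hy0 := fst_ne_zero_of_mem (hslit y hy)
    have e1 : lap W y = lap (fun y => v (lift β 1 θ y)) y - lap w y := by
      simp only [lap, hW, pd_pd_sub (hU y hy) (hwc y hy), Finset.sum_sub_distrib]
    rw [e1, h.lap_lift norm_one (hb2 hy) (hslit y hy), ← (h.avg_regular ⟨hb2 hy, hy0⟩).2]
    congr 1
    refine lap_congr ?_
    filter_upwards [((isOpen_eball _).sdiff isClosed_divisor).mem_nhds
      (show y ∈ eball m (1 / 2) \ divisor m from ⟨hb2 hy, hy0⟩)] with z hz using hwa z hz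
  -- Schauder at scale t = c r: the sup of W is O(r^(2+α)) by the oscillation estimate, and ΔW = f -
  -- avg f is Hölder, which scales to the same power. The factor 8 bounds 2^(2+α), because |y₁| ≤ 2
  -- r on the ball.
  have hb := hS x t (8 * K * (A + M) * r ^ (2 + α)) (2 * (A * √(m + 1) ^ α)) W univ ht0
    (by positivity) (by positivity)
    (fun y hy => ((hU y hy).sub (hwc y hy)).contDiffWithinAt)
    (Eventually.of_forall fun y hy => by
      refine (hWb y (hb1 hy) (hslit y hy)).trans ?_
      have h2 : ‖y.1‖ ^ (2 + α) ≤ 8 * r ^ (2 + α) := by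
        calc ‖y.1‖ ^ (2 + α) ≤ (2 * r) ^ (2 + α) :=
              Real.rpow_le_rpow (norm_nonneg _) (hny y hy) (by linarith)
          _ = 2 ^ (2 + α) * r ^ (2 + α) := Real.mul_rpow (by norm_num) hr0.le
          _ ≤ 8 * r ^ (2 + α) := by
              gcongr
              calc (2 : ℝ) ^ (2 + α) ≤ 2 ^ (3 : ℝ) :=
                    Real.rpow_le_rpow_of_exponent_le (by norm_num) (by linarith)
                _ = 8 := by norm_num
      calc K * (A + M) * ‖y.1‖ ^ (2 + α) ≤ K * (A + M) * (8 * r ^ (2 + α)) := by gcongr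
        _ = _ := by ring)
    (by simp) (fun y hy _ z hz _ => by
      rw [hlap y hy, hlap z hz]
      have h2 : |f (lift β 1 θ y) - f (lift β 1 θ z)| ≤ A * √(m + 1) ^ α * ‖y - z‖ ^ α := by
        refine (h.holder.lift_le h.pos h0.le hA norm_one θ (hre' y hy) (hre' z hz)
          (h.lift_mem norm_one (hb2 hy) (fst_ne_zero_of_mem (hslit y hy)) θ).1
          (h.lift_mem norm_one (hb2 hz) (fst_ne_zero_of_mem (hslit z hz)) θ).1).trans ?_
        rw [mul_assoc]
        exact mul_le_mul_of_nonneg_left (sqrt_sqNorm_rpow_le h0.le _) hA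
      have h3 := h.avg_holder (hb2 hy) (fst_ne_zero_of_mem (hslit y hy)) (hb2 hz)
        (fst_ne_zero_of_mem (hslit z hz))
      rw [show f (lift β 1 θ y) - avg β f y - (f (lift β 1 θ z) - avg β f z) =
        (f (lift β 1 θ y) - f (lift β 1 θ z)) - (avg β f y - avg β f z) by ring]
      refine (abs_sub _ _).trans ?_
      linarith)
  have hKle : C * (8 * K * (A + M) * r ^ (2 + α) + 2 * (A * √(m + 1) ^ α) * t ^ (2 + α)) ≤
      C₁ * (A + M) * r ^ (2 + α) := by
    have h2 : t ^ (2 + α) ≤ r ^ (2 + α) := Real.rpow_le_rpow ht0.le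
      (mul_le_of_le_one_left hr0.le hc1) (by linarith)
    have h3 : 2 * (A * √(m + 1) ^ α) * t ^ (2 + α) ≤
        2 * ((A + M) * √(m + 1) ^ α) * r ^ (2 + α) := by
      gcongr
      linarith
    calc _ ≤ C * (8 * K * (A + M) * r ^ (2 + α) + 2 * ((A + M) * √(m + 1) ^ α) * r ^ (2 + α)) := by
          gcongr
      _ = _ := by rw [hC₁]; ring
  have hx1 : x ∈ ball x (2 * t) := mem_ball_self (by positivity)
  have hpow : ∀ s : ℝ, s ≤ 3 → c ^ 3 ≤ c ^ s := fun s hs => by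
    calc c ^ 3 = c ^ (3 : ℝ) := by norm_cast
      _ ≤ c ^ s := Real.rpow_le_rpow_of_exponent_ge hc0 hc1 hs
  have hdiv : ∀ {X s q : ℝ}, s ≤ 3 → s + q = 2 + α →
      |X| * t ^ s ≤ C₁ * (A + M) * r ^ (2 + α) → |X| ≤ (K + C₁ / c ^ 3) * (A + M) * r ^ q := by
    intro X s q hs hq hX
    have e1 : r ^ (2 + α) = r ^ s * r ^ q := by rw [← hq, Real.rpow_add hr0]
    rw [ht, Real.mul_rpow hc0.le hr0.le, e1] at hX
    have hrs : 0 < r ^ s := by positivity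
    have h2 : |X| * c ^ s ≤ C₁ * (A + M) * r ^ q := by
      refine le_of_mul_le_mul_right ?_ hrs
      linarith
    have h3 : |X| * c ^ 3 ≤ C₁ * (A + M) * r ^ q :=
      (mul_le_mul_of_nonneg_left (hpow s hs) (abs_nonneg _)).trans h2
    have h4 : |X| ≤ C₁ / c ^ 3 * (A + M) * r ^ q := by
      rw [div_mul_eq_mul_div, div_mul_eq_mul_div, le_div_iff₀ (by positivity)]
      exact h3
    refine h4.trans ?_
    gcongr
  refine ⟨?_, fun i => ?_, fun i j => ?_, fun y hy i j => ?_⟩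
  · refine (hWb x (hb1 (mem_ball_self (by positivity)))
      (hslit x (mem_ball_self (by positivity)))).trans ?_
    gcongr
  · refine hdiv (s := 1) (by norm_num) (by ring) ?_
    rw [Real.rpow_one]
    exact (hb.fst x hx1 i).trans hKle
  · refine hdiv (s := 2) (by norm_num) (by ring) ?_
    rw [show t ^ (2 : ℝ) = t ^ 2 by norm_cast]
    exact (hb.snd x hx1 i j).trans hKle
  · have hy2 : y ∈ ball x (2 * t) := by
      rw [mem_ball, dist_comm, dist_eq_norm, ht]
      linarith
    have h2 := hb.holder x hx1 y hy2 i j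
    have h3 := h2.trans (mul_le_mul_of_nonneg_right hKle (by positivity))
    rcases (norm_nonneg (x - y)).eq_or_lt with hz | hz
    · have : x = y := sub_eq_zero.1 (norm_eq_zero.1 hz.symm)
      rw [this, sub_self, abs_zero]
      positivity
    have hz' : 0 < ‖x - y‖ ^ α := by positivity
    set X := pd j (pd i W) x - pd j (pd i W) y
    have h4 : |X / ‖x - y‖ ^ α| ≤ (K + C₁ / c ^ 3) * (A + M) * r ^ (0 : ℝ) := by
      refine hdiv (s := 2 + α) (by linarith) (by ring) ?_
      rw [abs_div, abs_of_pos hz', div_mul_eq_mul_div, div_le_iff₀ hz']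
      exact h3
    rw [Real.rpow_zero, mul_one, abs_div, abs_of_pos hz', div_le_iff₀ hz'] at h4
    exact h4

/-! ### Components of the Hessian -/

/-- The bilinear form with matrix `T` in the standard basis. -/
def bil (T : Idx m → Idx m → ℝ) (a b : Cn m) : ℝ := ∑ i, ∑ j, co i a * co j b * T i j

lemma D2_eq_bil {U : Cn m → ℝ} {x : Cn m} (hU : ContDiffAt ℝ 2 U x) (a b : Cn m) :
    D2 U x a b = bil (fun i j => pd i (pd j U) x) a b := by
  conv_lhs => rw [← sum_co_smul_dir a, ← sum_co_smul_dir b]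
  simp only [D2, map_sum, map_smul, sum_apply, smul_apply,
    smul_eq_mul, bil, pd_pd_eq_D2 hU, Finset.mul_sum]
  rw [Finset.sum_comm]
  refine Finset.sum_congr rfl fun i _ => ?_
  refine Finset.sum_congr rfl fun j _ => ?_
  ring

lemma abs_bil_le {T : Idx m → Idx m → ℝ} {K : ℝ} (hT : ∀ i j, |T i j| ≤ K) (a b : Cn m) :
    |bil T a b| ≤ (2 * (m + 1)) ^ 2 * K * (‖a‖ * ‖b‖) := by
  have h1 : ∀ i j, |co i a * co j b * T i j| ≤ ‖a‖ * ‖b‖ * K := fun i j => by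
    rw [abs_mul, abs_mul]
    gcongr
    · exact abs_co_le i a
    · exact abs_co_le j b
    · exact hT i j
  have h2 : |bil T a b| ≤ ∑ i : Idx m, ∑ j : Idx m, ‖a‖ * ‖b‖ * K :=
    (Finset.abs_sum_le_sum_abs _ _).trans <| Finset.sum_le_sum fun i _ =>
      (Finset.abs_sum_le_sum_abs _ _).trans <| Finset.sum_le_sum fun j _ => h1 i j
  refine h2.trans_eq ?_
  simp only [Finset.sum_const, Finset.card_univ, card_idx, nsmul_eq_mul]
  push_cast
  ring

lemma bil_sub_matrix (T S : Idx m → Idx m → ℝ) (a b : Cn m) :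
    bil T a b - bil S a b = bil (fun i j => T i j - S i j) a b := by
  simp only [bil, ← Finset.sum_sub_distrib, mul_sub]

lemma bil_add_matrix (T S : Idx m → Idx m → ℝ) (a b : Cn m) :
    bil T a b + bil S a b = bil (fun i j => T i j + S i j) a b := by
  simp only [bil, ← Finset.sum_add_distrib, mul_add]

lemma bil_sub_vectors (T : Idx m → Idx m → ℝ) (a b a' b' : Cn m) :
    bil T a b - bil T a' b' = bil T (a - a') b + bil T a' (b - b') := by
  simp only [bil, ← Finset.sum_sub_distrib, ← Finset.sum_add_distrib, map_sub]
  refine Finset.sum_congr rfl fun i _ => ?_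
  refine Finset.sum_congr rfl fun j _ => ?_
  ring

lemma norm_frame_one_le (i : Idx m) {x : Cn m} : ‖frame 1 i x‖ ≤ 1 := by
  rcases i with k | j
  · rw [frame_inl, rad_one, one_mul]
    have : ‖unit k‖ = 1 := by fin_cases k <;> simp [unit]
    refine max_le ?_ (by simp)
    simp only [norm_mul, this, one_mul, Complex.norm_real, norm_inv, norm_norm]
    exact inv_mul_le_one
  · rw [frame_inr]
    exact norm_dir_le _

lemma frame_one_ofReal (i : Idx m) {s : ℝ} (hs : 0 < s) (z : Fin m → ℂ) :
    frame 1 i ((s : ℂ), z) = dir i := by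
  rcases i with k | j
  · rw [frame_inl, rad_one, one_mul, dir]
    have : (s : ℂ) ≠ 0 := by exact_mod_cast hs.ne'
    simp only [Complex.norm_real, Real.norm_of_nonneg hs.le, unit]
    push_cast
    congr 1
    field_simp
  · rfl

lemma norm_frame_one_sub_le (i : Idx m) {x y : Cn m} (hx : x.1 ≠ 0) (hy : y.1 ≠ 0) :
    ‖frame 1 i x - frame 1 i y‖ ≤ 2 * ‖x - y‖ / ‖x.1‖ := by
  rcases i with k | j
  · have hx' : 0 < ‖x.1‖ := norm_pos_iff.2 hx
    have hy' : 0 < ‖y.1‖ := norm_pos_iff.2 hy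
    have hu : ‖unit k‖ = 1 := by fin_cases k <;> simp [unit]
    have h0 : ‖x.1 - y.1‖ ≤ ‖x - y‖ := norm_fst_le (x - y)
    have h1 : |‖y.1‖ - ‖x.1‖| ≤ ‖x - y‖ := by
      rw [abs_sub_comm]
      exact (abs_norm_sub_norm_le _ _).trans h0
    rw [frame_inl, frame_inl, rad_one, rad_one, one_mul, one_mul, le_div_iff₀ hx']
    have e : ((((‖x.1‖⁻¹ : ℝ) : ℂ) * (unit k * x.1), 0) : Cn m) -
        (((‖y.1‖⁻¹ : ℝ) : ℂ) * (unit k * y.1), 0) = ((‖x.1‖⁻¹ : ℝ) * (unit k * ((x.1 - y.1) +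
          ((‖y.1‖ - ‖x.1‖ : ℝ) * ((‖y.1‖⁻¹ : ℝ) * y.1)))), 0) := by
      ext1
      · have h2 : (‖x.1‖ : ℂ) ≠ 0 := by exact_mod_cast hx'.ne'
        have h3 : (‖y.1‖ : ℂ) ≠ 0 := by exact_mod_cast hy'.ne'
        simp only [Prod.fst_sub]
        push_cast
        field_simp
        ring
      · simp
    rw [e]
    have h4 : ‖(x.1 - y.1) + ((‖y.1‖ - ‖x.1‖ : ℝ) * ((‖y.1‖⁻¹ : ℝ) * y.1) : ℂ)‖ ≤ 2 * ‖x - y‖ := by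
      refine (norm_add_le _ _).trans ?_
      rw [norm_mul, norm_mul, Complex.norm_real, Complex.norm_real, norm_inv, norm_norm,
        inv_mul_cancel₀ hy'.ne', mul_one, Real.norm_eq_abs]
      linarith
    have h5 : ‖(((‖x.1‖⁻¹ : ℝ) : ℂ) * (unit k * ((x.1 - y.1) +
          ((‖y.1‖ - ‖x.1‖ : ℝ) * ((‖y.1‖⁻¹ : ℝ) * y.1)))), (0 : Fin m → ℂ))‖ ≤
        ‖x.1‖⁻¹ * (2 * ‖x - y‖) := by
      refine max_le ?_ (by simp only [norm_zero]; positivity)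
      simp only
      rw [norm_mul, norm_mul, hu, one_mul, Complex.norm_real, norm_inv, norm_norm]
      gcongr
    refine (mul_le_mul_of_nonneg_right h5 hx'.le).trans_eq ?_
    field_simp
  · rw [frame_inr, frame_inr, sub_self, norm_zero]
    positivity

lemma hess_congr {β : ℝ} {v w : Cn m → ℝ} {p : Cn m} (h : v =ᶠ[𝓝 p] w) (i j : Idx m) :
    hess β v p i j = hess β w p i j := by
  have h1 : ∀ k, D β k v =ᶠ[𝓝 p] D β k w := fun k => by
    filter_upwards [h.eventuallyEq_nhds] with q hq
    rw [D, D, hq.fderiv_eq]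
  have h2 : ∀ k, D β k v p = D β k w p := fun k => (h1 k).self_of_nhds
  have h3 : D β i (D β j v) p = D β i (D β j w) p := by
    rw [D, (h1 j).fderiv_eq]
    rfl
  simp only [hess, connection, h2, h3]

lemma avg_lift_one (β : ℝ) (v : Cn m → ℝ) (θ : ℝ) {x : Cn m} (hx : x.1 ≠ 0) :
    avg β v (lift 1 1 θ x) = avg β v x := by
  have h : ‖(lift 1 1 θ x).1‖ = ‖x.1‖ := by
    rw [norm_lift_fst norm_one, div_one, Real.exp_log (norm_pos_iff.2 hx)]
  rw [avg, avg, h]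
  rfl

lemma sqNorm_lift_one (θ : ℝ) {x : Cn m} (hx : x.1 ≠ 0) :
    sqNorm (lift 1 1 θ x) = sqNorm x := by
  have h : ‖(lift 1 1 θ x).1‖ = ‖x.1‖ := by
    rw [norm_lift_fst norm_one, div_one, Real.exp_log (norm_pos_iff.2 hx)]
  rw [sqNorm_eq, sqNorm_eq, h]
  rfl

/-- The map `lift 1 1 θ` is a rotation about the axis. It preserves the average, hence w, and
carries the polar frame to itself. -/
lemma hess_one_lift_one {β : ℝ} {v w : Cn m → ℝ} (hw : ContDiffOn ℝ 2 w (eball m (1 / 2)))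
    (hwv : ∀ x ∈ eball m (1 / 2) \ divisor m, w x = avg β v x) (θ : ℝ) {x : Cn m}
    (hx : x ∈ eball m (1 / 2)) (hxs : x.1 ∈ Complex.slitPlane) (i j : Idx m) :
    hess 1 w (lift 1 1 θ x) i j = hess 1 w x i j := by
  have hx' : (1 : ℂ) * x.1 ∈ Complex.slitPlane := by rwa [one_mul]
  have hx0 := fst_ne_zero_of_mem hx'
  have hm : lift 1 1 θ x ∈ eball m (1 / 2) := by
    change sqNorm _ < _
    rw [sqNorm_lift_one θ hx0]
    exact hx
  rw [hess_lift one_pos norm_one θ hx' (hw.contDiffAt ((isOpen_eball _).mem_nhds hm))]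
  refine hess_congr ?_ i j
  filter_upwards [(isOpen_eball _).mem_nhds hx, eventually_fst_ne_zero hx0] with y hy hy0
  rw [hwv y ⟨hy, hy0⟩, hwv _ ⟨?_, lift_fst_ne_zero _ _ _ _⟩, avg_lift_one β v θ hy0]
  change sqNorm _ < _
  rw [sqNorm_lift_one θ hy0]
  exact hy

/-- The two summands are estimated by different means: the remainder by its decay towards the axis,
w by its regularity across it. -/
lemma IsClassical.hess_lift {β α A M : ℝ} {v f w : Cn m → ℝ} (h : IsClassical β α A M v f)
    (hw : ContDiffOn ℝ 2 w (eball m (1 / 2))) (θ : ℝ) {x : Cn m}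
    (hx : x ∈ eball m (1 / 2)) (hxs : x.1 ∈ Complex.slitPlane) (i j : Idx m) :
    hess β v (lift β 1 θ x) i j =
      bil (fun k l => pd k (pd l fun y => v (lift β 1 θ y) - w y) x) (frame 1 i x) (frame 1 j x) +
        hess 1 w x i j := by
  have hx' : (1 : ℂ) * x.1 ∈ Complex.slitPlane := by rwa [one_mul]
  have hx0 := fst_ne_zero_of_mem hx'
  have hU := h.contDiffAt_lift norm_one hx hx' θ
  have hw' := hw.contDiffAt ((isOpen_eball _).mem_nhds hx)
  rw [ConeSchauder.hess_lift h.pos norm_one θ hx' (h.contDiffAt (h.lift_mem norm_one hx hx0 θ)),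
    hess_one hx0 hU, hess_one hx0 hw', D2_eq_bil hU, D2_eq_bil hw', bil_add_matrix]
  congr 1
  funext k l
  rw [pd_pd_sub hU hw']
  ring

/-! ### Comparison of two points of the cone in one chart -/

lemma eq_lift_rad {β : ℝ} (hβ : 0 < β) {p : Cn m} (hp : p.1 ≠ 0) :
    p = lift β 1 (Complex.arg p.1) ((rad β p : ℂ), p.2) := by
  have hβ' : (β : ℂ) ≠ 0 := by exact_mod_cast hβ.ne'
  have h : Complex.log (rad β p : ℂ) = β * (Real.log ‖p.1‖ : ℝ) := by
    rw [← Complex.ofReal_log (rad_pos β hp).le, rad, Real.log_rpow (norm_pos_iff.2 hp)]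
    push_cast
    rfl
  rw [lift]
  ext1
  · simp only [one_mul]
    rw [h, mul_div_cancel_left₀ _ hβ']
    exact (Complex.exp_log hp).symm.trans (by rw [Complex.log])
  · rfl

lemma lift_one_ofReal {s : ℝ} (hs : 0 < s) (ψ : ℝ) (z : Fin m → ℂ) :
    lift 1 1 ψ ((s : ℂ), z) = (s * Complex.exp (ψ * Complex.I), z) := by
  have : (s : ℂ) ≠ 0 := by exact_mod_cast hs.ne'
  rw [lift]
  simp only [one_mul, Complex.ofReal_one, div_one]
  rw [Complex.exp_add, Complex.exp_log this]

/-- The angle is ψ = β Δ with Δ = arg (y₁ / x₁). Jordan's inequality bounds |Δ| by π/2 times the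
chord, and β ≤ 1/4 gives |ψ| ≤ π/4, so a single chart centred at the angle of x contains both
points. -/
lemma exists_chart {β : ℝ} (hβ : 0 < β) (hβ4 : β ≤ 1 / 4) {x y : Cn m} (hx : x.1 ≠ 0)
    (hy : y.1 ≠ 0) : ∃ ψ : ℝ, |ψ| ≤ Real.pi / 4 ∧ |ψ| ≤ Real.pi / 2 * (β * ‖ang x - ang y‖) ∧
      y = lift β 1 (Complex.arg x.1) (lift 1 1 ψ ((rad β y : ℂ), y.2)) := by
  have hx' : 0 < ‖x.1‖ := norm_pos_iff.2 hx
  have hy' : 0 < ‖y.1‖ := norm_pos_iff.2 hy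
  have hxc : (‖x.1‖ : ℂ) ≠ 0 := by exact_mod_cast hx'.ne'
  have hyc : (‖y.1‖ : ℂ) ≠ 0 := by exact_mod_cast hy'.ne'
  set Δ := Complex.arg (y.1 / x.1) with hΔ
  have hpi := Real.pi_pos
  have habs : |Δ| ≤ Real.pi := Complex.abs_arg_le_pi _
  have e1 : ang y = Complex.exp (Δ * Complex.I) * ang x := by
    have h := Complex.norm_mul_exp_arg_mul_I (y.1 / x.1)
    rw [← hΔ, norm_div] at h
    push_cast at h
    rw [ang, ang]
    simp only [Complex.real_smul]
    push_cast
    have h2 : Complex.exp (Δ * Complex.I) = ‖x.1‖ / ‖y.1‖ * (y.1 / x.1) := by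
      rw [← h]
      field_simp
    rw [h2]
    field_simp
  have e2 : ‖ang x‖ = 1 := by
    rw [ang, norm_smul, norm_inv, norm_norm, inv_mul_cancel₀ hx'.ne']
  have e3 : ‖ang x - ang y‖ = 2 * |Real.sin (Δ / 2)| := by
    rw [e1, norm_sub_rev]
    nth_rewrite 2 [← one_mul (ang x)]
    rw [← sub_mul, norm_mul, e2, mul_one, mul_comm (Δ : ℂ), Complex.norm_exp_I_mul_ofReal_sub_one,
      norm_mul, Real.norm_eq_abs, Real.norm_eq_abs, abs_two]
  have h4 : 2 / Real.pi * |Δ| ≤ ‖ang x - ang y‖ := by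
    have h := Real.mul_abs_le_abs_sin (x := Δ / 2) (by rw [abs_div, abs_two]; linarith)
    rw [abs_div, abs_two] at h
    rw [e3]
    linarith
  have h5 : |Δ| ≤ Real.pi / 2 * ‖ang x - ang y‖ := by
    calc |Δ| = Real.pi / 2 * (2 / Real.pi * |Δ|) := by field_simp
      _ ≤ _ := by gcongr
  have h6 : |β * Δ| ≤ Real.pi / 4 := by
    rw [abs_mul, abs_of_pos hβ]
    calc β * |Δ| ≤ 1 / 4 * Real.pi := by gcongr
      _ = _ := by ring
  refine ⟨β * Δ, h6, ?_, ?_⟩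
  · rw [abs_mul, abs_of_pos hβ]
    calc β * |Δ| ≤ β * (Real.pi / 2 * ‖ang x - ang y‖) := by gcongr
      _ = _ := by ring
  · have hry := rad_pos β hy
    have hlt := abs_le.1 h6
    have hlog : Real.exp (Real.log (rad β y)) = rad β y := Real.exp_log hry
    have hexp : (rad β y * Complex.exp ((β * Δ : ℝ) * Complex.I) : ℂ) =
        Complex.exp (Real.log (rad β y) + (β * Δ : ℝ) * Complex.I) := by
      rw [Complex.exp_add, ← Complex.ofReal_exp, hlog]
    rw [lift_one_ofReal hry, hexp, ← pol_eq_lift hβ _ _ _ _ (by linarith) (by linarith), pol]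
    ext1
    · simp only
      rw [rad, Real.log_rpow hy', mul_div_cancel_left₀ _ hβ.ne']
      push_cast
      rw [add_mul, ← add_assoc, Complex.exp_add, Complex.exp_add, ← Complex.ofReal_exp,
        Real.exp_log hy']
      have hxe := Complex.norm_mul_exp_arg_mul_I x.1
      have hye := Complex.norm_mul_exp_arg_mul_I (y.1 / x.1)
      rw [norm_div, ← hΔ] at hye
      push_cast at hye
      have h7 : (‖y.1‖ : ℂ) * Complex.exp (Complex.arg x.1 * Complex.I) *
          Complex.exp (Δ * Complex.I) = (‖x.1‖ * Complex.exp (Complex.arg x.1 * Complex.I)) *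
            (‖y.1‖ / ‖x.1‖ * Complex.exp (Δ * Complex.I)) := by
        field_simp
      rw [h7, hxe, hye]
      field_simp
    · rfl

lemma norm_chart_sub_le {s t ψ : ℝ} (hs : 0 ≤ s) (ht : 0 < t) (z z' : Fin m → ℂ) :
    ‖(((s : ℂ), z) : Cn m) - lift 1 1 ψ ((t : ℂ), z')‖ ≤ ‖z - z'‖ + |s - t| + s * |ψ| := by
  rw [lift_one_ofReal ht]
  refine max_le ?_ ?_
  · simp only [Prod.fst_sub]
    have e : (s : ℂ) - t * Complex.exp (ψ * Complex.I) =
        (s - t : ℝ) * Complex.exp (ψ * Complex.I) - s * (Complex.exp (Complex.I * ψ) - 1) := by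
      push_cast
      rw [mul_comm Complex.I]
      ring
    rw [e]
    refine (norm_sub_le _ _).trans ?_
    rw [norm_mul, norm_mul, Complex.norm_exp_ofReal_mul_I, mul_one, Complex.norm_real,
      Complex.norm_real, Real.norm_eq_abs, Real.norm_of_nonneg hs]
    have h := Real.norm_exp_I_mul_ofReal_sub_one_le (x := ψ)
    rw [Real.norm_eq_abs] at h
    have := norm_nonneg (z - z')
    have := mul_le_mul_of_nonneg_left h hs
    linarith
  · simp only [Prod.snd_sub]
    have := abs_nonneg (s - t)
    have := mul_nonneg hs (abs_nonneg ψ)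
    linarith

lemma norm_lift_one_le_re {t ψ : ℝ} (ht : 0 < t) (hψ : |ψ| ≤ Real.pi / 4) (z : Fin m → ℂ) :
    ‖(lift 1 1 ψ ((t : ℂ), z)).1‖ = t ∧ t ≤ 2 * (lift 1 1 ψ ((t : ℂ), z)).1.re := by
  rw [lift_one_ofReal ht]
  simp only
  constructor
  · rw [norm_mul, Complex.norm_exp_ofReal_mul_I, mul_one, Complex.norm_real,
      Real.norm_of_nonneg ht.le]
  · rw [Complex.re_ofReal_mul, Complex.exp_ofReal_mul_I_re]
    have h1 := Real.one_sub_sq_div_two_le_cos (x := ψ)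
    have h2 : ψ ^ 2 ≤ 1 := by
      rw [sq_le_one_iff_abs_le_one]
      linarith [Real.pi_lt_four]
    have h3 : 1 / 2 ≤ Real.cos ψ := by linarith
    nlinarith

/-! ### Bounds for the derivatives in the frame -/

/-- Matrix and frame vectors are varied separately. The polar frame turns at rate at most of order
1/r, whence the quotient by ‖x.1‖. -/
lemma abs_bil_sub_le {T S : Idx m → Idx m → ℝ} {K L : ℝ} {x y : Cn m} (hx : x.1 ≠ 0)
    (hy : y.1 ≠ 0) (hT : ∀ i j, |T i j| ≤ K) (hTS : ∀ i j, |T i j - S i j| ≤ L) (i j : Idx m) :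
    |bil T (frame 1 i x) (frame 1 j x) - bil S (frame 1 i y) (frame 1 j y)| ≤
      (2 * (m + 1)) ^ 2 * (L + K * (4 * ‖x - y‖ / ‖x.1‖)) := by
  have hK : 0 ≤ K := (abs_nonneg _).trans (hT i j)
  have hL : 0 ≤ L := (abs_nonneg _).trans (hTS i j)
  have e : bil T (frame 1 i x) (frame 1 j x) - bil S (frame 1 i y) (frame 1 j y) =
      (bil T (frame 1 i x - frame 1 i y) (frame 1 j x) +
        bil T (frame 1 i y) (frame 1 j x - frame 1 j y)) +
        bil (fun k l => T k l - S k l) (frame 1 i y) (frame 1 j y) := by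
    rw [← bil_sub_vectors, ← bil_sub_matrix]
    ring
  rw [e]
  set d := 2 * ‖x - y‖ / ‖x.1‖ with hd
  have hd0 : 0 ≤ d := by positivity
  have h1 := (abs_bil_le hT (frame 1 i x - frame 1 i y) (frame 1 j x)).trans
    (mul_le_mul_of_nonneg_left (mul_le_mul (norm_frame_one_sub_le i hx hy) (norm_frame_one_le j)
      (norm_nonneg _) hd0) (by positivity))
  have h2 := (abs_bil_le hT (frame 1 i y) (frame 1 j x - frame 1 j y)).trans
    (mul_le_mul_of_nonneg_left (mul_le_mul (norm_frame_one_le i) (norm_frame_one_sub_le j hx hy)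
      (norm_nonneg _) zero_le_one) (by positivity))
  have h3 := (abs_bil_le hTS (frame 1 i y) (frame 1 j y)).trans
    (mul_le_mul_of_nonneg_left (mul_le_mul (norm_frame_one_le i) (norm_frame_one_le j)
      (norm_nonneg _) zero_le_one) (by positivity))
  refine (abs_add_le _ _).trans ((add_le_add ((abs_add_le _ _).trans (add_le_add h1 h2)) h3).trans ?_)
  rw [show 4 * ‖x - y‖ / ‖x.1‖ = 2 * d by rw [hd]; ring]
  exact le_of_eq (by ring)

lemma abs_bil_frame_le {T : Idx m → Idx m → ℝ} {K : ℝ} {x : Cn m} (hT : ∀ i j, |T i j| ≤ K)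
    (i j : Idx m) : |bil T (frame 1 i x) (frame 1 j x)| ≤ (2 * (m + 1)) ^ 2 * K := by
  have hK : 0 ≤ K := (abs_nonneg _).trans (hT i j)
  refine (abs_bil_le hT _ _).trans ?_
  refine mul_le_of_le_one_right (by positivity) ?_
  exact mul_le_one₀ (norm_frame_one_le i) (norm_nonneg _) (norm_frame_one_le j)

/-- The quantity comparable with the cone distance for points at comparable distance from the
divisor. -/
def polarDist (β : ℝ) (x y : Cn m) : ℝ :=
  ‖x.2 - y.2‖ + |rad β x - rad β y| + β * rad β x * ‖ang x - ang y‖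

lemma ofReal_mem_eball {β : ℝ} {ρ : ℝ} {p : Cn m} :
    (((rad β p : ℂ), p.2) : Cn m) ∈ eball m ρ ↔ p ∈ coneBall m β ρ := by
  simp only [eball, coneBall, mem_ofPred_eq, sqNorm_eq, Complex.norm_real, Real.norm_eq_abs,
    sq_abs]

lemma IsClassical.D_eq {β α A M : ℝ} {v f w : Cn m → ℝ} (h : IsClassical β α A M v f)
    (hw : ContDiffOn ℝ 2 w (eball m (1 / 2))) (θ : ℝ) {x : Cn m}
    (hx : x ∈ eball m (1 / 2)) (hxs : x.1 ∈ Complex.slitPlane) (i : Idx m) {K L : ℝ}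
    (hK : ∀ i, |pd i (fun y => v (lift β 1 θ y) - w y) x| ≤ K) (hL : ∀ i, |pd i w x| ≤ L) :
    |D β i v (lift β 1 θ x)| ≤ 2 * (m + 1) * (K + L) := by
  have hx' : (1 : ℂ) * x.1 ∈ Complex.slitPlane := by rwa [one_mul]
  have hx0 := fst_ne_zero_of_mem hx'
  have hU := (h.contDiffAt_lift norm_one hx hx' θ).differentiableAt (by simp)
  have hw' := (hw.contDiffAt ((isOpen_eball _).mem_nhds hx)).differentiableAt (by simp)
  have hv := (h.contDiffAt (h.lift_mem norm_one hx hx0 θ)).differentiableAt (by simp)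
  rw [D_lift h.pos norm_one θ hx' hv, D]
  have h1 : ∀ i, |pd i (fun y => v (lift β 1 θ y)) x| ≤ K + L := fun i => by
    have h2 := hK i
    rw [pd_sub hU hw'] at h2
    have h3 := abs_sub_abs_le_abs_sub (pd i (fun y => v (lift β 1 θ y)) x) (pd i w x)
    linarith [hL i]
  have h4 := (fderiv ℝ (fun y => v (lift β 1 θ y)) x).le_of_opNorm_le (norm_fderiv_le h1)
    (frame 1 i x)
  have h5 : 0 ≤ K + L := (abs_nonneg _).trans (h1 i)
  exact h4.trans (mul_le_of_le_one_right (by positivity) (norm_frame_one_le i))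

/-- If δ < κ r, then δ/r ≤ (δ/r)^α, so the error r^α δ/r from the rotating frame is at most δ^α.
Otherwise r ≤ δ/κ, and the bounds r^α for the two values are already O(δ^α). -/
lemma abs_sub_le_of_near_of_far {α κ Q r s δ K : ℝ} (h0 : 0 < α) (h1 : α < 1) (hκ : 0 < κ)
    (hκ1 : κ ≤ 1) (hK : 0 ≤ K) (hQ : 0 ≤ Q) (hr : 0 < r) (hs : 0 ≤ s) (hsr : s ≤ 2 * r) (hδ : 0 ≤ δ)
    {X Y : ℝ} (hX : |X| ≤ Q * (K * r ^ α)) (hY : |Y| ≤ Q * (K * s ^ α))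
    (hZ : δ < κ * r → |X - Y| ≤ Q * (K * δ ^ α + K * r ^ α * (4 * δ / r))) :
    |X - Y| ≤ Q * (5 + 3 / κ) * K * δ ^ α := by
  by_cases hd : δ < κ * r
  · refine (hZ hd).trans ?_
    have h2 : δ / r ≤ 1 := (div_le_one hr).2 (hd.le.trans (mul_le_of_le_one_left hr.le hκ1))
    have h3 : δ / r ≤ (δ / r) ^ α := Real.self_le_rpow_of_le_one (by positivity) h2 h1.le
    rw [Real.div_rpow hδ hr.le, le_div_iff₀ (by positivity)] at h3
    have h4 : K * r ^ α * (4 * δ / r) ≤ 4 * K * δ ^ α := by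
      calc K * r ^ α * (4 * δ / r) = 4 * K * (δ / r * r ^ α) := by ring
        _ ≤ _ := by gcongr
    have h5 : 0 ≤ 3 / κ * (Q * K * δ ^ α) := by positivity
    calc Q * (K * δ ^ α + K * r ^ α * (4 * δ / r)) ≤ Q * (K * δ ^ α + 4 * K * δ ^ α) := by gcongr
      _ ≤ _ := by linarith
  · have h2 : r ≤ δ / κ := (le_div_iff₀' hκ).2 (not_lt.1 hd)
    have h3 : r ^ α ≤ δ ^ α / κ := by
      calc r ^ α ≤ (δ / κ) ^ α := by gcongr
        _ = δ ^ α / κ ^ α := Real.div_rpow hδ hκ.le α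
        _ ≤ δ ^ α / κ := by
            gcongr
            exact Real.self_le_rpow_of_le_one hκ.le hκ1 h1.le
    have h4 : s ^ α ≤ 2 * r ^ α := by
      calc s ^ α ≤ (2 * r) ^ α := by gcongr
        _ = 2 ^ α * r ^ α := Real.mul_rpow zero_le_two hr.le
        _ ≤ 2 * r ^ α := by
            gcongr
            exact Real.rpow_le_self_of_one_le one_le_two h1.le
    have h5 : 0 ≤ 5 * (Q * K * δ ^ α) := by positivity
    calc |X - Y| ≤ |X| + |Y| := abs_sub _ _
      _ ≤ Q * (K * r ^ α) + Q * (K * (2 * r ^ α)) := by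
          refine add_le_add hX (hY.trans ?_)
          gcongr
      _ = Q * K * 3 * r ^ α := by ring
      _ ≤ Q * K * 3 * (δ ^ α / κ) := by gcongr
      _ ≤ _ := by
          have : Q * K * 3 * (δ ^ α / κ) = Q * (3 / κ) * K * δ ^ α := by ring
          linarith

/-- In the chart at the angle of x, the points become ξ, real, and ζ, the rotation by ψ of the real
point ζ₀. The remainder W is compared at ξ and ζ, and its decay offsets the rotation of the frame.
The Hessian of w at ζ has the same polar components as at ζ₀, where they are ordinary second partial
derivatives, so for w the comparison is between ξ and ζ₀. -/
theorem exists_frame_bound (m : ℕ) {α ρ : ℝ} (h0 : 0 < α) (h1 : α < 1) (hρ : 0 < ρ)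
    (hρ1 : ρ < 1 / 2) : ∃ C : ℝ, 0 ≤ C ∧ ∀ (β A M : ℝ) (v f : Cn m → ℝ),
      IsClassical β α A M v f →
      (∀ p ∈ coneBall m β ρ \ divisor m, (∀ i, |D β i v p| ≤ C * (A + M)) ∧
        ∀ i j, |hess β v p i j| ≤ C * (A + M)) ∧
      ∀ x ∈ coneBall m β ρ, ∀ y ∈ coneBall m β ρ, x.1 ≠ 0 → y.1 ≠ 0 →
        |rad β x - rad β y| < rad β x / 2 → ∀ i j,
          |hess β v x i j - hess β v y i j| ≤ C * (A + M) * polarDist β x y ^ α := by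
  obtain ⟨C₁, hC₁, hw₁⟩ := exists_avg_bound m h0 h1 hρ hρ1
  obtain ⟨C₂, κ, hC₂, hκ, hκ1, hW₁⟩ := exists_diff_bound m h0 h1 hρ hρ1
  set N : ℝ := 2 * (m + 1) with hN
  have hN1 : 1 ≤ N := by
    rw [hN]
    have : (0 : ℝ) ≤ m := m.cast_nonneg
    linarith
  have hN0 : 0 ≤ N := zero_le_one.trans hN1
  have hNN : N ≤ N ^ 2 := by nlinarith
  set B := N ^ 2 * (5 + 3 / κ) * C₂ with hB
  have hB0 : 0 ≤ B := by positivity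
  refine ⟨N ^ 2 * (C₂ + C₁) + (2 * B + C₁), by positivity, fun β A M v f h => ?_⟩
  obtain ⟨w, hw, hwv⟩ := h.exists_avg_extension
  obtain ⟨hwa, hwb, hwc⟩ := hw₁ β A M v f w h hw hwv
  have hW := hW₁ β A M v f w h hw hwv
  have hAM : 0 ≤ A + M := add_nonneg h.hA h.hM
  have hsub := eball_mono (m := m) hρ.le hρ1.le
  have hslit : ∀ {x : Cn m}, x.1 ≠ 0 → ‖x.1‖ ≤ 2 * x.1.re → x.1 ∈ Complex.slitPlane :=
    fun hx0 hx => Or.inl (by linarith [norm_pos_iff.2 hx0])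
  have hpoint : ∀ {r : ℝ}, 0 < r → ∀ z : Fin m → ℂ, (((r : ℂ), z) : Cn m).1 ≠ 0 ∧
      ‖(((r : ℂ), z) : Cn m).1‖ = r ∧ ‖(((r : ℂ), z) : Cn m).1‖ ≤ 2 * (((r : ℂ), z) : Cn m).1.re := by
    intro r hr z
    simp only [Complex.norm_real, Real.norm_of_nonneg hr.le, Complex.ofReal_re, ne_eq,
      Complex.ofReal_eq_zero, hr.ne', not_false_eq_true, true_and]
    linarith
  have hessw : ∀ {x : Cn m} {r : ℝ} {z : Fin m → ℂ}, 0 < r → x = ((r : ℂ), z) →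
      x ∈ eball m (1 / 2) → ∀ i j, hess 1 w x i j = pd i (pd j w) x := by
    intro x r z hr hx hxm i j
    have hw' := hw.contDiffAt ((isOpen_eball _).mem_nhds hxm)
    have hx0 : x.1 ≠ 0 := hx ▸ (hpoint hr z).1
    rw [hess_one hx0 hw', pd_pd_eq_D2 hw', hx, frame_one_ofReal _ hr, frame_one_ofReal _ hr]
  constructor
  · rintro p ⟨hp, hp0⟩
    replace hp0 : p.1 ≠ 0 := hp0
    set r := rad β p with hr
    have hr0 : 0 < r := rad_pos β hp0
    set ξ : Cn m := ((r : ℂ), p.2) with hξ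
    obtain ⟨hξ0, hξn, hξre⟩ := hpoint hr0 p.2
    have hξm : ξ ∈ eball m ρ := ofReal_mem_eball.2 hp
    have hr1 : r ≤ 1 := by
      rw [← hξn]
      exact (norm_fst_le ξ).trans ((norm_lt_half (hsub hξm)).le.trans (by norm_num))
    set θ := Complex.arg p.1
    have hpe : p = lift β 1 θ ξ := eq_lift_rad h.pos hp0
    obtain ⟨-, hb, hc, -⟩ := hW θ ξ hξm hξ0 hξre
    have hpow : ∀ q : ℝ, 0 ≤ q → C₂ * (A + M) * ‖ξ.1‖ ^ q ≤ C₂ * (A + M) := fun q hq =>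
      mul_le_of_le_one_right (by positivity)
        (Real.rpow_le_one (norm_nonneg _) (hξn.trans_le hr1) hq)
    have hE : 0 ≤ (2 * B + C₁) * (A + M) := by positivity
    constructor
    · intro i
      rw [hpe]
      have h3 := h.D_eq hw θ (hsub hξm) (hslit hξ0 hξre) i
        (fun i => (hb i).trans (hpow _ (by linarith))) (hwa ξ hξm)
      have h4 : N * (C₂ * (A + M) + C₁ * (A + M)) ≤ N ^ 2 * (C₂ * (A + M) + C₁ * (A + M)) := by
        gcongr
      linarith
    · intro i j
      rw [hpe, h.hess_lift hw θ (hsub hξm) (hslit hξ0 hξre), hessw hr0 hξ (hsub hξm)]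
      have h3 := abs_bil_frame_le (x := ξ) (fun k l => (hc l k).trans (hpow _ h0.le)) i j
      have h4 := hwb ξ hξm j i
      have h5 : C₁ * (A + M) ≤ N ^ 2 * (C₁ * (A + M)) :=
        le_mul_of_one_le_left (by positivity) (one_le_pow₀ hN1)
      refine (abs_add_le _ _).trans ?_
      linarith
  · intro x hx y hy hx0 hy0 hxy i j
    set r := rad β x with hr
    set s := rad β y with hs
    have hr0 : 0 < r := rad_pos β hx0
    have hs0 : 0 < s := rad_pos β hy0
    have hsr : s ≤ 2 * r := by linarith [(abs_lt.1 hxy).1]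
    obtain ⟨ψ, hψ, hψ2, hye⟩ := exists_chart h.pos h.le hx0 hy0
    set θ := Complex.arg x.1
    set ξ : Cn m := ((r : ℂ), x.2) with hξ
    set ζ₀ : Cn m := ((s : ℂ), y.2) with hζ₀
    set ζ := lift 1 1 ψ ζ₀ with hζ
    obtain ⟨hξ0, hξn, hξre⟩ := hpoint hr0 x.2
    obtain ⟨hζ₀0, hζ₀n, hζ₀re⟩ := hpoint hs0 y.2
    obtain ⟨hζn, hζre⟩ := norm_lift_one_le_re hs0 hψ y.2
    have hζ0 : ζ.1 ≠ 0 := lift_fst_ne_zero _ _ _ _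
    have hζre' : ‖ζ.1‖ ≤ 2 * ζ.1.re := hζn.trans_le hζre
    have hξm : ξ ∈ eball m ρ := ofReal_mem_eball.2 hx
    have hζ₀m : ζ₀ ∈ eball m ρ := ofReal_mem_eball.2 hy
    have hζm : ζ ∈ eball m ρ := by
      change sqNorm _ < _
      rw [hζ, sqNorm_lift_one ψ hζ₀0]
      exact hζ₀m
    have hxe : x = lift β 1 θ ξ := eq_lift_rad h.pos hx0
    set E := polarDist β x y with hE
    have hang := norm_nonneg (ang x - ang y)
    have hrang : 0 ≤ β * r * ‖ang x - ang y‖ := by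
      have := h.pos
      positivity
    have hE0 : 0 ≤ E := by
      rw [hE, polarDist]
      positivity
    have hd₀ : ‖ξ - ζ₀‖ ≤ E := by
      refine max_le ?_ ?_
      · rw [hξ, hζ₀, Prod.fst_sub]
        simp only
        rw [← Complex.ofReal_sub, Complex.norm_real, Real.norm_eq_abs, hE, polarDist]
        linarith [norm_nonneg (x.2 - y.2)]
      · simp only [hE, polarDist, Prod.snd_sub]
        linarith [abs_nonneg (rad β x - rad β y)]
    have hd : ‖ξ - ζ‖ ≤ 2 * E := by
      refine (norm_chart_sub_le hr0.le hs0 _ _).trans ?_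
      have h3 : r * |ψ| ≤ 2 * (β * r * ‖ang x - ang y‖) := by
        calc r * |ψ| ≤ r * (Real.pi / 2 * (β * ‖ang x - ang y‖)) := by gcongr
          _ = Real.pi / 2 * (β * r * ‖ang x - ang y‖) := by ring
          _ ≤ 2 * (β * r * ‖ang x - ang y‖) := by
              gcongr
              linarith [Real.pi_le_four]
      rw [hE, polarDist]
      linarith [norm_nonneg (x.2 - y.2), abs_nonneg (r - s)]
    set W : Cn m → ℝ := fun z => v (lift β 1 θ z) - w z with hWdef
    obtain ⟨-, -, hc, hh⟩ := hW θ ξ hξm hξ0 hξre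
    obtain ⟨-, -, hc', -⟩ := hW θ ζ hζm hζ0 hζre'
    rw [hξn] at hc hh
    rw [hζn] at hc'
    have e1 : hess β v x i j = bil (fun k l => pd k (pd l W) ξ) (frame 1 i ξ) (frame 1 j ξ) +
        pd i (pd j w) ξ := by
      rw [hxe, h.hess_lift hw θ (hsub hξm) (hslit hξ0 hξre), hessw hr0 hξ (hsub hξm)]
    have e2 : hess β v y i j = bil (fun k l => pd k (pd l W) ζ) (frame 1 i ζ) (frame 1 j ζ) +
        pd i (pd j w) ζ₀ := by
      rw [hye, h.hess_lift hw θ (hsub hζm) (hslit hζ0 hζre'), hζ,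
        hess_one_lift_one hw hwv ψ (hsub hζ₀m) (hslit hζ₀0 hζ₀re), hessw hs0 hζ₀ (hsub hζ₀m)]
    have hK : 0 ≤ C₂ * (A + M) := by positivity
    have h3 := abs_sub_le_of_near_of_far (Q := N ^ 2) (K := C₂ * (A + M)) (s := s) h0 h1 hκ hκ1 hK
      (by positivity) hr0 hs0.le hsr (norm_nonneg (ξ - ζ))
      (abs_bil_frame_le (x := ξ) (fun k l => hc l k) i j)
      (abs_bil_frame_le (x := ζ) (fun k l => hc' l k) i j) (fun hlt => by
        have h4 := abs_bil_sub_le hξ0 hζ0 (fun k l => hc l k) (fun k l => hh ζ hlt l k) i j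
        rwa [hξn] at h4)
    have h4 := hwc ξ hξm ζ₀ hζ₀m j i
    have h5 : ‖ξ - ζ‖ ^ α ≤ 2 * E ^ α := by
      calc ‖ξ - ζ‖ ^ α ≤ (2 * E) ^ α := by gcongr
        _ = 2 ^ α * E ^ α := Real.mul_rpow zero_le_two hE0
        _ ≤ 2 * E ^ α := by
            gcongr
            exact Real.rpow_le_self_of_one_le one_le_two h1.le
    have h6 : ‖ξ - ζ₀‖ ^ α ≤ E ^ α := by gcongr
    rw [e1, e2, add_sub_add_comm]
    refine (abs_add_le _ _).trans ((add_le_add (h3.trans (mul_le_mul_of_nonneg_left h5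
      (by positivity))) (h4.trans (mul_le_mul_of_nonneg_left h6 (by positivity)))).trans ?_)
    have h7 : 0 ≤ N ^ 2 * (C₂ + C₁) * (A + M) * E ^ α := by positivity
    rw [hB]
    linarith

/-! ### The strong Schauder estimate -/

lemma exists_coneBall_mem {β : ℝ} {p : Cn m} (hp : p ∈ coneBall m β (1 / 2)) :
    ∃ ρ, 0 < ρ ∧ ρ < 1 / 2 ∧ p ∈ coneBall m β ρ := by
  set q := rad β p ^ 2 + ∑ j, ‖p.2 j‖ ^ 2 with hq
  have hq0 : 0 ≤ q := by positivity
  have h1 : √q < 1 / 2 := (Real.sqrt_lt' (by norm_num)).2 hp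
  obtain ⟨ρ, h2, h3⟩ := exists_between h1
  have h4 : 0 < ρ := (Real.sqrt_nonneg q).trans_lt h2
  exact ⟨ρ, h4, h3, (Real.sqrt_lt' h4).1 h2⟩

/-- A bounded classical solution off the divisor extends continuously across the divisor. -/
lemma IsClassical.exists_continuousOn {β α A M : ℝ} {v f : Cn m → ℝ}
    (h : IsClassical β α A M v f) : ∃ v' : Cn m → ℝ, (∀ p : Cn m, p.1 ≠ 0 → v' p = v p) ∧
      ContinuousOn v' (coneBall m β (1 / 2)) := by
  obtain ⟨w, hw, hwv⟩ := h.exists_avg_extension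
  set v' : Cn m → ℝ := fun p => if p.1 = 0 then w p else v p with hv'
  have hne : ∀ p : Cn m, p.1 ≠ 0 → v' p = v p := fun p hp => if_neg hp
  refine ⟨v', hne, fun p hp => ContinuousAt.continuousWithinAt ?_⟩
  by_cases hp0 : p.1 = 0
  · obtain ⟨ρ, hρ, hρ1, hpρ⟩ := exists_coneBall_mem hp
    obtain ⟨C, κ, hC, -, -, hW⟩ := exists_diff_bound m h.hα h.hα1 hρ hρ1
    have hrc := continuous_rad (m := m) h.pos.le
    have hg : ContinuousAt (fun q : Cn m => w ((rad β q : ℂ), q.2)) p := by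
      have h1 : ContinuousAt w ((rad β p : ℂ), p.2) :=
        (hw.contDiffAt ((isOpen_eball _).mem_nhds (ofReal_mem_eball.2 hp))).continuousAt
      exact ContinuousAt.comp (f := fun q : Cn m => ((rad β q : ℂ), q.2)) h1
        ((Complex.continuous_ofReal.comp hrc).prodMk continuous_snd).continuousAt
    have hr0 : rad β p = 0 := rad_eq_zero h.pos.ne' hp0
    have hself : (((rad β p : ℂ), p.2) : Cn m) = p := by
      rw [hr0, Complex.ofReal_zero, ← hp0]
    have h2α : (2 + α) ≠ 0 := by linarith [h.hα]
    -- The comparison function w (r, z') is continuous at p. Off the divisor v' differs from it by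
    -- O(r^(2+α)), and on the divisor the two coincide.
    have hdiff : ∀ q ∈ coneBall m β ρ, |v' q - w ((rad β q : ℂ), q.2)| ≤
        C * (A + M) * rad β q ^ (2 + α) := by
      intro q hq
      by_cases hq0 : q.1 = 0
      · have hr : rad β q = 0 := rad_eq_zero h.pos.ne' hq0
        have e : (((rad β q : ℂ), q.2) : Cn m) = q := by rw [hr, Complex.ofReal_zero, ← hq0]
        rw [e, hv']
        simp only [hq0, if_true, sub_self, abs_zero]
        rw [hr, Real.zero_rpow h2α, mul_zero]
      · have hr := rad_pos β hq0
        have hn : ‖(rad β q : ℂ)‖ = rad β q := by rw [Complex.norm_real, Real.norm_of_nonneg hr.le]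
        have h1 := (hW β A M v f w h hw hwv (Complex.arg q.1) ((rad β q : ℂ), q.2)
          (ofReal_mem_eball.2 hq) (Complex.ofReal_ne_zero.2 hr.ne')
          (by rw [hn, Complex.ofReal_re]; linarith)).1
        rw [hn, ← eq_lift_rad h.pos hq0] at h1
        rwa [hne q hq0]
    have hlim : Tendsto (fun q : Cn m => C * (A + M) * rad β q ^ (2 + α)) (𝓝 p) (𝓝 0) := by
      have h1 : Continuous fun q : Cn m => C * (A + M) * rad β q ^ (2 + α) :=
        continuous_const.mul (hrc.rpow_const fun _ => Or.inr (by linarith [h.hα]))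
      have h2 := h1.tendsto p
      rwa [hr0, Real.zero_rpow h2α, mul_zero] at h2
    have hz : Tendsto (fun q => v' q - w ((rad β q : ℂ), q.2)) (𝓝 p) (𝓝 0) := by
      refine squeeze_zero_norm' ?_ hlim
      filter_upwards [(isOpen_coneBall h.pos.le ρ).mem_nhds hpρ] with q hq using hdiff q hq
    have h3 := hz.add hg.tendsto
    have e : v' p = w p := if_pos hp0
    rw [ContinuousAt, e]
    simpa only [sub_add_cancel, zero_add, hself] using h3
  · refine (h.contDiffAt ⟨hp, hp0⟩).continuousAt.congr ?_
    filter_upwards [eventually_fst_ne_zero hp0] with q hq using (hne q hq).symm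

lemma gradNorm_le {β K : ℝ} {v : Cn m → ℝ} {p : Cn m} (hK : ∀ i, |D β i v p| ≤ K) :
    gradNorm β v p ≤ 2 * (m + 1) * K := by
  have hK0 : 0 ≤ K := (abs_nonneg _).trans (hK (.inl 0))
  have hN : (1 : ℝ) ≤ 2 * (m + 1) := by linarith [m.cast_nonneg (α := ℝ)]
  refine Real.sqrt_le_iff.2 ⟨by positivity, ?_⟩
  calc ∑ i, D β i v p ^ 2 ≤ ∑ i : Idx m, K ^ 2 :=
        Finset.sum_le_sum fun i _ => sq_le_sq' (abs_le.1 (hK i)).1 (abs_le.1 (hK i)).2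
    _ = 2 * (m + 1) * K ^ 2 := by
        rw [Finset.sum_const, Finset.card_univ, card_idx, nsmul_eq_mul]
        push_cast
        ring
    _ ≤ (2 * (m + 1)) ^ 2 * K ^ 2 := by
        gcongr
        nlinarith
    _ = _ := by ring

lemma tensorNorm_le {K : ℝ} {T : Idx m → Idx m → ℝ} (hK : ∀ i j, |T i j| ≤ K) :
    tensorNorm T ≤ 2 * (m + 1) * K := by
  have hK0 : 0 ≤ K := (abs_nonneg _).trans (hK (.inl 0) (.inl 0))
  refine Real.sqrt_le_iff.2 ⟨by positivity, ?_⟩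
  calc ∑ i, ∑ j, T i j ^ 2 ≤ ∑ i : Idx m, ∑ j : Idx m, K ^ 2 :=
        Finset.sum_le_sum fun i _ => Finset.sum_le_sum fun j _ =>
          sq_le_sq' (abs_le.1 (hK i j)).1 (abs_le.1 (hK i j)).2
    _ = _ := by
        simp only [Finset.sum_const, Finset.card_univ, card_idx, nsmul_eq_mul]
        push_cast
        ring

theorem exists_c2HolderNorm_le (m : ℕ) {α ρ : ℝ} (h0 : 0 < α) (h1 : α < 1) (hρ : 0 < ρ)
    (hρ1 : ρ < 1 / 2) : ∃ C : ℝ, 0 ≤ C ∧ ∀ (β A M : ℝ) (v f : Cn m → ℝ),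
      IsClassical β α A M v f →
        c2HolderNorm β α (coneBall m β ρ) v ≤ ENNReal.ofReal (C * (A + M)) := by
  obtain ⟨C, hC, hF⟩ := exists_frame_bound m h0 h1 hρ hρ1
  obtain ⟨L, hL, hdist⟩ := exists_coneDist_lower
  set N : ℝ := 2 * (m + 1) with hN
  have hN0 : 0 ≤ N := by positivity
  refine ⟨(1 + N * C + N * C) + N * C * L ^ α, by positivity, fun β A M v f h => ?_⟩
  obtain ⟨hS, hH⟩ := hF β A M v f h
  have hAM : 0 ≤ A + M := add_nonneg h.hA h.hM
  have hsub : ∀ p ∈ coneBall m β ρ, p ∈ coneBall m β (1 / 2) := fun p hp =>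
    lt_of_lt_of_le (b := ρ ^ 2) hp (pow_le_pow_left₀ hρ.le hρ1.le 2)
  rw [add_mul, ENNReal.ofReal_add (by positivity) (by positivity)]
  refine add_le_add (iSup₂_le fun p hp => ENNReal.ofReal_le_ofReal ?_) ?_
  · obtain ⟨hD, hh⟩ := hS p hp
    have h2 := gradNorm_le hD
    have h3 := tensorNorm_le hh
    have h4 := h.bound p ⟨hsub p hp.1, hp.2⟩
    have h5 := h.hA
    rw [← hN] at h2 h3
    linarith
  · refine iSup₂_le fun x hx => iSup₂_le fun y hy => iSup_le fun hxy => ?_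
    -- The condition |r(x) - r(y)| < r(x)/2 forces both points off the divisor.
    have hx0 : x.1 ≠ 0 := fun hx0 => by
      rw [rad_eq_zero h.pos.ne' hx0] at hxy
      linarith [abs_nonneg (0 - rad β y)]
    have hy0 : y.1 ≠ 0 := fun hy0 => by
      rw [rad_eq_zero h.pos.ne' hy0, sub_zero] at hxy
      linarith [le_abs_self (rad β x), rad_pos β hx0]
    have hE0 : 0 ≤ polarDist β x y := by
      have := h.pos
      have := rad_pos β hx0
      rw [polarDist]
      positivity
    have h2 := tensorNorm_le (hH x hx y hy hx0 hy0 hxy)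
    rw [← hN] at h2
    refine ENNReal.div_le_of_le_mul ?_
    calc ENNReal.ofReal (tensorNorm fun i j => hess β v x i j - hess β v y i j)
        ≤ ENNReal.ofReal (N * C * (A + M) * polarDist β x y ^ α) :=
          ENNReal.ofReal_le_ofReal (h2.trans_eq (by ring))
      _ = ENNReal.ofReal (N * C * (A + M)) * ENNReal.ofReal (polarDist β x y) ^ α := by
          rw [ENNReal.ofReal_mul (by positivity), ENNReal.ofReal_rpow_of_nonneg hE0 h0.le]
      _ ≤ ENNReal.ofReal (N * C * (A + M)) * (ENNReal.ofReal L * coneDist β x y) ^ α := by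
          gcongr
          exact hdist m β x y h.pos h.le_one hx0 hxy
      _ = ENNReal.ofReal (N * C * L ^ α * (A + M)) * coneDist β x y ^ α := by
          rw [ENNReal.mul_rpow_of_nonneg _ _ h0.le, ENNReal.ofReal_rpow_of_nonneg hL.le h0.le,
            ← mul_assoc, ← ENNReal.ofReal_mul (by positivity)]
          congr 2
          ring

/-- Positivity of A matters if the denominator is infinite: the quotient is then 0 whatever f does,
and the product bound would fail for A = 0 because 0 * ⊤ = 0. -/
lemma coneHolder_of_holderNorm {β α A : ℝ} {O : Set (Cn m)} {f : Cn m → ℝ} (hA : 0 < A)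
    (h : holderNorm β α O f ≤ ENNReal.ofReal A) : ConeHolder β α A O f := by
  intro x hx y hy
  rw [← ENNReal.div_le_iff_le_mul (Or.inr ENNReal.ofReal_ne_top)
    (Or.inr (ENNReal.ofReal_pos.2 hA).ne')]
  refine le_trans ?_ h
  exact le_iSup₂_of_le x hx (le_iSup₂_of_le y hy le_rfl)

end ConeSchauder

end

theorem corollary6p7 (m : ℕ) (α : ℝ) (hα₀ : 0 < α) (hα₁ : α < 1) :
    ∃ C : ℝ≥0, ∀ β : ℝ, 0 < β → β ≤ 1 / 4 →
      ∀ u f : ConeSchauder.Cn m → ℝ,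
        MemLp u ⊤ (volume.restrict (ConeSchauder.coneBall m β (1 / 2))) →
        ConeSchauder.holderNorm β α (ConeSchauder.coneBall m β (1 / 2)) f < ⊤ →
        ConeSchauder.IsWeakSolution β (ConeSchauder.coneBall m β (1 / 2)) u f →
        ∃ v : ConeSchauder.Cn m → ℝ,
          v =ᵐ[volume.restrict (ConeSchauder.coneBall m β (1 / 2))] u ∧
          ContinuousOn v (ConeSchauder.coneBall m β (1 / 2)) ∧
          ContDiffOn ℝ 2 v (ConeSchauder.coneBall m β (1 / 2) \ ConeSchauder.divisor m) ∧
          (∀ p ∈ ConeSchauder.coneBall m β (1 / 2) \ ConeSchauder.divisor m,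
            ConeSchauder.laplacian β v p = f p) ∧
          (∀ ρ : ℝ, 0 < ρ → ρ < 1 / 2 →
            ConeSchauder.c2HolderNorm β α (ConeSchauder.coneBall m β ρ) v < ⊤) ∧
          ConeSchauder.c2HolderNorm β α (ConeSchauder.coneBall m β (1 / 4)) v ≤
            C * (ConeSchauder.holderNorm β α (ConeSchauder.coneBall m β (1 / 2)) f +
              eLpNorm u ⊤ (volume.restrict (ConeSchauder.coneBall m β (1 / 2)))) := by
  obtain ⟨C, hC, hbound⟩ := ConeSchauder.exists_c2HolderNorm_le m hα₀ hα₁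
    (show (0 : ℝ) < 1 / 4 by norm_num) (by norm_num)
  refine ⟨C.toNNReal, fun β hβ hβ4 u f hu hf hweak => ?_⟩
  set O := ConeSchauder.coneBall m β (1 / 2) with hO
  set H := (ConeSchauder.holderNorm β α O f).toReal with hH
  set M := (eLpNorm u ⊤ (volume.restrict O)).toReal with hM
  have hHe : ENNReal.ofReal H = ConeSchauder.holderNorm β α O f := ENNReal.ofReal_toReal hf.ne
  have hMe : ENNReal.ofReal M = eLpNorm u ⊤ (volume.restrict O) :=
    ENNReal.ofReal_toReal hu.2.ne
  have hH0 : 0 ≤ H := ENNReal.toReal_nonneg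
  have hM0 : 0 ≤ M := ENNReal.toReal_nonneg
  have hOo : IsOpen O := ConeSchauder.isOpen_coneBall hβ.le _
  have hub : ∀ᵐ p, p ∈ O → |u p| ≤ M := by
    rw [← ae_restrict_iff' hOo.measurableSet]
    filter_upwards [ae_le_eLpNormEssSup (f := u) (μ := volume.restrict O)] with p hp
    rw [← eLpNorm_exponent_top, ← hMe, ← ofReal_norm, Real.norm_eq_abs] at hp
    exact (ENNReal.ofReal_le_ofReal_iff hM0).1 hp
  -- The Hölder constant has to be positive whereas H may vanish, so H + ε is used and ε tends to 0
  -- at the end. The function v does not depend on ε.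
  have hholder : ∀ ε : ℝ, 0 < ε → ConeSchauder.ConeHolder β α (H + ε) O f := fun ε hε =>
    ConeSchauder.coneHolder_of_holderNorm (by positivity)
      (hHe ▸ ENNReal.ofReal_le_ofReal (by linarith))
  have hsol : ConeSchauder.IsConeSolution β α (H + 1) M O u f :=
    ⟨hOo, hu.1, hub, hholder 1 one_pos, hweak⟩
  obtain ⟨v₀, hv₀, hvu, hveq, hvM⟩ :=
    hsol.exists_rep hβ (by linarith) hα₀ hα₁ (by positivity) hM0
  have hcl₀ : ∀ ε : ℝ, 0 < ε → ConeSchauder.IsClassical β α (H + ε) M v₀ f := fun ε hε =>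
    ⟨hβ, hβ4, hα₀, hα₁, by positivity, hM0, hv₀, hveq, hvM, hholder ε hε⟩
  obtain ⟨v, hv, hvc⟩ := (hcl₀ 1 one_pos).exists_continuousOn
  have hcl : ∀ ε : ℝ, 0 < ε → ConeSchauder.IsClassical β α (H + ε) M v f := fun ε hε =>
    (hcl₀ ε hε).congr hv
  refine ⟨v, ?_, hvc, (hcl 1 one_pos).contDiffOn, (hcl 1 one_pos).eq, fun ρ hρ hρ1 => ?_, ?_⟩
  · rw [Filter.EventuallyEq, ae_restrict_iff' hOo.measurableSet]
    filter_upwards [hvu, measure_eq_zero_iff_ae_notMem.1 (ConeSchauder.volume_divisor (m := m))]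
      with p h1 h2 h3
    rw [hv p h2, h1 h3]
  · obtain ⟨C', -, hC'⟩ := ConeSchauder.exists_c2HolderNorm_le m hα₀ hα₁ hρ hρ1
    exact (hC' β _ M v f (hcl 1 one_pos)).trans_lt ENNReal.ofReal_lt_top
  · refine ENNReal.le_of_forall_pos_le_add fun ε hε _ => ?_
    -- Dividing by C + 1 rather than C covers C = 0 and keeps the total error C ε / (C + 1) below ε.
    have hε' : (0 : ℝ) < ε / (C + 1) := div_pos hε (by positivity)
    refine (hbound β _ M v f (hcl _ hε')).trans ?_
    have h1 : C * (H + ε / (C + 1) + M) ≤ C * (H + M) + ε := by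
      have h2 : C * (ε / (C + 1)) ≤ ε := by
        rw [← mul_div_assoc, div_le_iff₀ (by positivity)]
        nlinarith [ε.coe_nonneg]
      linarith
    refine (ENNReal.ofReal_le_ofReal h1).trans_eq ?_
    rw [ENNReal.ofReal_add (by positivity) ε.coe_nonneg, ENNReal.ofReal_mul hC,
      ENNReal.ofReal_add hH0 hM0, hHe, hMe, ENNReal.ofReal_coe_nnreal]
    rfl
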